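/- **Setup.** For each number of sectors $S$ there are $N=N_S$ regions and random variables on a (standard Borel) probability space whose law may change with $S$: shares $W=(w_{is})\in\mathbb R^{N\times S}$ with $w_{is}\ge 0$ and $\sum_s w_{is}\le 1$, shifters $\mathcal X_s\in\mathbb R$, sector-level controls $\mathcal Z_s\in\mathbb R^K$ ($K$ fixed), $U_i\in\mathbb R^K$, $Y_i(0)\in\mathbb R$, effects $B=(\beta_{is})$ and linearization errors $L_i$. Put $$X_i=\sum_s w_{is}\mathcal X_s,\qquad Z_i=\sum_s w_{is}\mathcal Z_s+U_i,\qquad Y_i=Y_i(0)+\sum_s w_{is}\mathcal X_s\beta_{is}+L_i .$$ Let $\mathcal F_0=\sigma(\mathcal Z,U,Y(0),B,W)$, $\gamma\in\mathbb R^K$ fixed, $\tilde{\mathcal X}_s=\mathcal X_s-\mathcal Z_s'\gamma$, $\sigma_s^2=\operatorname{var}(\mathcal X_s\mid\mathcal F_0)$, $n_s=\sum_i w_{is}$, $r_N=(\sum_s n_s^2)^{-1}$, $\beta=\sum_{i,s}w_{is}^2\sigma_s^2\beta_{is}/\sum_{i,s}w_{is}^2\sigma_s^2$, $\delta=E[Z'Z]^{-1}E[Z'(Y-X\beta)]$,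 $\check\delta=(Z'Z)^{-1}Z'(Y-X\beta)$, $\epsilon_i=Y_i-X_i\beta-Z_i'\delta$, $R_s=\sum_i w_{is}\epsilon_i$, $\ddot X=X-Z(Z'Z)^{-1}Z'X$, and $$\mathcal V_N=r_N\operatorname{var}\Big(\sum_i (X_i-Z_i'\gamma)\epsilon_i\;\Big|\;\mathcal F_0\Big).$$ Limits are as $S\to\infty$; limits of random quantities are in probability, and bounds on random quantities are almost sure, with constants not depending on $S,i,s$. **Assumptions.** (a) $E[\mathcal X_s\mid\mathcal F_0]=\mathcal Z_s'\gamma$; the $\mathcal X_s$ are independent across $s$ given $\mathcal F_0$; $\max_s n_s/N\to0$ and $r_N\max_s n_s^2\to0$; $N^{-1}\sum_iE[(U_i'\gamma)^2]\to0$. (b) $\beta_{is}$ is bounded; $N^{-1}\sum_{i,s}\sigma_s^2w_{is}^2$ converges to a positive constant; for some $\nu>0$, $E[|\mathcal X_s|^{4+\nu}\mid\mathcal F_0]$ is bounded; the fourth moments of $Y_i(0)$ and of the components of $\mathcal Z_s$ and $U_i$ given $W$ are bounded; $Z'Z/N$ converges to a positive definite constant matrix. (c) $E[L_i^4]<\infty$,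 $N^{-1}\sum_iE[L_i^2]^{1/2}\to0$, $r_N^{1/2}\sum_iE[L_i^2]^{1/2}\to0$ and $\max_iE[L_i^4\mid W]\to0$. (d) $\check\delta-\delta=O_p(q_S)$ for some deterministic $q_S\to0$ with $q_S^2N r_N\sum_iE[(U_i'\gamma)^2]\to0$; and $r_N^{1/2}\gamma'U'\epsilon=o_p(1)$. (e) $W$ has full column rank $S$ (so $N\ge S$), and either $\max_s\sum_i|((W'W)^{-1}W')_{si}|$ is bounded and $\max_iE[(U_i'\gamma)^4\mid W]\to0$, or $U_i=0$ for all $i$. **Proposition.** Let $(\tilde\beta,\tilde\delta)$ be the OLS coefficients in the regression of $Y$ on $(X,Z)$, or any other estimators with $\tilde\beta-\beta=o_p(1)$ and $\tilde\delta-\delta=o_p(1)$. Let $\hat{\mathcal X}=(W'W)^{-1}W'\ddot X$, $\hat\epsilon_i=Y_i-X_i\tilde\beta-Z_i'\tilde\delta$ and $\hat R_s=\sum_iw_{is}\hat\epsilon_i$. Then, with possibly heterogeneous effects $\beta_{is}$, $$r_N\sum_s\hat{\mathcal X}_s^2\hat R_s^2=r_N\sum_sE[\tilde{\mathcal X}_s^2R_s^2\mid\mathcal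 F_0]+o_p(1).$$ If moreover the effects are constant ($\beta_{is}$ does not depend on $i,s$), then $$r_N\sum_s\hat{\mathcal X}_s^2\hat R_s^2=\mathcal V_N+o_p(1),$$ and if in addition $L_i=0$ for all $i$, then $\mathcal V_N=r_N\sum_sE[\tilde{\mathcal X}_s^2R_s^2\mid\mathcal F_0]$ almost surely. -/

import Mathlib

open MeasureTheory ProbabilityTheory Filter Topology Matrix

noncomputable section

/-! ### Stochastic orders along a sequence of probability spaces -/

/-- `A S = o_p(1)` as `S → ∞`, where `A S` lives on its own probability space `(Ω S, μ S)`. -/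
def IsLittleOp {Ω : ℕ → Type*} [∀ S, MeasurableSpace (Ω S)] (μ : ∀ S, Measure (Ω S))
    (A : ∀ S, Ω S → ℝ) : Prop :=
  ∀ ε : ℝ, 0 < ε → Tendsto (fun S => μ S {ω | ε ≤ |A S ω|}) atTop (𝓝 0)

/-- `A S = O_p(q S)` as `S → ∞`, for a deterministic sequence `q`. -/
def IsBigOp {Ω : ℕ → Type*} [∀ S, MeasurableSpace (Ω S)] (μ : ∀ S, Measure (Ω S))
    (A : ∀ S, Ω S → ℝ) (q : ℕ → ℝ) : Prop :=
  ∀ ε : ℝ, 0 < ε → ∃ M : ℝ, ∀ᶠ S in atTop,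
    μ S {ω | M * q S < |A S ω|} ≤ ENNReal.ofReal ε

/-! ### The primitive variables of a shift-share design -/

/-- The random variables that generate the data for a sample with `N` regions, `S` sectors and
`K` controls: shares `w`, sectoral shifters `Xs`, sectoral controls `Zs`, regional noise `U` in
the controls, potential outcomes `Y0` at zero shocks, treatment effects `B` and linearization
errors `L`. -/
structure ShiftShareData (Ω : Type*) [MeasurableSpace Ω] (N S K : ℕ) where
  w : Ω → Fin N → Fin S → ℝ
  Xs : Ω → Fin S → ℝ
  Zs : Ω → Fin S → Fin K → ℝ
  U : Ω → Fin N → Fin K → ℝ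
  Y0 : Ω → Fin N → ℝ
  B : Ω → Fin N → Fin S → ℝ
  L : Ω → Fin N → ℝ
  measurable_w : Measurable w
  measurable_Xs : Measurable Xs
  measurable_Zs : Measurable Zs
  measurable_U : Measurable U
  measurable_Y0 : Measurable Y0
  measurable_B : Measurable B
  measurable_L : Measurable L

namespace ShiftShareData

variable {Ω : Type*} [mΩ : MeasurableSpace Ω] {N S K : ℕ}

/-- The σ-field generated by `(Zs, U, Y(0), B, W)`. -/
def F0 (D : ShiftShareData Ω N S K) : MeasurableSpace Ω :=
  MeasurableSpace.comap (fun ω => (D.Zs ω, D.U ω, D.Y0 ω, D.B ω, D.w ω)) inferInstance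

/-- The σ-field generated by the shares `W`. -/
def FW (D : ShiftShareData Ω N S K) : MeasurableSpace Ω :=
  MeasurableSpace.comap D.w inferInstance

theorem F0_le (D : ShiftShareData Ω N S K) : D.F0 ≤ mΩ :=
  (D.measurable_Zs.prodMk (D.measurable_U.prodMk (D.measurable_Y0.prodMk
    (D.measurable_B.prodMk D.measurable_w)))).comap_le

/-- The `N × S` matrix of shares. -/
def W (D : ShiftShareData Ω N S K) (ω : Ω) : Matrix (Fin N) (Fin S) ℝ := Matrix.of (D.w ω)

/-- Regional shift-share regressor `X_i = ∑_s w_is 𝒳_s`. -/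
def X (D : ShiftShareData Ω N S K) (ω : Ω) : Fin N → ℝ := D.W ω *ᵥ D.Xs ω

/-- Regional controls `Z_i = ∑_s w_is 𝒵_s + U_i`, as an `N × K` matrix. -/
def Z (D : ShiftShareData Ω N S K) (ω : Ω) : Matrix (Fin N) (Fin K) ℝ :=
  D.W ω * Matrix.of (D.Zs ω) + Matrix.of (D.U ω)

/-- Observed outcome `Y_i = Y_i(0) + ∑_s w_is 𝒳_s β_is + L_i`. -/
def Y (D : ShiftShareData Ω N S K) (ω : Ω) (i : Fin N) : ℝ :=
  D.Y0 ω i + ∑ s, D.w ω i s * D.Xs ω s * D.B ω i s + D.L ω i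

/-- Sector size `n_s = ∑_i w_is`. -/
def n (D : ShiftShareData Ω N S K) (ω : Ω) (s : Fin S) : ℝ := ∑ i, D.w ω i s

/-- `r_N = 1 / ∑_s n_s²`. -/
def r (D : ShiftShareData Ω N S K) (ω : Ω) : ℝ := (∑ s, D.n ω s ^ 2)⁻¹

/-- `𝒳̃_s = 𝒳_s - 𝒵_s'γ`. -/
def Xtilde (D : ShiftShareData Ω N S K) (γ : Fin K → ℝ) (ω : Ω) (s : Fin S) : ℝ :=
  D.Xs ω s - D.Zs ω s ⬝ᵥ γ

/-- `U_i'γ`. -/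
def Ugamma (D : ShiftShareData Ω N S K) (γ : Fin K → ℝ) (ω : Ω) (i : Fin N) : ℝ :=
  D.U ω i ⬝ᵥ γ

/-- `σ_s² = var(𝒳_s | ℱ₀)`. -/
def sigmaSq (D : ShiftShareData Ω N S K) (μ : Measure Ω) (ω : Ω) (s : Fin S) : ℝ :=
  condVar D.F0 (fun ω' => D.Xs ω' s) μ ω

/-- The estimand `β = ∑_{i,s} π_is β_is / ∑_{i,s} π_is`, where `π_is = w_is² var(𝒳_s | ℱ₀)`. -/
def beta (D : ShiftShareData Ω N S K) (μ : Measure Ω) (ω : Ω) : ℝ :=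
  (∑ i, ∑ s, D.w ω i s ^ 2 * D.sigmaSq μ ω s * D.B ω i s) /
    ∑ i, ∑ s, D.w ω i s ^ 2 * D.sigmaSq μ ω s

/-- The population coefficient `δ = E[Z'Z]⁻¹ E[Z'(Y - Xβ)]`. -/
def delta (D : ShiftShareData Ω N S K) (μ : Measure Ω) : Fin K → ℝ :=
  (Matrix.of fun k l => ∫ ω, ((D.Z ω)ᵀ * D.Z ω) k l ∂μ)⁻¹ *ᵥ
    fun k => ∫ ω, ((D.Z ω)ᵀ *ᵥ (D.Y ω - D.beta μ ω • D.X ω)) k ∂μ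

/-- The residual `Y_i - X_i b - Z_i'd` at a coefficient vector `(b, d)`. -/
def residual (D : ShiftShareData Ω N S K) (b : ℝ) (d : Fin K → ℝ) (ω : Ω) (i : Fin N) : ℝ :=
  D.Y ω i - D.X ω i * b - D.Z ω i ⬝ᵥ d

/-- The regression error `ε_i = Y_i - X_i β - Z_i'δ`. -/
def eps (D : ShiftShareData Ω N S K) (μ : Measure Ω) (ω : Ω) (i : Fin N) : ℝ :=
  D.residual (D.beta μ ω) (D.delta μ) ω i

/-- `R_s = ∑_i w_is ε_i`. -/
def R (D : ShiftShareData Ω N S K) (μ : Measure Ω) (ω : Ω) (s : Fin S) : ℝ :=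
  ∑ i, D.w ω i s * D.eps μ ω i

/-- Coefficients `(Z'Z)⁻¹ Z'A` in the regression of `A` on the controls. -/
def coefZ (D : ShiftShareData Ω N S K) (ω : Ω) (A : Fin N → ℝ) : Fin K → ℝ :=
  ((D.Z ω)ᵀ * D.Z ω)⁻¹ *ᵥ ((D.Z ω)ᵀ *ᵥ A)

/-- `Ẍ = X - Z (Z'Z)⁻¹ Z'X`. -/
def Xddot (D : ShiftShareData Ω N S K) (ω : Ω) : Fin N → ℝ :=
  D.X ω - D.Z ω *ᵥ D.coefZ ω (D.X ω)

/-- `δ̌ = (Z'Z)⁻¹ Z'(Y - Xβ)`. -/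
def deltaCheck (D : ShiftShareData Ω N S K) (μ : Measure Ω) (ω : Ω) : Fin K → ℝ :=
  D.coefZ ω (D.Y ω - D.beta μ ω • D.X ω)

/-- The OLS coefficient `β̂ = Ẍ'Y / Ẍ'Ẍ` on `X` in the regression of `Y` on `(X, Z)`. -/
def betaHat (D : ShiftShareData Ω N S K) (ω : Ω) : ℝ :=
  (D.Xddot ω ⬝ᵥ D.Y ω) / (D.Xddot ω ⬝ᵥ D.Xddot ω)

/-- The OLS coefficient `δ̂ = (Z'Z)⁻¹ Z'(Y - Xβ̂)` on `Z` in the regression of `Y` on `(X, Z)`. -/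
def deltaHat (D : ShiftShareData Ω N S K) (ω : Ω) : Fin K → ℝ :=
  D.coefZ ω (D.Y ω - D.betaHat ω • D.X ω)

/-- `(W'W)⁻¹ W'`. -/
def Wplus (D : ShiftShareData Ω N S K) (ω : Ω) : Matrix (Fin S) (Fin N) ℝ :=
  ((D.W ω)ᵀ * D.W ω)⁻¹ * (D.W ω)ᵀ

/-- Estimated shifters `X̂ = (W'W)⁻¹ W'Ẍ`. -/
def Xhat (D : ShiftShareData Ω N S K) (ω : Ω) : Fin S → ℝ := D.Wplus ω *ᵥ D.Xddot ω

/-- Aggregated residuals `R̂_s = ∑_i w_is ε̂_i`, with `ε̂_i` the residual at `(b, d)`. -/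
def Rhat (D : ShiftShareData Ω N S K) (b : ℝ) (d : Fin K → ℝ) (ω : Ω) (s : Fin S) : ℝ :=
  ∑ i, D.w ω i s * D.residual b d ω i

/-- The variance estimator `r_N ∑_s X̂_s² R̂_s²`, with residuals at `(b, d)`. -/
def Vhat (D : ShiftShareData Ω N S K) (b : ℝ) (d : Fin K → ℝ) (ω : Ω) : ℝ :=
  D.r ω * ∑ s, D.Xhat ω s ^ 2 * D.Rhat b d ω s ^ 2

/-- `r_N ∑_s E[𝒳̃_s² R_s² | ℱ₀]`. -/
def Vdiag (D : ShiftShareData Ω N S K) (μ : Measure Ω) (γ : Fin K → ℝ) (ω : Ω) : ℝ :=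
  D.r ω * ∑ s, (μ[fun ω' => D.Xtilde γ ω' s ^ 2 * D.R μ ω' s ^ 2 | D.F0]) ω

/-- `𝒱_N = r_N var(∑_i (X_i - Z_i'γ) ε_i | ℱ₀)`. -/
def VN (D : ShiftShareData Ω N S K) (μ : Measure Ω) (γ : Fin K → ℝ) (ω : Ω) : ℝ :=
  D.r ω * condVar D.F0
    (fun ω' => ∑ i, (D.X ω' i - D.Z ω' i ⬝ᵥ γ) * D.eps μ ω' i) μ ω

/-- Constant treatment effects: almost surely `β_is` does not vary with `i` and `s`. -/
def ConstantEffects (D : ShiftShareData Ω N S K) (μ : Measure Ω) : Prop :=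
  ∀ᵐ ω ∂μ, ∀ i s i' s', D.B ω i s = D.B ω i' s'

end ShiftShareData

/-! ### Assumptions on the triangular array -/

section Assumptions

variable {Ω : ℕ → Type*} [∀ S, MeasurableSpace (Ω S)] [∀ S, StandardBorelSpace (Ω S)]
  {N : ℕ → ℕ} {K : ℕ}

/-- Sampling assumptions: shares, as-good-as-random shifters given the controls, conditional
independence of the shifters, asymptotically negligible sectors. -/
structure ShiftShareDesign (μ : ∀ S, Measure (Ω S)) [∀ S, IsProbabilityMeasure (μ S)]
    (D : ∀ S, ShiftShareData (Ω S) (N S) S K) (γ : Fin K → ℝ) : Prop where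
  share_nonneg : ∀ S, ∀ᵐ ω ∂μ S, ∀ i s, 0 ≤ (D S).w ω i s
  share_sum_le : ∀ S, ∀ᵐ ω ∂μ S, ∀ i, ∑ s, (D S).w ω i s ≤ 1
  shifter_mean : ∀ S (s : Fin S),
    (μ S)[fun ω => (D S).Xs ω s | (D S).F0] =ᵐ[μ S] fun ω => (D S).Zs ω s ⬝ᵥ γ
  shifter_indep : ∀ S, iCondIndepFun (D S).F0 (D S).F0_le
    (fun (s : Fin S) ω => (D S).Xs ω s) (μ S)
  sector_size : IsLittleOp μ fun S ω => (⨆ s, (D S).n ω s) / (N S : ℝ)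
  sector_size_sq : IsLittleOp μ fun S ω => (⨆ s, (D S).n ω s ^ 2) * (D S).r ω
  noise_mean_sq : Tendsto
    (fun S => (N S : ℝ)⁻¹ * ∑ i, ∫ ω, (D S).Ugamma γ ω i ^ 2 ∂μ S) atTop (𝓝 0)

/-- Regularity conditions: bounded effects, moments, non-collinearity, negligible linearization
error, and the rate conditions on `δ̌` and `U'γ`. The moments of order four and `4 + ν` are
required to exist as well as to be bounded. -/
structure ShiftShareRegular (μ : ∀ S, Measure (Ω S))
    (D : ∀ S, ShiftShareData (Ω S) (N S) S K) (γ : Fin K → ℝ) : Prop where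
  effects_bounded : ∃ C : ℝ, ∀ S, ∀ᵐ ω ∂μ S, ∀ i s, |(D S).B ω i s| ≤ C
  shifter_variation : ∃ c : ℝ, 0 < c ∧ IsLittleOp μ fun S ω =>
    (N S : ℝ)⁻¹ * (∑ i, ∑ s, (D S).sigmaSq (μ S) ω s * (D S).w ω i s ^ 2) - c
  shifter_moment : ∃ ν : ℝ, 0 < ν ∧ ∃ C : ℝ, ∀ S (s : Fin S),
    Integrable (fun ω => |(D S).Xs ω s| ^ (4 + ν)) (μ S) ∧
    ∀ᵐ ω ∂μ S, ((μ S)[fun ω' => |(D S).Xs ω' s| ^ (4 + ν) | (D S).F0]) ω ≤ C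
  outcome_moment : ∃ C : ℝ, ∀ S (i : Fin (N S)),
    Integrable (fun ω => (D S).Y0 ω i ^ 4) (μ S) ∧
    ∀ᵐ ω ∂μ S, ((μ S)[fun ω' => (D S).Y0 ω' i ^ 4 | (D S).FW]) ω ≤ C
  control_moment : ∃ C : ℝ, ∀ S (s : Fin S) (k : Fin K),
    Integrable (fun ω => (D S).Zs ω s k ^ 4) (μ S) ∧
    ∀ᵐ ω ∂μ S, ((μ S)[fun ω' => (D S).Zs ω' s k ^ 4 | (D S).FW]) ω ≤ C
  noise_moment : ∃ C : ℝ, ∀ S (i : Fin (N S)) (k : Fin K),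
    Integrable (fun ω => (D S).U ω i k ^ 4) (μ S) ∧
    ∀ᵐ ω ∂μ S, ((μ S)[fun ω' => (D S).U ω' i k ^ 4 | (D S).FW]) ω ≤ C
  controls_gram : ∃ Q : Matrix (Fin K) (Fin K) ℝ, Q.PosDef ∧ ∀ k l,
    IsLittleOp μ fun S ω => (N S : ℝ)⁻¹ * (((D S).Z ω)ᵀ * (D S).Z ω) k l - Q k l
  lin_error_moment : ∀ S i, Integrable (fun ω => (D S).L ω i ^ 4) (μ S)
  lin_error_mean : Tendsto
    (fun S => (N S : ℝ)⁻¹ * ∑ i, √(∫ ω, (D S).L ω i ^ 2 ∂μ S)) atTop (𝓝 0)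
  lin_error_rate : IsLittleOp μ fun S ω =>
    √((D S).r ω) * ∑ i, √(∫ ω', (D S).L ω' i ^ 2 ∂μ S)
  lin_error_fourth : IsLittleOp μ fun S ω =>
    ⨆ i, ((μ S)[fun ω' => (D S).L ω' i ^ 4 | (D S).FW]) ω
  delta_rate : ∃ q : ℕ → ℝ, Tendsto q atTop (𝓝 0) ∧
    (∀ k, IsBigOp μ (fun S ω => (D S).deltaCheck (μ S) ω k - (D S).delta (μ S) k) q) ∧
    IsLittleOp μ fun S ω =>
      q S ^ 2 * (N S : ℝ) * (D S).r ω * ∑ i, ∫ ω', (D S).Ugamma γ ω' i ^ 2 ∂μ S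
  noise_error : IsLittleOp μ fun S ω =>
    √((D S).r ω) * ∑ i, (D S).Ugamma γ ω i * (D S).eps (μ S) ω i

/-- Conditions under which the shifters can be recovered: `W` has full column rank (so `S ≤ N`),
and either `max_s ∑_i |((W'W)⁻¹W')_si|` is bounded and `max_i E[(U_i'γ)⁴ | W] → 0`, or `U = 0`. -/
structure ShifterRecovery (μ : ∀ S, Measure (Ω S))
    (D : ∀ S, ShiftShareData (Ω S) (N S) S K) (γ : Fin K → ℝ) : Prop where
  full_rank : ∀ S, ∀ᵐ ω ∂μ S, ((D S).W ω).rank = S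
  noise : ((∃ C : ℝ, ∀ S, ∀ᵐ ω ∂μ S, ∀ s, ∑ i, |(D S).Wplus ω s i| ≤ C) ∧
      IsLittleOp μ fun S ω => ⨆ i, ((μ S)[fun ω' => (D S).Ugamma γ ω' i ^ 4 | (D S).FW]) ω) ∨
    ∀ S, ∀ᵐ ω ∂μ S, ∀ i k, (D S).U ω i k = 0

/-- `(b, d)` is consistent for `(β, δ)`. -/
def ConsistentFor (μ : ∀ S, Measure (Ω S)) (D : ∀ S, ShiftShareData (Ω S) (N S) S K)
    (b : ∀ S, Ω S → ℝ) (d : ∀ S, Ω S → Fin K → ℝ) : Prop :=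
  IsLittleOp μ (fun S ω => b S ω - (D S).beta (μ S) ω) ∧
    ∀ k, IsLittleOp μ fun S ω => d S ω k - (D S).delta (μ S) k

end Assumptions

end

/-! Write `ε_i` as an `ℱ₀`-measurable part, plus a linear form in the recentred shifters `𝒳̃_t` with
coefficients `w_it (β_it - β)`, plus `L_i`. Given `ℱ₀` the `𝒳̃_t` are independent with mean zero, so
apart from `L` every quantity in the estimator is a polynomial in independent variables with frozen
coefficients. The weights `r_N n_s²` sum to at most one, and `R_s / n_s` is a share-weighted mean of
the errors, so the estimator is a weighted mean of `𝒳̃_s² (R_s / n_s)²`.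

Replacing estimates by true values. The functional `∑ h P² Q²` is continuous in the weighted fourth
mean (`tendsto_sum_sq_mul_sq_sub`). The classes `FourthBdd` and `FourthNeg` of variables whose
weighted fourth moments are bounded or negligible, for all weights determined by the shares, are
stable under sums and under averaging with shares. Since `(W'W)⁻¹W'W = 1`, the error `X̂_s - 𝒳̃_s`
consists of `𝒵_s'(γ̂ - γ)` and of images under `(W'W)⁻¹W'` of `U'γ` and `U'(γ̂ - γ)`, where `γ̂ =
(Z'Z)⁻¹Z'X`; all are negligible (`fourthNeg_Xhat_sub`). The residuals differ from `ε` by consistent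
coefficient errors times variables with bounded moments. For OLS, consistency comes from the limits
of `Ẍ'Ẍ/N` and `Ẍ'ε/N`; the latter has vanishing limit because `β` is exactly the weighted mean of
effects that centres `Ẋ'ε`, where `Ẋ = W𝒳̃`.

From the oracle sum to its conditional mean. The law of large numbers
`tendsto_affineProdSq_sub_condExp` truncates the shifters, using that they have more than four
moments, and applies a bounded-differences variance bound to the truncated sum. One shifter
influences the sum by at most a constant times `r_N max_s n_s²`, or `max_s n_s / N` for region
averages. The errors `L` drop out on both sides because their conditional fourth moments are
negligible.

Constant effects. The linear form in the shifters then vanishes, and up to an `ℱ₀`-measurable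
constant the score is `∑_s a_s 𝒳̃_s` with `a_s` fixed by `ℱ₀`, plus a term linear in `L`. The
variance of the former is diagonal by independence and agrees with the limit already found. The hard
point is that `r_N E[(∑_s 𝒳̃_s ∑_i w_is L_i)² | ℱ₀]` is negligible although `L` may depend on the
shifters arbitrarily, so that nothing cancels in the square.

This is `exists_lintegral_sq_sum_mul_le`. It bounds `E(∑ X_s A_s)²` for nearly independent `X_s` and
arbitrary `A_s` that are small in summed `L²` norm and in fourth moment relative to scales `θ_s`
with `∑ θ_s² ≤ 1`. Values of `X_s` above a level depending on `θ_s` are so few that their number has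
exponential moments. Below that level, sectors are grouped into dyadic blocks of `θ_s`; in a block
the weighted sum of squares of the `X_s` is under control except with probability smaller than any
power of `θ_s`. Cauchy–Schwarz handles the good event, and the fourth moments handle the rest. -/

/-! ### Convergence in probability as convergence along a filter -/

section Whp

variable {Ω : ℕ → Type*} [∀ S, MeasurableSpace (Ω S)] {μ : ∀ S, Measure (Ω S)}

/-- The filter of events, along a sequence of probability spaces, whose probability tends to one. -/
def whp (μ : ∀ S, Measure (Ω S)) : Filter (Σ S, Ω S) where
  sets := {E | Tendsto (fun S => μ S {ω | (⟨S, ω⟩ : Σ S, Ω S) ∉ E}) atTop (𝓝 0)}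
  univ_sets := by simp
  sets_of_superset := by
    intro E F hE hEF
    refine tendsto_of_tendsto_of_tendsto_of_le_of_le tendsto_const_nhds hE (fun _ => zero_le) ?_
    exact fun S => measure_mono fun ω hω h => hω (hEF h)
  inter_sets := by
    intro E F hE hF
    have h := Tendsto.add hE hF
    rw [add_zero] at h
    refine tendsto_of_tendsto_of_tendsto_of_le_of_le tendsto_const_nhds h (fun _ => zero_le) ?_
    intro S
    refine (measure_mono ?_).trans (measure_union_le _ _)
    intro ω hω
    by_contra hcon
    simp only [Set.mem_union, Set.mem_ofPred_eq, not_or, not_not] at hcon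
    exact hω hcon

theorem eventually_whp_iff {p : (Σ S, Ω S) → Prop} :
    (∀ᶠ x in whp μ, p x) ↔ Tendsto (fun S => μ S {ω | ¬ p ⟨S, ω⟩}) atTop (𝓝 0) := Iff.rfl

theorem isLittleOp_iff_tendsto {A : ∀ S, Ω S → ℝ} :
    IsLittleOp μ A ↔ Tendsto (fun x : Σ S, Ω S => A x.1 x.2) (whp μ) (𝓝 0) := by
  rw [Metric.tendsto_nhds]
  refine forall₂_congr fun ε hε => ?_
  rw [eventually_whp_iff]
  simp

theorem eventually_whp_of_eventually_ae {p : (Σ S, Ω S) → Prop}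
    (h : ∀ᶠ S in atTop, ∀ᵐ ω ∂μ S, p ⟨S, ω⟩) : ∀ᶠ x in whp μ, p x := by
  rw [eventually_whp_iff]
  refine tendsto_const_nhds.congr' ?_
  filter_upwards [h] with S hS
  exact (ae_iff.1 hS).symm

theorem eventually_whp_of_ae {p : (Σ S, Ω S) → Prop}
    (h : ∀ S, ∀ᵐ ω ∂μ S, p ⟨S, ω⟩) : ∀ᶠ x in whp μ, p x :=
  eventually_whp_of_eventually_ae (Eventually.of_forall h)

theorem tendsto_fst_whp : Tendsto (fun x : Σ S, Ω S => x.1) (whp μ) atTop := by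
  intro s hs
  refine eventually_whp_of_eventually_ae ?_
  filter_upwards [hs] with S hS
  exact Eventually.of_forall fun _ => hS

/-- A sequence that tends to zero in probability is dominated, with probability tending to one, by
a deterministic null sequence. -/
theorem exists_deterministic_bound [∀ S, IsProbabilityMeasure (μ S)] {B : (Σ S, Ω S) → ℝ}
    (hB : Tendsto B (whp μ) (𝓝 0)) :
    ∃ c : ℕ → ℝ, Tendsto c atTop (𝓝 0) ∧ (∀ S, 0 ≤ c S) ∧ ∀ᶠ x in whp μ, |B x| ≤ c x.1 := by
  -- The infimum of this set is the Ky Fan distance from `B` to zero. The term `1/(S+1)` added below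
  -- leaves room for an actual member of the set beneath the bound.
  set T : ℕ → Set ℝ := fun S => {ε | 0 < ε ∧ μ S {ω | ε < |B ⟨S, ω⟩|} ≤ ENNReal.ofReal ε} with hT
  have hbdd : ∀ S, BddBelow (T S) := fun S => ⟨0, fun ε hε => hε.1.le⟩
  have hne : ∀ S, (T S).Nonempty := fun S => ⟨1, one_pos, by simpa using prob_le_one⟩
  have hnn : ∀ S, 0 ≤ sInf (T S) := fun S => le_csInf (hne S) fun ε hε => hε.1.le
  have hmem : ∀ ε : ℝ, 0 < ε → ∀ᶠ S in atTop, ε ∈ T S := by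
    intro ε hε
    have h1 : ∀ᶠ x in whp μ, |B x| ≤ ε := by
      filter_upwards [Metric.tendsto_nhds.1 hB ε hε] with x hx
      simpa [Real.dist_eq] using hx.le
    rw [eventually_whp_iff] at h1
    filter_upwards [(ENNReal.tendsto_nhds_zero.1 h1) (ENNReal.ofReal ε) (by simpa)] with S hS
    exact ⟨hε, by simpa using hS⟩
  have hinv : Tendsto (fun S : ℕ => 1 / ((S : ℝ) + 1)) atTop (𝓝 0) :=
    tendsto_one_div_add_atTop_nhds_zero_nat
  have hc : Tendsto (fun S : ℕ => sInf (T S) + 1 / ((S : ℝ) + 1)) atTop (𝓝 0) := by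
    rw [← add_zero (0 : ℝ)]
    refine Tendsto.add ?_ hinv
    rw [Metric.tendsto_nhds]
    intro ε hε
    filter_upwards [hmem (ε / 2) (by positivity)] with S hS
    rw [Real.dist_eq, sub_zero, abs_of_nonneg (hnn S)]
    exact (csInf_le (hbdd S) hS).trans_lt (by linarith)
  refine ⟨_, hc, fun S => add_nonneg (hnn S) (by positivity), ?_⟩
  rw [eventually_whp_iff]
  have h2 : Tendsto (fun S : ℕ => ENNReal.ofReal (sInf (T S) + 1 / ((S : ℝ) + 1))) atTop (𝓝 0) := by
    simpa using ENNReal.tendsto_ofReal hc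
  refine tendsto_of_tendsto_of_tendsto_of_le_of_le tendsto_const_nhds h2 (fun _ => zero_le) ?_
  intro S
  obtain ⟨ε, hε, hlt⟩ := exists_lt_of_csInf_lt (hne S)
    (show sInf (T S) < sInf (T S) + 1 / ((S : ℝ) + 1) by
      have : 0 < 1 / ((S : ℝ) + 1) := by positivity
      linarith)
  refine (measure_mono ?_).trans (hε.2.trans (ENNReal.ofReal_le_ofReal hlt.le))
  intro ω hω
  simp only [Set.mem_ofPred_eq, not_le] at hω ⊢
  exact hlt.trans hω

/-- Boundedness in probability: multiplication by any deterministic null sequence gives a sequence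
that tends to zero in probability. -/
def IsBoundedOp (μ : ∀ S, Measure (Ω S)) (A : (Σ S, Ω S) → ℝ) : Prop :=
  ∀ c : ℕ → ℝ, Tendsto c atTop (𝓝 0) → Tendsto (fun x => c x.1 * A x) (whp μ) (𝓝 0)

namespace IsBoundedOp

variable {A B : (Σ S, Ω S) → ℝ}

theorem of_tendsto {a : ℝ} (h : Tendsto A (whp μ) (𝓝 a)) : IsBoundedOp μ A := fun c hc => by
  simpa using (hc.comp tendsto_fst_whp).mul h

theorem const (a : ℝ) : IsBoundedOp μ (fun _ => a) := of_tendsto tendsto_const_nhds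

theorem mono (hA : IsBoundedOp μ A) (h : ∀ᶠ x in whp μ, |B x| ≤ |A x|) : IsBoundedOp μ B := by
  intro c hc
  refine squeeze_zero_norm' ?_ (tendsto_zero_iff_norm_tendsto_zero.1 (hA c hc))
  filter_upwards [h] with x hx
  simp only [norm_mul, Real.norm_eq_abs]
  gcongr

theorem add (hA : IsBoundedOp μ A) (hB : IsBoundedOp μ B) :
    IsBoundedOp μ (fun x => A x + B x) := fun c hc => by
  simpa [mul_add] using (hA c hc).add (hB c hc)

theorem mul (hA : IsBoundedOp μ A) (hB : IsBoundedOp μ B) :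
    IsBoundedOp μ (fun x => A x * B x) := fun c hc => by
  -- The null sequence is split into two equal square roots, one for each factor.
  have h0 : Tendsto (fun S => √|c S|) atTop (𝓝 0) := by
    simpa using ((continuous_abs.tendsto 0).comp hc).sqrt
  have h := (hA _ h0).mul (hB _ h0)
  rw [mul_zero] at h
  refine squeeze_zero_norm (fun x => ?_) (tendsto_zero_iff_norm_tendsto_zero.1 h)
  simp only [norm_mul, Real.norm_eq_abs, abs_of_nonneg (Real.sqrt_nonneg _)]
  refine le_of_eq ?_
  rw [mul_mul_mul_comm, Real.mul_self_sqrt (abs_nonneg _)]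

theorem const_mul (a : ℝ) (hA : IsBoundedOp μ A) : IsBoundedOp μ (fun x => a * A x) :=
  (const a).mul hA

theorem pow (hA : IsBoundedOp μ A) (k : ℕ) : IsBoundedOp μ (fun x => A x ^ k) := by
  induction k with
  | zero => simpa using const 1
  | succ k ih => simpa [pow_succ] using ih.mul hA

theorem sqrt (hA : IsBoundedOp μ A) : IsBoundedOp μ (fun x => √(A x)) := by
  refine ((const 1).add (mono hA (B := fun x => |A x|) (by simp))).mono
    (Eventually.of_forall fun x => ?_)
  rw [abs_of_nonneg (Real.sqrt_nonneg _), abs_of_nonneg (by positivity)]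
  refine (Real.sqrt_le_sqrt (le_abs_self _)).trans ?_
  rw [Real.sqrt_le_left (by positivity)]
  nlinarith [abs_nonneg (A x)]

theorem sum {ι : Type*} {s : Finset ι} {F : ι → (Σ S, Ω S) → ℝ}
    (h : ∀ i ∈ s, IsBoundedOp μ (F i)) : IsBoundedOp μ (fun x => ∑ i ∈ s, F i x) := by
  classical
  induction s using Finset.induction_on with
  | empty => simpa using const 0
  | insert a s ha ih =>
    simp only [Finset.sum_insert ha]
    exact (h a (by simp)).add (ih fun i hi => h i (by simp [hi]))

/-- The factor that tends to zero is dominated by a deterministic null sequence, which is the only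
kind of multiplier the definition of boundedness speaks about. -/
theorem mul_tendsto_zero [∀ S, IsProbabilityMeasure (μ S)] (hA : IsBoundedOp μ A)
    (hB : Tendsto B (whp μ) (𝓝 0)) : Tendsto (fun x => A x * B x) (whp μ) (𝓝 0) := by
  obtain ⟨c, hc, h0, hle⟩ := exists_deterministic_bound hB
  refine squeeze_zero_norm' ?_ (tendsto_zero_iff_norm_tendsto_zero.1 (hA c hc))
  filter_upwards [hle] with x hx
  simp only [norm_mul, Real.norm_eq_abs, abs_of_nonneg (h0 x.1)]
  rw [mul_comm]
  gcongr

end IsBoundedOp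

theorem IsBigOp.tendsto_zero {A : ∀ S, Ω S → ℝ} {q : ℕ → ℝ} (h : IsBigOp μ A q)
    (hq : Tendsto q atTop (𝓝 0)) : Tendsto (fun x : Σ S, Ω S => A x.1 x.2) (whp μ) (𝓝 0) := by
  rw [← isLittleOp_iff_tendsto]
  intro ε hε
  rw [ENNReal.tendsto_nhds_zero]
  intro δ hδ
  obtain ⟨δ', hδ', hle⟩ : ∃ δ' : ℝ, 0 < δ' ∧ ENNReal.ofReal δ' ≤ δ := by
    rcases eq_or_ne δ ⊤ with rfl | ht
    · exact ⟨1, one_pos, le_top⟩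
    · exact ⟨δ.toReal, ENNReal.toReal_pos hδ.ne' ht, by rw [ENNReal.ofReal_toReal ht]⟩
  obtain ⟨M, hM⟩ := h δ' hδ'
  have h0 : Tendsto (fun S => M * q S) atTop (𝓝 0) := by simpa using hq.const_mul M
  filter_upwards [hM, h0.eventually (gt_mem_nhds hε)] with S hS hlt
  exact (measure_mono fun ω hω => lt_of_lt_of_le hlt hω).trans (hS.trans hle)

/-- Markov's inequality applied to `c S * V`. -/
theorem isBoundedOp_of_lintegral_le {V : (Σ S, Ω S) → ℝ} {C : ℝ}
    (hV : ∀ S, Measurable fun ω => V ⟨S, ω⟩)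
    (h : ∀ S, ∫⁻ ω, ENNReal.ofReal |V ⟨S, ω⟩| ∂μ S ≤ ENNReal.ofReal C) : IsBoundedOp μ V := by
  intro c hc
  rw [Metric.tendsto_nhds]
  intro ε hε
  simp only [Real.dist_eq, sub_zero]
  rw [eventually_whp_iff]
  simp only [not_lt]
  have hlim : Tendsto (fun S => ENNReal.ofReal (|c S| * C / ε)) atTop (𝓝 0) := by
    have : Tendsto (fun S => |c S| * C / ε) atTop (𝓝 0) := by
      simpa using ((hc.abs).mul_const C).div_const ε
    simpa using ENNReal.tendsto_ofReal this
  refine tendsto_of_tendsto_of_tendsto_of_le_of_le tendsto_const_nhds hlim (fun _ => zero_le)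
    fun S => ?_
  have hset : {ω | ε ≤ |c S * V ⟨S, ω⟩|}
      = {ω | ENNReal.ofReal ε ≤ ENNReal.ofReal |c S * V ⟨S, ω⟩|} := by
    ext ω
    exact (ENNReal.ofReal_le_ofReal_iff (abs_nonneg _)).symm
  simp only
  rw [hset]
  refine (meas_ge_le_lintegral_div ((hV S).const_mul _).abs.ennreal_ofReal.aemeasurable (by simpa)
    ENNReal.ofReal_ne_top).trans ?_
  rw [ENNReal.ofReal_div_of_pos hε]
  gcongr
  simp only [abs_mul, ENNReal.ofReal_mul (abs_nonneg _)]
  rw [lintegral_const_mul _ (hV S).abs.ennreal_ofReal]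
  gcongr
  exact h S

end Whp

/-! ### Regular conditional distributions -/

section Kernel

variable {Ω : Type*} {m' m : MeasurableSpace Ω} [mΩ : MeasurableSpace Ω] [StandardBorelSpace Ω]
  {μ : Measure Ω} [IsProbabilityMeasure μ]

/-- Drawing `ω` from `μ` and `ω'` from the regular conditional distribution at `ω`, with `ω` seen
only through `m`, has the same law as `(ω, ω)`. This is how facts about single points become facts
about almost every conditional distribution. -/
theorem ae_ae_condExpKernel_diag (hm : m ≤ mΩ) {p : Ω × Ω → Prop}
    (hp : MeasurableSet[m.prod mΩ] {x | p x}) (h : ∀ᵐ ω ∂μ, p (ω, ω)) :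
    ∀ᵐ ω ∂μ, ∀ᵐ ω' ∂condExpKernel μ m ω, p (ω, ω') := by
  refine ae_of_ae_trim hm ?_
  refine @Measure.ae_ae_of_ae_compProd Ω Ω m mΩ (μ.trim hm) (condExpKernel μ m) _ _ p ?_
  rw [compProd_trim_condExpKernel hm]
  have hd : @Measurable Ω (Ω × Ω) mΩ (m.prod mΩ) Function.diag :=
    @Measurable.prodMk Ω mΩ Ω Ω m mΩ _ _ (measurable_id'' hm) measurable_id
  exact (@ae_map_iff Ω (Ω × Ω) mΩ (m.prod mΩ) μ _
    (@Measurable.aemeasurable _ _ mΩ (m.prod mΩ) _ μ hd) _ hp).2 h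

theorem ae_ae_condExpKernel (hm : m ≤ mΩ) {p : Ω → Prop} (h : ∀ᵐ ω ∂μ, p ω) :
    ∀ᵐ ω ∂μ, ∀ᵐ ω' ∂condExpKernel μ m ω, p ω' := by
  obtain ⟨t, ht, htm, ht0⟩ := exists_measurable_superset_of_null (ae_iff.1 h)
  have h' : ∀ᵐ ω ∂μ, ω ∉ t := measure_eq_zero_iff_ae_notMem.1 ht0
  have hmeas : MeasurableSet[m.prod mΩ] {x : Ω × Ω | x.2 ∉ t} :=
    (@measurable_snd Ω Ω m mΩ) htm.compl
  filter_upwards [ae_ae_condExpKernel_diag hm hmeas h'] with ω hω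
  filter_upwards [hω] with ω' hω'
  by_contra hcon
  exact hω' (ht hcon)

/-- Conditioning on `m` freezes `m`-measurable variables: the coefficients of all later sums may be
treated as constants under the kernel. -/
theorem ae_condExpKernel_eq {E : Type*} [MeasurableSpace E] [MeasurableEq E] (hm : m ≤ mΩ)
    {g : Ω → E} (hg : Measurable[m] g) :
    ∀ᵐ ω ∂μ, ∀ᵐ ω' ∂condExpKernel μ m ω, g ω' = g ω := by
  refine ae_ae_condExpKernel_diag (p := fun x => g x.2 = g x.1) hm ?_ (by simp)
  exact @measurableSet_eq_fun (Ω × Ω) E (m.prod mΩ) _ _ _ _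
    ((hg.mono hm le_rfl).comp (@measurable_snd Ω Ω m mΩ)) (hg.comp (@measurable_fst Ω Ω m mΩ))

theorem measurable_condExpKernel_measure (hm : m ≤ mΩ) :
    Measurable (fun ω => condExpKernel μ m ω) :=
  (condExpKernel μ m).measurable.mono hm le_rfl

theorem bind_condExpKernel (hm : m ≤ mΩ) : μ.bind (fun ω => condExpKernel μ m ω) = μ := by
  ext s hs
  have h := condExpKernel_comp_trim (μ := μ) hm
  rw [Measure.bind_apply hs (measurable_condExpKernel_measure hm).aemeasurable]
  conv_rhs => rw [← h]
  rw [Measure.bind_apply hs (Kernel.aemeasurable _),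
    lintegral_trim hm ((condExpKernel μ m).measurable_coe hs)]

theorem measure_eq_lintegral_condExpKernel (hm : m ≤ mΩ) {s : Set Ω} (hs : MeasurableSet s) :
    μ s = ∫⁻ ω, condExpKernel μ m ω s ∂μ := by
  conv_lhs => rw [← bind_condExpKernel (μ := μ) hm]
  rw [Measure.bind_apply hs (measurable_condExpKernel_measure hm).aemeasurable]

theorem lintegral_condExpKernel_le_of_condExp_le (hm : m ≤ mΩ) {f : Ω → ℝ} {H : Ω → ℝ}
    (hf : Integrable f μ) (hf0 : ∀ᵐ ω ∂μ, 0 ≤ f ω) (h : ∀ᵐ ω ∂μ, (μ[f | m]) ω ≤ H ω) :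
    ∀ᵐ ω ∂μ, ∫⁻ ω', ENNReal.ofReal (f ω') ∂condExpKernel μ m ω ≤ ENNReal.ofReal (H ω) := by
  filter_upwards [h, condExp_ae_eq_integral_condExpKernel hm hf, hf.condExpKernel_ae (m := m),
    ae_ae_condExpKernel hm hf0] with ω h1 h2 h3 h4
  rw [← ofReal_integral_eq_lintegral_ofReal h3 h4, ← h2]
  exact ENNReal.ofReal_le_ofReal h1

/-- Tower property for regular conditional distributions. -/
theorem ae_bind_condExpKernel (hm' : m' ≤ m) (hm : m ≤ mΩ) :
    ∀ᵐ ω ∂μ, (condExpKernel μ m' ω).bind (fun ω' => condExpKernel μ m ω')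
      = condExpKernel μ m' ω := by
  set e := embeddingReal Ω with he_def
  have he := measurableEmbedding_embeddingReal Ω
  have hfix : ∀ s, MeasurableSet s → ∀ᵐ ω ∂μ,
      (condExpKernel μ m' ω).bind (fun ω' => condExpKernel μ m ω') s
        = condExpKernel μ m' ω s := by
    intro s hs
    have h1 := condExpKernel_ae_eq_condExp (μ := μ) hm hs
    have h2 := condExpKernel_ae_eq_condExp (μ := μ) (hm'.trans hm) hs
    have hintegrable : Integrable (fun ω => (condExpKernel μ m ω).real s) μ :=
      integrable_toReal_condExpKernel hs
    have h3 := condExp_ae_eq_integral_condExpKernel (m := m') (hm'.trans hm) hintegrable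
    have h4 : μ[fun ω => (condExpKernel μ m ω).real s | m'] =ᵐ[μ]
        μ[s.indicator fun _ => (1 : ℝ) | m'] :=
      (condExp_congr_ae h1).trans (condExp_condExp_of_le hm' hm)
    filter_upwards [h2, h3, h4, hintegrable.condExpKernel_ae (m := m')] with ω h2 h3 h4 h5
    rw [Measure.bind_apply hs (measurable_condExpKernel_measure hm).aemeasurable]
    have h6 : ∫ ω', (condExpKernel μ m ω').real s ∂condExpKernel μ m' ω
        = (condExpKernel μ m' ω).real s := by rw [← h3, h4, ← h2]
    have h7 := ofReal_integral_eq_lintegral_ofReal h5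
      (Eventually.of_forall fun _ => measureReal_nonneg)
    rw [h6] at h7
    simpa [Measure.real, ENNReal.ofReal_toReal (measure_ne_top _ _)] using h7.symm
  -- The exceptional null set must not depend on the event. A countable generating π-system, made of
  -- preimages of rational rays under an embedding into the reals, suffices.
  have hgen : mΩ = MeasurableSpace.generateFrom
      (Set.preimage e '' (⋃ a : ℚ, {Set.Iic (a : ℝ)})) := by
    rw [← MeasurableSpace.comap_generateFrom, ← Real.borel_eq_generateFrom_Iic_rat,
      ← BorelSpace.measurable_eq (α := ℝ)]
    exact he.comap_eq.symm
  have hall : ∀ᵐ ω ∂μ, ∀ q : ℚ,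
      (condExpKernel μ m' ω).bind (fun ω' => condExpKernel μ m ω') (e ⁻¹' Set.Iic (q : ℝ))
        = condExpKernel μ m' ω (e ⁻¹' Set.Iic (q : ℝ)) :=
    ae_all_iff.2 fun q => hfix _ (he.measurable measurableSet_Iic)
  filter_upwards [hall, hfix Set.univ MeasurableSet.univ] with ω hω huniv
  refine (ext_of_generate_finite _ hgen ?_ ?_ huniv.symm).symm
  · exact Real.isPiSystem_Iic_rat.comap e
  · rintro _ ⟨t, ht, rfl⟩
    simp only [Set.iUnion_singleton_eq_range, Set.mem_range] at ht
    obtain ⟨q, rfl⟩ := ht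
    exact (hω q).symm

/-- Real random variables that are conditionally independent are independent under almost every
regular conditional distribution. -/
theorem iCondIndepFun.ae_iIndepFun {ι : Type*} [Fintype ι] (hm : m ≤ mΩ) {X : ι → Ω → ℝ}
    (hX : ∀ i, Measurable (X i)) (h : iCondIndepFun m hm X μ) :
    ∀ᵐ ω ∂μ, iIndepFun X (condExpKernel μ m ω) := by
  classical
  -- Only countably many events are tested, so one null set serves for all of them.
  have h1 : ∀ᵐ ω ∂μ, ∀ (s : Finset ι) (q : ι → ℚ),
      condExpKernel μ m ω (⋂ i ∈ s, X i ⁻¹' Set.Iic (q i : ℝ))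
        = ∏ i ∈ s, condExpKernel μ m ω (X i ⁻¹' Set.Iic (q i : ℝ)) := by
    refine ae_all_iff.2 fun s => ae_all_iff.2 fun q => ae_of_ae_trim hm ?_
    exact h s fun i _ => ⟨_, measurableSet_Iic, rfl⟩
  filter_upwards [h1] with ω hω
  rw [iIndepFun_iff_iIndep]
  refine iIndepSets.iIndep (fun i => (hX i).comap_le)
    (fun i => Set.preimage (X i) '' (⋃ a : ℚ, {Set.Iic (a : ℝ)}))
    (fun i => Real.isPiSystem_Iic_rat.comap (X i)) (fun i => ?_) ?_
  · rw [← MeasurableSpace.comap_generateFrom, ← Real.borel_eq_generateFrom_Iic_rat,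
      ← BorelSpace.measurable_eq (α := ℝ)]
  · rw [iIndepSets_iff]
    intro s f hf
    have : ∀ i, ∃ q : ℚ, i ∈ s → f i = X i ⁻¹' Set.Iic (q : ℝ) := by
      intro i
      by_cases hi : i ∈ s
      · obtain ⟨t, ht, hft⟩ := hf i hi
        simp only [Set.iUnion_singleton_eq_range, Set.mem_range] at ht
        obtain ⟨q, rfl⟩ := ht
        exact ⟨q, fun _ => hft.symm⟩
      · exact ⟨0, fun h => absurd h hi⟩
    choose q hq using this
    have e1 : (⋂ i ∈ s, f i) = ⋂ i ∈ s, X i ⁻¹' Set.Iic (q i : ℝ) :=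
      Set.iInter₂_congr fun i hi => hq i hi
    rw [e1, hω s q]
    exact Finset.prod_congr rfl fun i hi => by rw [hq i hi]

end Kernel

/-! ### Conditional Markov inequality along a sequence of spaces -/

section CondMarkov

variable {Ω : ℕ → Type*} {m' m : ∀ S, MeasurableSpace (Ω S)} [mΩ : ∀ S, MeasurableSpace (Ω S)]
  [∀ S, StandardBorelSpace (Ω S)]
  {μ : ∀ S, Measure (Ω S)} [∀ S, IsProbabilityMeasure (μ S)]

/-- Conditional Markov inequality. Where the conditional `L¹` norm is below `η`, the conditional
probability of `ε ≤ |V|` is at most `η / ε`; the remaining `ω` have small probability, and there the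
trivial bound one is used. -/
theorem tendsto_zero_of_condExpKernel_whp
    (hm : ∀ S, m S ≤ mΩ S) {V H : (Σ S, Ω S) → ℝ}
    (hV : ∀ S, Measurable fun ω => V ⟨S, ω⟩)
    (h : ∀ᶠ x in whp μ, ∫⁻ ω', ENNReal.ofReal |V ⟨x.1, ω'⟩| ∂condExpKernel (μ x.1) (m x.1) x.2
      ≤ ENNReal.ofReal (H x))
    (hH : Tendsto H (whp μ) (𝓝 0)) : Tendsto V (whp μ) (𝓝 0) := by
  rw [Metric.tendsto_nhds]
  intro ε hε
  simp only [Real.dist_eq, sub_zero]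
  rw [eventually_whp_iff, ENNReal.tendsto_nhds_zero]
  simp only [not_lt]
  intro δ hδ
  obtain ⟨η, hη, hηδ⟩ : ∃ η : ℝ, 0 < η ∧ ENNReal.ofReal (η / ε) ≤ δ / 2 := by
    rcases eq_or_ne δ ⊤ with rfl | ht
    · exact ⟨1, one_pos, by simp [ENNReal.top_div]⟩
    · refine ⟨ε * (δ / 2).toReal, mul_pos hε (ENNReal.toReal_pos (ENNReal.half_pos (ne_of_gt hδ)).ne'
        (ENNReal.div_ne_top ht (by simp))), ?_⟩
      rw [mul_div_cancel_left₀ _ hε.ne', ENNReal.ofReal_toReal (ENNReal.div_ne_top ht (by simp))]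
  have hbad : ∀ᶠ x in whp μ, ∫⁻ ω', ENNReal.ofReal |V ⟨x.1, ω'⟩|
      ∂condExpKernel (μ x.1) (m x.1) x.2 ≤ ENNReal.ofReal η := by
    filter_upwards [h, Metric.tendsto_nhds.1 hH η hη] with x h hx
    rw [Real.dist_eq, sub_zero] at hx
    exact h.trans (ENNReal.ofReal_le_ofReal ((le_abs_self _).trans hx.le))
  rw [eventually_whp_iff] at hbad
  filter_upwards [(ENNReal.tendsto_nhds_zero.1 hbad) (δ / 2) (ENNReal.half_pos (ne_of_gt hδ))]
    with S hS2
  simp only [not_le] at hS2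
  have hmeas : MeasurableSet {ω | ε ≤ |V ⟨S, ω⟩|} :=
    measurableSet_le measurable_const (hV S).abs
  rw [measure_eq_lintegral_condExpKernel (hm S) hmeas]
  -- A measurable hull of the exceptional event has the same measure and an indicator that can be
  -- integrated.
  set T := toMeasurable (μ S) {ω | ENNReal.ofReal η
    < ∫⁻ ω', ENNReal.ofReal |V ⟨S, ω'⟩| ∂condExpKernel (μ S) (m S) ω}
  calc ∫⁻ ω, condExpKernel (μ S) (m S) ω {ω | ε ≤ |V ⟨S, ω⟩|} ∂μ S
      ≤ ∫⁻ ω, (T.indicator (fun _ => (1 : ENNReal)) ω + ENNReal.ofReal (η / ε)) ∂μ S := by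
        refine lintegral_mono fun ω => ?_
        dsimp only
        by_cases hmem : ω ∈ T
        · rw [Set.indicator_of_mem hmem]
          exact prob_le_one.trans le_self_add
        · have hle : ∫⁻ ω', ENNReal.ofReal |V ⟨S, ω'⟩| ∂condExpKernel (μ S) (m S) ω
              ≤ ENNReal.ofReal η := by
            by_contra hcon
            exact hmem (subset_toMeasurable _ _ (not_le.1 hcon))
          refine le_trans ?_ le_add_self
          have hset : {ω' | ε ≤ |V ⟨S, ω'⟩|}
              = {ω' | ENNReal.ofReal ε ≤ ENNReal.ofReal |V ⟨S, ω'⟩|} := by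
            ext ω'
            exact (ENNReal.ofReal_le_ofReal_iff (abs_nonneg _)).symm
          rw [hset]
          refine (meas_ge_le_lintegral_div (hV S).abs.ennreal_ofReal.aemeasurable (by simpa)
            ENNReal.ofReal_ne_top).trans ?_
          rw [ENNReal.ofReal_div_of_pos hε]
          gcongr
    _ = μ S T + ENNReal.ofReal (η / ε) := by
        rw [lintegral_add_right _ measurable_const,
          lintegral_indicator_const (measurableSet_toMeasurable _ _)]
        simp [T]
    _ ≤ δ / 2 + δ / 2 := by
        rw [measure_toMeasurable]
        gcongr
    _ = δ := ENNReal.add_halves δ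

theorem tendsto_zero_of_condExpKernel
    (hm : ∀ S, m S ≤ mΩ S) {V H : (Σ S, Ω S) → ℝ}
    (hV : ∀ S, Measurable fun ω => V ⟨S, ω⟩)
    (h : ∀ᶠ S in atTop, ∀ᵐ ω ∂μ S,
      ∫⁻ ω', ENNReal.ofReal |V ⟨S, ω'⟩| ∂condExpKernel (μ S) (m S) ω ≤ ENNReal.ofReal (H ⟨S, ω⟩))
    (hH : Tendsto H (whp μ) (𝓝 0)) : Tendsto V (whp μ) (𝓝 0) :=
  tendsto_zero_of_condExpKernel_whp hm hV (eventually_whp_of_eventually_ae h) hH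

/-- A bound for conditional expectations given the coarser σ-fields `m'` controls conditional
expectations given the finer σ-fields `m`. -/
theorem tendsto_integral_condExpKernel_of_le
    (hm' : ∀ S, m' S ≤ m S) (hm : ∀ S, m S ≤ mΩ S) {f : ∀ S, Ω S → ℝ} {H : (Σ S, Ω S) → ℝ}
    (hf : ∀ S, Measurable (f S)) (hf0 : ∀ S ω, 0 ≤ f S ω)
    (h : ∀ᶠ x in whp μ, ∫⁻ ω', ENNReal.ofReal (f x.1 ω') ∂condExpKernel (μ x.1) (m' x.1) x.2
      ≤ ENNReal.ofReal (H x))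
    (hH : Tendsto H (whp μ) (𝓝 0)) :
    Tendsto (fun x : Σ S, Ω S => ∫ ω', f x.1 ω' ∂condExpKernel (μ x.1) (m x.1) x.2)
      (whp μ) (𝓝 0) := by
  refine tendsto_zero_of_condExpKernel_whp (m := m') (fun S => (hm' S).trans (hm S))
    (V := fun x => ∫ ω', f x.1 ω' ∂condExpKernel (μ x.1) (m x.1) x.2) (fun S => ?_) ?_ hH
  · have h1 : StronglyMeasurable[m S] fun ω => ∫ ω', f S ω' ∂condExpKernel (μ S) (m S) ω :=
      StronglyMeasurable.integral_condExpKernel (hf S).stronglyMeasurable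
    exact h1.measurable.mono (hm S) le_rfl
  have hbind : ∀ S, ∀ᵐ ω ∂μ S,
      (condExpKernel (μ S) (m' S) ω).bind (fun ω' => condExpKernel (μ S) (m S) ω')
        = condExpKernel (μ S) (m' S) ω := fun S => ae_bind_condExpKernel (hm' S) (hm S)
  have hbind' : ∀ᶠ x in whp μ,
      (condExpKernel (μ x.1) (m' x.1) x.2).bind (fun ω' => condExpKernel (μ x.1) (m x.1) ω')
        = condExpKernel (μ x.1) (m' x.1) x.2 := eventually_whp_of_ae hbind
  filter_upwards [h, hbind'] with x hx hb
  -- By the tower property the conditional `L¹` norm given `m'` of the conditional mean given `m` is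
  -- at most the conditional mean of `f` given `m'`.
  refine le_trans ?_ hx
  conv_rhs => rw [← hb]
  rw [Measure.lintegral_bind (measurable_condExpKernel_measure (hm x.1)).aemeasurable
    (hf x.1).ennreal_ofReal.aemeasurable]
  refine lintegral_mono fun ω => ?_
  dsimp only
  rw [abs_of_nonneg (integral_nonneg fun ω' => hf0 _ _),
    integral_eq_lintegral_of_nonneg_ae (Eventually.of_forall fun ω' => hf0 _ _)
      (hf x.1).aestronglyMeasurable]
  exact ENNReal.ofReal_toReal_le

theorem isBoundedOp_of_condExpKernel
    (hm : ∀ S, m S ≤ mΩ S) {V H : (Σ S, Ω S) → ℝ}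
    (hV : ∀ S, Measurable fun ω => V ⟨S, ω⟩)
    (h : ∀ᶠ S in atTop, ∀ᵐ ω ∂μ S,
      ∫⁻ ω', ENNReal.ofReal |V ⟨S, ω'⟩| ∂condExpKernel (μ S) (m S) ω ≤ ENNReal.ofReal (H ⟨S, ω⟩))
    (hH : IsBoundedOp μ H) : IsBoundedOp μ V := by
  intro c hc
  refine tendsto_zero_of_condExpKernel hm (H := fun x => |c x.1| * H x)
    (V := fun x => c x.1 * V x) (fun S => (hV S).const_mul (c S)) ?_ (hH (fun S => |c S|) ?_)
  rotate_left
  · simpa using hc.abs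
  filter_upwards [h] with S hS
  filter_upwards [hS] with ω hω
  simp only [abs_mul, ENNReal.ofReal_mul (abs_nonneg _)]
  rw [lintegral_const_mul _ (hV S).abs.ennreal_ofReal]
  gcongr

end CondMarkov

/-! ### Elementary inequalities -/

section Elementary

variable {ι : Type*}

theorem sq_sum_mul_le (s : Finset ι) {w : ι → ℝ} (hw : ∀ i ∈ s, 0 ≤ w i) (x : ι → ℝ) :
    (∑ i ∈ s, w i * x i) ^ 2 ≤ (∑ i ∈ s, w i) * ∑ i ∈ s, w i * x i ^ 2 :=
  Finset.sum_sq_le_sum_mul_sum_of_sq_le_mul s hw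
    (fun i hi => mul_nonneg (hw i hi) (sq_nonneg _)) (fun i _ => le_of_eq (by ring))

/-- Jensen's inequality for the fourth power, as Cauchy–Schwarz applied twice. -/
theorem pow_four_sum_mul_le (s : Finset ι) {w : ι → ℝ} (hw : ∀ i ∈ s, 0 ≤ w i) (x : ι → ℝ) :
    (∑ i ∈ s, w i * x i) ^ 4 ≤ (∑ i ∈ s, w i) ^ 3 * ∑ i ∈ s, w i * x i ^ 4 := by
  have h1 := sq_sum_mul_le s hw x
  have h2 := sq_sum_mul_le s hw fun i => x i ^ 2
  have h0 : 0 ≤ ∑ i ∈ s, w i := Finset.sum_nonneg hw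
  calc (∑ i ∈ s, w i * x i) ^ 4 = ((∑ i ∈ s, w i * x i) ^ 2) ^ 2 := by ring
    _ ≤ ((∑ i ∈ s, w i) * ∑ i ∈ s, w i * x i ^ 2) ^ 2 := by gcongr
    _ = (∑ i ∈ s, w i) ^ 2 * (∑ i ∈ s, w i * x i ^ 2) ^ 2 := by ring
    _ ≤ (∑ i ∈ s, w i) ^ 2 * ((∑ i ∈ s, w i) * ∑ i ∈ s, w i * (x i ^ 2) ^ 2) := by gcongr
    _ = (∑ i ∈ s, w i) ^ 3 * ∑ i ∈ s, w i * x i ^ 4 := by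
        simp only [← pow_mul]; ring

theorem pow_four_abs_sum_mul_le (s : Finset ι) {b : ι → ℝ} {c : ℝ} (hb : ∑ i ∈ s, |b i| ≤ c)
    (x : ι → ℝ) : (∑ i ∈ s, b i * x i) ^ 4 ≤ c ^ 3 * ∑ i ∈ s, |b i| * x i ^ 4 := by
  have h1 := pow_four_sum_mul_le s (fun i _ => abs_nonneg (b i)) fun i => |x i|
  have h2 : |∑ i ∈ s, b i * x i| ≤ ∑ i ∈ s, |b i| * |x i| := by
    simpa only [abs_mul] using Finset.abs_sum_le_sum_abs (fun i => b i * x i) s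
  have h3 : (∑ i ∈ s, b i * x i) ^ 4 ≤ (∑ i ∈ s, |b i| * |x i|) ^ 4 := by
    rw [← Even.pow_abs (by decide : Even 4)]
    gcongr
  simp only [Even.pow_abs (by decide : Even 4)] at h1
  refine h3.trans (h1.trans ?_)
  have h4 : 0 ≤ ∑ i ∈ s, |b i| := Finset.sum_nonneg fun i _ => abs_nonneg _
  gcongr

theorem add_pow_four_le (a b : ℝ) : (a + b) ^ 4 ≤ 8 * (a ^ 4 + b ^ 4) := by
  nlinarith [sq_nonneg (a - b), sq_nonneg (a ^ 2 - b ^ 2), sq_nonneg (a + b),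
    mul_nonneg (sq_nonneg (a - b)) (sq_nonneg (a + b)),
    mul_nonneg (sq_nonneg (a - b)) (sq_nonneg (a - b)), sq_nonneg (a ^ 2 + b ^ 2)]

/-- AM–GM after rescaling by `θ`: the first factor is meant to be small and may carry a large
constant, while the others only need bounded fourth moments. -/
theorem mul_four_le_add_pow (a b c d : ℝ) {θ : ℝ} (hθ : 0 < θ) :
    a * b * c * d ≤ (a ^ 4 / θ ^ 12 + θ ^ 4 * (b ^ 4 + c ^ 4 + d ^ 4)) / 4 := by
  have key : ∀ p q r s : ℝ, p * q * r * s ≤ (p ^ 4 + q ^ 4 + r ^ 4 + s ^ 4) / 4 := by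
    intro p q r s
    nlinarith [sq_nonneg (p * q - r * s), sq_nonneg (p ^ 2 - q ^ 2), sq_nonneg (r ^ 2 - s ^ 2)]
  have := key (a / θ ^ 3) (θ * b) (θ * c) (θ * d)
  have e : a / θ ^ 3 * (θ * b) * (θ * c) * (θ * d) = a * b * c * d := by field_simp
  rw [e] at this
  refine this.trans (le_of_eq ?_)
  rw [div_pow, ← pow_mul]
  ring

theorem abs_sq_mul_sq_sub_le (P Q P' Q' : ℝ) :
    |P ^ 2 * Q ^ 2 - P' ^ 2 * Q' ^ 2|
      ≤ (|P - P'| * |Q| + |P'| * |Q - Q'|) * (|P| * |Q| + |P'| * |Q'|) := by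
  have e : P ^ 2 * Q ^ 2 - P' ^ 2 * Q' ^ 2
      = ((P - P') * Q + P' * (Q - Q')) * (P * Q + P' * Q') := by ring
  rw [e, abs_mul]
  gcongr
  · exact (abs_add_le _ _).trans (by rw [abs_mul, abs_mul])
  · exact (abs_add_le _ _).trans (by rw [abs_mul, abs_mul])

/-- The basic perturbation bound: the differences are paid for with `θ⁻¹²`, everything else with a
factor `θ⁴` that can be made small. -/
theorem abs_sq_mul_sq_sub_le_pow_four (P Q P' Q' : ℝ) {θ : ℝ} (hθ : 0 < θ) :
    |P ^ 2 * Q ^ 2 - P' ^ 2 * Q' ^ 2| ≤ ((P - P') ^ 4 + (Q - Q') ^ 4) / θ ^ 12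
      + 2 * θ ^ 4 * (P ^ 4 + Q ^ 4 + P' ^ 4 + Q' ^ 4) := by
  refine (abs_sq_mul_sq_sub_le P Q P' Q').trans ?_
  have h1 := mul_four_le_add_pow |P - P'| |Q| |P| |Q| hθ
  have h2 := mul_four_le_add_pow |P - P'| |Q| |P'| |Q'| hθ
  have h3 := mul_four_le_add_pow |Q - Q'| |P'| |P| |Q| hθ
  have h4 := mul_four_le_add_pow |Q - Q'| |P'| |P'| |Q'| hθ
  simp only [Even.pow_abs (by decide : Even 4)] at h1 h2 h3 h4
  have hp : 0 ≤ (P - P') ^ 4 / θ ^ 12 := by positivity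
  have hq : 0 ≤ (Q - Q') ^ 4 / θ ^ 12 := by positivity
  have e1 : 0 ≤ θ ^ 4 * P ^ 4 := by positivity
  have e2 : 0 ≤ θ ^ 4 * Q ^ 4 := by positivity
  have e3 : 0 ≤ θ ^ 4 * P' ^ 4 := by positivity
  have e4 : 0 ≤ θ ^ 4 * Q' ^ 4 := by positivity
  rw [add_div]
  nlinarith

/-- Truncation of a real number at level `M`. -/
noncomputable def clip (M x : ℝ) : ℝ := max (-M) (min M x)

theorem measurable_clip (M : ℝ) : Measurable (clip M) := by
  unfold clip; fun_prop

theorem clip_of_abs_le {M x : ℝ} (h : |x| ≤ M) : clip M x = x := by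
  rw [abs_le] at h
  simp [clip, h.1, h.2]

theorem abs_clip_le {M : ℝ} (hM : 0 ≤ M) (x : ℝ) : |clip M x| ≤ M :=
  abs_le.2 ⟨le_max_left _ _, max_le (by linarith) (min_le_left _ _)⟩

theorem abs_clip_le_abs {M : ℝ} (hM : 0 ≤ M) (x : ℝ) : |clip M x| ≤ |x| := by
  rcases le_or_gt |x| M with h | h
  · rw [clip_of_abs_le h]
  · exact (abs_clip_le hM x).trans h.le

theorem abs_sub_clip_le {M : ℝ} (hM : 0 ≤ M) (x : ℝ) : |x - clip M x| ≤ |x| := by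
  unfold clip
  rcases le_total x 0 with h | h
  · rw [min_eq_right (by linarith), abs_of_nonpos h]
    rcases max_cases (-M) x with ⟨h1, h2⟩ | ⟨h1, h2⟩
    · rw [h1, abs_le]; constructor <;> linarith
    · rw [h1]; simpa using h
  · rw [max_eq_right (le_min (by linarith) (by linarith)), abs_of_nonneg h]
    rcases min_cases M x with ⟨h1, h2⟩ | ⟨h1, h2⟩
    · rw [h1, abs_le]; constructor <;> linarith
    · rw [h1]; simpa using h

theorem pow_four_le_of_lt_abs {M p x : ℝ} (hM : 0 < M) (hp : 4 ≤ p) (h : M ≤ |x|) :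
    x ^ 4 ≤ M ^ (-(p - 4)) * |x| ^ p := by
  have hx : 0 < |x| := hM.trans_le h
  have h1 : |x| ^ p = |x| ^ (p - 4) * x ^ 4 := by
    rw [← Even.pow_abs (by decide : Even 4) x, ← Real.rpow_natCast, ← Real.rpow_add hx]
    norm_num
  have h2 : 1 ≤ M ^ (-(p - 4)) * |x| ^ (p - 4) := by
    rw [Real.rpow_neg hM.le, ← div_eq_inv_mul, one_le_div (by positivity)]
    exact Real.rpow_le_rpow hM.le h (by linarith)
  rw [h1, ← mul_assoc]
  exact le_mul_of_one_le_left (by positivity) h2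

/-- The moment of order `p > 4` makes the fourth moment of the truncated part vanish as `M → ∞`,
uniformly over the variables. -/
theorem sub_clip_pow_four_le {M p : ℝ} (hM : 0 < M) (hp : 4 ≤ p) (x : ℝ) :
    (x - clip M x) ^ 4 ≤ M ^ (-(p - 4)) * |x| ^ p := by
  rcases le_or_gt |x| M with h | h
  · rw [clip_of_abs_le h]
    have : 0 ≤ M ^ (-(p - 4)) * |x| ^ p := by positivity
    simpa using this
  · refine le_trans ?_ (pow_four_le_of_lt_abs hM hp h.le)
    rw [← Even.pow_abs (by decide : Even 4), ← Even.pow_abs (by decide : Even 4) x]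
    have := abs_sub_clip_le hM.le x
    gcongr

theorem pow_four_le_one_add_rpow {p : ℝ} (hp : 4 ≤ p) (x : ℝ) : x ^ 4 ≤ 1 + |x| ^ p := by
  rcases le_or_gt 1 |x| with h | h
  · have := pow_four_le_of_lt_abs one_pos hp h
    simp only [Real.one_rpow, one_mul] at this
    linarith
  · have h1 : x ^ 4 ≤ 1 := by
      rw [← Even.pow_abs (by decide : Even 4)]
      exact pow_le_one₀ (abs_nonneg _) h.le
    have : 0 ≤ |x| ^ p := by positivity
    linarith

end Elementary

/-! ### Variance of functions with bounded differences -/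

section BoundedDifferences

/-- A form of the Efron–Stein inequality. Integrating out the first coordinate splits the variance
into the mean conditional variance, at most `d 0 ^ 2`, and the variance of a function of the
remaining coordinates that inherits their difference bounds. -/
theorem variance_pi_le_of_bounded_differences {n : ℕ} (ν : Fin n → Measure ℝ)
    [∀ i, IsProbabilityMeasure (ν i)] {g : (Fin n → ℝ) → ℝ} (hg : Measurable g) {C : ℝ}
    (hC : ∀ x, |g x| ≤ C) {d : Fin n → ℝ}
    (hd : ∀ t x a b, |g (Function.update x t a) - g (Function.update x t b)| ≤ d t) :
    ∫ x, (g x - ∫ y, g y ∂Measure.pi ν) ^ 2 ∂Measure.pi ν ≤ ∑ t, d t ^ 2 := by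
  induction n with
  | zero =>
    have h : ∀ x, g x = g default := fun x => by rw [Subsingleton.elim x default]
    simp [h]
  | succ n ih =>
    have hmp := measurePreserving_piFinSuccAbove ν 0
    set e := MeasurableEquiv.piFinSuccAbove (fun _ : Fin (n + 1) => ℝ) 0 with he
    set π' := Measure.pi fun j => ν (Fin.succAbove 0 j) with hπ'
    set G : ℝ × (Fin n → ℝ) → ℝ := fun z => g (e.symm z) with hG
    have hGm : Measurable G := hg.comp e.symm.measurable
    have hGC : ∀ z, |G z| ≤ C := fun z => hC _
    have hGe : ∀ x, G (e x) = g x := fun x => by simp [hG]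
    have hGi : ∀ y, Integrable (fun a => G (a, y)) (ν 0) := fun y =>
      Integrable.of_bound (hGm.comp (measurable_id.prodMk measurable_const)).aestronglyMeasurable C
        (Eventually.of_forall fun a => hGC _)
    set F : (Fin n → ℝ) → ℝ := fun y => ∫ a, G (a, y) ∂ν 0 with hF
    have hFm : Measurable F :=
      (StronglyMeasurable.integral_prod_left' (μ := ν 0) hGm.stronglyMeasurable).measurable
    have hFC : ∀ y, |F y| ≤ C := by
      intro y
      have := norm_integral_le_of_norm_le_const (μ := ν 0) (f := fun a => G (a, y)) (C := C)
        (Eventually.of_forall fun a => hGC _)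
      simpa using this
    have hup : ∀ (t : Fin n) (y : Fin n → ℝ) (a b : ℝ),
        e.symm (a, Function.update y t b) = Function.update (e.symm (a, y)) t.succ b := by
      intro t y a b
      have h1 : ∀ z : Fin n → ℝ, e.symm (a, z) = Fin.cons a z := by
        intro z
        rw [he]
        simp [MeasurableEquiv.piFinSuccAbove, Fin.insertNthEquiv]
      rw [h1, h1, Fin.cons_update]
    have hup0 : ∀ (y : Fin n → ℝ) (a b : ℝ),
        e.symm (a, y) = Function.update (e.symm (b, y)) 0 a := by
      intro y a b
      have h1 : ∀ c : ℝ, e.symm (c, y) = Fin.cons c y := by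
        intro z
        rw [he]
        simp [MeasurableEquiv.piFinSuccAbove, Fin.insertNthEquiv]
      rw [h1, h1, Fin.update_cons_zero]
    have hFd : ∀ t y a b, |F (Function.update y t a) - F (Function.update y t b)|
        ≤ d t.succ := by
      intro t y a b
      rw [hF, ← integral_sub (hGi _) (hGi _)]
      have := norm_integral_le_of_norm_le_const (μ := ν 0)
        (f := fun c => G (c, Function.update y t a) - G (c, Function.update y t b)) (C := d t.succ)
        (Eventually.of_forall fun c => by
          simp only [hG, hup, Real.norm_eq_abs]
          exact hd _ _ _ _)
      simpa using this
    have hd0 : ∀ y a, |G (a, y) - F y| ≤ d 0 := by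
      intro y a
      have h1 : G (a, y) - F y = ∫ b, (G (a, y) - G (b, y)) ∂ν 0 := by
        rw [integral_sub (integrable_const _) (hGi y)]
        simp [hF]
      rw [h1]
      have := norm_integral_le_of_norm_le_const (μ := ν 0)
        (f := fun b => G (a, y) - G (b, y)) (C := d 0)
        (Eventually.of_forall fun b => by
          simp only [hG, Real.norm_eq_abs]
          rw [hup0 y a a, hup0 y b a]
          exact hd _ _ _ _)
      simpa using this
    have hGint : Integrable G ((ν 0).prod π') :=
      Integrable.of_bound hGm.aestronglyMeasurable C (Eventually.of_forall fun a => hGC _)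
    have hmean : ∫ x, g x ∂Measure.pi ν = ∫ y, F y ∂π' := by
      have h1 := hmp.integral_comp e.measurableEmbedding G
      simp only [hGe] at h1
      rw [h1, integral_prod_symm _ hGint]
    set m0 := ∫ x, g x ∂Measure.pi ν with hm0
    have hm0C : |m0| ≤ C := by
      have := norm_integral_le_of_norm_le_const (μ := Measure.pi ν) (f := g) (C := C)
        (Eventually.of_forall fun a => hC _)
      simpa using this
    have hC0 : 0 ≤ C := (abs_nonneg _).trans hm0C
    have hsq : ∀ u : ℝ, |u| ≤ C → |(u - m0) ^ 2| ≤ (2 * C) ^ 2 := by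
      intro u hu
      rw [abs_pow]
      have := abs_sub u m0
      gcongr
      exact this.trans (by linarith)
    have hGsq : Integrable (fun z => (G z - m0) ^ 2) ((ν 0).prod π') :=
      Integrable.of_bound ((hGm.sub_const _).pow_const 2).aestronglyMeasurable ((2 * C) ^ 2)
        (Eventually.of_forall fun z => hsq _ (hGC z))
    have hFsq : Integrable (fun y => (F y - m0) ^ 2) π' :=
      Integrable.of_bound ((hFm.sub_const _).pow_const 2).aestronglyMeasurable ((2 * C) ^ 2)
        (Eventually.of_forall fun z => hsq _ (hFC z))
    have hvar : ∫ x, (g x - m0) ^ 2 ∂Measure.pi ν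
        = ∫ y, ∫ a, (G (a, y) - m0) ^ 2 ∂ν 0 ∂π' := by
      have h1 := hmp.integral_comp e.measurableEmbedding fun z => (G z - m0) ^ 2
      simp only [hGe] at h1
      rw [h1, integral_prod_symm _ hGsq]
    -- Expanding around `F y`, the conditional mean, kills the cross term.
    have hinner : ∀ y, ∫ a, (G (a, y) - m0) ^ 2 ∂ν 0 ≤ d 0 ^ 2 + (F y - m0) ^ 2 := by
      intro y
      have hi : Integrable (fun a => G (a, y) - F y) (ν 0) := (hGi y).sub (integrable_const _)
      have hi2 : Integrable (fun a => (G (a, y) - F y) ^ 2) (ν 0) :=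
        Integrable.of_bound (hi.aestronglyMeasurable.pow 2) (d 0 ^ 2)
          (Eventually.of_forall fun a => by
            rw [Real.norm_eq_abs, abs_pow]
            have := hd0 y a
            gcongr)
      have e1 : ∀ a, (G (a, y) - m0) ^ 2
          = (G (a, y) - F y) ^ 2 + (2 * (F y - m0) * (G (a, y) - F y) + (F y - m0) ^ 2) := by
        intro a; ring
      simp only [e1]
      have hi3 : Integrable (fun a => 2 * (F y - m0) * (G (a, y) - F y) + (F y - m0) ^ 2) (ν 0) :=
        (hi.const_mul _).add (integrable_const _)
      rw [integral_add hi2 hi3,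
        integral_add (hi.const_mul _) (integrable_const _), integral_const_mul,
        integral_sub (hGi y) (integrable_const _)]
      have h2 : ∫ a, (G (a, y) - F y) ^ 2 ∂ν 0 ≤ d 0 ^ 2 := by
        have := integral_mono hi2 (integrable_const (d 0 ^ 2)) (fun a => by
          have := hd0 y a
          rw [← sq_abs]
          gcongr)
        simpa using this
      have h3 : ∫ a, G (a, y) ∂ν 0 = F y := rfl
      simp only [h3, integral_const, probReal_univ, one_smul, sub_self, mul_zero, zero_add]
      linarith
    rw [hvar, Fin.sum_univ_succ]
    have hlast := ih (fun j => ν (Fin.succAbove 0 j)) hFm hFC hFd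
    rw [← hmean] at hlast
    refine (integral_mono hGsq.integral_prod_right ((integrable_const _).add hFsq) hinner).trans ?_
    rw [integral_add' (integrable_const _) hFsq]
    simp only [integral_const, probReal_univ, one_smul]
    linarith

theorem variance_le_of_bounded_differences {Ω : Type*} [MeasurableSpace Ω] {P : Measure Ω}
    [IsProbabilityMeasure P] {n : ℕ} {X : Fin n → Ω → ℝ} (hX : ∀ i, Measurable (X i))
    (hind : iIndepFun X P) {g : (Fin n → ℝ) → ℝ} (hg : Measurable g) {C : ℝ}
    (hC : ∀ x, |g x| ≤ C) {d : Fin n → ℝ}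
    (hd : ∀ t x a b, |g (Function.update x t a) - g (Function.update x t b)| ≤ d t) :
    ∫ ω, (g (fun i => X i ω) - ∫ ω', g (fun i => X i ω') ∂P) ^ 2 ∂P ≤ ∑ t, d t ^ 2 := by
  have hlaw := (iIndepFun_iff_map_fun_eq_pi_map (fun i => (hX i).aemeasurable)).1 hind
  have hXm : Measurable fun ω i => X i ω := measurable_pi_lambda _ hX
  have : ∀ i, IsProbabilityMeasure (P.map (X i)) := fun i =>
    Measure.isProbabilityMeasure_map (hX i).aemeasurable
  have h := variance_pi_le_of_bounded_differences (fun i => P.map (X i)) hg hC hd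
  rw [← hlaw] at h
  rw [integral_map hXm.aemeasurable hg.aestronglyMeasurable,
    integral_map hXm.aemeasurable ((hg.sub_const _).pow_const 2).aestronglyMeasurable] at h
  exact h

end BoundedDifferences

/-! ### A law of large numbers for weighted sums of squared products of affine forms -/

section LLN

variable {ι : Type*} [Fintype ι] {n : ℕ}

/-- The weighted sum `∑ₖ hₖ Pₖ² Qₖ²` of squared products of the affine forms `Pₖ = eₖ + ∑ₜ bₖₜ xₜ`
and `Qₖ = yₖ + ∑ₜ cₖₜ xₜ`. -/
noncomputable def affineProdSq (h e y : ι → ℝ) (b c : ι → Fin n → ℝ) (x : Fin n → ℝ) : ℝ :=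
  ∑ k, h k * ((e k + ∑ t, b k t * x t) ^ 2 * (y k + ∑ t, c k t * x t) ^ 2)

theorem measurable_affineProdSq (h e y : ι → ℝ) (b c : ι → Fin n → ℝ) :
    Measurable (affineProdSq h e y b c) := by
  unfold affineProdSq; fun_prop

theorem affine_pow_four_le {b : Fin n → ℝ} {cb p : ℝ} (hp : 4 ≤ p) (hb : ∑ t, |b t| ≤ cb)
    (a : ℝ) {x x' : Fin n → ℝ} (hx : ∀ t, |x' t| ≤ |x t|) :
    (a + ∑ t, b t * x' t) ^ 4 ≤ 8 * (a ^ 4 + cb ^ 3 * ∑ t, |b t| * (1 + |x t| ^ p)) := by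
  have hcb : 0 ≤ cb := (Finset.sum_nonneg fun t _ => abs_nonneg (b t)).trans hb
  refine (add_pow_four_le _ _).trans ?_
  gcongr
  refine (pow_four_abs_sum_mul_le _ hb x').trans ?_
  gcongr with t
  refine le_trans ?_ (pow_four_le_one_add_rpow hp (x t))
  rw [← Even.pow_abs (by decide : Even 4), ← Even.pow_abs (by decide : Even 4) (x t)]
  have := hx t
  gcongr

theorem affine_sub_clip_pow_four_le {b : Fin n → ℝ} {cb p M : ℝ} (hM : 0 < M) (hp : 4 ≤ p)
    (hb : ∑ t, |b t| ≤ cb) (a : ℝ) (x : Fin n → ℝ) :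
    (a + ∑ t, b t * x t - (a + ∑ t, b t * clip M (x t))) ^ 4
      ≤ cb ^ 3 * M ^ (-(p - 4)) * ∑ t, |b t| * |x t| ^ p := by
  have hcb : 0 ≤ cb := (Finset.sum_nonneg fun t _ => abs_nonneg (b t)).trans hb
  have e1 : a + ∑ t, b t * x t - (a + ∑ t, b t * clip M (x t))
      = ∑ t, b t * (x t - clip M (x t)) := by
    simp only [mul_sub, Finset.sum_sub_distrib]; ring
  rw [e1]
  refine (pow_four_abs_sum_mul_le _ hb _).trans ?_
  rw [mul_assoc, Finset.mul_sum (a := M ^ (-(p - 4)))]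
  refine mul_le_mul_of_nonneg_left (Finset.sum_le_sum fun t _ => ?_) (by positivity)
  rw [mul_left_comm]
  gcongr
  exact sub_clip_pow_four_le hM hp _

variable {h e y : ι → ℝ} {b c : ι → Fin n → ℝ} {cb p : ℝ}

/-- The first summand pays for the difference between the affine forms and their truncated versions,
the second for their size. The constant `32` is `2 * (8 + 8)`: an original and a truncated copy of
each form, each with the factor `8` of `add_pow_four_le`. -/
theorem abs_affineProdSq_sub_clip_le (hh : ∀ k, 0 ≤ h k) (he : ∀ k, |e k| ≤ 1)
    (hb : ∀ k, ∑ t, |b k t| ≤ cb) (hc : ∀ k, ∑ t, |c k t| ≤ cb) {M θ : ℝ}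
    (hM : 0 < M) (hp : 4 ≤ p) (hθ : 0 < θ) (x : Fin n → ℝ) :
    |affineProdSq h e y b c x - affineProdSq h e y b c fun t => clip M (x t)|
      ≤ ∑ k, h k * (cb ^ 3 * M ^ (-(p - 4)) / θ ^ 12 * ∑ t, (|b k t| + |c k t|) * |x t| ^ p
        + 32 * θ ^ 4 * (1 + y k ^ 4 + cb ^ 3 * ∑ t, (|b k t| + |c k t|) * (1 + |x t| ^ p))) := by
  unfold affineProdSq
  rw [← Finset.sum_sub_distrib]
  refine (Finset.abs_sum_le_sum_abs _ _).trans ?_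
  gcongr with k
  rw [← mul_sub, abs_mul, abs_of_nonneg (hh k)]
  refine mul_le_mul_of_nonneg_left ?_ (hh k)
  refine (abs_sq_mul_sq_sub_le_pow_four _ _ _ _ hθ).trans ?_
  have d1 := affine_sub_clip_pow_four_le hM hp (hb k) (e k) x
  have d2 := affine_sub_clip_pow_four_le hM hp (hc k) (y k) x
  have p1 := affine_pow_four_le hp (hb k) (e k) (x := x) (x' := x) fun _ => le_rfl
  have p2 := affine_pow_four_le hp (hc k) (y k) (x := x) (x' := x) fun _ => le_rfl
  have p3 := affine_pow_four_le hp (hb k) (e k) (x := x) (x' := fun t => clip M (x t))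
    fun t => abs_clip_le_abs hM.le _
  have p4 := affine_pow_four_le hp (hc k) (y k) (x := x) (x' := fun t => clip M (x t))
    fun t => abs_clip_le_abs hM.le _
  have he4 : e k ^ 4 ≤ 1 := by
    rw [← Even.pow_abs (by decide : Even 4)]
    exact pow_le_one₀ (abs_nonneg _) (he k)
  simp only [add_mul, Finset.sum_add_distrib, mul_add]
  have hθ4 : 0 < θ ^ 4 := by positivity
  simp only [mul_add, Finset.sum_add_distrib] at d1 d2 p1 p2 p3 p4
  refine add_le_add ?_ ?_
  · rw [div_mul_eq_mul_div, div_mul_eq_mul_div, ← add_div]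
    gcongr
  · rw [← sub_nonneg]
    nlinarith

theorem integrable_affineProdSq_bound {Ω : Type*} [MeasurableSpace Ω] {P : Measure Ω}
    [IsProbabilityMeasure P] {X : Fin n → Ω → ℝ}
    (hintegrable : ∀ t, Integrable (fun ω => |X t ω| ^ p) P) (A B : ℝ) :
    Integrable (fun ω => ∑ k, h k * (A * ∑ t, (|b k t| + |c k t|) * |X t ω| ^ p
        + B * (1 + y k ^ 4 + cb ^ 3 * ∑ t, (|b k t| + |c k t|) * (1 + |X t ω| ^ p)))) P := by
  refine integrable_finsetSum _ fun k _ => Integrable.const_mul (Integrable.add ?_ ?_) _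
  · exact (integrable_finsetSum _ fun t _ => (hintegrable t).const_mul _).const_mul _
  · refine Integrable.const_mul (Integrable.add (integrable_const _) ?_) _
    exact (integrable_finsetSum _ fun t _ =>
      ((integrable_const _).add (hintegrable t)).const_mul _).const_mul _

/-- The truncation error in mean: once `θ` is chosen small, a large `M` makes the remaining term
small. -/
theorem integral_abs_affineProdSq_sub_clip_le {Ω : Type*} [MeasurableSpace Ω] {P : Measure Ω}
    [IsProbabilityMeasure P] {X : Fin n → Ω → ℝ} (hX : ∀ t, Measurable (X t)) {C : ℝ}
    (hintegrable : ∀ t, Integrable (fun ω => |X t ω| ^ p) P) (hmom : ∀ t, ∫ ω, |X t ω| ^ p ∂P ≤ C)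
    (hC : 0 ≤ C) (hcb : 0 ≤ cb)
    (hh : ∀ k, 0 ≤ h k) (hh1 : ∑ k, h k ≤ 1) (he : ∀ k, |e k| ≤ 1)
    (hb : ∀ k, ∑ t, |b k t| ≤ cb) (hc : ∀ k, ∑ t, |c k t| ≤ cb) {M θ : ℝ}
    (hM : 0 < M) (hp : 4 ≤ p) (hθ : 0 < θ) :
    Integrable (fun ω => affineProdSq h e y b c (fun t => X t ω)
        - affineProdSq h e y b c (fun t => clip M (X t ω))) P ∧
    ∫ ω, |affineProdSq h e y b c (fun t => X t ω)
        - affineProdSq h e y b c (fun t => clip M (X t ω))| ∂P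
      ≤ (2 * cb ^ 4 * C * M ^ (-(p - 4)) / θ ^ 12 + 32 * θ ^ 4 * (1 + 2 * cb ^ 4 * (1 + C)))
        * (1 + ∑ k, h k * y k ^ 4) := by
  have hbd := fun ω => abs_affineProdSq_sub_clip_le (y := y) hh he hb hc hM hp hθ fun t => X t ω
  have hi := integrable_affineProdSq_bound (h := h) (y := y) (b := b) (c := c) (cb := cb) hintegrable
    (cb ^ 3 * M ^ (-(p - 4)) / θ ^ 12) (32 * θ ^ 4)
  have hmeas : Measurable fun ω => affineProdSq h e y b c (fun t => X t ω)
      - affineProdSq h e y b c (fun t => clip M (X t ω)) := by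
    refine Measurable.sub ?_ ?_
    · exact (measurable_affineProdSq _ _ _ _ _).comp (measurable_pi_lambda _ hX)
    · exact (measurable_affineProdSq _ _ _ _ _).comp
        (measurable_pi_lambda _ fun t => (measurable_clip M).comp (hX t))
  have hint0 := Integrable.mono' hi hmeas.aestronglyMeasurable (Eventually.of_forall hbd)
  refine ⟨hint0, (integral_mono hint0.abs hi hbd).trans ?_⟩
  have hpart : ∀ k t, Integrable (fun ω => (|b k t| + |c k t|) * |X t ω| ^ p) P :=
    fun k t => (hintegrable t).const_mul _
  have hpart1 : ∀ k t, Integrable (fun ω => (|b k t| + |c k t|) * (1 + |X t ω| ^ p)) P :=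
    fun k t => ((integrable_const _).add (hintegrable t)).const_mul _
  have hsum : ∀ k, Integrable (fun ω => ∑ t, (|b k t| + |c k t|) * |X t ω| ^ p) P :=
    fun k => integrable_finsetSum _ fun t _ => hpart k t
  have hsum1 : ∀ k, Integrable (fun ω => ∑ t, (|b k t| + |c k t|) * (1 + |X t ω| ^ p)) P :=
    fun k => integrable_finsetSum _ fun t _ => hpart1 k t
  have hg : ∀ k, ∑ t, (|b k t| + |c k t|) ≤ 2 * cb := by
    intro k
    rw [Finset.sum_add_distrib]
    linarith [hb k, hc k]
  have i1 : ∀ k, ∫ ω, ∑ t, (|b k t| + |c k t|) * |X t ω| ^ p ∂P ≤ 2 * cb * C := by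
    intro k
    rw [integral_finsetSum _ fun t _ => hpart k t]
    calc ∑ t, ∫ ω, (|b k t| + |c k t|) * |X t ω| ^ p ∂P
        ≤ ∑ t, (|b k t| + |c k t|) * C := by
          gcongr with t
          rw [integral_const_mul]
          have := hmom t
          gcongr
      _ ≤ 2 * cb * C := by
          rw [← Finset.sum_mul]
          have := hg k
          gcongr
  have i2 : ∀ k, ∫ ω, ∑ t, (|b k t| + |c k t|) * (1 + |X t ω| ^ p) ∂P ≤ 2 * cb * (1 + C) := by
    intro k
    rw [integral_finsetSum _ fun t _ => hpart1 k t]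
    calc ∑ t, ∫ ω, (|b k t| + |c k t|) * (1 + |X t ω| ^ p) ∂P
        ≤ ∑ t, (|b k t| + |c k t|) * (1 + C) := by
          gcongr with t
          rw [integral_const_mul, integral_add (integrable_const _) (hintegrable t)]
          have := hmom t
          simp only [integral_const, probReal_univ, one_smul]
          gcongr
      _ ≤ 2 * cb * (1 + C) := by
          rw [← Finset.sum_mul]
          have := hg k
          gcongr
  have hterm : ∀ k, Integrable (fun ω => cb ^ 3 * M ^ (-(p - 4)) / θ ^ 12
      * ∑ t, (|b k t| + |c k t|) * |X t ω| ^ p + 32 * θ ^ 4 * (1 + y k ^ 4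
        + cb ^ 3 * ∑ t, (|b k t| + |c k t|) * (1 + |X t ω| ^ p))) P := fun k =>
    ((hsum k).const_mul _).add
      (((integrable_const _).add ((hsum1 k).const_mul _)).const_mul _)
  rw [integral_finsetSum _ fun k _ => (hterm k).const_mul _]
  set A := 2 * cb ^ 4 * C * M ^ (-(p - 4)) / θ ^ 12 with hA
  have hA0 : 0 ≤ A := by positivity
  have hk : ∀ k, ∫ ω, h k * (cb ^ 3 * M ^ (-(p - 4)) / θ ^ 12
      * ∑ t, (|b k t| + |c k t|) * |X t ω| ^ p + 32 * θ ^ 4 * (1 + y k ^ 4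
        + cb ^ 3 * ∑ t, (|b k t| + |c k t|) * (1 + |X t ω| ^ p))) ∂P
      ≤ h k * (1 + y k ^ 4) * (A + 32 * θ ^ 4 * (1 + 2 * cb ^ 4 * (1 + C))) := by
    intro k
    rw [integral_const_mul, mul_assoc]
    refine mul_le_mul_of_nonneg_left ?_ (hh k)
    have j1 : Integrable (fun ω => 1 + y k ^ 4
        + cb ^ 3 * ∑ t, (|b k t| + |c k t|) * (1 + |X t ω| ^ p)) P :=
      (integrable_const _).add ((hsum1 k).const_mul _)
    rw [integral_add ((hsum k).const_mul _) (j1.const_mul _), integral_const_mul,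
      integral_const_mul, integral_add (integrable_const _) ((hsum1 k).const_mul _),
      integral_const_mul]
    simp only [integral_const, probReal_univ, one_smul]
    have a1 : cb ^ 3 * M ^ (-(p - 4)) / θ ^ 12
        * ∫ ω, ∑ t, (|b k t| + |c k t|) * |X t ω| ^ p ∂P ≤ A := by
      have : cb ^ 3 * M ^ (-(p - 4)) / θ ^ 12 * (2 * cb * C) = A := by rw [hA]; ring
      rw [← this]
      have := i1 k
      gcongr
    have a2 : cb ^ 3 * ∫ ω, ∑ t, (|b k t| + |c k t|) * (1 + |X t ω| ^ p) ∂P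
        ≤ 2 * cb ^ 4 * (1 + C) := by
      have : cb ^ 3 * (2 * cb * (1 + C)) = 2 * cb ^ 4 * (1 + C) := by ring
      rw [← this]
      have := i2 k
      gcongr
    have hy : 0 ≤ y k ^ 4 := by positivity
    have hD : 0 ≤ 2 * cb ^ 4 * (1 + C) := by positivity
    have hmain : 1 + y k ^ 4 + cb ^ 3 * ∫ ω, ∑ t, (|b k t| + |c k t|) * (1 + |X t ω| ^ p) ∂P
        ≤ (1 + y k ^ 4) * (1 + 2 * cb ^ 4 * (1 + C)) := by nlinarith [mul_nonneg hy hD]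
    calc _ ≤ A + 32 * θ ^ 4 * ((1 + y k ^ 4) * (1 + 2 * cb ^ 4 * (1 + C))) := by gcongr
      _ ≤ _ := by nlinarith [mul_nonneg hy hA0]
  refine (Finset.sum_le_sum fun k _ => hk k).trans ?_
  rw [← Finset.sum_mul, mul_comm]
  refine mul_le_mul_of_nonneg_left ?_ (by positivity)
  simp only [mul_add, mul_one, Finset.sum_add_distrib]
  linarith

/-- The influence of coordinate `t` is proportional to the weighted mass of the coefficients in
column `t`; the affine forms themselves are bounded because the variables are. -/
theorem abs_affineProdSq_update_sub_le (hh : ∀ k, 0 ≤ h k) (he : ∀ k, |e k| ≤ 1)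
    (hb : ∀ k, ∑ t, |b k t| ≤ cb) (hc : ∀ k, ∑ t, |c k t| ≤ cb) (hcb : 0 ≤ cb) {M : ℝ}
    (hM : 0 ≤ M) (t : Fin n) {x x' : Fin n → ℝ} (hx : ∀ s, |x s| ≤ M) (hx' : ∀ s, |x' s| ≤ M)
    (hne : ∀ s, s ≠ t → x s = x' s) :
    |affineProdSq h e y b c x - affineProdSq h e y b c x'|
      ≤ 8 * M * (1 + cb * M) ^ 3 * ∑ k, h k * (|b k t| + |c k t|) * (1 + y k ^ 2) := by
  have hlin : ∀ (β : Fin n → ℝ), ∑ s, |β s| ≤ cb → ∀ z : Fin n → ℝ, (∀ s, |z s| ≤ M) →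
      |∑ s, β s * z s| ≤ cb * M := by
    intro β hβ z hz
    refine (Finset.abs_sum_le_sum_abs _ _).trans ?_
    calc ∑ s, |β s * z s| ≤ ∑ s, |β s| * M := by
          gcongr with s
          rw [abs_mul]
          have := hz s
          gcongr
      _ ≤ cb * M := by rw [← Finset.sum_mul]; gcongr
  have hdiff : ∀ (β : Fin n → ℝ) (a : ℝ),
      |a + ∑ s, β s * x s - (a + ∑ s, β s * x' s)| ≤ |β t| * (2 * M) := by
    intro β a
    have e1 : a + ∑ s, β s * x s - (a + ∑ s, β s * x' s) = β t * (x t - x' t) := by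
      rw [add_sub_add_left_eq_sub, ← Finset.sum_sub_distrib]
      rw [Finset.sum_eq_single t]
      · ring
      · intro s _ hs; rw [hne s hs]; ring
      · simp
    rw [e1, abs_mul]
    gcongr
    exact (abs_sub _ _).trans (by linarith [hx t, hx' t])
  unfold affineProdSq
  rw [← Finset.sum_sub_distrib, Finset.mul_sum]
  refine (Finset.abs_sum_le_sum_abs _ _).trans ?_
  gcongr with k
  rw [← mul_sub, abs_mul, abs_of_nonneg (hh k)]
  have hre : 8 * M * (1 + cb * M) ^ 3 * (h k * (|b k t| + |c k t|) * (1 + y k ^ 2))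
      = h k * (8 * M * (1 + cb * M) ^ 3 * (|b k t| + |c k t|) * (1 + y k ^ 2)) := by ring
  rw [hre]
  refine mul_le_mul_of_nonneg_left ?_ (hh k)
  refine (abs_sq_mul_sq_sub_le _ _ _ _).trans ?_
  set A := 1 + cb * M with hA
  have hA1 : 1 ≤ A := by rw [hA]; nlinarith [mul_nonneg hcb hM]
  have hP : ∀ z : Fin n → ℝ, (∀ s, |z s| ≤ M) → |e k + ∑ s, b k s * z s| ≤ A := by
    intro z hz
    refine (abs_add_le _ _).trans ?_
    linarith [he k, hlin _ (hb k) z hz]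
  have hQ : ∀ z : Fin n → ℝ, (∀ s, |z s| ≤ M) → |y k + ∑ s, c k s * z s| ≤ A * (1 + |y k|) := by
    intro z hz
    refine (abs_add_le _ _).trans ?_
    have := hlin _ (hc k) z hz
    nlinarith [abs_nonneg (y k)]
  have hy1 : 1 ≤ 1 + |y k| := by linarith [abs_nonneg (y k)]
  have hAy : A ≤ A * (1 + |y k|) := le_mul_of_one_le_right (by linarith) hy1
  calc _ ≤ (|b k t| * (2 * M) * (A * (1 + |y k|)) + A * (1 + |y k|) * (|c k t| * (2 * M)))
        * (A * (A * (1 + |y k|)) + A * (A * (1 + |y k|))) := by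
        gcongr
        · exact hdiff _ _
        · exact hQ x hx
        · exact (hP x' hx').trans hAy
        · exact hdiff _ _
        · exact hP x hx
        · exact hQ x hx
        · exact hP x' hx'
        · exact hQ x' hx'
    _ = 4 * M * A ^ 3 * (|b k t| + |c k t|) * (1 + |y k|) ^ 2 := by ring
    _ ≤ 4 * M * A ^ 3 * (|b k t| + |c k t|) * (2 * (1 + y k ^ 2)) := by
        gcongr
        nlinarith [sq_nonneg (1 - |y k|), sq_abs (y k)]
    _ = _ := by ring

theorem integral_abs_le_sqrt {Ω : Type*} [MeasurableSpace Ω] {P : Measure Ω}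
    [IsProbabilityMeasure P] {g : Ω → ℝ} (hg : MemLp g 2 P) :
    ∫ ω, |g ω| ∂P ≤ √(∫ ω, g ω ^ 2 ∂P) := by
  refine Real.le_sqrt_of_sq_le ?_
  have h := variance_nonneg (fun ω => |g ω|) P
  rw [variance_eq_sub (X := fun ω => |g ω|) hg.norm] at h
  have e1 : P[(fun ω => |g ω|) ^ 2] = ∫ ω, g ω ^ 2 ∂P := by simp
  rw [e1] at h
  linarith

/-- Quantitative law of large numbers in `L¹`. Truncation costs `tol`; the truncated sum deviates
from its mean by its standard deviation, which the bounded-differences inequality bounds by a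
multiple of `√hmax`. The constant depends only on `cb`, `p`, `C` and `tol`, so it can be used under
every conditional distribution and for every `S`. -/
theorem exists_integral_abs_sub_affineProdSq_le {cb p C tol : ℝ} (hp : 4 < p) (hC : 0 ≤ C)
    (hcb : 0 ≤ cb) (htol : 0 < tol) :
    ∃ K : ℝ, 0 ≤ K ∧ ∀ {Ω : Type*} [MeasurableSpace Ω] (P : Measure Ω) [IsProbabilityMeasure P]
      {n : ℕ} {X : Fin n → Ω → ℝ} {ι : Type} [Fintype ι] {h e y : ι → ℝ} {b c : ι → Fin n → ℝ}
      {hmax : ℝ}, 0 ≤ hmax → (∀ t, Measurable (X t)) → iIndepFun X P →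
      (∀ t, Integrable (fun ω => |X t ω| ^ p) P) → (∀ t, ∫ ω, |X t ω| ^ p ∂P ≤ C) →
      (∀ k, 0 ≤ h k) → ∑ k, h k ≤ 1 → (∀ k, |e k| ≤ 1) →
      (∀ k, ∑ t, |b k t| ≤ cb) → (∀ k, ∑ t, |c k t| ≤ cb) →
      (∀ t, ∑ k, h k * (|b k t| + |c k t|) ≤ cb * hmax) →
      Integrable (fun ω => affineProdSq h e y b c fun t => X t ω) P ∧
      ∫ ω, |affineProdSq h e y b c (fun t => X t ω)
          - ∫ ω', affineProdSq h e y b c (fun t => X t ω') ∂P| ∂P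
        ≤ (tol + K * √hmax) * (1 + ∑ k, h k * y k ^ 4) := by
  -- The order matters: `θ` is fixed before `M`, since the truncation term is divided by `θ ^ 12`.
  obtain ⟨θ, hθ, hθle⟩ : ∃ θ : ℝ, 0 < θ ∧ 32 * θ ^ 4 * (1 + 2 * cb ^ 4 * (1 + C)) ≤ tol / 4 := by
    have hT : Tendsto (fun θ : ℝ => 32 * θ ^ 4 * (1 + 2 * cb ^ 4 * (1 + C))) (𝓝[>] 0) (𝓝 0) := by
      have : Tendsto (fun θ : ℝ => 32 * θ ^ 4 * (1 + 2 * cb ^ 4 * (1 + C))) (𝓝 0)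
          (𝓝 (32 * (0 : ℝ) ^ 4 * (1 + 2 * cb ^ 4 * (1 + C)))) :=
        Continuous.tendsto (by fun_prop) 0
      simpa using this.mono_left nhdsWithin_le_nhds
    obtain ⟨θ, h1, h2⟩ := ((hT.eventually (gt_mem_nhds (by positivity : 0 < tol / 4))).and
      self_mem_nhdsWithin).exists
    exact ⟨θ, h2, h1.le⟩
  obtain ⟨M, hM, hMle⟩ : ∃ M : ℝ, 0 < M ∧ 2 * cb ^ 4 * C * M ^ (-(p - 4)) / θ ^ 12 ≤ tol / 4 := by
    have hT : Tendsto (fun M : ℝ => 2 * cb ^ 4 * C * M ^ (-(p - 4)) / θ ^ 12) atTop (𝓝 0) := by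
      have := ((tendsto_rpow_neg_atTop (by linarith : 0 < p - 4)).const_mul
        (2 * cb ^ 4 * C)).div_const (θ ^ 12)
      simpa using this
    obtain ⟨M, h1, h2⟩ := ((hT.eventually (gt_mem_nhds (by positivity : 0 < tol / 4))).and
      (eventually_gt_atTop 0)).exists
    exact ⟨M, h2, h1.le⟩
  set Kd := 8 * M * (1 + cb * M) ^ 3 with hKd
  have hKd0 : 0 ≤ Kd := by positivity
  refine ⟨2 * cb * Kd, by positivity, ?_⟩
  intro Ω _ P _ n X ι _ h e y b c hmax hhm hX hind hintegrable hmom hh hh1 he hb hc hcol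
  obtain ⟨hdi, hdle⟩ := integral_abs_affineProdSq_sub_clip_le (y := y) hX hintegrable hmom hC hcb hh hh1 he
    hb hc hM hp.le hθ
  set Y : ℝ := 1 + ∑ k, h k * y k ^ 4 with hY
  have hY1 : 1 ≤ Y := by
    have : 0 ≤ ∑ k, h k * y k ^ 4 :=
      Finset.sum_nonneg fun k _ => mul_nonneg (hh k) (by positivity)
    linarith
  set f := affineProdSq h e y b c with hf
  have hfm : Measurable f := measurable_affineProdSq _ _ _ _ _
  set g : (Fin n → ℝ) → ℝ := fun x => f fun t => clip M (x t) with hg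
  have hgm : Measurable g :=
    hfm.comp (measurable_pi_lambda _ fun t => (measurable_clip M).comp (measurable_pi_apply t))
  set d : Fin n → ℝ := fun t => Kd * ∑ k, h k * (|b k t| + |c k t|) * (1 + y k ^ 2) with hd
  have hgd : ∀ t x a a', |g (Function.update x t a) - g (Function.update x t a')| ≤ d t := by
    intro t x a a'
    refine abs_affineProdSq_update_sub_le hh he hb hc hcb hM.le t (fun s => abs_clip_le hM.le _)
      (fun s => abs_clip_le hM.le _) fun s hs => ?_
    simp [Function.update_of_ne hs]
  have hgC : ∃ B, ∀ x, |g x| ≤ B := by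
    refine ⟨∑ k, h k * ((1 + ∑ t, |b k t| * M) ^ 2 * (|y k| + ∑ t, |c k t| * M) ^ 2), fun x => ?_⟩
    have hl : ∀ (β : Fin n → ℝ) (a a' : ℝ), |a| ≤ a' →
        |a + ∑ t, β t * clip M (x t)| ≤ a' + ∑ t, |β t| * M := by
      intro β a a' ha
      refine (abs_add_le _ _).trans (add_le_add ha ?_)
      refine (Finset.abs_sum_le_sum_abs _ _).trans ?_
      gcongr with t
      rw [abs_mul]
      have := abs_clip_le hM.le (x t)
      gcongr
    refine (Finset.abs_sum_le_sum_abs _ _).trans ?_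
    gcongr with k
    rw [abs_mul, abs_of_nonneg (hh k), abs_mul, abs_pow, abs_pow]
    have h1 := hl (b k) (e k) 1 (he k)
    have h2 := hl (c k) (y k) _ le_rfl
    have := hh k
    gcongr
  obtain ⟨B, hB⟩ := hgC
  have hvar := variance_le_of_bounded_differences hX hind hgm hB hgd
  have hXm : Measurable fun ω t => X t ω := measurable_pi_lambda _ hX
  have hgXm : Measurable fun ω => g fun t => X t ω := hgm.comp hXm
  have hgi : Integrable (fun ω => g fun t => X t ω) P :=
    Integrable.of_bound hgXm.aestronglyMeasurable B (Eventually.of_forall fun ω => hB _)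
  have hfi : Integrable (fun ω => f fun t => X t ω) P := by
    have := hdi.add hgi
    refine this.congr (Eventually.of_forall fun ω => ?_)
    simp [hg]
  refine ⟨hfi, ?_⟩
  -- Cauchy–Schwarz in `d t` extracts one column sum, which is at most `cb * hmax`; summing what is
  -- left over `t` uses row sums, at most `2 * cb`.
  have hsq : ∑ t, d t ^ 2 ≤ (2 * cb * Kd * Y) ^ 2 * hmax := by
    have h1 : ∀ t, d t ^ 2 ≤ Kd ^ 2 * (cb * hmax *
        ∑ k, h k * (|b k t| + |c k t|) * (1 + y k ^ 2) ^ 2) := by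
      intro t
      rw [hd, mul_pow]
      gcongr
      refine (sq_sum_mul_le Finset.univ (w := fun k => h k * (|b k t| + |c k t|))
        (fun k _ => mul_nonneg (hh k) (by positivity)) fun k => 1 + y k ^ 2).trans ?_
      refine mul_le_mul_of_nonneg_right (hcol t) ?_
      exact Finset.sum_nonneg fun k _ =>
        mul_nonneg (mul_nonneg (hh k) (by positivity)) (by positivity)
    have hcm : 0 ≤ cb * hmax := by positivity
    have h2 : ∑ t, ∑ k, h k * (|b k t| + |c k t|) * (1 + y k ^ 2) ^ 2 ≤ 2 * cb * (2 * Y) := by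
      rw [Finset.sum_comm]
      have h3 : ∀ k, ∑ t, h k * (|b k t| + |c k t|) * (1 + y k ^ 2) ^ 2
          ≤ 2 * cb * (2 * (h k * (1 + y k ^ 4))) := by
        intro k
        rw [← Finset.sum_mul, ← Finset.mul_sum, Finset.sum_add_distrib]
        have h4 : (1 + y k ^ 2) ^ 2 ≤ 2 * (1 + y k ^ 4) := by nlinarith [sq_nonneg (1 - y k ^ 2)]
        have h5 : ∑ t, |b k t| + ∑ t, |c k t| ≤ 2 * cb := by linarith [hb k, hc k]
        have := hh k
        calc _ ≤ h k * (2 * cb) * (2 * (1 + y k ^ 4)) := by gcongr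
          _ = _ := by ring
      refine (Finset.sum_le_sum fun k _ => h3 k).trans ?_
      rw [← Finset.mul_sum, ← Finset.mul_sum]
      gcongr
      simp only [mul_add, mul_one, Finset.sum_add_distrib]
      rw [hY]
      linarith
    calc ∑ t, d t ^ 2 ≤ ∑ t, Kd ^ 2 * (cb * hmax *
          ∑ k, h k * (|b k t| + |c k t|) * (1 + y k ^ 2) ^ 2) :=
          Finset.sum_le_sum fun t _ => h1 t
      _ = Kd ^ 2 * (cb * hmax * ∑ t, ∑ k, h k * (|b k t| + |c k t|) * (1 + y k ^ 2) ^ 2) := by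
          rw [Finset.mul_sum, Finset.mul_sum]
      _ ≤ Kd ^ 2 * (cb * hmax * (2 * cb * (2 * Y))) := by gcongr
      _ = (2 * cb * Kd) ^ 2 * hmax * Y := by ring
      _ ≤ (2 * cb * Kd * Y) ^ 2 * hmax := by
          have h6 : 0 ≤ (2 * cb * Kd) ^ 2 * hmax := by
            have : (2 * cb * Kd) ^ 2 * hmax = 4 * cb * Kd ^ 2 * (cb * hmax) := by ring
            rw [this]; positivity
          nlinarith [mul_nonneg h6 (by nlinarith : 0 ≤ Y ^ 2 - Y)]
  have hgl2 : MemLp (fun ω => g (fun t => X t ω) - ∫ ω', g (fun t => X t ω') ∂P) 2 P := by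
    refine MemLp.of_bound (hgXm.sub_const _).aestronglyMeasurable
      (B + |∫ ω', g (fun t => X t ω') ∂P|) (Eventually.of_forall fun ω => ?_)
    refine (norm_sub_le _ _).trans ?_
    have := hB fun t => X t ω
    simp only [Real.norm_eq_abs]
    gcongr
  have hL1 : ∫ ω, |g (fun t => X t ω) - ∫ ω', g (fun t => X t ω') ∂P| ∂P
      ≤ 2 * cb * Kd * √hmax * Y := by
    refine (integral_abs_le_sqrt hgl2).trans ((Real.sqrt_le_sqrt (hvar.trans hsq)).trans ?_)
    rw [Real.sqrt_mul (by positivity), Real.sqrt_sq (by positivity)]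
    exact le_of_eq (by ring)
  set E := ∫ ω, |f (fun t => X t ω) - g (fun t => X t ω)| ∂P with hE
  have hEle : E ≤ tol / 2 * Y := by
    refine hdle.trans ?_
    gcongr
    linarith
  have hdi' : Integrable (fun ω => f (fun t => X t ω) - g (fun t => X t ω)) P := hdi
  have hmeandiff : |∫ ω, g (fun t => X t ω) ∂P - ∫ ω, f (fun t => X t ω) ∂P| ≤ E := by
    rw [abs_sub_comm, ← integral_sub hfi hgi]
    exact abs_integral_le_integral_abs
  have hgc : Integrable (fun ω => g (fun t => X t ω) - ∫ ω', g (fun t => X t ω') ∂P) P :=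
    hgi.sub (integrable_const _)
  calc ∫ ω, |f (fun t => X t ω) - ∫ ω', f (fun t => X t ω') ∂P| ∂P
      ≤ ∫ ω, (|f (fun t => X t ω) - g (fun t => X t ω)|
          + |g (fun t => X t ω) - ∫ ω', g (fun t => X t ω') ∂P| + E) ∂P := by
        refine integral_mono (hfi.sub (integrable_const _)).abs
          ((hdi'.abs.add hgc.abs).add (integrable_const _)) fun ω => ?_
        have e1 : f (fun t => X t ω) - ∫ ω', f (fun t => X t ω') ∂P
            = (f (fun t => X t ω) - g (fun t => X t ω))
              + (g (fun t => X t ω) - ∫ ω', g (fun t => X t ω') ∂P)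
              + (∫ ω', g (fun t => X t ω') ∂P - ∫ ω', f (fun t => X t ω') ∂P) := by ring
        simp only
        rw [e1]
        refine (abs_add_le _ _).trans (add_le_add (abs_add_le _ _) hmeandiff)
    _ = E + ∫ ω, |g (fun t => X t ω) - ∫ ω', g (fun t => X t ω') ∂P| ∂P + E := by
        have j : Integrable (fun ω => |f (fun t => X t ω) - g (fun t => X t ω)|
            + |g (fun t => X t ω) - ∫ ω', g (fun t => X t ω') ∂P|) P := hdi'.abs.add hgc.abs
        rw [integral_add j (integrable_const _), integral_add hdi'.abs hgc.abs]
        simp [hE]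
    _ ≤ tol / 2 * Y + 2 * cb * Kd * √hmax * Y + tol / 2 * Y := by gcongr
    _ = (tol + 2 * cb * Kd * √hmax) * Y := by ring

end LLN

/-! ### Diagonal arguments, share-weighted sums and the conditional law of large numbers -/

section WhpTools

variable {Ω : ℕ → Type*} {m : ∀ S, MeasurableSpace (Ω S)} [mΩ : ∀ S, MeasurableSpace (Ω S)]
  {μ : ∀ S, Measure (Ω S)} [∀ S, IsProbabilityMeasure (μ S)]

/-- If `|H| ≤ (τ + K_τ a) A` for arbitrarily small `τ`, where `a` tends to zero in probability and
`A` is bounded in probability, then `H` tends to zero in probability. -/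
theorem tendsto_zero_of_forall_le {K : ℕ → ℝ} (hK : ∀ k, 0 ≤ K k) {H a A : (Σ S, Ω S) → ℝ}
    (ha : Tendsto a (whp μ) (𝓝 0)) (hA : IsBoundedOp μ A) (hA0 : ∀ᶠ x in whp μ, 0 ≤ A x)
    (h : ∀ᶠ x in whp μ, ∀ k : ℕ, |H x| ≤ (1 / ((k : ℝ) + 1) + K k * a x) * A x) :
    Tendsto H (whp μ) (𝓝 0) := by
  obtain ⟨c, hc, hc0, hac⟩ := exists_deterministic_bound ha
  -- Optimising over `k` for each `S` gives one deterministic null sequence, against which `A` is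
  -- bounded in probability.
  set t : ℕ → ℝ := fun S => ⨅ k : ℕ, (1 / ((k : ℝ) + 1) + K k * c S) with ht
  have hterm0 : ∀ S (k : ℕ), 0 ≤ 1 / ((k : ℝ) + 1) + K k * c S := fun S k =>
    add_nonneg (by positivity) (mul_nonneg (hK k) (hc0 S))
  have hbdd : ∀ S, BddBelow (Set.range fun k : ℕ => 1 / ((k : ℝ) + 1) + K k * c S) := fun S =>
    ⟨0, by rintro _ ⟨k, rfl⟩; exact hterm0 S k⟩
  have ht0 : ∀ S, 0 ≤ t S := fun S => le_ciInf (hterm0 S)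
  have htt : Tendsto t atTop (𝓝 0) := by
    rw [Metric.tendsto_nhds]
    intro ε hε
    obtain ⟨k, hk⟩ := exists_nat_one_div_lt (half_pos hε)
    have h1 : Tendsto (fun S => K k * c S) atTop (𝓝 0) := by simpa using hc.const_mul (K k)
    filter_upwards [h1.eventually (gt_mem_nhds (half_pos hε))] with S hS
    rw [Real.dist_eq, sub_zero, abs_of_nonneg (ht0 S)]
    exact (ciInf_le (hbdd S) k).trans_lt (by linarith)
  refine squeeze_zero_norm' ?_ (hA t htt)
  filter_upwards [h, hac, hA0] with x h1 h2 h3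
  rw [Real.norm_eq_abs, ht, Real.iInf_mul_of_nonneg h3]
  refine le_ciInf fun k => (h1 k).trans ?_
  have := (le_abs_self _).trans h2
  have := hK k
  gcongr

variable [∀ S, StandardBorelSpace (Ω S)]

/-- The weights are constant under the conditional distribution, so a common bound on the
conditional means passes to the weighted mean. -/
theorem lintegral_weighted_sum_le {Ω : Type*} {m : MeasurableSpace Ω} [MeasurableSpace Ω]
    [StandardBorelSpace Ω] {μ : Measure Ω} [IsProbabilityMeasure μ]
    {ι : Type*} [Fintype ι] {g v : Ω → ι → ℝ} {H : Ω → ℝ}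
    (hv : ∀ i, Measurable fun ω => v ω i)
    (hg0 : ∀ᵐ ω ∂μ, ∀ i, 0 ≤ g ω i) (hg1 : ∀ᵐ ω ∂μ, ∑ i, g ω i ≤ 1)
    (hgc : ∀ᵐ ω ∂μ, ∀ᵐ ω' ∂condExpKernel μ m ω, g ω' = g ω)
    (hv0 : ∀ ω i, 0 ≤ v ω i)
    (hvH : ∀ i, ∀ᵐ ω ∂μ, ∫⁻ ω', ENNReal.ofReal (v ω' i) ∂condExpKernel μ m ω
      ≤ ENNReal.ofReal (H ω)) :
    ∀ᵐ ω ∂μ, ∫⁻ ω', ENNReal.ofReal |∑ i, g ω' i * v ω' i| ∂condExpKernel μ m ω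
      ≤ ENNReal.ofReal (H ω) := by
  filter_upwards [hg0, hg1, hgc, ae_all_iff.2 hvH] with ω h0 h1 hc hH
  have e1 : ∫⁻ ω', ENNReal.ofReal |∑ i, g ω' i * v ω' i| ∂condExpKernel μ m ω
      = ∫⁻ ω', ∑ i, ENNReal.ofReal (g ω i) * ENNReal.ofReal (v ω' i) ∂condExpKernel μ m ω := by
    refine lintegral_congr_ae ?_
    filter_upwards [hc] with ω' hω'
    rw [hω', abs_of_nonneg (Finset.sum_nonneg fun i _ => mul_nonneg (h0 i) (hv0 _ _)),
      ENNReal.ofReal_sum_of_nonneg fun i _ => mul_nonneg (h0 i) (hv0 _ _)]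
    exact Finset.sum_congr rfl fun i _ => ENNReal.ofReal_mul (h0 i)
  rw [e1, lintegral_finsetSum _ fun i _ => (hv i).ennreal_ofReal.const_mul _]
  calc ∑ i, ∫⁻ ω', ENNReal.ofReal (g ω i) * ENNReal.ofReal (v ω' i) ∂condExpKernel μ m ω
      ≤ ∑ i, ENNReal.ofReal (g ω i) * ENNReal.ofReal (H ω) := by
        gcongr with i
        rw [lintegral_const_mul _ (hv i).ennreal_ofReal]
        gcongr
        exact hH i
    _ = ENNReal.ofReal (∑ i, g ω i) * ENNReal.ofReal (H ω) := by
        rw [← Finset.sum_mul, ENNReal.ofReal_sum_of_nonneg fun i _ => h0 i]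
    _ ≤ 1 * ENNReal.ofReal (H ω) := by
        gcongr
        exact ENNReal.ofReal_le_one.2 h1
    _ = ENNReal.ofReal (H ω) := one_mul _

variable {ι : ℕ → Type} [∀ S, Fintype (ι S)]

theorem isBoundedOp_weighted_sum (hm : ∀ S, m S ≤ mΩ S) {g v : ∀ S, Ω S → ι S → ℝ}
    {H : (Σ S, Ω S) → ℝ}
    (hgm : ∀ S i, Measurable fun ω => g S ω i) (hv : ∀ S i, Measurable fun ω => v S ω i)
    (hg0 : ∀ S, ∀ᵐ ω ∂μ S, ∀ i, 0 ≤ g S ω i) (hg1 : ∀ S, ∀ᵐ ω ∂μ S, ∑ i, g S ω i ≤ 1)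
    (hgc : ∀ S, ∀ᵐ ω ∂μ S, ∀ᵐ ω' ∂condExpKernel (μ S) (m S) ω, g S ω' = g S ω)
    (hv0 : ∀ S ω i, 0 ≤ v S ω i)
    (hvH : ∀ S i, ∀ᵐ ω ∂μ S, ∫⁻ ω', ENNReal.ofReal (v S ω' i) ∂condExpKernel (μ S) (m S) ω
      ≤ ENNReal.ofReal (H ⟨S, ω⟩)) (hH : IsBoundedOp μ H) :
    IsBoundedOp μ fun x => ∑ i, g x.1 x.2 i * v x.1 x.2 i := by
  refine isBoundedOp_of_condExpKernel hm (H := H) (fun S => ?_) (Eventually.of_forall fun S => ?_) hH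
  · change Measurable fun ω => ∑ i, g S ω i * v S ω i
    exact Finset.measurable_fun_sum _ fun i _ => (hgm S i).mul (hv S i)
  · exact lintegral_weighted_sum_le (g := g S) (v := v S) (H := fun ω => H ⟨S, ω⟩) (hv S) (hg0 S)
      (hg1 S) (hgc S) (hv0 S) (hvH S)

theorem tendsto_zero_weighted_sum (hm : ∀ S, m S ≤ mΩ S) {g v : ∀ S, Ω S → ι S → ℝ}
    {H : (Σ S, Ω S) → ℝ}
    (hgm : ∀ S i, Measurable fun ω => g S ω i) (hv : ∀ S i, Measurable fun ω => v S ω i)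
    (hg0 : ∀ S, ∀ᵐ ω ∂μ S, ∀ i, 0 ≤ g S ω i) (hg1 : ∀ S, ∀ᵐ ω ∂μ S, ∑ i, g S ω i ≤ 1)
    (hgc : ∀ S, ∀ᵐ ω ∂μ S, ∀ᵐ ω' ∂condExpKernel (μ S) (m S) ω, g S ω' = g S ω)
    (hv0 : ∀ S ω i, 0 ≤ v S ω i)
    (hvH : ∀ S i, ∀ᵐ ω ∂μ S, ∫⁻ ω', ENNReal.ofReal (v S ω' i) ∂condExpKernel (μ S) (m S) ω
      ≤ ENNReal.ofReal (H ⟨S, ω⟩)) (hH : Tendsto H (whp μ) (𝓝 0)) :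
    Tendsto (fun x => ∑ i, g x.1 x.2 i * v x.1 x.2 i) (whp μ) (𝓝 0) := by
  refine tendsto_zero_of_condExpKernel hm (H := H) (fun S => ?_) (Eventually.of_forall fun S => ?_) hH
  · change Measurable fun ω => ∑ i, g S ω i * v S ω i
    exact Finset.measurable_fun_sum _ fun i _ => (hgm S i).mul (hv S i)
  · exact lintegral_weighted_sum_le (g := g S) (v := v S) (H := fun ω => H ⟨S, ω⟩) (hv S) (hg0 S)
      (hg1 S) (hgc S) (hv0 S) (hvH S)

/-- Law of large numbers, conditional on `m`: coefficients are fixed by `m`, the variables `X` are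
independent given `m`. -/
theorem tendsto_affineProdSq_sub_condExp (hm : ∀ S, m S ≤ mΩ S) {X : ∀ S, Ω S → Fin S → ℝ}
    (hX : ∀ S t, Measurable fun ω => X S ω t) {p C cb : ℝ} (hp : 4 < p) (hC : 0 ≤ C)
    (hcb : 0 ≤ cb)
    (hind : ∀ S, ∀ᵐ ω ∂μ S, iIndepFun (fun t ω' => X S ω' t) (condExpKernel (μ S) (m S) ω))
    (hintegrable : ∀ S, ∀ᵐ ω ∂μ S, ∀ t,
      Integrable (fun ω' => |X S ω' t| ^ p) (condExpKernel (μ S) (m S) ω))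
    (hmom : ∀ S, ∀ᵐ ω ∂μ S, ∀ t, ∫ ω', |X S ω' t| ^ p ∂condExpKernel (μ S) (m S) ω ≤ C)
    {h e y : ∀ S, Ω S → ι S → ℝ} {b c : ∀ S, Ω S → ι S → Fin S → ℝ} {hmax : (Σ S, Ω S) → ℝ}
    (hmeas : ∀ S, Measurable fun ω =>
      affineProdSq (h S ω) (e S ω) (y S ω) (b S ω) (c S ω) (X S ω))
    (hconst : ∀ S, ∀ᵐ ω ∂μ S, ∀ᵐ ω' ∂condExpKernel (μ S) (m S) ω,
      h S ω' = h S ω ∧ e S ω' = e S ω ∧ y S ω' = y S ω ∧ b S ω' = b S ω ∧ c S ω' = c S ω)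
    (hhm : ∀ x, 0 ≤ hmax x) (hh : ∀ S, ∀ᵐ ω ∂μ S, ∀ k, 0 ≤ h S ω k)
    (hh1 : ∀ S, ∀ᵐ ω ∂μ S, ∑ k, h S ω k ≤ 1) (he : ∀ S, ∀ᵐ ω ∂μ S, ∀ k, |e S ω k| ≤ 1)
    (hb : ∀ S, ∀ᵐ ω ∂μ S, ∀ k, ∑ t, |b S ω k t| ≤ cb)
    (hc : ∀ S, ∀ᵐ ω ∂μ S, ∀ k, ∑ t, |c S ω k t| ≤ cb)
    (hcol : ∀ S, ∀ᵐ ω ∂μ S, ∀ t,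
      ∑ k, h S ω k * (|b S ω k t| + |c S ω k t|) ≤ cb * hmax ⟨S, ω⟩)
    (hmax0 : Tendsto hmax (whp μ) (𝓝 0))
    (hY : IsBoundedOp μ fun x => ∑ k, h x.1 x.2 k * y x.1 x.2 k ^ 4) :
    Tendsto (fun x : Σ S, Ω S =>
      affineProdSq (h x.1 x.2) (e x.1 x.2) (y x.1 x.2) (b x.1 x.2) (c x.1 x.2) (X x.1 x.2)
      - ∫ ω', affineProdSq (h x.1 ω') (e x.1 ω') (y x.1 ω') (b x.1 ω') (c x.1 ω') (X x.1 ω')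
          ∂condExpKernel (μ x.1) (m x.1) x.2) (whp μ) (𝓝 0) := by
  -- One constant for each tolerance `1 / (k + 1)`; `tendsto_zero_of_forall_le` then lets the
  -- tolerance go to zero along with `hmax`.
  have hK := fun k : ℕ => exists_integral_abs_sub_affineProdSq_le (tol := 1 / ((k : ℝ) + 1))
    hp hC hcb (by positivity)
  choose K hK0 hKbound using hK
  set F : ∀ S, Ω S → ℝ := fun S ω =>
    affineProdSq (h S ω) (e S ω) (y S ω) (b S ω) (c S ω) (X S ω) with hF
  set Hf : (Σ S, Ω S) → ℝ := fun x =>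
    ∫ ω', |F x.1 ω' - ∫ ω'', F x.1 ω'' ∂condExpKernel (μ x.1) (m x.1) x.2|
      ∂condExpKernel (μ x.1) (m x.1) x.2 with hHf
  have hIm : ∀ S, Measurable[m S] fun ω => ∫ ω'', F S ω'' ∂condExpKernel (μ S) (m S) ω := fun S =>
    (StronglyMeasurable.integral_condExpKernel (hmeas S).stronglyMeasurable).measurable
  have hbound : ∀ S, ∀ᵐ ω ∂μ S, Integrable (F S) (condExpKernel (μ S) (m S) ω) ∧
      ∀ k : ℕ, Hf ⟨S, ω⟩ ≤ (1 / ((k : ℝ) + 1) + K k * √(hmax ⟨S, ω⟩))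
        * (1 + ∑ k, h S ω k * y S ω k ^ 4) := by
    intro S
    filter_upwards [hind S, hintegrable S, hmom S, hconst S, hh S, hh1 S, he S, hb S, hc S, hcol S]
      with ω h1 h2 h3 h4 h5 h6 h7 h8 h9 h10
    have hFeq : F S =ᵐ[condExpKernel (μ S) (m S) ω] fun ω' =>
        affineProdSq (h S ω) (e S ω) (y S ω) (b S ω) (c S ω) fun t => X S ω' t := by
      filter_upwards [h4] with ω' hω'
      obtain ⟨a1, a2, a3, a4, a5⟩ := hω'
      simp only [hF, a1, a2, a3, a4, a5]
    have hk := fun k => hKbound k (condExpKernel (μ S) (m S) ω) (y := y S ω) (hhm ⟨S, ω⟩)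
      (fun t => hX S t) h1 h2 h3 h5 h6 h7 h8 h9 h10
    refine ⟨(hk 0).1.congr hFeq.symm, fun k => ?_⟩
    refine le_trans (le_of_eq ?_) (hk k).2
    rw [hHf]
    simp only
    rw [integral_congr_ae hFeq]
    refine integral_congr_ae ?_
    filter_upwards [hFeq] with ω' hω'
    rw [hω']
  refine tendsto_zero_of_condExpKernel hm (H := Hf) (fun S => ?_)
    (Eventually.of_forall fun S => ?_) ?_
  · exact (hmeas S).sub ((hIm S).mono (hm S) le_rfl)
  · filter_upwards [hbound S, ae_condExpKernel_eq (μ := μ S) (hm S) (hIm S)] with ω h1 h2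
    have hi : Integrable (fun ω' => F S ω' - ∫ ω'', F S ω'' ∂condExpKernel (μ S) (m S) ω)
      (condExpKernel (μ S) (m S) ω) := h1.1.sub (integrable_const _)
    rw [hHf]
    simp only
    rw [ofReal_integral_eq_lintegral_ofReal hi.abs (Eventually.of_forall fun _ => abs_nonneg _)]
    refine le_of_eq (lintegral_congr_ae ?_)
    filter_upwards [h2] with ω' hω'
    rw [← hω']
  · refine tendsto_zero_of_forall_le hK0 (a := fun x => √(hmax x))
      (A := fun x => 1 + ∑ k, h x.1 x.2 k * y x.1 x.2 k ^ 4) ?_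
      ((IsBoundedOp.const 1).add hY) ?_ ?_
    · simpa using hmax0.sqrt
    · refine eventually_whp_of_ae fun S => ?_
      filter_upwards [hh S] with ω hω
      exact add_nonneg zero_le_one
        (Finset.sum_nonneg fun k _ => mul_nonneg (hω k) (by positivity))
    · refine eventually_whp_of_ae fun S => ?_
      filter_upwards [hbound S] with ω hω k
      rw [abs_of_nonneg (integral_nonneg fun _ => abs_nonneg _)]
      exact hω.2 k

end WhpTools

/-! ### Decomposition of the residuals of a shift-share design -/

section Moments

variable {Ω : Type*} [MeasurableSpace Ω] {p C : ℝ}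

theorem integrable_abs_of_rpow (hp : 4 < p) {P : Measure Ω} [IsProbabilityMeasure P]
    {X : Ω → ℝ} (hX : Measurable X) (h : Integrable (fun ω => |X ω| ^ p) P) :
    Integrable X P := by
  refine Integrable.mono' ((integrable_const 1).add h) hX.aestronglyMeasurable
    (Eventually.of_forall fun ω => ?_)
  simp only [Real.norm_eq_abs, Pi.add_apply]
  rcases le_or_gt 1 |X ω| with h1 | h1
  · have := Real.rpow_le_rpow_of_exponent_le h1 (by linarith : (1 : ℝ) ≤ p)
    rw [Real.rpow_one] at this
    linarith
  · have : 0 ≤ |X ω| ^ p := by positivity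
    linarith

theorem abs_integral_le_of_rpow (hp : 4 < p) {P : Measure Ω} [IsProbabilityMeasure P]
    {X : Ω → ℝ} (h : Integrable (fun ω => |X ω| ^ p) P)
    (hC : ∫ ω, |X ω| ^ p ∂P ≤ C) : |∫ ω, X ω ∂P| ≤ 1 + C := by
  have h1 := norm_integral_le_of_norm_le (f := X) ((integrable_const 1).add h)
    (Eventually.of_forall fun ω => by
      simp only [Real.norm_eq_abs, Pi.add_apply]
      rcases le_or_gt 1 |X ω| with h1 | h1
      · have := Real.rpow_le_rpow_of_exponent_le h1 (by linarith : (1 : ℝ) ≤ p)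
        rw [Real.rpow_one] at this
        linarith
      · have : 0 ≤ |X ω| ^ p := by positivity
        linarith)
  rw [integral_add' (integrable_const _) h] at h1
  simp only [integral_const, probReal_univ, one_smul, Real.norm_eq_abs] at h1
  linarith

theorem abs_sub_rpow_le (hp : 4 < p) (a b : ℝ) :
    |a - b| ^ p ≤ 2 ^ p * (|a| ^ p + |b| ^ p) := by
  have h1 : |a - b| ≤ 2 * max |a| |b| := by
    refine (abs_sub a b).trans ?_
    linarith [le_max_left |a| |b|, le_max_right |a| |b|]
  have h2 : (max |a| |b|) ^ p ≤ |a| ^ p + |b| ^ p := by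
    have ha : 0 ≤ |a| ^ p := by positivity
    have hb : 0 ≤ |b| ^ p := by positivity
    rcases max_cases |a| |b| with ⟨h, _⟩ | ⟨h, _⟩ <;> rw [h] <;> linarith
  calc |a - b| ^ p ≤ (2 * max |a| |b|) ^ p :=
        Real.rpow_le_rpow (abs_nonneg _) h1 (by linarith)
    _ = 2 ^ p * (max |a| |b|) ^ p :=
        Real.mul_rpow (by norm_num) ((abs_nonneg a).trans (le_max_left _ _))
    _ ≤ _ := by gcongr

theorem lintegral_pow_four_le (hp : 4 < p) {P : Measure Ω} [IsProbabilityMeasure P]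
    {X : Ω → ℝ} (h : Integrable (fun ω => |X ω| ^ p) P)
    (hC : ∫ ω, |X ω| ^ p ∂P ≤ C) :
    ∫⁻ ω, ENNReal.ofReal (X ω ^ 4) ∂P ≤ ENNReal.ofReal (1 + C) := by
  have hi : Integrable (fun ω => 1 + |X ω| ^ p) P := (integrable_const _).add h
  calc ∫⁻ ω, ENNReal.ofReal (X ω ^ 4) ∂P ≤ ∫⁻ ω, ENNReal.ofReal (1 + |X ω| ^ p) ∂P := by
        refine lintegral_mono fun ω => ENNReal.ofReal_le_ofReal ?_
        exact pow_four_le_one_add_rpow hp.le _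
    _ = ENNReal.ofReal (∫ ω, (1 + |X ω| ^ p) ∂P) := by
        rw [ofReal_integral_eq_lintegral_ofReal hi]
        exact Eventually.of_forall fun ω => by positivity
    _ ≤ _ := by
        refine ENNReal.ofReal_le_ofReal ?_
        rw [integral_add (integrable_const _) h]
        simp only [integral_const, probReal_univ, one_smul]
        linarith

end Moments

namespace ShiftShareData

section Algebra

variable {Ω : Type*} [mΩ : MeasurableSpace Ω] {N S K : ℕ} (D : ShiftShareData Ω N S K)

/-- The shift-share aggregate `∑ₛ wᵢₛ 𝒳̃ₛ` of the recentred shifters. -/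
noncomputable def Xdot (γ : Fin K → ℝ) (ω : Ω) (i : Fin N) : ℝ :=
  ∑ s, D.w ω i s * D.Xtilde γ ω s

/-- The deviation `βᵢₛ - β`. -/
noncomputable def effectDev (μ : Measure Ω) (ω : Ω) (i : Fin N) (s : Fin S) : ℝ :=
  D.B ω i s - D.beta μ ω

/-- The part of the regression error that is determined by `ℱ₀`. -/
noncomputable def errorMean (μ : Measure Ω) (γ : Fin K → ℝ) (ω : Ω) (i : Fin N) : ℝ :=
  D.Y0 ω i + ∑ t, D.w ω i t * (D.effectDev μ ω i t * (D.Zs ω t ⬝ᵥ γ)) - D.Z ω i ⬝ᵥ D.delta μ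

/-- The aggregated linearization error `∑ᵢ wᵢₛ Lᵢ`. -/
noncomputable def Lagg (ω : Ω) (s : Fin S) : ℝ := ∑ i, D.w ω i s * D.L ω i

theorem X_apply (ω : Ω) (i : Fin N) : D.X ω i = ∑ s, D.w ω i s * D.Xs ω s := by
  simp [X, W, mulVec, dotProduct]

theorem Z_apply (ω : Ω) (i : Fin N) (k : Fin K) :
    D.Z ω i k = ∑ s, D.w ω i s * D.Zs ω s k + D.U ω i k := by
  simp [Z, W, Matrix.mul_apply]

theorem Xs_eq (γ : Fin K → ℝ) (ω : Ω) (s : Fin S) :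
    D.Xs ω s = D.Xtilde γ ω s + D.Zs ω s ⬝ᵥ γ := by simp [Xtilde]

theorem Z_dotProduct (ω : Ω) (i : Fin N) (v : Fin K → ℝ) :
    D.Z ω i ⬝ᵥ v = ∑ s, D.w ω i s * (D.Zs ω s ⬝ᵥ v) + D.U ω i ⬝ᵥ v := by
  simp only [dotProduct, Z_apply, add_mul, Finset.sum_add_distrib, Finset.sum_mul, Finset.mul_sum]
  rw [Finset.sum_comm]
  simp only [mul_assoc]

theorem X_eq (γ : Fin K → ℝ) (ω : Ω) (i : Fin N) :
    D.X ω i = D.Xdot γ ω i - D.Ugamma γ ω i + D.Z ω i ⬝ᵥ γ := by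
  rw [X_apply, Z_dotProduct, Xdot, Ugamma]
  simp only [D.Xs_eq γ, mul_add, Finset.sum_add_distrib]
  ring

/-- Splits the error into a part fixed by `ℱ₀`, a linear form in the independent recentred shifters,
and the linearization error. The limit arguments on errors use this form. -/
theorem eps_eq (μ : Measure Ω) (γ : Fin K → ℝ) (ω : Ω) (i : Fin N) :
    D.eps μ ω i = D.errorMean μ γ ω i
      + ∑ t, D.w ω i t * D.effectDev μ ω i t * D.Xtilde γ ω t + D.L ω i := by
  have h : ∀ t, D.w ω i t * D.Xs ω t * D.B ω i t = D.w ω i t * D.Xs ω t * D.beta μ ω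
      + (D.w ω i t * (D.effectDev μ ω i t * (D.Zs ω t ⬝ᵥ γ))
        + D.w ω i t * D.effectDev μ ω i t * D.Xtilde γ ω t) := by
    intro t
    rw [D.Xs_eq γ, effectDev]
    ring
  unfold eps residual Y errorMean
  simp only [h, Finset.sum_add_distrib, X_apply, ← Finset.sum_mul]
  ring

theorem R_eq (μ : Measure Ω) (γ : Fin K → ℝ) (ω : Ω) (s : Fin S) :
    D.R μ ω s = ∑ i, D.w ω i s * D.errorMean μ γ ω i
      + ∑ t, (∑ i, D.w ω i s * (D.w ω i t * D.effectDev μ ω i t)) * D.Xtilde γ ω t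
      + D.Lagg ω s := by
  have h : ∑ t, (∑ i, D.w ω i s * (D.w ω i t * D.effectDev μ ω i t)) * D.Xtilde γ ω t
      = ∑ i, D.w ω i s * ∑ t, D.w ω i t * D.effectDev μ ω i t * D.Xtilde γ ω t := by
    simp only [Finset.sum_mul, Finset.mul_sum]
    rw [Finset.sum_comm]
    simp only [mul_assoc]
  rw [h, R, Lagg, ← Finset.sum_add_distrib, ← Finset.sum_add_distrib]
  refine Finset.sum_congr rfl fun i _ => ?_
  rw [D.eps_eq μ γ]
  ring

/-- The score in terms of recentred shifters. -/
theorem score_eq (μ : Measure Ω) (γ : Fin K → ℝ) (ω : Ω) :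
    ∑ i, (D.X ω i - D.Z ω i ⬝ᵥ γ) * D.eps μ ω i
      = ∑ s, D.Xtilde γ ω s * D.R μ ω s - ∑ i, D.Ugamma γ ω i * D.eps μ ω i := by
  have h : ∑ s, D.Xtilde γ ω s * D.R μ ω s = ∑ i, D.Xdot γ ω i * D.eps μ ω i := by
    simp only [R, Xdot, Finset.sum_mul, Finset.mul_sum]
    rw [Finset.sum_comm]
    exact Finset.sum_congr rfl fun i _ => Finset.sum_congr rfl fun s _ => by ring
  rw [h, ← Finset.sum_sub_distrib]
  refine Finset.sum_congr rfl fun i _ => ?_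
  rw [D.X_eq γ]
  ring

theorem n_nonneg {ω : Ω} (hw : ∀ i s, 0 ≤ D.w ω i s) (s : Fin S) : 0 ≤ D.n ω s :=
  Finset.sum_nonneg fun i _ => hw i s

theorem r_nonneg (ω : Ω) : 0 ≤ D.r ω :=
  inv_nonneg.2 (Finset.sum_nonneg fun _ _ => sq_nonneg _)

theorem sum_r_mul_sq_le_one (ω : Ω) : ∑ s, D.r ω * D.n ω s ^ 2 ≤ 1 := by
  rw [← Finset.mul_sum, r]
  exact inv_mul_le_one

theorem isUnit_gram_of_rank {ω : Ω} (h : (D.W ω).rank = S) :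
    IsUnit ((D.W ω)ᵀ * D.W ω).det := by
  have h1 : ((D.W ω)ᵀ * D.W ω).rank = S := by rw [Matrix.rank_transpose_mul_self, h]
  rw [← Matrix.isUnit_iff_isUnit_det]
  refine Matrix.linearIndependent_cols_iff_isUnit.1 ?_
  rw [linearIndependent_iff_card_eq_finrank_span, Set.finrank,
    ← Matrix.rank_eq_finrank_span_cols, h1, Fintype.card_fin]

theorem Wplus_mul_W {ω : Ω} (h : (D.W ω).rank = S) : D.Wplus ω * D.W ω = 1 := by
  rw [Wplus, Matrix.mul_assoc, Matrix.nonsing_inv_mul _ (D.isUnit_gram_of_rank h)]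

/-- A sector of size zero would be a zero column of `W`, contrary to full column rank. This makes
division by `n_s` harmless. -/
theorem n_pos {ω : Ω} (h : (D.W ω).rank = S) (hw : ∀ i s, 0 ≤ D.w ω i s) (s : Fin S) :
    0 < D.n ω s := by
  refine lt_of_le_of_ne (D.n_nonneg hw s) fun h0 => ?_
  have hz : ∀ i, D.w ω i s = 0 := fun i =>
    (Finset.sum_eq_zero_iff_of_nonneg fun i _ => hw i s).1 h0.symm i (Finset.mem_univ i)
  have h1 := congrFun (congrFun (D.Wplus_mul_W h) s) s
  rw [Matrix.mul_apply] at h1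
  simp [W, hz] at h1

/-- Left multiplication by `(W'W)⁻¹W'` inverts `W`, so shift-share aggregates are recovered exactly.
Only the noise `U`, which lies outside the range of `W`, is transformed. -/
theorem Xhat_eq (γ : Fin K → ℝ) {ω : Ω} (h : (D.W ω).rank = S) (s : Fin S) :
    D.Xhat ω s = D.Xtilde γ ω s
      - D.Zs ω s ⬝ᵥ (D.coefZ ω (D.X ω) - γ)
      - ∑ i, D.Wplus ω s i * D.Ugamma γ ω i
      - ∑ i, D.Wplus ω s i * (D.U ω i ⬝ᵥ (D.coefZ ω (D.X ω) - γ)) := by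
  set ζ := D.coefZ ω (D.X ω) - γ with hζ
  have hdd : D.Xddot ω = D.W ω *ᵥ (D.Xtilde γ ω) - D.Ugamma γ ω
      - D.W ω *ᵥ (fun s => D.Zs ω s ⬝ᵥ ζ) - fun i => D.U ω i ⬝ᵥ ζ := by
    ext i
    have e1 : (D.Z ω *ᵥ D.coefZ ω (D.X ω)) i = D.Z ω i ⬝ᵥ ζ + D.Z ω i ⬝ᵥ γ := by
      rw [← dotProduct_add, hζ, sub_add_cancel]
      rfl
    simp only [Xddot, Pi.sub_apply, e1]
    rw [D.X_eq γ, D.Z_dotProduct ω i ζ]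
    simp only [Xdot, W, mulVec, dotProduct, Matrix.of_apply]
    ring
  have hW : ∀ v, D.Wplus ω *ᵥ (D.W ω *ᵥ v) = v := fun v => by
    rw [Matrix.mulVec_mulVec, D.Wplus_mul_W h, Matrix.one_mulVec]
  rw [Xhat, hdd, Matrix.mulVec_sub, Matrix.mulVec_sub, Matrix.mulVec_sub, hW, hW]
  simp only [Pi.sub_apply, mulVec, dotProduct]
  ring

end Algebra

/-! ### Measurability, and the σ-fields that fix each variable -/

section Measurability

variable {Ω : Type*} [mΩ : MeasurableSpace Ω] {N S K : ℕ} (D : ShiftShareData Ω N S K)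

@[fun_prop]
theorem measurable_w_apply (i : Fin N) (s : Fin S) : Measurable fun ω => D.w ω i s :=
  measurable_pi_iff.1 (measurable_pi_iff.1 D.measurable_w i) s

@[fun_prop]
theorem measurable_Xs_apply (s : Fin S) : Measurable fun ω => D.Xs ω s :=
  measurable_pi_iff.1 D.measurable_Xs s

@[fun_prop]
theorem measurable_Zs_apply (s : Fin S) (k : Fin K) : Measurable fun ω => D.Zs ω s k :=
  measurable_pi_iff.1 (measurable_pi_iff.1 D.measurable_Zs s) k

@[fun_prop]
theorem measurable_U_apply (i : Fin N) (k : Fin K) : Measurable fun ω => D.U ω i k :=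
  measurable_pi_iff.1 (measurable_pi_iff.1 D.measurable_U i) k

@[fun_prop]
theorem measurable_Y0_apply (i : Fin N) : Measurable fun ω => D.Y0 ω i :=
  measurable_pi_iff.1 D.measurable_Y0 i

@[fun_prop]
theorem measurable_B_apply (i : Fin N) (s : Fin S) : Measurable fun ω => D.B ω i s :=
  measurable_pi_iff.1 (measurable_pi_iff.1 D.measurable_B i) s

@[fun_prop]
theorem measurable_L_apply (i : Fin N) : Measurable fun ω => D.L ω i :=
  measurable_pi_iff.1 D.measurable_L i

@[fun_prop]
theorem measurable_n (s : Fin S) : Measurable fun ω => D.n ω s := by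
  unfold n; fun_prop

@[fun_prop]
theorem measurable_r : Measurable fun ω => D.r ω := by
  unfold r; fun_prop

@[fun_prop]
theorem measurable_Xtilde (γ : Fin K → ℝ) (s : Fin S) : Measurable fun ω => D.Xtilde γ ω s := by
  unfold Xtilde dotProduct; fun_prop

@[fun_prop]
theorem measurable_Ugamma (γ : Fin K → ℝ) (i : Fin N) : Measurable fun ω => D.Ugamma γ ω i := by
  unfold Ugamma dotProduct; fun_prop

@[fun_prop]
theorem measurable_Lagg (s : Fin S) : Measurable fun ω => D.Lagg ω s := by
  unfold Lagg; fun_prop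

@[fun_prop]
theorem measurable_Z_apply (i : Fin N) (k : Fin K) : Measurable fun ω => D.Z ω i k := by
  simp only [Z_apply]; fun_prop

@[fun_prop]
theorem measurable_X_apply (i : Fin N) : Measurable fun ω => D.X ω i := by
  simp only [X_apply]; fun_prop

theorem measurable_F0_tuple : Measurable[D.F0]
    fun ω => (D.Zs ω, D.U ω, D.Y0 ω, D.B ω, D.w ω) := comap_measurable _

theorem measurable_F0_w : Measurable[D.F0] D.w :=
  (measurable_snd.comp (measurable_snd.comp (measurable_snd.comp measurable_snd))).comp
    D.measurable_F0_tuple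

theorem measurable_F0_B : Measurable[D.F0] D.B :=
  (measurable_fst.comp (measurable_snd.comp (measurable_snd.comp measurable_snd))).comp
    D.measurable_F0_tuple

theorem measurable_F0_Y0 : Measurable[D.F0] D.Y0 :=
  (measurable_fst.comp (measurable_snd.comp measurable_snd)).comp D.measurable_F0_tuple

theorem measurable_F0_U : Measurable[D.F0] D.U :=
  (measurable_fst.comp measurable_snd).comp D.measurable_F0_tuple

theorem measurable_F0_Zs : Measurable[D.F0] D.Zs :=
  measurable_fst.comp D.measurable_F0_tuple

theorem measurable_FW_w : Measurable[D.FW] D.w := comap_measurable _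

theorem FW_le_F0 : D.FW ≤ D.F0 := D.measurable_F0_w.comap_le

theorem FW_le : D.FW ≤ mΩ := D.measurable_w.comap_le

variable (μ : Measure Ω)

theorem measurable_F0_sigmaSq (s : Fin S) : Measurable[D.F0] fun ω => D.sigmaSq μ ω s :=
  stronglyMeasurable_condVar.measurable

theorem measurable_F0_beta : Measurable[D.F0] (D.beta μ) := by
  have hw : ∀ i s, Measurable[D.F0] fun ω => D.w ω i s := fun i s =>
    (measurable_pi_apply s).comp ((measurable_pi_apply i).comp D.measurable_F0_w)
  have hB : ∀ i s, Measurable[D.F0] fun ω => D.B ω i s := fun i s =>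
    (measurable_pi_apply s).comp ((measurable_pi_apply i).comp D.measurable_F0_B)
  refine Measurable.div ?_ ?_
  · exact Finset.measurable_fun_sum _ fun i _ => Finset.measurable_fun_sum _ fun s _ =>
      (((hw i s).pow_const 2).mul (D.measurable_F0_sigmaSq μ s)).mul (hB i s)
  · exact Finset.measurable_fun_sum _ fun i _ => Finset.measurable_fun_sum _ fun s _ =>
      ((hw i s).pow_const 2).mul (D.measurable_F0_sigmaSq μ s)

@[fun_prop]
theorem measurable_beta : Measurable fun ω => D.beta μ ω :=
  (D.measurable_F0_beta μ).mono D.F0_le le_rfl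

@[fun_prop]
theorem measurable_effectDev (i : Fin N) (s : Fin S) :
    Measurable fun ω => D.effectDev μ ω i s := by
  unfold effectDev; fun_prop

@[fun_prop]
theorem measurable_errorMean (γ : Fin K → ℝ) (i : Fin N) :
    Measurable fun ω => D.errorMean μ γ ω i := by
  unfold errorMean dotProduct; fun_prop

@[fun_prop]
theorem measurable_eps (i : Fin N) : Measurable fun ω => D.eps μ ω i := by
  unfold eps residual Y dotProduct; fun_prop

end Measurability

/-! ### Conditional distributions given `ℱ₀` -/

section Conditional

variable {Ω : Type*} [mΩ : MeasurableSpace Ω] [StandardBorelSpace Ω] {N S K : ℕ}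
  (D : ShiftShareData Ω N S K) (μ : Measure Ω) [IsProbabilityMeasure μ]

theorem ae_kernel_F0_const : ∀ᵐ ω ∂μ, ∀ᵐ ω' ∂condExpKernel μ D.F0 ω,
    D.Zs ω' = D.Zs ω ∧ D.U ω' = D.U ω ∧ D.Y0 ω' = D.Y0 ω ∧ D.B ω' = D.B ω ∧ D.w ω' = D.w ω
      ∧ D.beta μ ω' = D.beta μ ω := by
  filter_upwards [ae_condExpKernel_eq (μ := μ) D.F0_le D.measurable_F0_Zs,
    ae_condExpKernel_eq (μ := μ) D.F0_le D.measurable_F0_U,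
    ae_condExpKernel_eq (μ := μ) D.F0_le D.measurable_F0_Y0,
    ae_condExpKernel_eq (μ := μ) D.F0_le D.measurable_F0_B,
    ae_condExpKernel_eq (μ := μ) D.F0_le D.measurable_F0_w,
    ae_condExpKernel_eq (μ := μ) D.F0_le (D.measurable_F0_beta μ)] with ω h1 h2 h3 h4 h5 h6
  filter_upwards [h1, h2, h3, h4, h5, h6] with ω' h1 h2 h3 h4 h5 h6
  exact ⟨h1, h2, h3, h4, h5, h6⟩

theorem ae_kernel_FW_const : ∀ᵐ ω ∂μ, ∀ᵐ ω' ∂condExpKernel μ D.FW ω, D.w ω' = D.w ω :=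
  ae_condExpKernel_eq (μ := μ) D.FW_le D.measurable_FW_w

variable {μ} {γ : Fin K → ℝ} {p C : ℝ}

/-- Properties of the recentred shifters under the conditional distribution given `ℱ₀`. -/
structure ShifterLaw (γ : Fin K → ℝ) (p C : ℝ) (ω : Ω) (P : Measure Ω) (σ : Fin S → ℝ) : Prop where
  indep : iIndepFun (fun s ω' => D.Xtilde γ ω' s) P
  integrable : ∀ s, Integrable (fun ω' => |D.Xtilde γ ω' s| ^ p) P
  moment : ∀ s, ∫ ω', |D.Xtilde γ ω' s| ^ p ∂P ≤ C
  mean : ∀ s, ∫ ω', D.Xtilde γ ω' s ∂P = 0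
  variance : ∀ s, ∫ ω', D.Xtilde γ ω' s ^ 2 ∂P = σ s
  shifter : ∀ s, ∫⁻ ω', ENNReal.ofReal (D.Xs ω' s ^ 4) ∂P ≤ ENNReal.ofReal C
  fourth : ∀ s, ∫⁻ ω', ENNReal.ofReal (D.Xtilde γ ω' s ^ 4) ∂P ≤ ENNReal.ofReal C

/-- Collects what holds under almost every conditional distribution given `ℱ₀`. The conditional mean
`𝒵_s'γ` is at most `1 + C` in absolute value by the moment bound, whence the `p`-th moment bound `2
^ p * (C + (1 + C) ^ p)` for the recentred shifter. The stated constant also dominates both fourth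
moments. -/
theorem ae_shifterLaw (hp : 4 < p) (hC : 0 ≤ C)
    (hmean : ∀ s, μ[fun ω => D.Xs ω s | D.F0] =ᵐ[μ] fun ω => D.Zs ω s ⬝ᵥ γ)
    (hind : iCondIndepFun D.F0 D.F0_le (fun s ω => D.Xs ω s) μ)
    (hmom : ∀ s, Integrable (fun ω => |D.Xs ω s| ^ p) μ ∧
      ∀ᵐ ω ∂μ, (μ[fun ω' => |D.Xs ω' s| ^ p | D.F0]) ω ≤ C) :
    ∀ᵐ ω ∂μ, D.ShifterLaw γ p (2 + C + 2 ^ p * (C + (1 + C) ^ p)) ω (condExpKernel μ D.F0 ω)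
      (D.sigmaSq μ ω) := by
  have hXi : ∀ s, Integrable (fun ω => D.Xs ω s) μ := fun s =>
    integrable_abs_of_rpow hp (D.measurable_Xs_apply s) (hmom s).1
  have hXsq : ∀ s, Integrable (fun ω => D.Xs ω s ^ 2) μ := by
    intro s
    refine Integrable.mono' ((integrable_const 2).add (hmom s).1)
      ((D.measurable_Xs_apply s).pow_const 2).aestronglyMeasurable
      (Eventually.of_forall fun ω => ?_)
    have := pow_four_le_one_add_rpow hp.le (D.Xs ω s)
    simp only [Real.norm_eq_abs, Pi.add_apply]
    rw [abs_of_nonneg (sq_nonneg _)]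
    nlinarith [sq_nonneg (D.Xs ω s ^ 2 - 1)]
  have hsq : ∀ s, Integrable (fun ω => (D.Xs ω s - (μ[fun ω' => D.Xs ω' s | D.F0]) ω) ^ 2) μ := by
    intro s
    have h1 : MemLp (fun ω => D.Xs ω s) 2 μ :=
      (memLp_two_iff_integrable_sq (D.measurable_Xs_apply s).aestronglyMeasurable).2 (hXsq s)
    exact (h1.sub (MemLp.condExp (m := D.F0) (by norm_num) h1)).integrable_sq
  filter_upwards [D.ae_kernel_F0_const μ,
    iCondIndepFun.ae_iIndepFun D.F0_le (fun s => D.measurable_Xs_apply s) hind,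
    ae_all_iff.2 fun s => (hmom s).1.condExpKernel_ae (m := D.F0),
    ae_all_iff.2 fun s => (hmom s).2,
    ae_all_iff.2 fun s => condExp_ae_eq_integral_condExpKernel D.F0_le (hmom s).1,
    ae_all_iff.2 hmean,
    ae_all_iff.2 fun s => condExp_ae_eq_integral_condExpKernel D.F0_le (hXi s),
    ae_all_iff.2 fun s => condExp_ae_eq_integral_condExpKernel D.F0_le (hsq s),
    ae_all_iff.2 fun s => ae_ae_condExpKernel (m := D.F0) D.F0_le (hmean s)]
    with ω hc hi hintegrable hle heq hm hmi hv hmm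
  set P := condExpKernel μ D.F0 ω with hP
  have hmomP : ∀ s, ∫ ω', |D.Xs ω' s| ^ p ∂P ≤ C := fun s => by rw [← heq s]; exact hle s
  have hz : ∀ s, |D.Zs ω s ⬝ᵥ γ| ≤ 1 + C := fun s => by
    rw [← hm s, hmi s]
    exact abs_integral_le_of_rpow hp (hintegrable s) (hmomP s)
  have hXt : ∀ s, (fun ω' => D.Xtilde γ ω' s) =ᵐ[P] fun ω' => D.Xs ω' s - D.Zs ω s ⬝ᵥ γ := by
    intro s
    filter_upwards [hc] with ω' hω'
    rw [Xtilde, hω'.1]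
  have hK0 : 0 ≤ 2 ^ p * (C + (1 + C) ^ p) := by positivity
  have hbd : ∀ ω' s, |D.Xs ω' s - D.Zs ω s ⬝ᵥ γ| ^ p
      ≤ 2 ^ p * (|D.Xs ω' s| ^ p + (1 + C) ^ p) := by
    intro ω' s
    refine (abs_sub_rpow_le hp _ _).trans ?_
    have := Real.rpow_le_rpow (abs_nonneg _) (hz s) (by linarith : 0 ≤ p)
    gcongr
  have hbi : ∀ s, Integrable (fun ω' => 2 ^ p * (|D.Xs ω' s| ^ p + (1 + C) ^ p)) P := fun s =>
    ((hintegrable s).add (integrable_const _)).const_mul _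
  have hi1 : ∀ s, Integrable (fun ω' => |D.Xs ω' s - D.Zs ω s ⬝ᵥ γ| ^ p) P := by
    intro s
    refine Integrable.mono' (hbi s) ?_ (Eventually.of_forall fun ω' => ?_)
    · exact Measurable.aestronglyMeasurable (by fun_prop)
    · rw [Real.norm_eq_abs, abs_of_nonneg (by positivity)]
      exact hbd ω' s
  have hi1' : ∀ s, Integrable (fun ω' => |D.Xtilde γ ω' s| ^ p) P := by
    intro s
    refine (hi1 s).congr ?_
    filter_upwards [hXt s] with ω' hω'
    rw [hω']
  have hm1 : ∀ s, ∫ ω', |D.Xtilde γ ω' s| ^ p ∂P ≤ 2 ^ p * (C + (1 + C) ^ p) := by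
    intro s
    have e1 : ∫ ω', |D.Xtilde γ ω' s| ^ p ∂P = ∫ ω', |D.Xs ω' s - D.Zs ω s ⬝ᵥ γ| ^ p ∂P := by
      refine integral_congr_ae ?_
      filter_upwards [hXt s] with ω' hω'
      rw [hω']
    rw [e1]
    refine (integral_mono (hi1 s) (hbi s) fun ω' => hbd ω' s).trans ?_
    rw [integral_const_mul, integral_add (hintegrable s) (integrable_const _)]
    simp only [integral_const, probReal_univ, one_smul]
    have := hmomP s
    gcongr
  have hXiP : ∀ s, Integrable (fun ω' => D.Xs ω' s) P := fun s =>
    integrable_abs_of_rpow hp (D.measurable_Xs_apply s) (hintegrable s)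
  refine ⟨?_, hi1', ?_, ?_, ?_, ?_, ?_⟩
  · have h1 := hi.comp (fun s x => x - D.Zs ω s ⬝ᵥ γ) (fun s => by fun_prop)
    exact (iIndepFun_congr fun s => hXt s).2 h1
  · intro s; linarith [hm1 s]
  · intro s
    rw [integral_congr_ae (hXt s), integral_sub (hXiP s) (integrable_const _), ← hmi s, hm s]
    simp
  · intro s
    unfold sigmaSq condVar
    have h2 : (μ[((fun ω' => D.Xs ω' s) - μ[fun ω' => D.Xs ω' s | D.F0]) ^ 2 | D.F0]) ω
        = ∫ ω', (D.Xs ω' s - (μ[fun ω' => D.Xs ω' s | D.F0]) ω') ^ 2 ∂P := hv s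
    rw [h2]
    refine integral_congr_ae ?_
    filter_upwards [hmm s] with ω' hω'
    rw [hω', Xtilde]
  · intro s
    refine (lintegral_pow_four_le hp (hintegrable s) (hmomP s)).trans (ENNReal.ofReal_le_ofReal ?_)
    linarith
  · intro s
    refine (lintegral_pow_four_le hp (hi1' s) (hm1 s)).trans (ENNReal.ofReal_le_ofReal ?_)
    linarith

end Conditional

end ShiftShareData

/-! ### Weighted fourth moments -/

section Weights

variable {Ω : ℕ → Type*} [mΩ : ∀ S, MeasurableSpace (Ω S)]
  {μ : ∀ S, Measure (Ω S)} {N : ℕ → ℕ} {K : ℕ} {D : ∀ S, ShiftShareData (Ω S) (N S) S K}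
  {ι κ : ℕ → Type} [∀ S, Fintype (ι S)] [∀ S, Fintype (κ S)]

theorem eventually_whp_of_ae_curried {p : ∀ S, Ω S → Prop} (h : ∀ S, ∀ᵐ ω ∂μ S, p S ω) :
    ∀ᶠ x : Σ S, Ω S in whp μ, p x.1 x.2 := eventually_whp_of_ae h

theorem pow_four_le_pow_four_of_abs_le {a b : ℝ} (h : |a| ≤ |b|) : a ^ 4 ≤ b ^ 4 := by
  rw [← Even.pow_abs (by decide : Even 4), ← Even.pow_abs (by decide : Even 4) b]
  gcongr

/-- Nonnegative weights with sum at most one that are determined by the shares. -/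
structure ShareWeight (μ : ∀ S, Measure (Ω S)) (D : ∀ S, ShiftShareData (Ω S) (N S) S K)
    (g : ∀ S, Ω S → ι S → ℝ) : Prop where
  measurable : ∀ S i, Measurable fun ω => g S ω i
  nonneg : ∀ S, ∀ᵐ ω ∂μ S, ∀ i, 0 ≤ g S ω i
  sum_le : ∀ S, ∀ᵐ ω ∂μ S, ∑ i, g S ω i ≤ 1
  const : ∀ S ω ω', (D S).w ω' = (D S).w ω → g S ω' = g S ω

/-- All weighted fourth moments of `v` are bounded in probability. -/
def FourthBdd (μ : ∀ S, Measure (Ω S)) (D : ∀ S, ShiftShareData (Ω S) (N S) S K)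
    (v : ∀ S, Ω S → ι S → ℝ) : Prop :=
  ∀ g : ∀ S, Ω S → ι S → ℝ, ShareWeight μ D g →
    IsBoundedOp μ fun x => ∑ i, g x.1 x.2 i * v x.1 x.2 i ^ 4

/-- All weighted fourth moments of `v` tend to zero in probability. -/
def FourthNeg (μ : ∀ S, Measure (Ω S)) (D : ∀ S, ShiftShareData (Ω S) (N S) S K)
    (v : ∀ S, Ω S → ι S → ℝ) : Prop :=
  ∀ g : ∀ S, Ω S → ι S → ℝ, ShareWeight μ D g →
    Tendsto (fun x : Σ S, Ω S => ∑ i, g x.1 x.2 i * v x.1 x.2 i ^ 4) (whp μ) (𝓝 0)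

namespace ShareWeight

variable {g : ∀ S, Ω S → ι S → ℝ}

theorem eventually_nonneg (hg : ShareWeight μ D g) :
    ∀ᶠ x : Σ S, Ω S in whp μ, ∀ i, 0 ≤ g x.1 x.2 i := eventually_whp_of_ae hg.nonneg

theorem eventually_sum_le (hg : ShareWeight μ D g) :
    ∀ᶠ x : Σ S, Ω S in whp μ, ∑ i, g x.1 x.2 i ≤ 1 := eventually_whp_of_ae hg.sum_le

/-- Pushing weights through a matrix with bounded absolute row sums gives weights of the same kind.
For this reason the classes `FourthBdd` and `FourthNeg` quantify over all weights. -/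
theorem push (hg : ShareWeight μ D g) {A : ∀ S, Ω S → ι S → κ S → ℝ} {c : ℝ} (hc : 0 < c)
    (hAm : ∀ S i j, Measurable fun ω => A S ω i j)
    (hAc : ∀ S ω ω', (D S).w ω' = (D S).w ω → A S ω' = A S ω)
    (hA : ∀ S, ∀ᵐ ω ∂μ S, ∀ i, ∑ j, |A S ω i j| ≤ c) :
    ShareWeight μ D fun S ω j => ∑ i, g S ω i * (|A S ω i j| / c) where
  measurable S j := Finset.measurable_fun_sum _ fun i _ =>
    (hg.measurable S i).mul ((hAm S i j).abs.div_const c)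
  nonneg S := by
    filter_upwards [hg.nonneg S] with ω hω j
    exact Finset.sum_nonneg fun i _ => mul_nonneg (hω i) (by positivity)
  sum_le S := by
    filter_upwards [hg.nonneg S, hg.sum_le S, hA S] with ω h0 h1 hω
    rw [Finset.sum_comm]
    refine le_trans (Finset.sum_le_sum fun i _ => ?_) h1
    rw [← Finset.mul_sum, ← Finset.sum_div]
    exact mul_le_of_le_one_right (h0 i) ((div_le_one hc).2 (hω i))
  const S ω ω' h := by simp only [hg.const S ω ω' h, hAc S ω ω' h]

theorem average (μ : ∀ S, Measure (Ω S)) (D : ∀ S, ShiftShareData (Ω S) (N S) S K) :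
    ShareWeight μ D fun S _ (_ : Fin (N S)) => (N S : ℝ)⁻¹ where
  measurable S i := measurable_const
  nonneg S := Eventually.of_forall fun ω i => by positivity
  sum_le S := Eventually.of_forall fun ω => by
    simp only [Finset.sum_const, Finset.card_univ, Fintype.card_fin, nsmul_eq_mul]
    exact mul_inv_le_one
  const S ω ω' h := rfl

/-- The weights of the variance estimator: `r_N R_s²` is `r_N n_s²` times the square of a
share-weighted mean of errors. -/
theorem sector (μ : ∀ S, Measure (Ω S)) (D : ∀ S, ShiftShareData (Ω S) (N S) S K) :
    ShareWeight μ D fun S ω (s : Fin S) => (D S).r ω * (D S).n ω s ^ 2 where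
  measurable S i := by fun_prop
  nonneg S := Eventually.of_forall fun ω i => mul_nonneg ((D S).r_nonneg ω) (sq_nonneg _)
  sum_le S := Eventually.of_forall fun ω => (D S).sum_r_mul_sq_le_one ω
  const S ω ω' h := by
    simp only [ShiftShareData.r, ShiftShareData.n, h]

end ShareWeight

/-! ### Calculus of variables with bounded or negligible weighted fourth moments -/

section Calculus

variable {v v' : ∀ S, Ω S → ι S → ℝ}

theorem FourthNeg.mono (hv : FourthNeg μ D v)
    (h : ∀ᶠ x : Σ S, Ω S in whp μ, ∀ i, |v' x.1 x.2 i| ≤ |v x.1 x.2 i|) : FourthNeg μ D v' := by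
  intro g hg
  refine squeeze_zero_norm' ?_ (hv g hg)
  filter_upwards [h, hg.eventually_nonneg] with x hx h0
  rw [Real.norm_eq_abs, abs_of_nonneg (Finset.sum_nonneg fun i _ => mul_nonneg (h0 i)
    (by positivity))]
  exact Finset.sum_le_sum fun i _ =>
    mul_le_mul_of_nonneg_left (pow_four_le_pow_four_of_abs_le (hx i)) (h0 i)

theorem FourthBdd.mono (hv : FourthBdd μ D v)
    (h : ∀ᶠ x : Σ S, Ω S in whp μ, ∀ i, |v' x.1 x.2 i| ≤ |v x.1 x.2 i|) : FourthBdd μ D v' := by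
  intro g hg
  refine (hv g hg).mono ?_
  filter_upwards [h, hg.eventually_nonneg] with x hx h0
  rw [abs_of_nonneg (Finset.sum_nonneg fun i _ => mul_nonneg (h0 i) (by positivity))]
  refine le_trans ?_ (le_abs_self _)
  exact Finset.sum_le_sum fun i _ =>
    mul_le_mul_of_nonneg_left (pow_four_le_pow_four_of_abs_le (hx i)) (h0 i)

theorem sum_mul_add_pow_four_le {ι : Type*} [Fintype ι] {g : ι → ℝ} (hg : ∀ i, 0 ≤ g i)
    (v v' : ι → ℝ) : ∑ i, g i * (v i + v' i) ^ 4
      ≤ 8 * (∑ i, g i * v i ^ 4 + ∑ i, g i * v' i ^ 4) := by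
  rw [← Finset.sum_add_distrib, Finset.mul_sum]
  refine Finset.sum_le_sum fun i _ => ?_
  have := mul_le_mul_of_nonneg_left (add_pow_four_le (v i) (v' i)) (hg i)
  linarith

theorem FourthBdd.add (hv : FourthBdd μ D v) (hv' : FourthBdd μ D v') :
    FourthBdd μ D fun S ω i => v S ω i + v' S ω i := by
  intro g hg
  refine (((hv g hg).add (hv' g hg)).const_mul 8).mono ?_
  filter_upwards [hg.eventually_nonneg] with x h0
  rw [abs_of_nonneg (Finset.sum_nonneg fun i _ => mul_nonneg (h0 i) (by positivity))]
  exact (sum_mul_add_pow_four_le h0 _ _).trans (le_abs_self _)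

theorem FourthNeg.add (hv : FourthNeg μ D v) (hv' : FourthNeg μ D v') :
    FourthNeg μ D fun S ω i => v S ω i + v' S ω i := by
  intro g hg
  have := (((hv g hg).add (hv' g hg)).const_mul 8)
  rw [add_zero, mul_zero] at this
  refine squeeze_zero_norm' ?_ this
  filter_upwards [hg.eventually_nonneg] with x h0
  rw [Real.norm_eq_abs,
    abs_of_nonneg (Finset.sum_nonneg fun i _ => mul_nonneg (h0 i) (by positivity))]
  exact sum_mul_add_pow_four_le h0 _ _

theorem FourthBdd.neg (hv : FourthBdd μ D v) : FourthBdd μ D fun S ω i => - v S ω i :=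
  hv.mono (Eventually.of_forall fun _ _ => (abs_neg _).le)

theorem FourthBdd.sub (hv : FourthBdd μ D v) (hv' : FourthBdd μ D v') :
    FourthBdd μ D fun S ω i => v S ω i - v' S ω i := by
  simpa only [sub_eq_add_neg] using hv.add hv'.neg

theorem FourthNeg.fourthBdd (hv : FourthNeg μ D v) : FourthBdd μ D v :=
  fun g hg => IsBoundedOp.of_tendsto (hv g hg)

theorem fourthNeg_zero : FourthNeg μ D fun S _ (_ : ι S) => (0 : ℝ) := fun g _ => by
  simpa using tendsto_const_nhds

theorem sum_mul_mul_pow_four {ι : Type*} [Fintype ι] (g v : ι → ℝ) (a : ℝ) :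
    ∑ i, g i * (a * v i) ^ 4 = a ^ 4 * ∑ i, g i * v i ^ 4 := by
  rw [Finset.mul_sum]
  exact Finset.sum_congr rfl fun i _ => by ring

theorem FourthBdd.smul {a : (Σ S, Ω S) → ℝ} (ha : IsBoundedOp μ a) (hv : FourthBdd μ D v) :
    FourthBdd μ D fun S ω i => a ⟨S, ω⟩ * v S ω i := by
  intro g hg
  simp only [sum_mul_mul_pow_four]
  exact (ha.pow 4).mul (hv g hg)

theorem FourthBdd.sum {J : Type*} (s : Finset J) {v : J → ∀ S, Ω S → ι S → ℝ}
    (hv : ∀ j ∈ s, FourthBdd μ D (v j)) : FourthBdd μ D fun S ω i => ∑ j ∈ s, v j S ω i := by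
  classical
  induction s using Finset.induction_on with
  | empty => simpa using fourthNeg_zero.fourthBdd
  | insert a s ha ih =>
    simp only [Finset.sum_insert ha]
    exact (hv a (by simp)).add (ih fun i hi => hv i (by simp [hi]))

theorem FourthNeg.sum {J : Type*} (s : Finset J) {v : J → ∀ S, Ω S → ι S → ℝ}
    (hv : ∀ j ∈ s, FourthNeg μ D (v j)) : FourthNeg μ D fun S ω i => ∑ j ∈ s, v j S ω i := by
  classical
  induction s using Finset.induction_on with
  | empty => simpa using fourthNeg_zero
  | insert a s ha ih =>
    simp only [Finset.sum_insert ha]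
    exact (hv a (by simp)).add (ih fun i hi => hv i (by simp [hi]))

theorem sum_mul_sum_pow_four_le {ι κ : Type*} [Fintype ι] [Fintype κ] {g : ι → ℝ}
    (hg : ∀ i, 0 ≤ g i) {A : ι → κ → ℝ} {c : ℝ} (hc : 0 < c) (hA : ∀ i, ∑ j, |A i j| ≤ c)
    (v : κ → ℝ) : ∑ i, g i * (∑ j, A i j * v j) ^ 4
      ≤ c ^ 4 * ∑ j, (∑ i, g i * (|A i j| / c)) * v j ^ 4 := by
  have e : c ^ 4 * ∑ j, (∑ i, g i * (|A i j| / c)) * v j ^ 4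
      = ∑ i, g i * (c ^ 3 * ∑ j, |A i j| * v j ^ 4) := by
    simp only [Finset.mul_sum, Finset.sum_mul]
    rw [Finset.sum_comm]
    refine Finset.sum_congr rfl fun i _ => Finset.sum_congr rfl fun j _ => ?_
    field_simp
  rw [e]
  exact Finset.sum_le_sum fun i _ =>
    mul_le_mul_of_nonneg_left (pow_four_abs_sum_mul_le _ (hA i) v) (hg i)

/-- Jensen's inequality in each row turns the weighted fourth moment of the aggregate into that of
`v` under the pushed weights. -/
theorem FourthBdd.aggregate (hv : FourthBdd μ D v)
    {A : ∀ S, Ω S → κ S → ι S → ℝ} {c : ℝ} (hc : 0 < c)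
    (hAm : ∀ S i j, Measurable fun ω => A S ω i j)
    (hAc : ∀ S ω ω', (D S).w ω' = (D S).w ω → A S ω' = A S ω)
    (hA : ∀ S, ∀ᵐ ω ∂μ S, ∀ i, ∑ j, |A S ω i j| ≤ c) :
    FourthBdd μ D fun S ω i => ∑ j, A S ω i j * v S ω j := by
  intro g hg
  refine ((hv _ (hg.push hc hAm hAc hA)).const_mul (c ^ 4)).mono ?_
  filter_upwards [hg.eventually_nonneg, eventually_whp_of_ae_curried hA] with x h0 h1
  rw [abs_of_nonneg (Finset.sum_nonneg fun i _ => mul_nonneg (h0 i) (by positivity))]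
  exact (sum_mul_sum_pow_four_le h0 hc h1 _).trans (le_abs_self _)

theorem FourthNeg.aggregate (hv : FourthNeg μ D v)
    {A : ∀ S, Ω S → κ S → ι S → ℝ} {c : ℝ} (hc : 0 < c)
    (hAm : ∀ S i j, Measurable fun ω => A S ω i j)
    (hAc : ∀ S ω ω', (D S).w ω' = (D S).w ω → A S ω' = A S ω)
    (hA : ∀ S, ∀ᵐ ω ∂μ S, ∀ i, ∑ j, |A S ω i j| ≤ c) :
    FourthNeg μ D fun S ω i => ∑ j, A S ω i j * v S ω j := by
  intro g hg
  have := (hv _ (hg.push hc hAm hAc hA)).const_mul (c ^ 4)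
  rw [mul_zero] at this
  refine squeeze_zero_norm' ?_ this
  filter_upwards [hg.eventually_nonneg, eventually_whp_of_ae_curried hA] with x h0 h1
  rw [Real.norm_eq_abs,
    abs_of_nonneg (Finset.sum_nonneg fun i _ => mul_nonneg (h0 i) (by positivity))]
  exact sum_mul_sum_pow_four_le h0 hc h1 _

/-- Cauchy–Schwarz for the product, and again for each second moment, where the total weight is at
most one. -/
theorem sum_mul_mul_pow_four_le {ι : Type*} [Fintype ι] {g : ι → ℝ} (hg : ∀ i, 0 ≤ g i)
    (hg1 : ∑ i, g i ≤ 1) (v v' : ι → ℝ) :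
    (∑ i, g i * (v i * v' i)) ^ 4 ≤ (∑ i, g i * v i ^ 4) * ∑ i, g i * v' i ^ 4 := by
  have h0 : ∀ u : ι → ℝ, (∑ i, g i * u i ^ 2) ^ 2 ≤ ∑ i, g i * u i ^ 4 := by
    intro u
    have h := sq_sum_mul_le Finset.univ (fun i _ => hg i) fun i => u i ^ 2
    refine h.trans ?_
    have h2 : ∑ i, g i * (u i ^ 2) ^ 2 = ∑ i, g i * u i ^ 4 :=
      Finset.sum_congr rfl fun i _ => by ring
    rw [h2]
    exact mul_le_of_le_one_left (Finset.sum_nonneg fun i _ => mul_nonneg (hg i)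
      (by positivity)) hg1
  have h1 : (∑ i, g i * (v i * v' i)) ^ 2 ≤ (∑ i, g i * v i ^ 2) * ∑ i, g i * v' i ^ 2 :=
    Finset.sum_sq_le_sum_mul_sum_of_sq_le_mul _ (fun i _ => mul_nonneg (hg i) (sq_nonneg _))
      (fun i _ => mul_nonneg (hg i) (sq_nonneg _)) (fun i _ => le_of_eq (by ring))
  calc (∑ i, g i * (v i * v' i)) ^ 4 = ((∑ i, g i * (v i * v' i)) ^ 2) ^ 2 := by ring
    _ ≤ ((∑ i, g i * v i ^ 2) * ∑ i, g i * v' i ^ 2) ^ 2 := by gcongr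
    _ = (∑ i, g i * v i ^ 2) ^ 2 * (∑ i, g i * v' i ^ 2) ^ 2 := by ring
    _ ≤ _ := mul_le_mul (h0 v) (h0 v') (sq_nonneg _) (Finset.sum_nonneg fun i _ =>
        mul_nonneg (hg i) (by positivity))

variable {g : ∀ S, Ω S → ι S → ℝ}

theorem FourthBdd.sum_mul (hv : FourthBdd μ D v) (hv' : FourthBdd μ D v')
    (hg : ShareWeight μ D g) :
    IsBoundedOp μ fun x => ∑ i, g x.1 x.2 i * (v x.1 x.2 i * v' x.1 x.2 i) := by
  refine ((IsBoundedOp.const 1).add ((hv g hg).mul (hv' g hg))).mono ?_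
  filter_upwards [hg.eventually_nonneg, hg.eventually_sum_le] with x h0 h1
  have h := sum_mul_mul_pow_four_le h0 h1 (v x.1 x.2) (v' x.1 x.2)
  refine le_trans ?_ (le_abs_self _)
  set a := ∑ i, g x.1 x.2 i * (v x.1 x.2 i * v' x.1 x.2 i)
  rw [← Even.pow_abs (by decide : Even 4)] at h
  have : |a| ≤ 1 + |a| ^ 4 := by
    nlinarith [sq_nonneg (|a| - 1), sq_nonneg (|a| ^ 2 - 1), abs_nonneg a]
  linarith

variable [∀ S, IsProbabilityMeasure (μ S)]

theorem FourthBdd.smul_tendsto_zero {a : (Σ S, Ω S) → ℝ} (ha : Tendsto a (whp μ) (𝓝 0))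
    (hv : FourthBdd μ D v) : FourthNeg μ D fun S ω i => a ⟨S, ω⟩ * v S ω i := by
  intro g hg
  simp only [sum_mul_mul_pow_four]
  have := (hv g hg).mul_tendsto_zero (by simpa using ha.pow 4)
  simpa only [mul_comm] using this

theorem FourthBdd.sum_mul_fourthNeg (hv : FourthBdd μ D v) (hv' : FourthNeg μ D v')
    (hg : ShareWeight μ D g) :
    Tendsto (fun x : Σ S, Ω S => ∑ i, g x.1 x.2 i * (v x.1 x.2 i * v' x.1 x.2 i))
      (whp μ) (𝓝 0) := by
  have h := ((hv g hg).mul_tendsto_zero (hv' g hg)).sqrt.sqrt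
  rw [Real.sqrt_zero, Real.sqrt_zero] at h
  refine squeeze_zero_norm' ?_ h
  filter_upwards [hg.eventually_nonneg, hg.eventually_sum_le] with x h0 h1
  have h := sum_mul_mul_pow_four_le h0 h1 (v x.1 x.2) (v' x.1 x.2)
  rw [Real.norm_eq_abs]
  refine Real.le_sqrt_of_sq_le (Real.le_sqrt_of_sq_le ?_)
  refine le_trans (le_of_eq ?_) h
  rw [sq_abs]
  ring

/-- Stability of `∑ h P² Q²` under perturbations that are small in the weighted fourth mean. -/
theorem tendsto_sum_sq_mul_sq_sub {P Q P' Q' : ∀ S, Ω S → ι S → ℝ} (hg : ShareWeight μ D g)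
    (hP : FourthBdd μ D P) (hQ : FourthBdd μ D Q)
    (hP' : FourthNeg μ D fun S ω i => P S ω i - P' S ω i)
    (hQ' : FourthNeg μ D fun S ω i => Q S ω i - Q' S ω i) :
    Tendsto (fun x : Σ S, Ω S => ∑ i, g x.1 x.2 i *
      (P x.1 x.2 i ^ 2 * Q x.1 x.2 i ^ 2 - P' x.1 x.2 i ^ 2 * Q' x.1 x.2 i ^ 2))
      (whp μ) (𝓝 0) := by
  have hPb : FourthBdd μ D P' := by simpa using hP.sub hP'.fourthBdd
  have hQb : FourthBdd μ D Q' := by simpa using hQ.sub hQ'.fourthBdd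
  have ha := (hP' g hg).add (hQ' g hg)
  rw [add_zero] at ha
  have hA := (IsBoundedOp.const 1).add
    ((((hP g hg).add (hQ g hg)).add (hPb g hg)).add (hQb g hg))
  refine tendsto_zero_of_forall_le (K := fun k => ((k : ℝ) + 2) ^ 12) (fun k => by positivity)
    ha hA ?_ ?_
  · filter_upwards [hg.eventually_nonneg] with x h0
    have : ∀ v : ι x.1 → ℝ, 0 ≤ ∑ i, g x.1 x.2 i * v i ^ 4 := fun v =>
      Finset.sum_nonneg fun i _ => mul_nonneg (h0 i) (by positivity)
    have h1 := this (P x.1 x.2)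
    have h2 := this (Q x.1 x.2)
    have h3 := this (P' x.1 x.2)
    have h4 := this (Q' x.1 x.2)
    linarith
  · filter_upwards [hg.eventually_nonneg] with x h0 k
    have hnn : ∀ v : ι x.1 → ℝ, 0 ≤ ∑ i, g x.1 x.2 i * v i ^ 4 := fun v =>
      Finset.sum_nonneg fun i _ => mul_nonneg (h0 i) (by positivity)
    have h1 := hnn (P x.1 x.2)
    have h2 := hnn (Q x.1 x.2)
    have h3 := hnn (P' x.1 x.2)
    have h4 := hnn (Q' x.1 x.2)
    have h5 := hnn fun i => P x.1 x.2 i - P' x.1 x.2 i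
    have h6 := hnn fun i => Q x.1 x.2 i - Q' x.1 x.2 i
    -- With this choice `2 * θ ^ 4` is below the tolerance `1 / (k + 1)`, and `θ ^ (-12)` is the
    -- constant `K k` announced above.
    set θ : ℝ := 1 / ((k : ℝ) + 2) with hθ
    have hθ0 : 0 < θ := by positivity
    have hθ12 : ∀ a : ℝ, a / θ ^ 12 = ((k : ℝ) + 2) ^ 12 * a := fun a => by
      rw [hθ]; field_simp
    have hθ4 : 2 * θ ^ 4 ≤ 1 / ((k : ℝ) + 1) := by
      rw [hθ, div_pow, one_pow, ← mul_div_assoc, mul_one, div_le_div_iff₀ (by positivity)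
        (by positivity)]
      have hk : (0 : ℝ) ≤ k := by positivity
      nlinarith [pow_nonneg hk 2, pow_nonneg hk 3, pow_nonneg hk 4]
    have hb := fun i => abs_sq_mul_sq_sub_le_pow_four (P x.1 x.2 i) (Q x.1 x.2 i) (P' x.1 x.2 i)
      (Q' x.1 x.2 i) hθ0
    have hsum : |∑ i, g x.1 x.2 i *
        (P x.1 x.2 i ^ 2 * Q x.1 x.2 i ^ 2 - P' x.1 x.2 i ^ 2 * Q' x.1 x.2 i ^ 2)|
        ≤ ((k : ℝ) + 2) ^ 12 * (∑ i, g x.1 x.2 i * (P x.1 x.2 i - P' x.1 x.2 i) ^ 4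
            + ∑ i, g x.1 x.2 i * (Q x.1 x.2 i - Q' x.1 x.2 i) ^ 4)
          + 2 * θ ^ 4 * (∑ i, g x.1 x.2 i * P x.1 x.2 i ^ 4 + ∑ i, g x.1 x.2 i * Q x.1 x.2 i ^ 4
            + ∑ i, g x.1 x.2 i * P' x.1 x.2 i ^ 4 + ∑ i, g x.1 x.2 i * Q' x.1 x.2 i ^ 4) := by
      refine (Finset.abs_sum_le_sum_abs _ _).trans ?_
      simp only [← Finset.sum_add_distrib, Finset.mul_sum]
      refine Finset.sum_le_sum fun i _ => ?_
      rw [abs_mul, abs_of_nonneg (h0 i)]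
      have := mul_le_mul_of_nonneg_left (hb i) (h0 i)
      rw [hθ12] at this
      linarith
    refine hsum.trans ?_
    set a1 := ∑ i, g x.1 x.2 i * (P x.1 x.2 i - P' x.1 x.2 i) ^ 4
    set a2 := ∑ i, g x.1 x.2 i * (Q x.1 x.2 i - Q' x.1 x.2 i) ^ 4
    set b1 := ∑ i, g x.1 x.2 i * P x.1 x.2 i ^ 4
    set b2 := ∑ i, g x.1 x.2 i * Q x.1 x.2 i ^ 4
    set b3 := ∑ i, g x.1 x.2 i * P' x.1 x.2 i ^ 4
    set b4 := ∑ i, g x.1 x.2 i * Q' x.1 x.2 i ^ 4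
    have hc : 0 ≤ ((k : ℝ) + 2) ^ 12 * (a1 + a2) := by positivity
    have hB : 0 ≤ b1 + b2 + b3 + b4 := by positivity
    have h7 := mul_le_mul_of_nonneg_right hθ4 hB
    have h8 := mul_nonneg hc hB
    have h9 : 0 ≤ 1 / ((k : ℝ) + 1) := by positivity
    linarith

end Calculus

end Weights

/-! ### Moments of the variables of a shift-share design -/

section DesignMoments

set_option linter.unusedSectionVars false

variable {Ω : ℕ → Type*} [mΩ : ∀ S, MeasurableSpace (Ω S)] [∀ S, StandardBorelSpace (Ω S)]
  {μ : ∀ S, Measure (Ω S)} [∀ S, IsProbabilityMeasure (μ S)] {N : ℕ → ℕ} {K : ℕ}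
  {D : ∀ S, ShiftShareData (Ω S) (N S) S K} {γ : Fin K → ℝ}
  {ι : ℕ → Type} [∀ S, Fintype (ι S)]

theorem exists_shifterLaw (hd : ShiftShareDesign μ D γ) (hr : ShiftShareRegular μ D γ) :
    ∃ p C : ℝ, 4 < p ∧ 0 ≤ C ∧ ∀ S, ∀ᵐ ω ∂μ S,
      (D S).ShifterLaw γ p C ω (condExpKernel (μ S) (D S).F0 ω) ((D S).sigmaSq (μ S) ω) := by
  obtain ⟨ν, hν, C, hC⟩ := hr.shifter_moment
  have hC0 : 0 ≤ max C 0 := le_max_right _ _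
  refine ⟨4 + ν, _, by linarith, ?_, fun S => (D S).ae_shifterLaw (C := max C 0) (by linarith) hC0
    (hd.shifter_mean S) (hd.shifter_indep S) fun s => ⟨(hC S s).1, ?_⟩⟩
  · positivity
  · filter_upwards [(hC S s).2] with ω hω
    exact hω.trans (le_max_left _ _)

theorem ShareWeight.ae_const_FW {g : ∀ S, Ω S → ι S → ℝ} (hg : ShareWeight μ D g) (S : ℕ) :
    ∀ᵐ ω ∂μ S, ∀ᵐ ω' ∂condExpKernel (μ S) (D S).FW ω, g S ω' = g S ω := by
  filter_upwards [(D S).ae_kernel_FW_const (μ S)] with ω hω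
  filter_upwards [hω] with ω' hω'
  exact hg.const S ω ω' hω'

theorem ShareWeight.ae_const_F0 {g : ∀ S, Ω S → ι S → ℝ} (hg : ShareWeight μ D g) (S : ℕ) :
    ∀ᵐ ω ∂μ S, ∀ᵐ ω' ∂condExpKernel (μ S) (D S).F0 ω, g S ω' = g S ω := by
  filter_upwards [(D S).ae_kernel_F0_const (μ S)] with ω hω
  filter_upwards [hω] with ω' hω'
  exact hg.const S ω ω' hω'.2.2.2.2.1

/-- Share-determined weights are frozen given `W`, so conditional fourth moments that are bounded
given `W` suffice; no independence between regions is involved. -/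
theorem fourthBdd_of_FW {v : ∀ S, Ω S → ι S → ℝ} (hv : ∀ S i, Measurable fun ω => v S ω i)
    {C : ℝ} (h : ∀ S i, Integrable (fun ω => v S ω i ^ 4) (μ S) ∧
      ∀ᵐ ω ∂μ S, ((μ S)[fun ω' => v S ω' i ^ 4 | (D S).FW]) ω ≤ C) : FourthBdd μ D v := by
  intro g hg
  refine isBoundedOp_weighted_sum (m := fun S => (D S).FW) (fun S => (D S).FW_le)
    (H := fun _ => C) (v := fun S ω i => v S ω i ^ 4) hg.measurable
    (fun S i => (hv S i).pow_const 4) hg.nonneg hg.sum_le hg.ae_const_FW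
    (fun S ω i => by positivity) (fun S i => ?_) (IsBoundedOp.const C)
  exact lintegral_condExpKernel_le_of_condExp_le (D S).FW_le (h S i).1
    (Eventually.of_forall fun ω => by positivity) (h S i).2

theorem fourthBdd_of_F0 {v : ∀ S, Ω S → ι S → ℝ} (hv : ∀ S i, Measurable fun ω => v S ω i)
    {C : ℝ} (h : ∀ S, ∀ᵐ ω ∂μ S, ∀ i,
      ∫⁻ ω', ENNReal.ofReal (v S ω' i ^ 4) ∂condExpKernel (μ S) (D S).F0 ω ≤ ENNReal.ofReal C) :
    FourthBdd μ D v := by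
  intro g hg
  refine isBoundedOp_weighted_sum (m := fun S => (D S).F0) (fun S => (D S).F0_le)
    (H := fun _ => C) (v := fun S ω i => v S ω i ^ 4) hg.measurable
    (fun S i => (hv S i).pow_const 4) hg.nonneg hg.sum_le hg.ae_const_F0
    (fun S ω i => by positivity) (fun S i => ?_) (IsBoundedOp.const C)
  filter_upwards [h S] with ω hω using hω i

theorem tendsto_zero_weighted_sum_of_FW {v g : ∀ S, Ω S → ι S → ℝ}
    (hv : ∀ S i, Measurable fun ω => v S ω i) (hv0 : ∀ S ω i, 0 ≤ v S ω i)
    (hi : ∀ S i, Integrable (fun ω => v S ω i) (μ S))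
    (h : IsLittleOp μ fun S ω => ⨆ i, ((μ S)[fun ω' => v S ω' i | (D S).FW]) ω)
    (hg : ShareWeight μ D g) :
    Tendsto (fun x : Σ S, Ω S => ∑ i, g x.1 x.2 i * v x.1 x.2 i) (whp μ) (𝓝 0) := by
  rw [isLittleOp_iff_tendsto] at h
  refine tendsto_zero_weighted_sum (m := fun S => (D S).FW) (fun S => (D S).FW_le)
    (v := v) hg.measurable hv hg.nonneg hg.sum_le hg.ae_const_FW hv0 (fun S i => ?_) h
  refine lintegral_condExpKernel_le_of_condExp_le (D S).FW_le (hi S i)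
    (Eventually.of_forall fun ω => hv0 S ω i) (Eventually.of_forall fun ω => ?_)
  exact le_ciSup (f := fun i => ((μ S)[fun ω' => v S ω' i | (D S).FW]) ω)
    (Set.finite_range _).bddAbove i

theorem fourthNeg_of_FW {v : ∀ S, Ω S → ι S → ℝ} (hv : ∀ S i, Measurable fun ω => v S ω i)
    (hi : ∀ S i, Integrable (fun ω => v S ω i ^ 4) (μ S))
    (h : IsLittleOp μ fun S ω => ⨆ i, ((μ S)[fun ω' => v S ω' i ^ 4 | (D S).FW]) ω) :
    FourthNeg μ D v := fun _ hg =>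
  tendsto_zero_weighted_sum_of_FW (v := fun S ω i => v S ω i ^ 4) (fun S i => (hv S i).pow_const 4)
    (fun S ω i => by positivity) hi h hg

/-! Elementary variables -/

theorem fourthBdd_Y0 (hr : ShiftShareRegular μ D γ) : FourthBdd μ D fun S => (D S).Y0 := by
  obtain ⟨C, hC⟩ := hr.outcome_moment
  exact fourthBdd_of_FW (fun S i => by fun_prop) hC

theorem fourthBdd_Zs (hr : ShiftShareRegular μ D γ) (k : Fin K) :
    FourthBdd μ D fun S ω s => (D S).Zs ω s k := by
  obtain ⟨C, hC⟩ := hr.control_moment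
  exact fourthBdd_of_FW (fun S i => by fun_prop) fun S s => hC S s k

theorem fourthBdd_U (hr : ShiftShareRegular μ D γ) (k : Fin K) :
    FourthBdd μ D fun S ω i => (D S).U ω i k := by
  obtain ⟨C, hC⟩ := hr.noise_moment
  exact fourthBdd_of_FW (fun S i => by fun_prop) fun S i => hC S i k

theorem fourthBdd_Xs (hd : ShiftShareDesign μ D γ) (hr : ShiftShareRegular μ D γ) :
    FourthBdd μ D fun S => (D S).Xs := by
  obtain ⟨p, C, -, -, h⟩ := exists_shifterLaw hd hr
  refine fourthBdd_of_F0 (fun S i => by fun_prop) (C := C) fun S => ?_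
  filter_upwards [h S] with ω hω using hω.shifter

theorem fourthBdd_Xtilde (hd : ShiftShareDesign μ D γ) (hr : ShiftShareRegular μ D γ) :
    FourthBdd μ D fun S => (D S).Xtilde γ := by
  obtain ⟨p, C, -, -, h⟩ := exists_shifterLaw hd hr
  refine fourthBdd_of_F0 (fun S i => by fun_prop) (C := C) fun S => ?_
  filter_upwards [h S] with ω hω using hω.fourth

theorem fourthNeg_L (hr : ShiftShareRegular μ D γ) : FourthNeg μ D fun S => (D S).L :=
  fourthNeg_of_FW (fun S i => by fun_prop) hr.lin_error_moment hr.lin_error_fourth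

theorem integrable_Ugamma_pow_four (hr : ShiftShareRegular μ D γ) (S : ℕ) (i : Fin (N S)) :
    Integrable (fun ω => (D S).Ugamma γ ω i ^ 4) (μ S) := by
  obtain ⟨C, hC⟩ := hr.noise_moment
  refine Integrable.mono' (g := fun ω => (∑ k, |γ k|) ^ 3 * ∑ k, |γ k| * (D S).U ω i k ^ 4)
    ((integrable_finsetSum _ fun k _ => ((hC S i k).1.const_mul _)).const_mul _)
    (Measurable.aestronglyMeasurable (by fun_prop)) (Eventually.of_forall fun ω => ?_)
  rw [Real.norm_eq_abs, abs_of_nonneg (by positivity)]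
  have := pow_four_abs_sum_mul_le Finset.univ (b := γ) le_rfl ((D S).U ω i)
  rw [ShiftShareData.Ugamma, dotProduct_comm]
  exact this

theorem fourthNeg_Ugamma (hr : ShiftShareRegular μ D γ) (hc : ShifterRecovery μ D γ) :
    FourthNeg μ D fun S => (D S).Ugamma γ := by
  rcases hc.noise with h | h
  · exact fourthNeg_of_FW (fun S i => by fun_prop) (integrable_Ugamma_pow_four hr) h.2
  · refine fourthNeg_zero.mono ?_
    filter_upwards [eventually_whp_of_ae_curried h] with x hx i
    simp [ShiftShareData.Ugamma, dotProduct, hx]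

/-! Aggregates -/

section Aggregates

variable {v : ∀ S, Ω S → Fin S → ℝ} {v' : ∀ S, Ω S → Fin (N S) → ℝ}

theorem ae_sum_abs_share_le (hd : ShiftShareDesign μ D γ) (S : ℕ) :
    ∀ᵐ ω ∂μ S, ∀ i, ∑ s, |(D S).w ω i s| ≤ 1 := by
  filter_upwards [hd.share_nonneg S, hd.share_sum_le S] with ω h0 h1 i
  simpa only [abs_of_nonneg (h0 i _)] using h1 i

theorem ae_sum_abs_share_div_le (hd : ShiftShareDesign μ D γ) (S : ℕ) :
    ∀ᵐ ω ∂μ S, ∀ s, ∑ i, |(D S).w ω i s / (D S).n ω s| ≤ 1 := by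
  filter_upwards [hd.share_nonneg S] with ω h0 s
  have hn := (D S).n_nonneg h0 s
  simp only [abs_div, abs_of_nonneg (h0 _ s), abs_of_nonneg hn]
  rw [← Finset.sum_div]
  exact div_self_le_one _

theorem FourthBdd.region (hd : ShiftShareDesign μ D γ) (hv : FourthBdd μ D v) :
    FourthBdd μ D fun S ω i => ∑ s, (D S).w ω i s * v S ω s :=
  hv.aggregate one_pos (A := fun S => (D S).w) (fun S i j => by fun_prop) (fun S ω ω' h => h)
    (ae_sum_abs_share_le hd)

theorem FourthBdd.sectorMean (hd : ShiftShareDesign μ D γ) (hv : FourthBdd μ D v') :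
    FourthBdd μ D fun S ω s => ∑ i, (D S).w ω i s / (D S).n ω s * v' S ω i :=
  hv.aggregate one_pos (A := fun S ω s i => (D S).w ω i s / (D S).n ω s)
    (fun S i j => by fun_prop) (fun S ω ω' h => by simp only [ShiftShareData.n, h])
    (ae_sum_abs_share_div_le hd)

theorem FourthNeg.sectorMean (hd : ShiftShareDesign μ D γ) (hv : FourthNeg μ D v') :
    FourthNeg μ D fun S ω s => ∑ i, (D S).w ω i s / (D S).n ω s * v' S ω i :=
  hv.aggregate one_pos (A := fun S ω s i => (D S).w ω i s / (D S).n ω s)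
    (fun S i j => by fun_prop) (fun S ω ω' h => by simp only [ShiftShareData.n, h])
    (ae_sum_abs_share_div_le hd)

end Aggregates

theorem fourthBdd_X (hd : ShiftShareDesign μ D γ) (hr : ShiftShareRegular μ D γ) :
    FourthBdd μ D fun S => (D S).X := by
  have := (fourthBdd_Xs hd hr).region hd
  simpa only [← ShiftShareData.X_apply] using this

theorem fourthBdd_Xdot (hd : ShiftShareDesign μ D γ) (hr : ShiftShareRegular μ D γ) :
    FourthBdd μ D fun S => (D S).Xdot γ := (fourthBdd_Xtilde hd hr).region hd

theorem fourthBdd_Z (hd : ShiftShareDesign μ D γ) (hr : ShiftShareRegular μ D γ) (k : Fin K) :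
    FourthBdd μ D fun S ω i => (D S).Z ω i k := by
  have := ((fourthBdd_Zs hr k).region hd).add (fourthBdd_U hr k)
  simpa only [← ShiftShareData.Z_apply] using this

/-- The estimand is a weighted mean of the effects with nonnegative weights, hence bounded like
them; if all weights vanish it is `0` by the convention for division. -/
theorem exists_abs_effectDev_le (hd : ShiftShareDesign μ D γ) (hr : ShiftShareRegular μ D γ) :
    ∃ C : ℝ, 0 < C ∧ ∀ S, ∀ᵐ ω ∂μ S, ∀ i s, |(D S).effectDev (μ S) ω i s| ≤ C := by
  obtain ⟨C, hC⟩ := hr.effects_bounded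
  obtain ⟨p, C', -, -, h⟩ := exists_shifterLaw hd hr
  refine ⟨2 * max C 1, by positivity, fun S => ?_⟩
  filter_upwards [hC S, h S] with ω hB hlaw i s
  have hσ : ∀ s, 0 ≤ (D S).sigmaSq (μ S) ω s := fun s => by
    rw [← hlaw.variance s]
    exact integral_nonneg fun _ => sq_nonneg _
  have hπ : ∀ i s, 0 ≤ (D S).w ω i s ^ 2 * (D S).sigmaSq (μ S) ω s := fun i s =>
    mul_nonneg (sq_nonneg _) (hσ s)
  have hπs : 0 ≤ ∑ i, ∑ s, (D S).w ω i s ^ 2 * (D S).sigmaSq (μ S) ω s :=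
    Finset.sum_nonneg fun i _ => Finset.sum_nonneg fun s _ => hπ i s
  have hβ : |(D S).beta (μ S) ω| ≤ max C 1 := by
    unfold ShiftShareData.beta
    rw [abs_div, abs_of_nonneg hπs]
    refine div_le_of_le_mul₀ hπs (by positivity) ?_
    rw [Finset.mul_sum]
    refine (Finset.abs_sum_le_sum_abs _ _).trans (Finset.sum_le_sum fun i _ => ?_)
    rw [Finset.mul_sum]
    refine (Finset.abs_sum_le_sum_abs _ _).trans (Finset.sum_le_sum fun s _ => ?_)
    rw [abs_mul, abs_of_nonneg (hπ i s), mul_comm]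
    exact mul_le_mul_of_nonneg_right ((hB i s).trans (le_max_left _ _)) (hπ i s)
  refine (abs_sub _ _).trans ?_
  have := (hB i s).trans (le_max_left C 1)
  linarith

/-- The deviations are not fixed by the shares and cannot be part of a weight matrix. Being bounded,
they are dominated by a constant before aggregation. -/
theorem FourthBdd.region_mul_effectDev (hd : ShiftShareDesign μ D γ)
    (hr : ShiftShareRegular μ D γ) {v : ∀ S, Ω S → Fin S → ℝ} (hv : FourthBdd μ D v) :
    FourthBdd μ D fun S ω i =>
      ∑ s, (D S).w ω i s * ((D S).effectDev (μ S) ω i s * v S ω s) := by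
  obtain ⟨C, hC, h⟩ := exists_abs_effectDev_le hd hr
  have hv' : FourthBdd μ D fun S ω s => |v S ω s| :=
    hv.mono (Eventually.of_forall fun _ _ => (abs_abs _).le)
  refine ((hv'.region hd).smul (IsBoundedOp.const C)).mono ?_
  filter_upwards [eventually_whp_of_ae_curried h, eventually_whp_of_ae_curried hd.share_nonneg]
    with x h1 h2 i
  refine le_trans ?_ (le_abs_self _)
  rw [Finset.mul_sum]
  refine (Finset.abs_sum_le_sum_abs _ _).trans (Finset.sum_le_sum fun s _ => ?_)
  rw [abs_mul, abs_of_nonneg (h2 i s), abs_mul, mul_left_comm]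
  have := h1 i s
  have := h2 i s
  gcongr

theorem outcome_sub_eq (S : ℕ) (ω : Ω S) (i : Fin (N S)) :
    ((D S).Y ω - (D S).beta (μ S) ω • (D S).X ω) i = (D S).Y0 ω i
      + ∑ s, (D S).w ω i s * ((D S).effectDev (μ S) ω i s * (D S).Xs ω s) + (D S).L ω i := by
  simp only [Pi.sub_apply, Pi.smul_apply, smul_eq_mul, ShiftShareData.Y, ShiftShareData.X_apply,
    ShiftShareData.effectDev, Finset.mul_sum]
  have : ∑ s, (D S).w ω i s * (D S).Xs ω s * (D S).B ω i s
      = ∑ s, (D S).w ω i s * (((D S).B ω i s - (D S).beta (μ S) ω) * (D S).Xs ω s)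
        + ∑ s, (D S).beta (μ S) ω * ((D S).w ω i s * (D S).Xs ω s) := by
    rw [← Finset.sum_add_distrib]
    exact Finset.sum_congr rfl fun s _ => by ring
  rw [this]
  ring

theorem fourthBdd_outcome_sub (hd : ShiftShareDesign μ D γ) (hr : ShiftShareRegular μ D γ) :
    FourthBdd μ D fun S ω => (D S).Y ω - (D S).beta (μ S) ω • (D S).X ω := by
  have := ((fourthBdd_Y0 hr).add ((fourthBdd_Xs hd hr).region_mul_effectDev hd hr)).add
    (fourthNeg_L hr).fourthBdd
  refine this.mono (Eventually.of_forall fun x i => ?_)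
  rw [outcome_sub_eq]

/-! ### Regression on the controls -/

section Gram

/-- The limit of `Z'Z/N` is positive definite, so inversion is continuous there and the Gram matrix
is invertible with probability tending to one. -/
theorem tendsto_gram_inv (hr : ShiftShareRegular μ D γ) :
    ∃ Q : Matrix (Fin K) (Fin K) ℝ,
      (∀ᶠ x : Σ S, Ω S in whp μ,
        IsUnit ((N x.1 : ℝ)⁻¹ • (((D x.1).Z x.2)ᵀ * (D x.1).Z x.2)).det) ∧
      ∀ k l, Tendsto (fun x : Σ S, Ω S =>
        ((N x.1 : ℝ)⁻¹ • (((D x.1).Z x.2)ᵀ * (D x.1).Z x.2))⁻¹ k l) (whp μ) (𝓝 (Q k l)) := by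
  obtain ⟨Q, hQ, hQt⟩ := hr.controls_gram
  have hdet : Q.det ≠ 0 := hQ.det_pos.ne'
  have hT : Tendsto (fun x : Σ S, Ω S =>
      (N x.1 : ℝ)⁻¹ • (((D x.1).Z x.2)ᵀ * (D x.1).Z x.2)) (whp μ) (𝓝 Q) := by
    refine tendsto_pi_nhds.2 fun k => tendsto_pi_nhds.2 fun l => ?_
    have h := (isLittleOp_iff_tendsto.1 (hQt k l)).add_const (Q k l)
    simpa using h
  refine ⟨Q⁻¹, ?_, fun k l => ?_⟩
  · have h1 := ((continuous_id.matrix_det (n := Fin K) (R := ℝ)).tendsto Q).comp hT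
    filter_upwards [h1.eventually_ne hdet] with x hx
    exact isUnit_iff_ne_zero.2 hx
  · have h2 : ContinuousAt Inv.inv Q := continuousAt_matrix_inv Q (by
      have : (Ring.inverse : ℝ → ℝ) = Inv.inv := by ext; simp
      rw [this]
      exact continuousAt_inv₀ hdet)
    have h3 := h2.tendsto.comp hT
    exact tendsto_pi_nhds.1 (tendsto_pi_nhds.1 h3 k) l

theorem isUnit_gram_of_smul {n : ℕ} {a : ℝ} {G : Matrix (Fin n) (Fin n) ℝ}
    (h : IsUnit (a • G).det) : IsUnit G.det ∧ G⁻¹ = a • (a • G)⁻¹ := by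
  have hG : IsUnit G.det := by
    rw [Matrix.det_smul] at h
    exact isUnit_of_mul_isUnit_right h
  refine ⟨hG, ?_⟩
  refine Matrix.inv_eq_left_inv ?_
  rw [Matrix.smul_mul, ← Matrix.mul_smul, Matrix.nonsing_inv_mul _ h]

theorem isUnit_gram (hr : ShiftShareRegular μ D γ) :
    ∀ᶠ x : Σ S, Ω S in whp μ, IsUnit (((D x.1).Z x.2)ᵀ * (D x.1).Z x.2).det := by
  obtain ⟨Q, h1, -⟩ := tendsto_gram_inv hr
  filter_upwards [h1] with x hx
  exact (isUnit_gram_of_smul hx).1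

theorem coefZ_eventually_eq (hr : ShiftShareRegular μ D γ) :
    ∀ᶠ x : Σ S, Ω S in whp μ, ∀ (A : Fin (N x.1) → ℝ) k, (D x.1).coefZ x.2 A k
      = ∑ l, ((N x.1 : ℝ)⁻¹ • (((D x.1).Z x.2)ᵀ * (D x.1).Z x.2))⁻¹ k l
        * ∑ i, (N x.1 : ℝ)⁻¹ * ((D x.1).Z x.2 i l * A i) := by
  obtain ⟨Q, h1, -⟩ := tendsto_gram_inv hr
  filter_upwards [h1] with x hx A k
  rw [ShiftShareData.coefZ, (isUnit_gram_of_smul hx).2]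
  simp only [mulVec, dotProduct, Matrix.smul_apply, smul_eq_mul, Matrix.transpose_apply,
    Finset.mul_sum]
  exact Finset.sum_congr rfl fun l _ => Finset.sum_congr rfl fun i _ => by ring

theorem isBoundedOp_coefZ (hd : ShiftShareDesign μ D γ) (hr : ShiftShareRegular μ D γ) {v : ∀ S, Ω S → Fin (N S) → ℝ} (hv : FourthBdd μ D v)
    (k : Fin K) : IsBoundedOp μ fun x => (D x.1).coefZ x.2 (v x.1 x.2) k := by
  obtain ⟨Q, -, h2⟩ := tendsto_gram_inv hr
  refine (IsBoundedOp.sum (s := Finset.univ) fun l _ => (IsBoundedOp.of_tendsto (h2 k l)).mul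
    ((fourthBdd_Z hd hr l).sum_mul hv (ShareWeight.average μ D))).mono ?_
  filter_upwards [coefZ_eventually_eq hr] with x hx
  rw [hx]

theorem tendsto_coefZ (hr : ShiftShareRegular μ D γ) {v : ∀ S, Ω S → Fin (N S) → ℝ}
    (hv : ∀ l, Tendsto (fun x : Σ S, Ω S => ∑ i, (N x.1 : ℝ)⁻¹ *
      ((D x.1).Z x.2 i l * v x.1 x.2 i)) (whp μ) (𝓝 0)) (k : Fin K) :
    Tendsto (fun x : Σ S, Ω S => (D x.1).coefZ x.2 (v x.1 x.2) k) (whp μ) (𝓝 0) := by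
  obtain ⟨Q, -, h2⟩ := tendsto_gram_inv hr
  have h := tendsto_finsetSum Finset.univ fun l _ => (h2 k l).mul (hv l)
  simp only [mul_zero, Finset.sum_const_zero] at h
  refine h.congr' ?_
  filter_upwards [coefZ_eventually_eq hr] with x hx
  rw [hx]

end Gram

/-- `δ` is a ratio of unconditional means, which the conditional moment assumptions do not control
directly. It is `δ̌` minus an error that tends to zero, and `δ̌` is a regression coefficient of a
variable with bounded moments. -/
theorem isBoundedOp_delta (hd : ShiftShareDesign μ D γ) (hr : ShiftShareRegular μ D γ) (k : Fin K) :
    IsBoundedOp μ fun x => (D x.1).delta (μ x.1) k := by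
  obtain ⟨q, hq, hO, -⟩ := hr.delta_rate
  have h1 := isBoundedOp_coefZ hd hr (fourthBdd_outcome_sub hd hr) k
  have h2 := IsBoundedOp.of_tendsto ((hO k).tendsto_zero hq)
  refine (h1.add (h2.const_mul (-1))).mono (Eventually.of_forall fun x => le_of_eq ?_)
  simp only [ShiftShareData.deltaCheck]
  congr 1
  ring

theorem FourthBdd.dotProduct {v : ∀ S, Ω S → ι S → Fin K → ℝ} {a : ∀ S, Ω S → Fin K → ℝ}
    (hv : ∀ k, FourthBdd μ D fun S ω i => v S ω i k)
    (ha : ∀ k, IsBoundedOp μ fun x => a x.1 x.2 k) :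
    FourthBdd μ D fun S ω i => v S ω i ⬝ᵥ a S ω := by
  have := FourthBdd.sum Finset.univ fun k _ => (hv k).smul (ha k)
  simpa only [_root_.dotProduct, mul_comm] using this

theorem FourthBdd.dotProduct_tendsto_zero {v : ∀ S, Ω S → ι S → Fin K → ℝ}
    {a : ∀ S, Ω S → Fin K → ℝ} (hv : ∀ k, FourthBdd μ D fun S ω i => v S ω i k)
    (ha : ∀ k, Tendsto (fun x : Σ S, Ω S => a x.1 x.2 k) (whp μ) (𝓝 0)) :
    FourthNeg μ D fun S ω i => v S ω i ⬝ᵥ a S ω := by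
  have := FourthNeg.sum Finset.univ fun k _ => (hv k).smul_tendsto_zero (ha k)
  simpa only [_root_.dotProduct, mul_comm] using this

theorem fourthBdd_errorMean (hd : ShiftShareDesign μ D γ) (hr : ShiftShareRegular μ D γ) :
    FourthBdd μ D fun S => (D S).errorMean (μ S) γ := by
  have h1 : FourthBdd μ D fun S ω s => (D S).Zs ω s ⬝ᵥ γ :=
    FourthBdd.dotProduct (v := fun S => (D S).Zs) (a := fun _ _ => γ) (fourthBdd_Zs hr)
      fun k => IsBoundedOp.const (γ k)
  have h2 : FourthBdd μ D fun S ω i => (D S).Z ω i ⬝ᵥ (D S).delta (μ S) :=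
    FourthBdd.dotProduct (v := fun S => (D S).Z) (a := fun S _ => (D S).delta (μ S))
      (fourthBdd_Z hd hr) (isBoundedOp_delta hd hr)
  exact ((fourthBdd_Y0 hr).add (h1.region_mul_effectDev hd hr)).sub h2

theorem fourthBdd_eps (hd : ShiftShareDesign μ D γ) (hr : ShiftShareRegular μ D γ) :
    FourthBdd μ D fun S => (D S).eps (μ S) := by
  have := (fourthBdd_outcome_sub hd hr).sub
    (FourthBdd.dotProduct (v := fun S => (D S).Z) (a := fun S _ => (D S).delta (μ S))
      (fourthBdd_Z hd hr) (isBoundedOp_delta hd hr))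
  refine this.mono (Eventually.of_forall fun x i => le_of_eq ?_)
  simp only [ShiftShareData.eps, ShiftShareData.residual, Pi.sub_apply, Pi.smul_apply, smul_eq_mul]
  congr 2
  ring

end DesignMoments

/-! ### Laws of large numbers for region averages -/

section IndependentSums

variable {Ω : Type*} [MeasurableSpace Ω] {P : Measure Ω} {n : ℕ}
  {X : Fin n → Ω → ℝ}

theorem integrable_mul_of_memLp_two {f g : Ω → ℝ} (hf : MemLp f 2 P) (hg : MemLp g 2 P) :
    Integrable (fun ω => f ω * g ω) P := hf.integrable_mul hg

theorem integral_mul_of_iIndepFun (hX : ∀ t, MemLp (X t) 2 P) (hind : iIndepFun X P)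
    (hmean : ∀ t, ∫ ω, X t ω ∂P = 0) (s t : Fin n) :
    ∫ ω, X s ω * X t ω ∂P = if s = t then ∫ ω, X t ω ^ 2 ∂P else 0 := by
  split_ifs with h
  · subst h
    simp only [pow_two]
  · have := (hind.indepFun h).integral_mul_eq_mul_integral (hX s).aestronglyMeasurable
      (hX t).aestronglyMeasurable
    simp only [Pi.mul_apply] at this
    rw [this, hmean, zero_mul]

/-- For independent centred variables only the diagonal of the double sum survives, and the constant
`y` drops out. -/
theorem integral_sum_mul_affine [IsProbabilityMeasure P] (hX : ∀ t, MemLp (X t) 2 P) (hind : iIndepFun X P)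
    (hmean : ∀ t, ∫ ω, X t ω ∂P = 0) (a c : Fin n → ℝ) (y : ℝ) :
    Integrable (fun ω => (∑ t, a t * X t ω) * (y + ∑ t, c t * X t ω)) P ∧
    ∫ ω, (∑ t, a t * X t ω) * (y + ∑ t, c t * X t ω) ∂P
      = ∑ t, a t * c t * ∫ ω, X t ω ^ 2 ∂P := by
  have hXi : ∀ t, Integrable (X t) P := fun t => (hX t).integrable (by norm_num)
  have e : ∀ ω, (∑ t, a t * X t ω) * (y + ∑ t, c t * X t ω)
      = ∑ s, (a s * y * X s ω + ∑ t, a s * c t * (X s ω * X t ω)) := by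
    intro ω
    rw [Finset.sum_mul]
    refine Finset.sum_congr rfl fun s _ => ?_
    rw [mul_add, Finset.mul_sum]
    congr 1
    · ring
    · exact Finset.sum_congr rfl fun t _ => by ring
  have hi : ∀ s, Integrable (fun ω => a s * y * X s ω + ∑ t, a s * c t * (X s ω * X t ω)) P :=
    fun s => ((hXi s).const_mul _).add (integrable_finsetSum _ fun t _ =>
      (integrable_mul_of_memLp_two (hX s) (hX t)).const_mul _)
  simp only [e]
  refine ⟨integrable_finsetSum _ fun s _ => hi s, ?_⟩
  rw [integral_finsetSum _ fun s _ => hi s]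
  refine Finset.sum_congr rfl fun s _ => ?_
  rw [integral_add ((hXi s).const_mul _) (integrable_finsetSum _ fun t _ =>
      (integrable_mul_of_memLp_two (hX s) (hX t)).const_mul _), integral_const_mul, hmean,
    integral_finsetSum _ fun t _ => (integrable_mul_of_memLp_two (hX s) (hX t)).const_mul _]
  simp only [integral_const_mul, integral_mul_of_iIndepFun hX hind hmean, mul_zero, zero_add,
    mul_ite, Finset.sum_ite_eq, Finset.mem_univ, if_true]

end IndependentSums

namespace ShiftShareData.ShifterLaw

variable {Ω : Type*} [mΩ : MeasurableSpace Ω] {N S K : ℕ} {D : ShiftShareData Ω N S K}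
  {γ : Fin K → ℝ} {p C : ℝ} {ω : Ω} {P : Measure Ω} {σ : Fin S → ℝ}

theorem memLp_four (h : D.ShifterLaw γ p C ω P σ) (s : Fin S) :
    MemLp (fun ω' => D.Xtilde γ ω' s) 4 P := by
  refine ⟨(D.measurable_Xtilde γ s).aestronglyMeasurable, ?_⟩
  rw [eLpNorm_lt_top_iff_lintegral_rpow_enorm_lt_top (by norm_num) (by norm_num)]
  refine lt_of_le_of_lt (le_of_eq ?_) ((h.fourth s).trans_lt ENNReal.ofReal_lt_top)
  refine lintegral_congr fun ω' => ?_
  have e4 : (4 : ENNReal).toReal = ((4 : ℕ) : ℝ) := by norm_num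
  rw [e4, ENNReal.rpow_natCast, Real.enorm_eq_ofReal_abs, ← ENNReal.ofReal_pow (abs_nonneg _),
    Even.pow_abs (by decide)]

theorem memLp_two [IsProbabilityMeasure P] (h : D.ShifterLaw γ p C ω P σ) (s : Fin S) :
    MemLp (fun ω' => D.Xtilde γ ω' s) 2 P := (h.memLp_four s).mono_exponent (by norm_num)

theorem sigma_nonneg (h : D.ShifterLaw γ p C ω P σ) (s : Fin S) : 0 ≤ σ s := by
  rw [← h.variance s]
  exact integral_nonneg fun _ => sq_nonneg _

end ShiftShareData.ShifterLaw

section Averages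

variable {Ω : ℕ → Type*} [mΩ : ∀ S, MeasurableSpace (Ω S)] [∀ S, StandardBorelSpace (Ω S)]
  {μ : ∀ S, Measure (Ω S)} [∀ S, IsProbabilityMeasure (μ S)] {N : ℕ → ℕ} {K : ℕ}
  {D : ∀ S, ShiftShareData (Ω S) (N S) S K} {γ : Fin K → ℝ}

/-- Averages of squares of region variables that are affine in the recentred shifters. -/
theorem tendsto_average_sq_sub (hd : ShiftShareDesign μ D γ) (hr : ShiftShareRegular μ D γ)
    {y : ∀ S, Ω S → Fin (N S) → ℝ} {e : ∀ S, Ω S → Fin (N S) → Fin S → ℝ} {C : ℝ} (hC : 0 ≤ C)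
    (hym : ∀ S i, Measurable fun ω => y S ω i) (hem : ∀ S i t, Measurable fun ω => e S ω i t)
    (hyc : ∀ S, ∀ᵐ ω ∂μ S, ∀ᵐ ω' ∂condExpKernel (μ S) (D S).F0 ω, y S ω' = y S ω ∧ e S ω' = e S ω)
    (he : ∀ S, ∀ᵐ ω ∂μ S, ∀ i t, |e S ω i t| ≤ C) (hy : FourthBdd μ D y) :
    Tendsto (fun x : Σ S, Ω S =>
      (∑ i, (N x.1 : ℝ)⁻¹ * (y x.1 x.2 i
          + ∑ t, (D x.1).w x.2 i t * e x.1 x.2 i t * (D x.1).Xtilde γ x.2 t) ^ 2)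
      - ∫ ω', (∑ i, (N x.1 : ℝ)⁻¹ * (y x.1 ω' i
          + ∑ t, (D x.1).w ω' i t * e x.1 ω' i t * (D x.1).Xtilde γ ω' t) ^ 2)
          ∂condExpKernel (μ x.1) (D x.1).F0 x.2) (whp μ) (𝓝 0) := by
  obtain ⟨p, Cp, hp, hCp, hlaw⟩ := exists_shifterLaw hd hr
  have hmax := (isLittleOp_iff_tendsto.1 hd.sector_size).abs
  rw [abs_zero] at hmax
  have hY := hy _ (ShareWeight.average μ D)
  -- The first affine form is the constant `1`, so the law of large numbers for products of squares
  -- gives one for squares. The column sums are `n_t / N` up to the constant `C`.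
  have key := tendsto_affineProdSq_sub_condExp (m := fun S => (D S).F0) (μ := μ)
    (fun S => (D S).F0_le) (X := fun S => (D S).Xtilde γ) (fun S t => by fun_prop) hp hCp hC
    (fun S => (hlaw S).mono fun ω h => h.indep) (fun S => (hlaw S).mono fun ω h => h.integrable)
    (fun S => (hlaw S).mono fun ω h => h.moment)
    (h := fun S _ _ => (N S : ℝ)⁻¹) (e := fun _ _ _ => 1) (y := y) (b := fun _ _ _ _ => 0)
    (c := fun S ω i t => (D S).w ω i t * e S ω i t)
    (hmax := fun x => |(⨆ s, (D x.1).n x.2 s) / (N x.1 : ℝ)|)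
    (fun S => by unfold affineProdSq; fun_prop) (fun S => ?_) (fun x => abs_nonneg _)
    (ShareWeight.average μ D).nonneg (ShareWeight.average μ D).sum_le (by simp)
    (fun S => Eventually.of_forall fun ω k => by simpa using hC) (fun S => ?_) (fun S => ?_) hmax
    hY
  · simp only [affineProdSq, zero_mul, Finset.sum_const_zero, add_zero, one_pow, one_mul] at key
    exact key
  · filter_upwards [hyc S, (D S).ae_kernel_F0_const (μ S)] with ω h1 h2
    filter_upwards [h1, h2] with ω' h1 h2
    refine ⟨rfl, rfl, h1.1, rfl, ?_⟩
    simp only [h1.2, h2.2.2.2.2.1]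
  · filter_upwards [he S, hd.share_nonneg S, hd.share_sum_le S] with ω h1 h2 h3 i
    calc ∑ t, |(D S).w ω i t * e S ω i t| ≤ ∑ t, (D S).w ω i t * C := by
          refine Finset.sum_le_sum fun t _ => ?_
          rw [abs_mul, abs_of_nonneg (h2 i t)]
          exact mul_le_mul_of_nonneg_left (h1 i t) (h2 i t)
      _ = (∑ t, (D S).w ω i t) * C := by rw [Finset.sum_mul]
      _ ≤ C := mul_le_of_le_one_left hC (h3 i)
  · filter_upwards [he S, hd.share_nonneg S] with ω h1 h2 t
    simp only [abs_zero, zero_add]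
    calc ∑ i, (N S : ℝ)⁻¹ * |(D S).w ω i t * e S ω i t|
        ≤ ∑ i, (N S : ℝ)⁻¹ * ((D S).w ω i t * C) := by
          refine Finset.sum_le_sum fun i _ => mul_le_mul_of_nonneg_left ?_ (by positivity)
          rw [abs_mul, abs_of_nonneg (h2 i t)]
          exact mul_le_mul_of_nonneg_left (h1 i t) (h2 i t)
      _ = C * ((D S).n ω t / N S) := by
          rw [ShiftShareData.n, ← Finset.mul_sum, ← Finset.sum_mul]
          ring
      _ ≤ C * |(⨆ s, (D S).n ω s) / (N S : ℝ)| := by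
          refine mul_le_mul_of_nonneg_left (le_trans ?_ (le_abs_self _)) hC
          gcongr
          exact le_ciSup (f := fun s => (D S).n ω s) (Set.finite_range _).bddAbove t

/-- Averages of products of `Ẋ` with region variables affine in the recentred shifters. -/
theorem tendsto_average_Xdot_mul_sub (hd : ShiftShareDesign μ D γ) (hr : ShiftShareRegular μ D γ)
    {y : ∀ S, Ω S → Fin (N S) → ℝ} {e : ∀ S, Ω S → Fin (N S) → Fin S → ℝ} {C : ℝ} (hC : 0 ≤ C)
    (hym : ∀ S i, Measurable fun ω => y S ω i) (hem : ∀ S i t, Measurable fun ω => e S ω i t)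
    (hyc : ∀ S, ∀ᵐ ω ∂μ S, ∀ᵐ ω' ∂condExpKernel (μ S) (D S).F0 ω, y S ω' = y S ω ∧ e S ω' = e S ω)
    (he : ∀ S, ∀ᵐ ω ∂μ S, ∀ i t, |e S ω i t| ≤ C) (hy : FourthBdd μ D y) :
    Tendsto (fun x : Σ S, Ω S =>
      (∑ i, (N x.1 : ℝ)⁻¹ * ((D x.1).Xdot γ x.2 i * (y x.1 x.2 i
          + ∑ t, (D x.1).w x.2 i t * e x.1 x.2 i t * (D x.1).Xtilde γ x.2 t)))
      - ∑ i, (N x.1 : ℝ)⁻¹ * ∑ t, (D x.1).w x.2 i t * ((D x.1).w x.2 i t * e x.1 x.2 i t)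
          * (D x.1).sigmaSq (μ x.1) x.2 t) (whp μ) (𝓝 0) := by
  have h1 := tendsto_average_sq_sub hd hr (y := y) (e := fun S ω i t => 1 + e S ω i t)
    (C := 1 + C) (by linarith) hym (fun S i t => by fun_prop)
    (fun S => by
      filter_upwards [hyc S] with ω h
      filter_upwards [h] with ω' h
      exact ⟨h.1, by simp only [h.2]⟩)
    (fun S => by
      filter_upwards [he S] with ω h i t
      refine (abs_add_le _ _).trans ?_
      rw [abs_one]
      linarith [h i t]) hy
  have h2 := tendsto_average_sq_sub hd hr (y := fun S ω i => - y S ω i)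
    (e := fun S ω i t => 1 - e S ω i t)
    (C := 1 + C) (by linarith) (fun S i => (hym S i).neg) (fun S i t => by fun_prop)
    (fun S => by
      filter_upwards [hyc S] with ω h
      filter_upwards [h] with ω' h
      exact ⟨by simp only [h.1], by simp only [h.2]⟩)
    (fun S => by
      filter_upwards [he S] with ω h i t
      refine (abs_sub _ _).trans ?_
      rw [abs_one]
      linarith [h i t]) hy.neg
  -- Polarisation: the product of `Ẋ` with `y + ∑ w e 𝒳̃` is a quarter of the difference of the
  -- squares of `Ẋ ± (y + ∑ w e 𝒳̃)`.
  have h3 := (h1.sub h2).const_mul (1 / 4)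
  rw [sub_zero, mul_zero] at h3
  refine h3.congr' ?_
  obtain ⟨p, Cp, hp, hCp, hlaw⟩ := exists_shifterLaw hd hr
  filter_upwards [eventually_whp_of_ae_curried hlaw, eventually_whp_of_ae_curried hyc,
    eventually_whp_of_ae_curried fun S => (D S).ae_kernel_F0_const (μ S)] with x hx hyx hwx
  obtain ⟨S, ω⟩ := x
  simp only at hx hyx hwx ⊢
  set P := condExpKernel (μ S) (D S).F0 ω
  have hpt : ∀ ω', (∑ i, (N S : ℝ)⁻¹ * (y S ω' i
        + ∑ t, (D S).w ω' i t * (1 + e S ω' i t) * (D S).Xtilde γ ω' t) ^ 2)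
      - (∑ i, (N S : ℝ)⁻¹ * (- y S ω' i
        + ∑ t, (D S).w ω' i t * (1 - e S ω' i t) * (D S).Xtilde γ ω' t) ^ 2)
      = 4 * ∑ i, (N S : ℝ)⁻¹ * ((D S).Xdot γ ω' i * (y S ω' i
          + ∑ t, (D S).w ω' i t * e S ω' i t * (D S).Xtilde γ ω' t)) := by
    intro ω'
    rw [← Finset.sum_sub_distrib, Finset.mul_sum]
    refine Finset.sum_congr rfl fun i _ => ?_
    have e1 : ∑ t, (D S).w ω' i t * (1 + e S ω' i t) * (D S).Xtilde γ ω' t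
        = (D S).Xdot γ ω' i + ∑ t, (D S).w ω' i t * e S ω' i t * (D S).Xtilde γ ω' t := by
      rw [ShiftShareData.Xdot, ← Finset.sum_add_distrib]
      exact Finset.sum_congr rfl fun t _ => by ring
    have e2 : ∑ t, (D S).w ω' i t * (1 - e S ω' i t) * (D S).Xtilde γ ω' t
        = (D S).Xdot γ ω' i - ∑ t, (D S).w ω' i t * e S ω' i t * (D S).Xtilde γ ω' t := by
      rw [ShiftShareData.Xdot, ← Finset.sum_sub_distrib]
      exact Finset.sum_congr rfl fun t _ => by ring
    rw [e1, e2]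
    ring
  have hsq : ∀ (u : Ω S → Fin (N S) → ℝ) (a : Ω S → Fin (N S) → Fin S → ℝ),
      (∀ᵐ ω' ∂P, u ω' = u ω ∧ a ω' = a ω) → Integrable (fun ω' => ∑ i, (N S : ℝ)⁻¹ * (u ω' i
        + ∑ t, (D S).w ω' i t * a ω' i t * (D S).Xtilde γ ω' t) ^ 2) P := by
    intro u a hua
    have hi : Integrable (fun ω' => ∑ i, (N S : ℝ)⁻¹ * (u ω i
        + ∑ t, (D S).w ω i t * a ω i t * (D S).Xtilde γ ω' t) ^ 2) P := by
      refine integrable_finsetSum _ fun i _ => Integrable.const_mul ?_ _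
      refine MemLp.integrable_sq ?_
      have h1 : MemLp (fun ω' => ∑ t, (D S).w ω i t * a ω i t * (D S).Xtilde γ ω' t) 2 P :=
        memLp_finsetSum _ fun t _ => (hx.memLp_two t).const_mul _
      exact (memLp_const (u ω i)).add h1
    refine hi.congr ?_
    filter_upwards [hua, hwx] with ω' h1 h2
    rw [h1.1, h1.2, h2.2.2.2.2.1]
  have hi1 := hsq (y S) (fun ω' i t => 1 + e S ω' i t) (by
    filter_upwards [hyx] with ω' h
    exact ⟨h.1, by simp only [h.2]⟩)
  have hi2 := hsq (fun ω' i => - y S ω' i) (fun ω' i t => 1 - e S ω' i t) (by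
    filter_upwards [hyx] with ω' h
    exact ⟨by simp only [h.1], by simp only [h.2]⟩)
  -- The conditional mean of the product is the diagonal sum, since the shifters are centred and
  -- independent given `ℱ₀`.
  have hprod : ∫ ω', ∑ i, (N S : ℝ)⁻¹ * ((D S).Xdot γ ω' i * (y S ω' i
          + ∑ t, (D S).w ω' i t * e S ω' i t * (D S).Xtilde γ ω' t)) ∂P
      = ∑ i, (N S : ℝ)⁻¹ * ∑ t, (D S).w ω i t * ((D S).w ω i t * e S ω i t)
          * (D S).sigmaSq (μ S) ω t := by
    have hb := fun i => integral_sum_mul_affine hx.memLp_two hx.indep hx.mean ((D S).w ω i)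
      (fun t => (D S).w ω i t * e S ω i t) (y S ω i)
    have h4 : ∫ ω', ∑ i, (N S : ℝ)⁻¹ * ((D S).Xdot γ ω' i * (y S ω' i
          + ∑ t, (D S).w ω' i t * e S ω' i t * (D S).Xtilde γ ω' t)) ∂P
        = ∫ ω', ∑ i, (N S : ℝ)⁻¹ * ((∑ t, (D S).w ω i t * (D S).Xtilde γ ω' t) * (y S ω i
          + ∑ t, (D S).w ω i t * e S ω i t * (D S).Xtilde γ ω' t)) ∂P := by
      refine integral_congr_ae ?_
      filter_upwards [hyx, hwx] with ω' h1 h2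
      simp only [ShiftShareData.Xdot, h1.1, h1.2, h2.2.2.2.2.1]
    rw [h4, integral_finsetSum _ fun i _ => (hb i).1.const_mul _]
    refine Finset.sum_congr rfl fun i _ => ?_
    rw [integral_const_mul, (hb i).2]
    simp only [hx.variance]
  have hI := integral_sub hi1 hi2
  rw [integral_congr_ae (Eventually.of_forall hpt), integral_const_mul, hprod] at hI
  have h5 := hpt ω
  linarith

end Averages

/-! ### Estimated shifters, residuals and OLS coefficients -/

namespace ShiftShareData

variable {Ω : Type*} [mΩ : MeasurableSpace Ω] {N S K : ℕ} (D : ShiftShareData Ω N S K)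

theorem coefZ_add (ω : Ω) (A A' : Fin N → ℝ) : D.coefZ ω (A + A') = D.coefZ ω A + D.coefZ ω A' := by
  simp only [coefZ, Matrix.mulVec_add]

theorem coefZ_smul (ω : Ω) (a : ℝ) (A : Fin N → ℝ) : D.coefZ ω (a • A) = a • D.coefZ ω A := by
  simp only [coefZ, Matrix.mulVec_smul]

theorem coefZ_mulVec {ω : Ω} (h : IsUnit ((D.Z ω)ᵀ * D.Z ω).det) (v : Fin K → ℝ) :
    D.coefZ ω (D.Z ω *ᵥ v) = v := by
  rw [coefZ, Matrix.mulVec_mulVec, Matrix.mulVec_mulVec, Matrix.mul_assoc,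
    Matrix.nonsing_inv_mul _ h, Matrix.one_mulVec]

/-- `X = Ẋ - U'γ + Zγ`, and regression on `Z` reproduces the last term exactly. -/
theorem coefZ_X_sub {ω : Ω} (h : IsUnit ((D.Z ω)ᵀ * D.Z ω).det) (γ : Fin K → ℝ) :
    D.coefZ ω (D.X ω) - γ = D.coefZ ω fun i => D.Xdot γ ω i - D.Ugamma γ ω i := by
  have e : D.X ω = (fun i => D.Xdot γ ω i - D.Ugamma γ ω i) + D.Z ω *ᵥ γ := by
    ext i
    rw [D.X_eq γ]
    rfl
  rw [e, coefZ_add, coefZ_mulVec D h, add_sub_cancel_right]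

theorem Xddot_eq (γ : Fin K → ℝ) (ω : Ω) (i : Fin N) :
    D.Xddot ω i = D.Xdot γ ω i
      - (D.Ugamma γ ω i + D.Z ω i ⬝ᵥ (D.coefZ ω (D.X ω) - γ)) := by
  have : (D.Z ω *ᵥ D.coefZ ω (D.X ω)) i = D.Z ω i ⬝ᵥ D.coefZ ω (D.X ω) := rfl
  rw [Xddot, Pi.sub_apply, this, D.X_eq γ, dotProduct_sub]
  ring

theorem transpose_mulVec_Xddot {ω : Ω} (h : IsUnit ((D.Z ω)ᵀ * D.Z ω).det) :
    (D.Z ω)ᵀ *ᵥ D.Xddot ω = 0 := by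
  rw [Xddot, Matrix.mulVec_sub, coefZ, Matrix.mulVec_mulVec, Matrix.mulVec_mulVec,
    Matrix.mulVec_mulVec, Matrix.mul_nonsing_inv _ h, Matrix.one_mul, sub_self]

theorem Xddot_dotProduct_mulVec {ω : Ω} (h : IsUnit ((D.Z ω)ᵀ * D.Z ω).det) (v : Fin K → ℝ) :
    D.Xddot ω ⬝ᵥ (D.Z ω *ᵥ v) = 0 := by
  rw [Matrix.dotProduct_mulVec, ← Matrix.mulVec_transpose, D.transpose_mulVec_Xddot h,
    zero_dotProduct]

/-- Partialling out: `Ẍ` is orthogonal to the columns of `Z`, so only the component of `X` along `Ẍ`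
and the error remain. -/
theorem betaHat_sub (μ : Measure Ω) {ω : Ω} (h : IsUnit ((D.Z ω)ᵀ * D.Z ω).det)
    (h0 : D.Xddot ω ⬝ᵥ D.Xddot ω ≠ 0) :
    D.betaHat ω - D.beta μ ω = (D.Xddot ω ⬝ᵥ D.eps μ ω) / (D.Xddot ω ⬝ᵥ D.Xddot ω) := by
  have e : D.Y ω = D.eps μ ω + D.beta μ ω • (D.Xddot ω + D.Z ω *ᵥ D.coefZ ω (D.X ω))
      + D.Z ω *ᵥ D.delta μ := by
    ext i
    have : (D.Z ω *ᵥ D.delta μ) i = D.Z ω i ⬝ᵥ D.delta μ := rfl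
    simp only [Xddot, sub_add_cancel, Pi.add_apply, Pi.smul_apply, smul_eq_mul, this, eps,
      residual]
    ring
  rw [betaHat, e, dotProduct_add, dotProduct_add, dotProduct_smul, dotProduct_add,
    D.Xddot_dotProduct_mulVec h, D.Xddot_dotProduct_mulVec h, add_zero, add_zero, add_div,
    smul_eq_mul, mul_div_cancel_right₀ _ h0, add_sub_cancel_right]

theorem deltaHat_eq (μ : Measure Ω) (ω : Ω) :
    D.deltaHat ω = D.deltaCheck μ ω - (D.betaHat ω - D.beta μ ω) • D.coefZ ω (D.X ω) := by
  have e : D.Y ω - D.betaHat ω • D.X ω = (D.Y ω - D.beta μ ω • D.X ω)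
      + (-(D.betaHat ω - D.beta μ ω)) • D.X ω := by
    ext i
    simp only [Pi.sub_apply, Pi.smul_apply, Pi.add_apply, smul_eq_mul]
    ring
  rw [deltaHat, e, coefZ_add, coefZ_smul, deltaCheck, neg_smul, ← sub_eq_add_neg]

theorem measurable_matrix_inv_apply {n : ℕ} {G : Ω → Matrix (Fin n) (Fin n) ℝ}
    (hG : ∀ i j, Measurable fun ω => G ω i j) (i j : Fin n) :
    Measurable fun ω => (G ω)⁻¹ i j := by
  have hdet : ∀ {G : Ω → Matrix (Fin n) (Fin n) ℝ}, (∀ i j, Measurable fun ω => G ω i j) →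
      Measurable fun ω => (G ω).det := by
    intro G hG
    simp only [Matrix.det_apply]
    refine Finset.measurable_fun_sum _ fun σ _ => ?_
    exact (Finset.measurable_fun_prod _ fun i _ => hG _ _).const_smul _
  simp only [Matrix.inv_def, Matrix.smul_apply, Ring.inverse_eq_inv', smul_eq_mul,
    Matrix.adjugate_apply]
  refine (hdet hG).inv.mul (hdet fun k l => ?_)
  simp only [Matrix.updateRow_apply]
  split_ifs
  · exact measurable_const
  · exact hG k l

@[fun_prop]
theorem measurable_Wplus (s : Fin S) (i : Fin N) : Measurable fun ω => D.Wplus ω s i := by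
  simp only [Wplus, Matrix.mul_apply, Matrix.transpose_apply]
  refine Finset.measurable_fun_sum _ fun t _ => Measurable.mul ?_ (D.measurable_w_apply i t)
  refine measurable_matrix_inv_apply (fun s t => ?_) s t
  simp only [Matrix.mul_apply, Matrix.transpose_apply, W, Matrix.of_apply]
  fun_prop

theorem sum_share_div_mul (ω : Ω) (s : Fin S) (v : Fin N → ℝ) :
    ∑ i, D.w ω i s / D.n ω s * v i = (∑ i, D.w ω i s * v i) / D.n ω s := by
  rw [Finset.sum_div]
  exact Finset.sum_congr rfl fun i _ => by ring

end ShiftShareData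

section Estimation

variable {Ω : ℕ → Type*} [mΩ : ∀ S, MeasurableSpace (Ω S)] [∀ S, StandardBorelSpace (Ω S)]
  {μ : ∀ S, Measure (Ω S)} [∀ S, IsProbabilityMeasure (μ S)] {N : ℕ → ℕ} {K : ℕ}
  {D : ∀ S, ShiftShareData (Ω S) (N S) S K} {γ : Fin K → ℝ}

theorem tendsto_average_Xdot_mul_Z (hd : ShiftShareDesign μ D γ) (hr : ShiftShareRegular μ D γ)
    (k : Fin K) : Tendsto (fun x : Σ S, Ω S =>
      ∑ i, (N x.1 : ℝ)⁻¹ * ((D x.1).Xdot γ x.2 i * (D x.1).Z x.2 i k)) (whp μ) (𝓝 0) := by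
  have h := tendsto_average_Xdot_mul_sub hd hr (y := fun S ω i => (D S).Z ω i k)
    (e := fun _ _ _ _ => 0) (C := 0) le_rfl (fun S i => by fun_prop)
    (fun S i t => measurable_const)
    (fun S => by
      filter_upwards [(D S).ae_kernel_F0_const (μ S)] with ω h
      filter_upwards [h] with ω' h
      refine ⟨?_, rfl⟩
      simp only [ShiftShareData.Z_apply, h.1, h.2.1, h.2.2.2.2.1])
    (fun S => by simp) (fourthBdd_Z hd hr k)
  simpa only [mul_zero, zero_mul, Finset.sum_const_zero, add_zero, sub_zero] using h

/-- `γ̂ - γ` is the regression coefficient of `Ẋ - U'γ` on `Z`. The controls are fixed by `ℱ₀` and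
`Ẋ` is centred given `ℱ₀`, so they are asymptotically uncorrelated; the noise part is negligible in
fourth mean. -/
theorem tendsto_gammaHat_sub (hd : ShiftShareDesign μ D γ) (hr : ShiftShareRegular μ D γ)
    (hc : ShifterRecovery μ D γ) (k : Fin K) : Tendsto (fun x : Σ S, Ω S =>
      ((D x.1).coefZ x.2 ((D x.1).X x.2) - γ) k) (whp μ) (𝓝 0) := by
  have h := tendsto_coefZ hr (v := fun S ω i => (D S).Xdot γ ω i - (D S).Ugamma γ ω i)
    (fun l => by
      have h1 := (tendsto_average_Xdot_mul_Z hd hr l).sub ((fourthBdd_Z hd hr l).sum_mul_fourthNeg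
        (fourthNeg_Ugamma hr hc) (ShareWeight.average μ D))
      rw [sub_zero] at h1
      refine h1.congr fun x => ?_
      rw [← Finset.sum_sub_distrib]
      exact Finset.sum_congr rfl fun i _ => by ring) k
  refine h.congr' ?_
  filter_upwards [isUnit_gram hr] with x hx
  rw [(D x.1).coefZ_X_sub hx]

/-- Each error term is either a consistent coefficient times a variable with bounded moments, or the
image under `(W'W)⁻¹W'` of a negligible region variable. -/
theorem fourthNeg_Xhat_sub (hd : ShiftShareDesign μ D γ) (hr : ShiftShareRegular μ D γ)
    (hc : ShifterRecovery μ D γ) :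
    FourthNeg μ D fun S ω s => (D S).Xtilde γ ω s - (D S).Xhat ω s := by
  have hζ := tendsto_gammaHat_sub hd hr hc
  have h1 : FourthNeg μ D fun S ω s => (D S).Zs ω s ⬝ᵥ ((D S).coefZ ω ((D S).X ω) - γ) :=
    FourthBdd.dotProduct_tendsto_zero (v := fun S => (D S).Zs)
      (a := fun S ω => (D S).coefZ ω ((D S).X ω) - γ) (fourthBdd_Zs hr) hζ
  have hU : FourthNeg μ D fun S ω i => (D S).U ω i ⬝ᵥ ((D S).coefZ ω ((D S).X ω) - γ) :=
    FourthBdd.dotProduct_tendsto_zero (v := fun S => (D S).U)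
      (a := fun S ω => (D S).coefZ ω ((D S).X ω) - γ) (fourthBdd_U hr) hζ
  -- Handles both alternatives of the recovery assumption: bounded absolute row sums of `(W'W)⁻¹W'`,
  -- or no noise, in which case `v` vanishes.
  have hplus : ∀ v : ∀ S, Ω S → Fin (N S) → ℝ, FourthNeg μ D v →
      (∀ S ω i, (∀ k, (D S).U ω i k = 0) → v S ω i = 0) →
      FourthNeg μ D fun S ω s => ∑ i, (D S).Wplus ω s i * v S ω i := by
    intro v hv hv0
    rcases hc.noise with ⟨⟨C, hC⟩, -⟩ | h
    · refine hv.aggregate (c := max C 1) (by positivity) (A := fun S ω s i => (D S).Wplus ω s i)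
        (fun S s i => by fun_prop) (fun S ω ω' h => ?_) fun S => ?_
      · simp only [ShiftShareData.Wplus, ShiftShareData.W, h]
      · filter_upwards [hC S] with ω hω s
        exact (hω s).trans (le_max_left _ _)
    · refine fourthNeg_zero.mono ?_
      filter_upwards [eventually_whp_of_ae_curried h] with x hx s
      simp [fun i => hv0 x.1 x.2 i (hx i)]
  have h2 := hplus _ (fourthNeg_Ugamma hr hc) fun S ω i h => by
    simp [ShiftShareData.Ugamma, dotProduct, h]
  have h3 := hplus _ hU fun S ω i h => by simp [dotProduct, h]
  refine ((h1.add h2).add h3).mono ?_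
  filter_upwards [eventually_whp_of_ae_curried hc.full_rank] with x hx s
  rw [(D x.1).Xhat_eq γ hx]
  refine le_of_eq (congrArg _ ?_)
  ring

/-- The variance estimator may be evaluated at the true recentred shifters and errors. -/
theorem tendsto_Vhat_sub (hd : ShiftShareDesign μ D γ) (hr : ShiftShareRegular μ D γ)
    (hc : ShifterRecovery μ D γ) {b : ∀ S, Ω S → ℝ} {d : ∀ S, Ω S → Fin K → ℝ}
    (hbd : ConsistentFor μ D b d) :
    Tendsto (fun x : Σ S, Ω S => (D x.1).Vhat (b x.1 x.2) (d x.1 x.2) x.2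
      - (D x.1).r x.2 * ∑ s, (D x.1).Xtilde γ x.2 s ^ 2 * (D x.1).R (μ x.1) x.2 s ^ 2)
      (whp μ) (𝓝 0) := by
  obtain ⟨hb1, hb2⟩ := hbd
  have hres : FourthNeg μ D fun S ω i =>
      (D S).eps (μ S) ω i - (D S).residual (b S ω) (d S ω) ω i := by
    have hβ := isLittleOp_iff_tendsto.1 hb1
    have hδ := fun k => isLittleOp_iff_tendsto.1 (hb2 k)
    have h1 := (fourthBdd_X hd hr).smul_tendsto_zero hβ
    have h2 : FourthNeg μ D fun S ω i => (D S).Z ω i ⬝ᵥ (d S ω - (D S).delta (μ S)) :=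
      FourthBdd.dotProduct_tendsto_zero (v := fun S => (D S).Z)
        (a := fun S ω => d S ω - (D S).delta (μ S)) (fourthBdd_Z hd hr)
        hδ
    have h3 := h1.add h2
    refine h3.mono (Eventually.of_forall fun x i => ?_)
    have e : (D x.1).eps (μ x.1) x.2 i - (D x.1).residual (b x.1 x.2) (d x.1 x.2) x.2 i
        = (b x.1 x.2 - (D x.1).beta (μ x.1) x.2) * (D x.1).X x.2 i
          + (D x.1).Z x.2 i ⬝ᵥ (d x.1 x.2 - (D x.1).delta (μ x.1)) := by
      simp only [ShiftShareData.eps, ShiftShareData.residual, dotProduct_sub]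
      ring
    exact (congrArg abs e).le
  have hmean := hres.sectorMean hd
  have key := tendsto_sum_sq_mul_sq_sub (ShareWeight.sector μ D) (fourthBdd_Xtilde hd hr)
    ((fourthBdd_eps hd hr).sectorMean hd) (fourthNeg_Xhat_sub hd hr hc)
    (Q' := fun S ω s => ∑ i, (D S).w ω i s / (D S).n ω s * (D S).residual (b S ω) (d S ω) ω i)
    (by simpa only [← Finset.sum_sub_distrib, ← mul_sub] using hmean)
  have key' := key.neg
  rw [neg_zero] at key'
  refine key'.congr' ?_
  filter_upwards [eventually_whp_of_ae_curried hc.full_rank,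
    eventually_whp_of_ae_curried hd.share_nonneg] with x hx h0
  have hn := (D x.1).n_pos hx h0
  -- The factors `n_s²` in the weights cancel the normalisation of the sector means, because every
  -- `n_s` is positive.
  simp only [ShiftShareData.sum_share_div_mul]
  rw [ShiftShareData.Vhat, Finset.mul_sum, Finset.mul_sum, ← Finset.sum_sub_distrib,
    ← Finset.sum_neg_distrib]
  refine Finset.sum_congr rfl fun s _ => ?_
  have := (hn s).ne'
  rw [ShiftShareData.Rhat, ShiftShareData.R]
  field_simp
  ring

/-! Consistency of OLS -/

theorem fourthNeg_Xddot_error (hd : ShiftShareDesign μ D γ) (hr : ShiftShareRegular μ D γ)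
    (hc : ShifterRecovery μ D γ) : FourthNeg μ D fun S ω i =>
      (D S).Ugamma γ ω i + (D S).Z ω i ⬝ᵥ ((D S).coefZ ω ((D S).X ω) - γ) :=
  (fourthNeg_Ugamma hr hc).add (FourthBdd.dotProduct_tendsto_zero (v := fun S => (D S).Z)
      (a := fun S ω => (D S).coefZ ω ((D S).X ω) - γ) (fourthBdd_Z hd hr)
      (tendsto_gammaHat_sub hd hr hc))

/-- `Ẍ` is `Ẋ` up to a negligible error, and the conditional mean of `Ẋ'Ẋ/N` is `N⁻¹ ∑ σ_s² w_is²`,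
whose limit is assumed positive. -/
theorem tendsto_average_Xddot_sq (hd : ShiftShareDesign μ D γ) (hr : ShiftShareRegular μ D γ)
    (hc : ShifterRecovery μ D γ) : ∃ c : ℝ, 0 < c ∧ Tendsto (fun x : Σ S, Ω S =>
      (N x.1 : ℝ)⁻¹ * ((D x.1).Xddot x.2 ⬝ᵥ (D x.1).Xddot x.2)) (whp μ) (𝓝 c) := by
  obtain ⟨c, hc0, hct⟩ := hr.shifter_variation
  refine ⟨c, hc0, ?_⟩
  have h1 := tendsto_average_Xdot_mul_sub hd hr (y := fun _ _ _ => 0)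
    (e := fun _ _ _ _ => 1) (C := 1) zero_le_one (fun S i => measurable_const)
    (fun S i t => measurable_const) (fun S => by simp) (fun S => by simp)
    fourthNeg_zero.fourthBdd
  have hq := fourthNeg_Xddot_error hd hr hc
  have h2 := (fourthBdd_Xdot hd hr).sum_mul_fourthNeg hq (ShareWeight.average μ D)
  have h3 := hq.fourthBdd.sum_mul_fourthNeg hq (ShareWeight.average μ D)
  have h4 := isLittleOp_iff_tendsto.1 hct
  have h5 := (((h1.add h4).add_const c).sub (h2.const_mul 2)).add h3
  simp only [zero_add, mul_zero, sub_zero, add_zero] at h5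
  refine h5.congr fun x => ?_
  have e1 : ∑ i, (N x.1 : ℝ)⁻¹ * ∑ t, (D x.1).w x.2 i t * ((D x.1).w x.2 i t * 1)
      * (D x.1).sigmaSq (μ x.1) x.2 t
      = (N x.1 : ℝ)⁻¹ * ∑ i, ∑ s, (D x.1).sigmaSq (μ x.1) x.2 s * (D x.1).w x.2 i s ^ 2 := by
    rw [Finset.mul_sum]
    refine Finset.sum_congr rfl fun i _ => ?_
    congr 1
    exact Finset.sum_congr rfl fun t _ => by ring
  have e2 : (N x.1 : ℝ)⁻¹ * ((D x.1).Xddot x.2 ⬝ᵥ (D x.1).Xddot x.2)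
      = ∑ i, (N x.1 : ℝ)⁻¹ * ((D x.1).Xdot γ x.2 i *
          ∑ t, (D x.1).w x.2 i t * 1 * (D x.1).Xtilde γ x.2 t)
        - 2 * ∑ i, (N x.1 : ℝ)⁻¹ * ((D x.1).Xdot γ x.2 i * ((D x.1).Ugamma γ x.2 i
          + (D x.1).Z x.2 i ⬝ᵥ ((D x.1).coefZ x.2 ((D x.1).X x.2) - γ)))
        + ∑ i, (N x.1 : ℝ)⁻¹ * (((D x.1).Ugamma γ x.2 i
          + (D x.1).Z x.2 i ⬝ᵥ ((D x.1).coefZ x.2 ((D x.1).X x.2) - γ)) *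
            ((D x.1).Ugamma γ x.2 i
          + (D x.1).Z x.2 i ⬝ᵥ ((D x.1).coefZ x.2 ((D x.1).X x.2) - γ))) := by
    rw [dotProduct, Finset.mul_sum, Finset.mul_sum, ← Finset.sum_sub_distrib,
      ← Finset.sum_add_distrib]
    refine Finset.sum_congr rfl fun i _ => ?_
    simp only [mul_one]
    rw [(D x.1).Xddot_eq γ, ShiftShareData.Xdot]
    ring
  rw [e2, e1]
  ring

theorem ae_kernel_F0_errorMean (S : ℕ) :
    ∀ᵐ ω ∂μ S, ∀ᵐ ω' ∂condExpKernel (μ S) (D S).F0 ω,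
      (D S).errorMean (μ S) γ ω' = (D S).errorMean (μ S) γ ω ∧
      (D S).effectDev (μ S) ω' = (D S).effectDev (μ S) ω ∧ (D S).w ω' = (D S).w ω := by
  filter_upwards [(D S).ae_kernel_F0_const (μ S)] with ω h
  filter_upwards [h] with ω' h
  obtain ⟨a1, a2, a3, a4, a5, a6⟩ := h
  have he : (D S).effectDev (μ S) ω' = (D S).effectDev (μ S) ω := by
    funext i t
    simp only [ShiftShareData.effectDev, a4, a6]
  refine ⟨?_, he, a5⟩
  funext i
  simp only [ShiftShareData.errorMean, he, a1, a3, a5, ShiftShareData.Z_dotProduct, a2]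

/-- The conditional mean of `Ẋ'ε/N`, apart from the linearization error, is the weighted sum of
`β_is - β` with weights `w_is² σ_s²`. It vanishes by the definition of the estimand. -/
theorem tendsto_average_Xddot_mul_eps (hd : ShiftShareDesign μ D γ)
    (hr : ShiftShareRegular μ D γ) (hc : ShifterRecovery μ D γ) :
    Tendsto (fun x : Σ S, Ω S =>
      (N x.1 : ℝ)⁻¹ * ((D x.1).Xddot x.2 ⬝ᵥ (D x.1).eps (μ x.1) x.2)) (whp μ) (𝓝 0) := by
  obtain ⟨C, hC, hCe⟩ := exists_abs_effectDev_le hd hr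
  have h1 := tendsto_average_Xdot_mul_sub hd hr (y := fun S => (D S).errorMean (μ S) γ)
    (e := fun S => (D S).effectDev (μ S)) (C := C) hC.le (fun S i => by fun_prop)
    (fun S i t => by fun_prop)
    (fun S => by
      filter_upwards [ae_kernel_F0_errorMean S] with ω h
      filter_upwards [h] with ω' h
      exact ⟨h.1, h.2.1⟩)
    hCe (fourthBdd_errorMean hd hr)
  have h2 := (fourthBdd_Xdot hd hr).sum_mul_fourthNeg (fourthNeg_L hr) (ShareWeight.average μ D)
  have h3 := (fourthBdd_eps hd hr).sum_mul_fourthNeg (fourthNeg_Xddot_error hd hr hc)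
    (ShareWeight.average μ D)
  have h4 := (h1.add h2).sub h3
  rw [add_zero, sub_zero] at h4
  refine h4.congr' ?_
  obtain ⟨p, Cp, -, -, hlaw⟩ := exists_shifterLaw hd hr
  filter_upwards [eventually_whp_of_ae_curried hlaw] with x hx
  have e1 : ∑ i, (N x.1 : ℝ)⁻¹ * ∑ t, (D x.1).w x.2 i t * ((D x.1).w x.2 i t *
      (D x.1).effectDev (μ x.1) x.2 i t) * (D x.1).sigmaSq (μ x.1) x.2 t = 0 := by
    rw [← Finset.mul_sum]
    refine mul_eq_zero_of_right _ ?_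
    have hπ : ∀ i s, 0 ≤ (D x.1).w x.2 i s ^ 2 * (D x.1).sigmaSq (μ x.1) x.2 s := fun i s =>
      mul_nonneg (sq_nonneg _) (hx.sigma_nonneg s)
    have e3 : ∑ i, ∑ t, (D x.1).w x.2 i t * ((D x.1).w x.2 i t *
        (D x.1).effectDev (μ x.1) x.2 i t) * (D x.1).sigmaSq (μ x.1) x.2 t
        = ∑ i, ∑ t, (D x.1).w x.2 i t ^ 2 * (D x.1).sigmaSq (μ x.1) x.2 t * (D x.1).B x.2 i t
          - (D x.1).beta (μ x.1) x.2 *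
            ∑ i, ∑ t, (D x.1).w x.2 i t ^ 2 * (D x.1).sigmaSq (μ x.1) x.2 t := by
      simp only [Finset.mul_sum, ← Finset.sum_sub_distrib]
      refine Finset.sum_congr rfl fun i _ => Finset.sum_congr rfl fun t _ => ?_
      rw [ShiftShareData.effectDev]
      ring
    rw [e3]
    -- If the denominator of `β` vanishes, so does every nonnegative weight, and the sum is zero
    -- whatever value `β` has.
    by_cases h0 : ∑ i, ∑ t, (D x.1).w x.2 i t ^ 2 * (D x.1).sigmaSq (μ x.1) x.2 t = 0
    · rw [h0, mul_zero, sub_zero]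
      have h5 := (Finset.sum_eq_zero_iff_of_nonneg fun i _ =>
        Finset.sum_nonneg fun t _ => hπ i t).1 h0
      refine Finset.sum_eq_zero fun i hi => Finset.sum_eq_zero fun t ht => ?_
      rw [(Finset.sum_eq_zero_iff_of_nonneg fun t _ => hπ i t).1 (h5 i hi) t ht, zero_mul]
    · rw [ShiftShareData.beta, div_mul_cancel₀ _ h0, sub_self]
  rw [e1, sub_zero, ← Finset.sum_add_distrib, ← Finset.sum_sub_distrib, dotProduct,
    Finset.mul_sum]
  refine Finset.sum_congr rfl fun i _ => ?_
  rw [(D x.1).Xddot_eq γ, (D x.1).eps_eq (μ x.1) γ]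
  ring

theorem tendsto_betaHat_sub (hd : ShiftShareDesign μ D γ) (hr : ShiftShareRegular μ D γ)
    (hc : ShifterRecovery μ D γ) : Tendsto (fun x : Σ S, Ω S =>
      (D x.1).betaHat x.2 - (D x.1).beta (μ x.1) x.2) (whp μ) (𝓝 0) := by
  obtain ⟨c, hc0, h1⟩ := tendsto_average_Xddot_sq hd hr hc
  have h2 := (tendsto_average_Xddot_mul_eps hd hr hc).div h1 hc0.ne'
  rw [zero_div] at h2
  refine h2.congr' ?_
  filter_upwards [isUnit_gram hr, h1.eventually_ne hc0.ne'] with x hx h0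
  simp only [Pi.div_apply]
  rw [(D x.1).betaHat_sub (μ x.1) hx (right_ne_zero_of_mul h0),
    mul_div_mul_left _ _ (left_ne_zero_of_mul h0)]

/-- The OLS coefficients are consistent. -/
theorem consistentFor_ols (hd : ShiftShareDesign μ D γ) (hr : ShiftShareRegular μ D γ)
    (hc : ShifterRecovery μ D γ) :
    ConsistentFor μ D (fun S => (D S).betaHat) (fun S => (D S).deltaHat) := by
  have hβ := tendsto_betaHat_sub hd hr hc
  refine ⟨isLittleOp_iff_tendsto.2 hβ, fun k => isLittleOp_iff_tendsto.2 ?_⟩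
  obtain ⟨q, hq, hO, -⟩ := hr.delta_rate
  have h1 := (hO k).tendsto_zero hq
  have h2 := hβ.mul ((tendsto_gammaHat_sub hd hr hc k).add_const (γ k))
  have h3 := h1.sub h2
  rw [zero_mul, sub_zero] at h3
  refine h3.congr fun x => ?_
  simp only [(D x.1).deltaHat_eq (μ x.1)]
  simp only [Pi.sub_apply, Pi.smul_apply, smul_eq_mul]
  ring

end Estimation

/-! ### The conditional expectation of the oracle variance estimator -/

section FourthMoments

variable {Ω : Type*} [MeasurableSpace Ω] {P : Measure Ω}

theorem memLp_four_iff {f : Ω → ℝ} (hf : AEStronglyMeasurable f P) :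
    MemLp f 4 P ↔ Integrable (fun ω => f ω ^ 4) P := by
  rw [← integrable_norm_rpow_iff hf (by norm_num) (by norm_num)]
  have e4 : (4 : ENNReal).toReal = ((4 : ℕ) : ℝ) := by norm_num
  simp only [e4, Real.rpow_natCast, Real.norm_eq_abs, Even.pow_abs (by decide : Even 4)]

theorem integrable_pow_four {f : Ω → ℝ} (hf : MemLp f 4 P) : Integrable (fun ω => f ω ^ 4) P :=
  (memLp_four_iff hf.aestronglyMeasurable).1 hf

theorem integrable_sq_mul_sq {f g : Ω → ℝ} (hf : MemLp f 4 P) (hg : MemLp g 4 P) :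
    Integrable (fun ω => f ω ^ 2 * g ω ^ 2) P := by
  refine Integrable.mono' ((integrable_pow_four hf).add (integrable_pow_four hg))
    ((hf.aestronglyMeasurable.pow 2).mul (hg.aestronglyMeasurable.pow 2))
    (Eventually.of_forall fun ω => ?_)
  rw [Real.norm_eq_abs, abs_of_nonneg (by positivity), Pi.add_apply]
  nlinarith [sq_nonneg (f ω ^ 2 - g ω ^ 2), sq_nonneg (f ω ^ 2), sq_nonneg (g ω ^ 2)]

theorem memLp_bdd_mul {p : ENNReal} {f g : Ω → ℝ} (hf : MemLp f p P)
    (hg : AEStronglyMeasurable g P) {C : ℝ} (hC : ∀ᵐ ω ∂P, |g ω| ≤ C) :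
    MemLp (fun ω => g ω * f ω) p P := by
  refine hf.of_le_mul (c := C) (hg.mul hf.aestronglyMeasurable) ?_
  filter_upwards [hC] with ω hω
  rw [norm_mul]
  exact mul_le_mul_of_nonneg_right hω (norm_nonneg _)

theorem integral_sum_mul_pow_four_le {ι : Type*} [Fintype ι] {b : ι → ℝ} {c : ℝ}
    (hb : ∑ i, |b i| ≤ c) {x : ι → Ω → ℝ} (hx : ∀ i, MemLp (x i) 4 P) :
    ∫ ω, (∑ i, b i * x i ω) ^ 4 ∂P ≤ c ^ 3 * ∑ i, |b i| * ∫ ω, x i ω ^ 4 ∂P := by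
  have hi : Integrable (fun ω => c ^ 3 * ∑ i, |b i| * x i ω ^ 4) P :=
    (integrable_finsetSum _ fun i _ => (integrable_pow_four (hx i)).const_mul _).const_mul _
  have hs : MemLp (fun ω => ∑ i, b i * x i ω) 4 P :=
    memLp_finsetSum _ fun i _ => (hx i).const_mul _
  refine (integral_mono (integrable_pow_four hs) hi fun ω =>
    pow_four_abs_sum_mul_le _ hb fun i => x i ω).trans (le_of_eq ?_)
  rw [integral_const_mul, integral_finsetSum _ fun i _ => (integrable_pow_four (hx i)).const_mul _]
  simp only [integral_const_mul]

/-- Perturbation of `∑ h E[x² T²]` in the second factor. -/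
theorem abs_sum_integral_sq_mul_sq_sub_le {ι : Type*} [Fintype ι] {h τ ε : ι → ℝ} {C : ℝ}
    (hC : 0 ≤ C) (hh : ∀ s, 0 ≤ h s) (hh1 : ∑ s, h s ≤ 1) {x T E : ι → Ω → ℝ}
    (hx : ∀ s, MemLp (x s) 4 P) (hT : ∀ s, MemLp (T s) 4 P) (hE : ∀ s, MemLp (E s) 4 P)
    (hxC : ∀ s, ∫ ω, x s ω ^ 4 ∂P ≤ C) (hTτ : ∀ s, ∫ ω, T s ω ^ 4 ∂P ≤ τ s)
    (hEε : ∀ s, ∫ ω, E s ω ^ 4 ∂P ≤ ε s) {θ : ℝ} (hθ : 0 < θ) :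
    |∑ s, h s * ∫ ω, x s ω ^ 2 * T s ω ^ 2 ∂P
        - ∑ s, h s * ∫ ω, x s ω ^ 2 * (T s ω + E s ω) ^ 2 ∂P|
      ≤ (∑ s, h s * ε s) / θ ^ 12
        + 2 * θ ^ 4 * (2 * C + 9 * ∑ s, h s * τ s + 8 * ∑ s, h s * ε s) := by
  have hb : ∀ s, |∫ ω, x s ω ^ 2 * T s ω ^ 2 ∂P - ∫ ω, x s ω ^ 2 * (T s ω + E s ω) ^ 2 ∂P|
      ≤ ε s / θ ^ 12 + 2 * θ ^ 4 * (2 * C + 9 * τ s + 8 * ε s) := by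
    intro s
    have hTE : MemLp (fun ω => T s ω + E s ω) 4 P := (hT s).add (hE s)
    rw [← integral_sub (integrable_sq_mul_sq (hx s) (hT s)) (integrable_sq_mul_sq (hx s) hTE)]
    have hx4 := integrable_pow_four (hx s)
    have hT4 := integrable_pow_four (hT s)
    have hE4 := integrable_pow_four (hE s)
    have hi2 : Integrable (fun ω => 2 * x s ω ^ 4 + 9 * T s ω ^ 4) P :=
      (hx4.const_mul 2).add (hT4.const_mul 9)
    have hi3 : Integrable (fun ω => 2 * x s ω ^ 4 + 9 * T s ω ^ 4 + 8 * E s ω ^ 4) P :=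
      hi2.add (hE4.const_mul 8)
    have hi : Integrable (fun ω => E s ω ^ 4 / θ ^ 12
        + 2 * θ ^ 4 * (2 * x s ω ^ 4 + 9 * T s ω ^ 4 + 8 * E s ω ^ 4)) P :=
      (hE4.div_const _).add (hi3.const_mul _)
    have h1 := norm_integral_le_of_norm_le (f := fun ω =>
      x s ω ^ 2 * T s ω ^ 2 - x s ω ^ 2 * (T s ω + E s ω) ^ 2) hi
      (Eventually.of_forall fun ω => by
        rw [Real.norm_eq_abs]
        refine (abs_sq_mul_sq_sub_le_pow_four _ _ _ _ hθ).trans ?_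
        have h2 := add_pow_four_le (T s ω) (E s ω)
        have e1 : (x s ω - x s ω) ^ 4 + (T s ω - (T s ω + E s ω)) ^ 4 = E s ω ^ 4 := by ring
        rw [e1]
        refine add_le_add_right (mul_le_mul_of_nonneg_left ?_ (by positivity)) _
        linarith)
    rw [Real.norm_eq_abs] at h1
    refine h1.trans ?_
    rw [integral_add (hE4.div_const _) (hi3.const_mul _), integral_div, integral_const_mul,
      integral_add hi2 (hE4.const_mul 8),
      integral_add (hx4.const_mul 2) (hT4.const_mul 9), integral_const_mul, integral_const_mul,
      integral_const_mul]
    have := hxC s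
    have := hTτ s
    have := hEε s
    gcongr
  rw [← Finset.sum_sub_distrib]
  refine (Finset.abs_sum_le_sum_abs _ _).trans ?_
  have h2 : ∑ s, |h s * ∫ ω, x s ω ^ 2 * T s ω ^ 2 ∂P
        - h s * ∫ ω, x s ω ^ 2 * (T s ω + E s ω) ^ 2 ∂P|
      ≤ ∑ s, h s * (ε s / θ ^ 12 + 2 * θ ^ 4 * (2 * C + 9 * τ s + 8 * ε s)) := by
    refine Finset.sum_le_sum fun s _ => ?_
    rw [← mul_sub, abs_mul, abs_of_nonneg (hh s)]
    exact mul_le_mul_of_nonneg_left (hb s) (hh s)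
  refine h2.trans ?_
  have e : ∑ s, h s * (ε s / θ ^ 12 + 2 * θ ^ 4 * (2 * C + 9 * τ s + 8 * ε s))
      = (∑ s, h s * ε s) / θ ^ 12
        + 2 * θ ^ 4 * ((∑ s, h s) * (2 * C) + 9 * ∑ s, h s * τ s + 8 * ∑ s, h s * ε s) := by
    simp only [Finset.sum_div, Finset.mul_sum, Finset.sum_mul, ← Finset.sum_add_distrib]
    exact Finset.sum_congr rfl fun s _ => by ring
  rw [e]
  have h3 : (∑ s, h s) * (2 * C) ≤ 2 * C := mul_le_of_le_one_left (by positivity) hh1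
  gcongr

end FourthMoments

/-! ### Unconditional fourth moments, so that conditional expectations are kernel integrals -/

section Integrability

set_option linter.unusedSectionVars false

variable {Ω : ℕ → Type*} [mΩ : ∀ S, MeasurableSpace (Ω S)] [∀ S, StandardBorelSpace (Ω S)]
  {μ : ∀ S, Measure (Ω S)} [∀ S, IsProbabilityMeasure (μ S)] {N : ℕ → ℕ} {K : ℕ}
  {D : ∀ S, ShiftShareData (Ω S) (N S) S K} {γ : Fin K → ℝ}

theorem memLp_Xs (hr : ShiftShareRegular μ D γ) (S : ℕ) (s : Fin S) :
    MemLp (fun ω => (D S).Xs ω s) 4 (μ S) := by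
  obtain ⟨ν, hν, C, hC⟩ := hr.shifter_moment
  rw [memLp_four_iff (Measurable.aestronglyMeasurable (by fun_prop))]
  refine Integrable.mono' ((integrable_const 1).add (hC S s).1)
    (Measurable.aestronglyMeasurable (by fun_prop)) (Eventually.of_forall fun ω => ?_)
  rw [Real.norm_eq_abs, abs_of_nonneg (by positivity), Pi.add_apply]
  exact pow_four_le_one_add_rpow (by linarith) _

theorem memLp_Zs_dotProduct (hr : ShiftShareRegular μ D γ) (S : ℕ) (s : Fin S) (v : Fin K → ℝ) :
    MemLp (fun ω => (D S).Zs ω s ⬝ᵥ v) 4 (μ S) := by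
  obtain ⟨C, hC⟩ := hr.control_moment
  unfold dotProduct
  refine memLp_finsetSum _ fun k _ => MemLp.mul_const ?_ _
  exact (memLp_four_iff (Measurable.aestronglyMeasurable (by fun_prop))).2 (hC S s k).1

theorem memLp_Xtilde (hr : ShiftShareRegular μ D γ) (S : ℕ) (s : Fin S) :
    MemLp (fun ω => (D S).Xtilde γ ω s) 4 (μ S) :=
  (memLp_Xs hr S s).sub (memLp_Zs_dotProduct hr S s γ)

theorem memLp_L (hr : ShiftShareRegular μ D γ) (S : ℕ) (i : Fin (N S)) :
    MemLp (fun ω => (D S).L ω i) 4 (μ S) :=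
  (memLp_four_iff (Measurable.aestronglyMeasurable (by fun_prop))).2 (hr.lin_error_moment S i)

theorem memLp_U_dotProduct (hr : ShiftShareRegular μ D γ) (S : ℕ) (i : Fin (N S)) (v : Fin K → ℝ) :
    MemLp (fun ω => (D S).U ω i ⬝ᵥ v) 4 (μ S) := by
  obtain ⟨C, hC⟩ := hr.noise_moment
  unfold dotProduct
  refine memLp_finsetSum _ fun k _ => MemLp.mul_const ?_ _
  exact (memLp_four_iff (Measurable.aestronglyMeasurable (by fun_prop))).2 (hC S i k).1

theorem ae_abs_share_le (hd : ShiftShareDesign μ D γ) (S : ℕ) (i : Fin (N S)) (s : Fin S) :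
    ∀ᵐ ω ∂μ S, |(D S).w ω i s| ≤ 1 := by
  filter_upwards [ae_sum_abs_share_le hd S] with ω h
  exact (Finset.single_le_sum (f := fun s => |(D S).w ω i s|) (fun s _ => abs_nonneg _)
    (Finset.mem_univ s)).trans (h i)

theorem MeasureTheory.MemLp.share_mul (hd : ShiftShareDesign μ D γ) {S : ℕ} {f : Ω S → ℝ} {p : ENNReal}
    (hf : MemLp f p (μ S)) (i : Fin (N S)) (s : Fin S) :
    MemLp (fun ω => (D S).w ω i s * f ω) p (μ S) :=
  memLp_bdd_mul hf (Measurable.aestronglyMeasurable (by fun_prop)) (ae_abs_share_le hd S i s)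

theorem memLp_errorMean (hd : ShiftShareDesign μ D γ) (hr : ShiftShareRegular μ D γ) (S : ℕ)
    (i : Fin (N S)) : MemLp (fun ω => (D S).errorMean (μ S) γ ω i) 4 (μ S) := by
  obtain ⟨C, hC, he⟩ := exists_abs_effectDev_le hd hr
  obtain ⟨C', hC'⟩ := hr.outcome_moment
  have hY : MemLp (fun ω => (D S).Y0 ω i) 4 (μ S) :=
    (memLp_four_iff (Measurable.aestronglyMeasurable (by fun_prop))).2 (hC' S i).1
  have hZ : MemLp (fun ω => (D S).Z ω i ⬝ᵥ (D S).delta (μ S)) 4 (μ S) := by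
    simp only [ShiftShareData.Z_dotProduct]
    have h1 : MemLp (fun ω => ∑ s, (D S).w ω i s * ((D S).Zs ω s ⬝ᵥ (D S).delta (μ S))) 4 (μ S) :=
      memLp_finsetSum _ fun s _ => (memLp_Zs_dotProduct hr S s _).share_mul hd i s
    exact h1.add (memLp_U_dotProduct hr S i _)
  have hB : MemLp (fun ω => ∑ t, (D S).w ω i t *
      ((D S).effectDev (μ S) ω i t * ((D S).Zs ω t ⬝ᵥ γ))) 4 (μ S) := by
    refine memLp_finsetSum _ fun t _ => MemLp.share_mul hd ?_ i t
    exact memLp_bdd_mul (memLp_Zs_dotProduct hr S t γ)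
      (Measurable.aestronglyMeasurable (by fun_prop)) ((he S).mono fun ω h => h i t)
  exact (hY.add hB).sub hZ

theorem memLp_eps (hd : ShiftShareDesign μ D γ) (hr : ShiftShareRegular μ D γ) (S : ℕ)
    (i : Fin (N S)) : MemLp (fun ω => (D S).eps (μ S) ω i) 4 (μ S) := by
  obtain ⟨C, hC, he⟩ := exists_abs_effectDev_le hd hr
  simp only [(D S).eps_eq (μ S) γ]
  have hB : MemLp (fun ω => ∑ t, (D S).w ω i t *
      (D S).effectDev (μ S) ω i t * (D S).Xtilde γ ω t) 4 (μ S) := by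
    simp only [mul_assoc]
    refine memLp_finsetSum _ fun t _ => MemLp.share_mul hd ?_ i t
    exact memLp_bdd_mul (memLp_Xtilde hr S t)
      (Measurable.aestronglyMeasurable (by fun_prop)) ((he S).mono fun ω h => h i t)
  exact ((memLp_errorMean hd hr S i).add hB).add (memLp_L hr S i)

theorem memLp_R (hd : ShiftShareDesign μ D γ) (hr : ShiftShareRegular μ D γ) (S : ℕ)
    (s : Fin S) : MemLp (fun ω => (D S).R (μ S) ω s) 4 (μ S) :=
  memLp_finsetSum _ fun i _ => (memLp_eps hd hr S i).share_mul hd i s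

theorem ae_Vdiag_eq (hd : ShiftShareDesign μ D γ) (hr : ShiftShareRegular μ D γ) (S : ℕ) :
    ∀ᵐ ω ∂μ S, (D S).Vdiag (μ S) γ ω = (D S).r ω * ∑ s, ∫ ω', (D S).Xtilde γ ω' s ^ 2
      * (D S).R (μ S) ω' s ^ 2 ∂condExpKernel (μ S) (D S).F0 ω := by
  filter_upwards [ae_all_iff.2 fun s => condExp_ae_eq_integral_condExpKernel (D S).F0_le
    (integrable_sq_mul_sq (memLp_Xtilde hr S s) (memLp_R hd hr S s))] with ω hω
  rw [ShiftShareData.Vdiag]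
  congr 1
  exact Finset.sum_congr rfl fun s _ => hω s

end Integrability

/-! ### Convergence of the oracle variance estimator -/

namespace ShiftShareData

variable {Ω : Type*} [mΩ : MeasurableSpace Ω] {N S K : ℕ} (D : ShiftShareData Ω N S K)

/-- The share-weighted mean of the `ℱ₀`-measurable part of the error over the regions of a
sector. -/
noncomputable def sectorError (μ : Measure Ω) (γ : Fin K → ℝ) (ω : Ω) (s : Fin S) : ℝ :=
  ∑ i, D.w ω i s / D.n ω s * D.errorMean μ γ ω i

/-- The loading of the mean error of sector `s` on the recentred shifter of sector `t`. -/
noncomputable def sectorLoading (μ : Measure Ω) (ω : Ω) (s t : Fin S) : ℝ :=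
  ∑ i, D.w ω i s / D.n ω s * (D.w ω i t * D.effectDev μ ω i t)

@[fun_prop]
theorem measurable_sectorError (μ : Measure Ω) (γ : Fin K → ℝ) (s : Fin S) :
    Measurable fun ω => D.sectorError μ γ ω s := by
  unfold sectorError; fun_prop

@[fun_prop]
theorem measurable_sectorLoading (μ : Measure Ω) (s t : Fin S) :
    Measurable fun ω => D.sectorLoading μ ω s t := by
  unfold sectorLoading; fun_prop

theorem sectorMean_eps (μ : Measure Ω) (γ : Fin K → ℝ) (ω : Ω) (s : Fin S) :
    ∑ i, D.w ω i s / D.n ω s * D.eps μ ω i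
      = D.sectorError μ γ ω s + ∑ t, D.sectorLoading μ ω s t * D.Xtilde γ ω t
        + ∑ i, D.w ω i s / D.n ω s * D.L ω i := by
  have h : ∑ t, D.sectorLoading μ ω s t * D.Xtilde γ ω t = ∑ i, D.w ω i s / D.n ω s *
      ∑ t, D.w ω i t * D.effectDev μ ω i t * D.Xtilde γ ω t := by
    simp only [sectorLoading, Finset.sum_mul, Finset.mul_sum]
    rw [Finset.sum_comm]
    exact Finset.sum_congr rfl fun i _ => Finset.sum_congr rfl fun t _ => by ring
  rw [h, sectorError, ← Finset.sum_add_distrib, ← Finset.sum_add_distrib]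
  refine Finset.sum_congr rfl fun i _ => ?_
  rw [D.eps_eq μ γ]
  ring

theorem R_eq_mul {ω : Ω} {s : Fin S} (hn : D.n ω s ≠ 0) (μ : Measure Ω) :
    D.R μ ω s = D.n ω s * ∑ i, D.w ω i s / D.n ω s * D.eps μ ω i := by
  rw [D.sum_share_div_mul, mul_div_cancel₀ _ hn, R]

/-- The loadings average `w_it (β_it - β)` over regions, and shares sum to at most one within a
region. -/
theorem sum_abs_sectorLoading_le {μ : Measure Ω} {ω : Ω} {C : ℝ} (hC : 0 ≤ C)
    (h0 : ∀ i s, 0 ≤ D.w ω i s) (h1 : ∀ i, ∑ s, D.w ω i s ≤ 1)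
    (he : ∀ i s, |D.effectDev μ ω i s| ≤ C) (s : Fin S) :
    ∑ t, |D.sectorLoading μ ω s t| ≤ C := by
  have hn := D.n_nonneg h0 s
  calc ∑ t, |D.sectorLoading μ ω s t|
      ≤ ∑ t, ∑ i, D.w ω i s / D.n ω s * (D.w ω i t * C) := by
        refine Finset.sum_le_sum fun t _ => (Finset.abs_sum_le_sum_abs _ _).trans ?_
        refine Finset.sum_le_sum fun i _ => ?_
        rw [abs_mul, abs_mul, abs_of_nonneg (div_nonneg (h0 i s) hn), abs_of_nonneg (h0 i t)]
        exact mul_le_mul_of_nonneg_left (mul_le_mul_of_nonneg_left (he i t) (h0 i t))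
          (div_nonneg (h0 i s) hn)
    _ = ∑ i, D.w ω i s / D.n ω s * ((∑ t, D.w ω i t) * C) := by
        rw [Finset.sum_comm]
        simp only [Finset.mul_sum, Finset.sum_mul]
    _ ≤ ∑ i, D.w ω i s / D.n ω s * C := by
        refine Finset.sum_le_sum fun i _ => mul_le_mul_of_nonneg_left ?_
          (div_nonneg (h0 i s) hn)
        exact mul_le_of_le_one_left hC (h1 i)
    _ = (D.n ω s / D.n ω s) * C := by
        rw [← Finset.sum_mul, ← Finset.sum_div]
        rfl
    _ ≤ C := mul_le_of_le_one_left hC (div_self_le_one _)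

/-- The influence of shifter `t` on the whole estimator. One factor `n_s` of the weight cancels the
normalisation; in what remains, `∑_s n_s w_is` is at most the largest sector size, and summing
`w_it` over regions gives another sector size. -/
theorem sum_mul_abs_sectorLoading_le {μ : Measure Ω} {ω : Ω} {C : ℝ} (hC : 0 ≤ C)
    (h0 : ∀ i s, 0 ≤ D.w ω i s) (h1 : ∀ i, ∑ s, D.w ω i s ≤ 1)
    (he : ∀ i s, |D.effectDev μ ω i s| ≤ C) (t : Fin S) :
    ∑ s, D.r ω * D.n ω s ^ 2 * |D.sectorLoading μ ω s t| ≤ C * ((⨆ s, D.n ω s ^ 2) * D.r ω) := by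
  have hn := D.n_nonneg h0
  have : Nonempty (Fin S) := ⟨t⟩
  obtain ⟨s₀, hs₀⟩ := Finite.exists_max (D.n ω)
  have hM : D.n ω s₀ ^ 2 ≤ ⨆ s, D.n ω s ^ 2 :=
    le_ciSup (f := fun s => D.n ω s ^ 2) (Set.finite_range _).bddAbove s₀
  have hr := D.r_nonneg ω
  have hdiv : ∀ i s, D.n ω s ^ 2 * (D.w ω i s / D.n ω s) = D.n ω s * D.w ω i s := by
    intro i s
    rcases eq_or_ne (D.n ω s) 0 with h | h
    · simp [h]
    · field_simp
  calc ∑ s, D.r ω * D.n ω s ^ 2 * |D.sectorLoading μ ω s t|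
      ≤ ∑ s, D.r ω * D.n ω s ^ 2 * ∑ i, D.w ω i s / D.n ω s * (D.w ω i t * C) := by
        refine Finset.sum_le_sum fun s _ => mul_le_mul_of_nonneg_left ?_
          (mul_nonneg hr (sq_nonneg _))
        refine (Finset.abs_sum_le_sum_abs _ _).trans (Finset.sum_le_sum fun i _ => ?_)
        rw [abs_mul, abs_mul, abs_of_nonneg (div_nonneg (h0 i s) (hn s)),
          abs_of_nonneg (h0 i t)]
        exact mul_le_mul_of_nonneg_left (mul_le_mul_of_nonneg_left (he i t) (h0 i t))
          (div_nonneg (h0 i s) (hn s))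
    _ = C * D.r ω * ∑ i, D.w ω i t * ∑ s, D.n ω s * D.w ω i s := by
        simp only [Finset.mul_sum]
        rw [Finset.sum_comm]
        refine Finset.sum_congr rfl fun i _ => Finset.sum_congr rfl fun s _ => ?_
        rw [← hdiv i s]
        ring
    _ ≤ C * D.r ω * ∑ i, D.w ω i t * D.n ω s₀ := by
        refine mul_le_mul_of_nonneg_left (Finset.sum_le_sum fun i _ =>
          mul_le_mul_of_nonneg_left ?_ (h0 i t)) (mul_nonneg hC hr)
        calc ∑ s, D.n ω s * D.w ω i s ≤ ∑ s, D.n ω s₀ * D.w ω i s :=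
              Finset.sum_le_sum fun s _ => mul_le_mul_of_nonneg_right (hs₀ s) (h0 i s)
          _ = D.n ω s₀ * ∑ s, D.w ω i s := by rw [Finset.mul_sum]
          _ ≤ D.n ω s₀ := mul_le_of_le_one_right (hn s₀) (h1 i)
    _ = C * D.r ω * (D.n ω t * D.n ω s₀) := by
        rw [← Finset.sum_mul]
        rfl
    _ ≤ C * D.r ω * (D.n ω s₀ * D.n ω s₀) :=
        mul_le_mul_of_nonneg_left (mul_le_mul_of_nonneg_right (hs₀ t) (hn s₀))
          (mul_nonneg hC hr)
    _ ≤ C * D.r ω * ⨆ s, D.n ω s ^ 2 := by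
        rw [← pow_two]
        exact mul_le_mul_of_nonneg_left hM (mul_nonneg hC hr)
    _ = _ := by ring

end ShiftShareData

section Oracle

set_option linter.unusedSectionVars false

variable {Ω : ℕ → Type*} [mΩ : ∀ S, MeasurableSpace (Ω S)] [∀ S, StandardBorelSpace (Ω S)]
  {μ : ∀ S, Measure (Ω S)} [∀ S, IsProbabilityMeasure (μ S)] {N : ℕ → ℕ} {K : ℕ}
  {D : ∀ S, ShiftShareData (Ω S) (N S) S K} {γ : Fin K → ℝ}

theorem fourthBdd_sectorError (hd : ShiftShareDesign μ D γ) (hr : ShiftShareRegular μ D γ) :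
    FourthBdd μ D fun S => (D S).sectorError (μ S) γ := (fourthBdd_errorMean hd hr).sectorMean hd

theorem ae_kernel_F0_sector (S : ℕ) :
    ∀ᵐ ω ∂μ S, ∀ᵐ ω' ∂condExpKernel (μ S) (D S).F0 ω,
      (D S).sectorError (μ S) γ ω' = (D S).sectorError (μ S) γ ω ∧
      (D S).sectorLoading (μ S) ω' = (D S).sectorLoading (μ S) ω ∧ (D S).w ω' = (D S).w ω := by
  filter_upwards [ae_kernel_F0_errorMean (D := D) (γ := γ) S] with ω h
  filter_upwards [h] with ω' h
  obtain ⟨h1, h2, h3⟩ := h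
  refine ⟨?_, ?_, h3⟩
  · funext s
    simp only [ShiftShareData.sectorError, ShiftShareData.n, h1, h3]
  · funext s t
    simp only [ShiftShareData.sectorLoading, ShiftShareData.n, h2, h3]

/-- Law of large numbers for the part of the oracle estimator without linearization error. -/
theorem tendsto_sum_sector_sub (hd : ShiftShareDesign μ D γ) (hr : ShiftShareRegular μ D γ) :
    Tendsto (fun x : Σ S, Ω S =>
      (∑ s, (D x.1).r x.2 * (D x.1).n x.2 s ^ 2 * ((D x.1).Xtilde γ x.2 s ^ 2
        * ((D x.1).sectorError (μ x.1) γ x.2 s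
          + ∑ t, (D x.1).sectorLoading (μ x.1) x.2 s t * (D x.1).Xtilde γ x.2 t) ^ 2))
      - ∫ ω', ∑ s, (D x.1).r ω' * (D x.1).n ω' s ^ 2 * ((D x.1).Xtilde γ ω' s ^ 2
        * ((D x.1).sectorError (μ x.1) γ ω' s
          + ∑ t, (D x.1).sectorLoading (μ x.1) ω' s t * (D x.1).Xtilde γ ω' t) ^ 2)
          ∂condExpKernel (μ x.1) (D x.1).F0 x.2) (whp μ) (𝓝 0) := by
  obtain ⟨p, Cp, hp, hCp, hlaw⟩ := exists_shifterLaw hd hr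
  obtain ⟨C, hC, he⟩ := exists_abs_effectDev_le hd hr
  have hmax := (isLittleOp_iff_tendsto.1 hd.sector_size_sq).abs
  rw [abs_zero] at hmax
  have hY := fourthBdd_sectorError hd hr _ (ShareWeight.sector μ D)
  -- The first affine form is `𝒳̃_s` itself, so `b` is the identity matrix and `e` is zero. Its
  -- column sums are the weights `r_N n_t²`, which is why `r_N max_s n_s²` must vanish.
  have key := tendsto_affineProdSq_sub_condExp (m := fun S => (D S).F0) (μ := μ)
    (fun S => (D S).F0_le) (X := fun S => (D S).Xtilde γ) (fun S t => by fun_prop) hp hCp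
    (cb := 1 + C) (by positivity)
    (fun S => (hlaw S).mono fun ω h => h.indep) (fun S => (hlaw S).mono fun ω h => h.integrable)
    (fun S => (hlaw S).mono fun ω h => h.moment)
    (h := fun S ω s => (D S).r ω * (D S).n ω s ^ 2) (e := fun _ _ _ => 0)
    (y := fun S => (D S).sectorError (μ S) γ) (b := fun _ _ s t => if s = t then 1 else 0)
    (c := fun S => (D S).sectorLoading (μ S))
    (hmax := fun x => |(⨆ s, (D x.1).n x.2 s ^ 2) * (D x.1).r x.2|)
    (fun S => by unfold affineProdSq; fun_prop) (fun S => ?_) (fun x => abs_nonneg _)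
    (ShareWeight.sector μ D).nonneg (ShareWeight.sector μ D).sum_le (by simp)
    (fun S => ?_) (fun S => ?_) (fun S => ?_) hmax hY
  · simp only [affineProdSq, ite_mul, one_mul, zero_mul, Finset.sum_ite_eq, Finset.mem_univ,
      if_true, zero_add] at key
    exact key
  · filter_upwards [ae_kernel_F0_sector (D := D) (γ := γ) S] with ω h
    filter_upwards [h] with ω' h
    refine ⟨?_, rfl, h.1, rfl, h.2.1⟩
    simp only [ShiftShareData.r, ShiftShareData.n, h.2.2]
  · refine Eventually.of_forall fun ω s => ?_
    have : ∑ t, |if s = t then (1 : ℝ) else 0| = 1 := by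
      simp [apply_ite abs]
    rw [this]
    linarith
  · filter_upwards [hd.share_nonneg S, hd.share_sum_le S, he S] with ω h0 h1 h2 s
    have := (D S).sum_abs_sectorLoading_le hC.le h0 h1 h2 s
    linarith
  · filter_upwards [hd.share_nonneg S, hd.share_sum_le S, he S] with ω h0 h1 h2 t
    have h3 := (D S).sum_mul_abs_sectorLoading_le hC.le h0 h1 h2 t
    have h4 : ∑ s, (D S).r ω * (D S).n ω s ^ 2 * |if s = t then (1 : ℝ) else 0|
        = (D S).n ω t ^ 2 * (D S).r ω := by
      simp [apply_ite abs, mul_comm]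
    have h5 : (D S).n ω t ^ 2 ≤ ⨆ s, (D S).n ω s ^ 2 :=
      le_ciSup (f := fun s => (D S).n ω s ^ 2) (Set.finite_range _).bddAbove t
    have h6 := mul_le_mul_of_nonneg_right h5 ((D S).r_nonneg ω)
    have h7 := le_abs_self ((⨆ s, (D S).n ω s ^ 2) * (D S).r ω)
    simp only [mul_add, Finset.sum_add_distrib]
    rw [h4]
    have h8 := mul_le_mul_of_nonneg_left h7 hC.le
    linarith

/-- The conditional mean of the linearization errors' fourth moments is negligible. -/
theorem tendsto_sum_condFourth_L (hd : ShiftShareDesign μ D γ) (hr : ShiftShareRegular μ D γ) :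
    Tendsto (fun x : Σ S, Ω S => ∑ s, (D x.1).r x.2 * (D x.1).n x.2 s ^ 2 *
      ∑ i, (D x.1).w x.2 i s / (D x.1).n x.2 s *
        ∫ ω', (D x.1).L ω' i ^ 4 ∂condExpKernel (μ x.1) (D x.1).F0 x.2) (whp μ) (𝓝 0) := by
  have hg := (ShareWeight.sector μ D).push (A := fun S ω s i => (D S).w ω i s / (D S).n ω s)
    one_pos (fun S i j => by fun_prop) (fun S ω ω' h => by simp only [ShiftShareData.n, h])
    (ae_sum_abs_share_div_le hd)
  have hvm : ∀ S i, Measurable fun ω => ∫ ω', (D S).L ω' i ^ 4 ∂condExpKernel (μ S) (D S).F0 ω := by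
    intro S i
    have : StronglyMeasurable fun ω => (D S).L ω i ^ 4 :=
      Measurable.stronglyMeasurable (by fun_prop)
    exact (StronglyMeasurable.integral_condExpKernel this).measurable.mono (D S).F0_le le_rfl
  have hae := fun S i => condExp_ae_eq_integral_condExpKernel (μ := μ S) (D S).F0_le
    (hr.lin_error_moment S i)
  have h := tendsto_zero_weighted_sum_of_FW (D := D) (μ := μ)
    (v := fun S ω i => ∫ ω', (D S).L ω' i ^ 4 ∂condExpKernel (μ S) (D S).F0 ω) hvm
    (fun S ω i => integral_nonneg fun ω' => by positivity)
    (fun S i => integrable_condExp.congr (hae S i)) ?_ hg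
  · refine h.congr' ?_
    filter_upwards [eventually_whp_of_ae_curried hd.share_nonneg] with x h0
    simp only [Finset.sum_mul, Finset.mul_sum, div_one]
    rw [Finset.sum_comm]
    refine Finset.sum_congr rfl fun s _ => Finset.sum_congr rfl fun i _ => ?_
    rw [abs_of_nonneg (div_nonneg (h0 i s) ((D x.1).n_nonneg h0 s))]
    ring
  · rw [isLittleOp_iff_tendsto]
    refine (isLittleOp_iff_tendsto.1 hr.lin_error_fourth).congr' ?_
    refine eventually_whp_of_ae_curried (p := fun S ω =>
      (⨆ i, ((μ S)[fun ω' => (D S).L ω' i ^ 4 | (D S).FW]) ω) = ⨆ i, ((μ S)[fun ω' =>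
        ∫ ω'', (D S).L ω'' i ^ 4 ∂condExpKernel (μ S) (D S).F0 ω' | (D S).FW]) ω) fun S => ?_
    -- Tower property: conditioning on `ℱ₀` in between does not change the conditional mean given
    -- `W`, so the assumption on fourth moments given `W` applies to the inner conditional moments.
    have h1 : ∀ i, (μ S)[fun ω' => (D S).L ω' i ^ 4 | (D S).FW] =ᵐ[μ S] (μ S)[fun ω' =>
        ∫ ω'', (D S).L ω'' i ^ 4 ∂condExpKernel (μ S) (D S).F0 ω' | (D S).FW] := fun i =>
      ((condExp_condExp_of_le (D S).FW_le_F0 (D S).F0_le).symm).trans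
        (condExp_congr_ae (hae S i))
    filter_upwards [ae_all_iff.2 h1] with ω hω
    simp only [hω]

theorem integral_Xtilde_pow_four_le {Ω : Type*} [MeasurableSpace Ω] {N S K : ℕ}
    {D : ShiftShareData Ω N S K} {γ : Fin K → ℝ} {p C : ℝ} {ω : Ω} {P : Measure Ω} {σ : Fin S → ℝ}
    (h : D.ShifterLaw γ p C ω P σ) (hC : 0 ≤ C) (s : Fin S) :
    ∫ ω', D.Xtilde γ ω' s ^ 4 ∂P ≤ C := by
  have h1 := h.fourth s
  rw [← ofReal_integral_eq_lintegral_ofReal (integrable_pow_four (h.memLp_four s))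
    (Eventually.of_forall fun _ => by positivity)] at h1
  exact (ENNReal.ofReal_le_ofReal_iff hC).1 h1

/-- The conditional second moments of the scores are not affected by the linearization error. -/
theorem tendsto_integral_sector_sub_Vdiag (hd : ShiftShareDesign μ D γ)
    (hr : ShiftShareRegular μ D γ) (hc : ShifterRecovery μ D γ) :
    Tendsto (fun x : Σ S, Ω S =>
      (∫ ω', ∑ s, (D x.1).r ω' * (D x.1).n ω' s ^ 2 * ((D x.1).Xtilde γ ω' s ^ 2
        * ((D x.1).sectorError (μ x.1) γ ω' s + ∑ t, (D x.1).sectorLoading (μ x.1) ω' s t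
          * (D x.1).Xtilde γ ω' t) ^ 2) ∂condExpKernel (μ x.1) (D x.1).F0 x.2)
      - (D x.1).Vdiag (μ x.1) γ x.2) (whp μ) (𝓝 0) := by
  obtain ⟨p, Cp, hp, hCp, hlaw⟩ := exists_shifterLaw hd hr
  obtain ⟨C, hC, he⟩ := exists_abs_effectDev_le hd hr
  set T : ∀ S, Ω S → Fin S → ℝ := fun S ω s => (D S).sectorError (μ S) γ ω s
    + ∑ t, (D S).sectorLoading (μ S) ω s t * (D S).Xtilde γ ω t with hT
  have hΛ := tendsto_sum_condFourth_L hd hr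
  -- The factor `72` is `9 * 8`: the coefficient of the fourth moment of the main term in the
  -- perturbation bound, times the constant of `add_pow_four_le`.
  have hA := (IsBoundedOp.const (μ := μ) (1 + 2 * Cp + 72 * C ^ 4 * Cp)).add
    (((fourthBdd_sectorError hd hr _ (ShareWeight.sector μ D)).const_mul 72).add
      ((IsBoundedOp.of_tendsto hΛ).const_mul 8))
  refine tendsto_zero_of_forall_le (K := fun k => ((k : ℝ) + 2) ^ 12) (fun k => by positivity)
    hΛ hA ?_ ?_
  · filter_upwards [eventually_whp_of_ae_curried hd.share_nonneg] with x h0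
    have hr0 := (D x.1).r_nonneg x.2
    have hn := (D x.1).n_nonneg h0
    refine add_nonneg (by positivity) (add_nonneg (mul_nonneg (by norm_num)
      (Finset.sum_nonneg fun s _ => by positivity)) (mul_nonneg (by norm_num)
      (Finset.sum_nonneg fun s _ => mul_nonneg (by positivity) (Finset.sum_nonneg fun i _ =>
        mul_nonneg (div_nonneg (h0 i s) (hn s)) (integral_nonneg fun _ => by positivity)))))
  · have hall : ∀ S, ∀ᵐ ω ∂μ S, ∀ i,
        Integrable (fun ω' => (D S).L ω' i ^ 4) (condExpKernel (μ S) (D S).F0 ω) := fun S =>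
      ae_all_iff.2 fun i => (hr.lin_error_moment S i).condExpKernel_ae
    filter_upwards [eventually_whp_of_ae_curried hd.share_nonneg,
      eventually_whp_of_ae_curried hd.share_sum_le, eventually_whp_of_ae_curried hc.full_rank,
      eventually_whp_of_ae_curried he, eventually_whp_of_ae_curried hlaw,
      eventually_whp_of_ae_curried (ae_kernel_F0_sector (D := D) (γ := γ) (μ := μ)),
      eventually_whp_of_ae_curried (ae_Vdiag_eq hd hr), eventually_whp_of_ae_curried hall]
      with x h0 hs1 hrk hex hlx hcx hVx hLx k
    obtain ⟨S, ω⟩ := x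
    simp only at h0 hs1 hrk hex hlx hcx hVx hLx ⊢
    set P := condExpKernel (μ S) (D S).F0 ω with hP
    have hn := (D S).n_pos hrk h0
    have hr0 := (D S).r_nonneg ω
    set θ : ℝ := 1 / ((k : ℝ) + 2) with hθ
    have hθ0 : 0 < θ := by positivity
    have hLm : ∀ i, MemLp (fun ω' => (D S).L ω' i) 4 P := fun i =>
      (memLp_four_iff (Measurable.aestronglyMeasurable (by fun_prop))).2 (hLx i)
    have hcX : ∀ s, MemLp (fun ω' => ∑ t, (D S).sectorLoading (μ S) ω s t
        * (D S).Xtilde γ ω' t) 4 P := fun s =>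
      memLp_finsetSum _ fun t _ => (hlx.memLp_four t).const_mul _
    have hTm : ∀ s, MemLp (fun ω' => (D S).sectorError (μ S) γ ω s
        + ∑ t, (D S).sectorLoading (μ S) ω s t * (D S).Xtilde γ ω' t) 4 P := fun s =>
      (memLp_const ((D S).sectorError (μ S) γ ω s)).add (hcX s)
    have hEm : ∀ s, MemLp (fun ω' => ∑ i, (D S).w ω i s / (D S).n ω s * (D S).L ω' i) 4 P :=
      fun s => memLp_finsetSum _ fun i _ => (hLm i).const_mul _
    have hrow : ∀ s, ∑ i, |(D S).w ω i s / (D S).n ω s| ≤ 1 := fun s => by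
      simp only [abs_of_nonneg (div_nonneg (h0 _ s) (hn s).le)]
      rw [← Finset.sum_div]
      exact div_self_le_one _
    have hloc := (D S).sum_abs_sectorLoading_le hC.le h0 hs1 hex
    have hX4 := integral_Xtilde_pow_four_le hlx hCp
    have hTb : ∀ s, ∫ ω', ((D S).sectorError (μ S) γ ω s
        + ∑ t, (D S).sectorLoading (μ S) ω s t * (D S).Xtilde γ ω' t) ^ 4 ∂P
        ≤ 8 * ((D S).sectorError (μ S) γ ω s ^ 4 + C ^ 4 * Cp) := by
      intro s
      have hi : Integrable (fun ω' => 8 * ((D S).sectorError (μ S) γ ω s ^ 4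
          + (∑ t, (D S).sectorLoading (μ S) ω s t * (D S).Xtilde γ ω' t) ^ 4)) P :=
        ((integrable_const _).add (integrable_pow_four (hcX s))).const_mul _
      refine (integral_mono (integrable_pow_four (hTm s)) hi fun ω' =>
        add_pow_four_le _ _).trans ?_
      rw [integral_const_mul, integral_add (integrable_const _) (integrable_pow_four (hcX s))]
      simp only [integral_const, probReal_univ, one_smul]
      have h4 : ∫ ω', (∑ t, (D S).sectorLoading (μ S) ω s t * (D S).Xtilde γ ω' t) ^ 4 ∂P
          ≤ C ^ 4 * Cp := by
        refine (integral_sum_mul_pow_four_le (hloc s) hlx.memLp_four).trans ?_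
        calc C ^ 3 * ∑ t, |(D S).sectorLoading (μ S) ω s t| * ∫ ω', (D S).Xtilde γ ω' t ^ 4 ∂P
            ≤ C ^ 3 * ∑ t, |(D S).sectorLoading (μ S) ω s t| * Cp := by
              refine mul_le_mul_of_nonneg_left (Finset.sum_le_sum fun t _ =>
                mul_le_mul_of_nonneg_left (hX4 t) (abs_nonneg _)) (by positivity)
          _ = C ^ 3 * ((∑ t, |(D S).sectorLoading (μ S) ω s t|) * Cp) := by
              rw [Finset.sum_mul]
          _ ≤ C ^ 3 * (C * Cp) := by
              have := hloc s
              gcongr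
          _ = C ^ 4 * Cp := by ring
      linarith
    have hEb : ∀ s, ∫ ω', (∑ i, (D S).w ω i s / (D S).n ω s * (D S).L ω' i) ^ 4 ∂P
        ≤ ∑ i, (D S).w ω i s / (D S).n ω s * ∫ ω', (D S).L ω' i ^ 4 ∂P := by
      intro s
      refine (integral_sum_mul_pow_four_le (hrow s) hLm).trans ?_
      simp only [abs_of_nonneg (div_nonneg (h0 _ s) (hn s).le), one_pow, one_mul]
      exact le_rfl
    have hmain := abs_sum_integral_sq_mul_sq_sub_le hCp
      (h := fun s => (D S).r ω * (D S).n ω s ^ 2) (fun s => by positivity)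
      ((D S).sum_r_mul_sq_le_one ω) hlx.memLp_four hTm hEm hX4 hTb hEb hθ0
    have e1 : ∫ ω', ∑ s, (D S).r ω' * (D S).n ω' s ^ 2 * ((D S).Xtilde γ ω' s ^ 2
        * T S ω' s ^ 2) ∂P = ∑ s, (D S).r ω * (D S).n ω s ^ 2 * ∫ ω', (D S).Xtilde γ ω' s ^ 2
        * ((D S).sectorError (μ S) γ ω s
        + ∑ t, (D S).sectorLoading (μ S) ω s t * (D S).Xtilde γ ω' t) ^ 2 ∂P := by
      have e2 : ∫ ω', ∑ s, (D S).r ω' * (D S).n ω' s ^ 2 * ((D S).Xtilde γ ω' s ^ 2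
          * T S ω' s ^ 2) ∂P = ∫ ω', ∑ s, (D S).r ω * (D S).n ω s ^ 2 *
          ((D S).Xtilde γ ω' s ^ 2 * ((D S).sectorError (μ S) γ ω s
          + ∑ t, (D S).sectorLoading (μ S) ω s t * (D S).Xtilde γ ω' t) ^ 2) ∂P := by
        refine integral_congr_ae ?_
        filter_upwards [hcx] with ω' h
        simp only [hT, h.1, h.2.1, ShiftShareData.r, ShiftShareData.n, h.2.2]
      rw [e2, integral_finsetSum _ fun s _ =>
        (integrable_sq_mul_sq (hlx.memLp_four s) (hTm s)).const_mul _]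
      simp only [integral_const_mul]
    have e3 : (D S).Vdiag (μ S) γ ω = ∑ s, (D S).r ω * (D S).n ω s ^ 2 *
        ∫ ω', (D S).Xtilde γ ω' s ^ 2 * ((D S).sectorError (μ S) γ ω s
        + ∑ t, (D S).sectorLoading (μ S) ω s t * (D S).Xtilde γ ω' t
        + ∑ i, (D S).w ω i s / (D S).n ω s * (D S).L ω' i) ^ 2 ∂P := by
      rw [hVx, Finset.mul_sum]
      refine Finset.sum_congr rfl fun s _ => ?_
      rw [mul_assoc, ← integral_const_mul ((D S).n ω s ^ 2)]
      refine congrArg (fun a => (D S).r ω * a) (integral_congr_ae ?_)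
      filter_upwards [hcx] with ω' h
      have hne : (D S).n ω' s ≠ 0 := by
        simp only [ShiftShareData.n, h.2.2]
        exact (hn s).ne'
      rw [(D S).R_eq_mul hne, (D S).sectorMean_eps (μ S) γ]
      simp only [h.1, h.2.1, ShiftShareData.n, h.2.2]
      ring
    rw [e1, e3]
    refine hmain.trans ?_
    have hθ12 : ∀ a : ℝ, a / θ ^ 12 = ((k : ℝ) + 2) ^ 12 * a := fun a => by
      rw [hθ]; field_simp
    have hθ4 : 2 * θ ^ 4 ≤ 1 / ((k : ℝ) + 1) := by
      rw [hθ, div_pow, one_pow, ← mul_div_assoc, mul_one, div_le_div_iff₀ (by positivity)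
        (by positivity)]
      have hk : (0 : ℝ) ≤ k := by positivity
      nlinarith [pow_nonneg hk 2, pow_nonneg hk 3, pow_nonneg hk 4]
    rw [hθ12]
    have e4 : ∑ s, (D S).r ω * (D S).n ω s ^ 2 *
        (8 * ((D S).sectorError (μ S) γ ω s ^ 4 + C ^ 4 * Cp))
        ≤ 8 * ∑ s, (D S).r ω * (D S).n ω s ^ 2 * (D S).sectorError (μ S) γ ω s ^ 4
          + 8 * (C ^ 4 * Cp) := by
      have e5 : ∑ s, (D S).r ω * (D S).n ω s ^ 2 *
          (8 * ((D S).sectorError (μ S) γ ω s ^ 4 + C ^ 4 * Cp))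
          = 8 * ∑ s, (D S).r ω * (D S).n ω s ^ 2 * (D S).sectorError (μ S) γ ω s ^ 4
          + (∑ s, (D S).r ω * (D S).n ω s ^ 2) * (8 * (C ^ 4 * Cp)) := by
        simp only [Finset.mul_sum, Finset.sum_mul, ← Finset.sum_add_distrib]
        exact Finset.sum_congr rfl fun s _ => by ring
      rw [e5]
      have := mul_le_of_le_one_left (b := 8 * (C ^ 4 * Cp)) (by positivity)
        ((D S).sum_r_mul_sq_le_one ω)
      linarith
    set a := ∑ s, (D S).r ω * (D S).n ω s ^ 2 * ∑ i, (D S).w ω i s / (D S).n ω s *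
      ∫ ω', (D S).L ω' i ^ 4 ∂P with ha
    set E := ∑ s, (D S).r ω * (D S).n ω s ^ 2 * (D S).sectorError (μ S) γ ω s ^ 4 with hE
    have ha0 : 0 ≤ a := Finset.sum_nonneg fun s _ => mul_nonneg (by positivity)
      (Finset.sum_nonneg fun i _ => mul_nonneg (div_nonneg (h0 i s) (hn s).le)
        (integral_nonneg fun _ => by positivity))
    have hE0 : 0 ≤ E := Finset.sum_nonneg fun s _ => by positivity
    have hk0 : 0 ≤ ((k : ℝ) + 2) ^ 12 * a := by positivity
    have hk1 : 0 ≤ 1 / ((k : ℝ) + 1) := by positivity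
    have hb1 : 0 ≤ 2 * Cp + 72 * C ^ 4 * Cp + 72 * E + 8 * a := by positivity
    have hb2 : 2 * θ ^ 4 * (2 * Cp + 9 * ∑ s, (D S).r ω * (D S).n ω s ^ 2 *
        (8 * ((D S).sectorError (μ S) γ ω s ^ 4 + C ^ 4 * Cp)) + 8 * a)
        ≤ 1 / ((k : ℝ) + 1) * (2 * Cp + 72 * C ^ 4 * Cp + 72 * E + 8 * a) := by
      refine (mul_le_mul_of_nonneg_left (b := 2 * Cp + 9 * ∑ s, (D S).r ω * (D S).n ω s ^ 2 *
        (8 * ((D S).sectorError (μ S) γ ω s ^ 4 + C ^ 4 * Cp)) + 8 * a)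
        (c := 2 * Cp + 72 * C ^ 4 * Cp + 72 * E + 8 * a) (by linarith)
        (by positivity)).trans (mul_le_mul_of_nonneg_right hθ4 hb1)
    have hb3 := mul_nonneg hk0 hb1
    linarith

/-- The oracle variance estimator is close to its conditional expectation. -/
theorem tendsto_oracle_sub_Vdiag (hd : ShiftShareDesign μ D γ) (hr : ShiftShareRegular μ D γ)
    (hc : ShifterRecovery μ D γ) :
    Tendsto (fun x : Σ S, Ω S =>
      (D x.1).r x.2 * ∑ s, (D x.1).Xtilde γ x.2 s ^ 2 * (D x.1).R (μ x.1) x.2 s ^ 2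
        - (D x.1).Vdiag (μ x.1) γ x.2) (whp μ) (𝓝 0) := by
  set T : ∀ S, Ω S → Fin S → ℝ := fun S ω s => (D S).sectorError (μ S) γ ω s
    + ∑ t, (D S).sectorLoading (μ S) ω s t * (D S).Xtilde γ ω t with hT
  -- Removes the linearization error from the realised sum; `h2` replaces the result by its
  -- conditional mean, and `h3` puts the error back inside that mean.
  have h1 := tendsto_sum_sq_mul_sq_sub (ShareWeight.sector μ D) (fourthBdd_Xtilde hd hr)
    ((fourthBdd_eps hd hr).sectorMean hd) (P' := fun S => (D S).Xtilde γ) (Q' := T)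
    (by simpa using fourthNeg_zero)
    (by
      refine ((fourthNeg_L hr).sectorMean hd).mono (Eventually.of_forall fun x s => ?_)
      rw [(D x.1).sectorMean_eps (μ x.1) γ, hT, add_sub_cancel_left])
  have h2 := tendsto_sum_sector_sub hd hr
  have h3 := tendsto_integral_sector_sub_Vdiag hd hr hc
  have h4 := (h1.add h2).add h3
  simp only [add_zero] at h4
  refine h4.congr' ?_
  filter_upwards [eventually_whp_of_ae_curried hc.full_rank,
    eventually_whp_of_ae_curried hd.share_nonneg] with x hx h0
  have hn := (D x.1).n_pos hx h0
  have e : (D x.1).r x.2 * ∑ s, (D x.1).Xtilde γ x.2 s ^ 2 * (D x.1).R (μ x.1) x.2 s ^ 2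
      = ∑ s, (D x.1).r x.2 * (D x.1).n x.2 s ^ 2 * ((D x.1).Xtilde γ x.2 s ^ 2
        * (∑ i, (D x.1).w x.2 i s / (D x.1).n x.2 s * (D x.1).eps (μ x.1) x.2 i) ^ 2) := by
    rw [Finset.mul_sum]
    refine Finset.sum_congr rfl fun s _ => ?_
    rw [(D x.1).R_eq_mul (hn s).ne']
    ring
  rw [e]
  simp only [hT, mul_sub, Finset.sum_sub_distrib]
  ring

end Oracle

/-! ### A maximal-type inequality for sums of products with independent factors -/

section ProdMoment

variable {Ω ι : Type*} [MeasurableSpace Ω] [Fintype ι] {p C : ℝ}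

theorem lintegral_ofReal_sum_le {P : Measure Ω} {g : ι → Ω → ℝ} {b : ι → ℝ}
    (hg : ∀ s, Measurable (g s)) (hg0 : ∀ s ω, 0 ≤ g s ω) (hb : ∀ s, 0 ≤ b s)
    (h : ∀ s, ∫⁻ ω, ENNReal.ofReal (g s ω) ∂P ≤ ENNReal.ofReal (b s)) :
    ∫⁻ ω, ENNReal.ofReal (∑ s, g s ω) ∂P ≤ ENNReal.ofReal (∑ s, b s) := by
  simp_rw [ENNReal.ofReal_sum_of_nonneg fun s _ => hg0 s _]
  rw [lintegral_finsetSum _ fun s _ => (hg s).ennreal_ofReal,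
    ENNReal.ofReal_sum_of_nonneg fun s _ => hb s]
  exact Finset.sum_le_sum fun s _ => h s

theorem lintegral_ofReal_const_mul_le {P : Measure Ω} {g : Ω → ℝ} {b c : ℝ} (hc : 0 ≤ c)
    (hg : Measurable g) (h : ∫⁻ ω, ENNReal.ofReal (g ω) ∂P ≤ ENNReal.ofReal b) :
    ∫⁻ ω, ENNReal.ofReal (c * g ω) ∂P ≤ ENNReal.ofReal (c * b) := by
  simp_rw [ENNReal.ofReal_mul hc]
  rw [lintegral_const_mul _ hg.ennreal_ofReal]
  gcongr

theorem lintegral_ofReal_add_le {P : Measure Ω} {f g : Ω → ℝ} {a b : ℝ}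
    (hf : Measurable f) (hf0 : ∀ ω, 0 ≤ f ω) (hg0 : ∀ ω, 0 ≤ g ω)
    (ha : 0 ≤ a) (hb : 0 ≤ b)
    (hfa : ∫⁻ ω, ENNReal.ofReal (f ω) ∂P ≤ ENNReal.ofReal a)
    (hgb : ∫⁻ ω, ENNReal.ofReal (g ω) ∂P ≤ ENNReal.ofReal b) :
    ∫⁻ ω, ENNReal.ofReal (f ω + g ω) ∂P ≤ ENNReal.ofReal (a + b) := by
  simp_rw [ENNReal.ofReal_add (hf0 _) (hg0 _)]
  rw [lintegral_add_left hf.ennreal_ofReal, ENNReal.ofReal_add ha hb]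
  gcongr

/-- Expectations of products of functions of the `X t` are controlled by moments of order `p` as
if the `X t` were independent. -/
def HasProdMoment (P : Measure Ω) (X : ι → Ω → ℝ) (p C : ℝ) : Prop :=
  ∀ (f : ι → ℝ → ℝ) (a b : ι → ℝ), (∀ t, Measurable (f t)) → (∀ t x, 0 ≤ f t x) →
    (∀ t, 0 ≤ a t) → (∀ t, 0 ≤ b t) → (∀ t x, f t x ≤ a t + b t * |x| ^ p) →
    ∫⁻ ω, ENNReal.ofReal (∏ t, f t (X t ω)) ∂P ≤ ENNReal.ofReal (∏ t, (a t + b t * C))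

/-- Under independence the expectation factorises, and each factor is bounded by its moment. -/
theorem hasProdMoment_of_iIndepFun {P : Measure Ω} [IsProbabilityMeasure P] {X : ι → Ω → ℝ}
    (hX : ∀ t, Measurable (X t)) (hind : iIndepFun X P)
    (hintegrable : ∀ t, Integrable (fun ω => |X t ω| ^ p) P) (hC : ∀ t, ∫ ω, |X t ω| ^ p ∂P ≤ C) :
    HasProdMoment P X p C := by
  intro f a b hf hf0 ha hb hle
  have hi : ∀ t, Integrable (fun ω => a t + b t * |X t ω| ^ p) P := fun t =>
    (integrable_const _).add ((hintegrable t).const_mul _)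
  have h1 := lintegral_prod_eq_prod_lintegral_of_indepFun (μ := P) Finset.univ
    (fun t ω => ENNReal.ofReal (f t (X t ω)))
    (hind.comp (fun t x => ENNReal.ofReal (f t x)) fun t => (hf t).ennreal_ofReal)
    (fun t => ((hf t).comp (hX t)).ennreal_ofReal)
  simp_rw [ENNReal.ofReal_prod_of_nonneg fun t _ => hf0 t _]
  rw [h1, ENNReal.ofReal_prod_of_nonneg fun t _ => add_nonneg (ha t) (mul_nonneg (hb t)
    ((integral_nonneg fun ω => by positivity).trans (hC t)))]
  refine Finset.prod_le_prod' fun t _ => ?_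
  calc ∫⁻ ω, ENNReal.ofReal (f t (X t ω)) ∂P
      ≤ ∫⁻ ω, ENNReal.ofReal (a t + b t * |X t ω| ^ p) ∂P :=
        lintegral_mono fun ω => ENNReal.ofReal_le_ofReal (hle t _)
    _ = ENNReal.ofReal (∫ ω, (a t + b t * |X t ω| ^ p) ∂P) := by
        rw [ofReal_integral_eq_lintegral_ofReal (hi t)]
        exact Eventually.of_forall fun ω => add_nonneg (ha t) (mul_nonneg (hb t) (by positivity))
    _ ≤ _ := by
        refine ENNReal.ofReal_le_ofReal ?_
        rw [integral_add (integrable_const _) ((hintegrable t).const_mul _), integral_const_mul]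
        simp only [integral_const, probReal_univ, one_smul]
        have := mul_le_mul_of_nonneg_left (hC t) (hb t)
        linarith

/-- Independence is lost when conditional laws given `ℱ₀` are mixed into a law given `W`, but a
product bound with uniform constants survives mixing. This motivates the definition. -/
theorem HasProdMoment.of_bind {P : Measure Ω} [IsProbabilityMeasure P] {κ : Ω → Measure Ω}
    {X : ι → Ω → ℝ} (hX : ∀ t, Measurable (X t)) (hκ : Measurable κ) (hbind : P.bind κ = P)
    (h : ∀ᵐ ω ∂P, HasProdMoment (κ ω) X p C) : HasProdMoment P X p C := by
  intro f a b hf hf0 ha hb hle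
  have hm : Measurable fun ω => ENNReal.ofReal (∏ t, f t (X t ω)) :=
    (Finset.measurable_prod _ fun t _ => (hf t).comp (hX t)).ennreal_ofReal
  conv_lhs => rw [← hbind]
  rw [Measure.lintegral_bind hκ.aemeasurable hm.aemeasurable]
  calc _ ≤ ∫⁻ _, ENNReal.ofReal (∏ t, (a t + b t * C)) ∂P := by
        refine lintegral_mono_ae ?_
        filter_upwards [h] with ω hω
        exact hω f a b hf hf0 ha hb hle
    _ = _ := by simp

theorem prod_one_add_mul_le_exp {x : ι → ℝ} (hx : ∀ t, 0 ≤ x t) :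
    ∏ t, (1 + x t) ≤ Real.exp (∑ t, x t) := by
  rw [Real.exp_sum]
  exact Finset.prod_le_prod (fun t _ => by linarith [hx t]) fun t _ => by
    linarith [Real.add_one_le_exp (x t)]

theorem exp_le_one_add_two_mul {x : ℝ} (h0 : 0 ≤ x) (h1 : x ≤ 1) : Real.exp x ≤ 1 + 2 * x := by
  have h2 := Real.abs_exp_sub_one_le (x := x) (by rwa [abs_of_nonneg h0])
  rw [abs_of_nonneg h0] at h2
  linarith [le_abs_self (Real.exp x - 1)]

/-- The number of exceedances satisfies `K² ≤ 2 exp K`, and `exp K` times a function of `X_s` is a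
product over `t`. An exceedance has probability at most `θ_t² C`, so the product stays bounded since
`∑ θ_t² ≤ 1`. -/
theorem lintegral_sq_sum_mul_exp_le {P : Measure Ω} {X : ι → Ω → ℝ} {τ θ : ι → ℝ}
    (hX : ∀ t, Measurable (X t)) (hp : 4 ≤ p) (hC : 0 ≤ C) (hprod : HasProdMoment P X p C)
    (hτ : ∀ s, 1 ≤ τ s) (hθτ : ∀ s, 1 ≤ θ s ^ 2 * τ s ^ p) (hθ : ∑ s, θ s ^ 2 ≤ 1) (s : ι) :
    ∫⁻ ω, ENNReal.ofReal ((∑ t, if τ t < |X t ω| then (1 : ℝ) else 0) ^ 2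
        * (if τ s < |X s ω| then |X s ω| else 0) ^ 4) ∂P
      ≤ ENNReal.ofReal (2 * (Real.exp 1 * C * Real.exp (2 * C))) := by
  classical
  have he3 : Real.exp 1 ≤ 3 := by linarith [Real.exp_one_lt_d9]
  set f : ι → ℝ → ℝ := fun t x => (if τ t < |x| then Real.exp 1 else 1)
    * (if t = s then (if τ t < |x| then |x| else 0) ^ 4 else 1) with hf
  have hmeas : ∀ t, MeasurableSet {x : ℝ | τ t < |x|} := fun t =>
    measurableSet_lt measurable_const measurable_norm
  have hfm : ∀ t, Measurable (f t) := fun t => by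
    refine Measurable.mul (Measurable.ite (hmeas t) measurable_const measurable_const) ?_
    by_cases h : t = s
    · simp only [h, if_true]
      exact (Measurable.ite (hmeas s) measurable_norm measurable_const).pow_const 4
    · simp only [h, if_false]
      exact measurable_const
  have hbig : ∀ t x, τ t < |x| → 1 ≤ θ t ^ 2 * |x| ^ p := fun t x hx =>
    (hθτ t).trans (by
      have : τ t ^ p ≤ |x| ^ p := Real.rpow_le_rpow (by linarith [hτ t]) hx.le (by linarith)
      gcongr)
  -- For `t ≠ s` the bound `exp χ_t ≤ 1 + 2 θ_t² |x|^p` uses `e ≤ 3` and `1 ≤ θ_t² |x|^p` on an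
  -- exceedance. For `t = s` the fourth power is at most `|x|^p`, as the level is at least one.
  have key := hprod f (fun t => if t = s then 0 else 1)
    (fun t => if t = s then Real.exp 1 else 2 * θ t ^ 2) hfm ?_ ?_ ?_ ?_
  rotate_left
  · intro t x
    simp only [hf]
    refine mul_nonneg ?_ ?_
    · split_ifs <;> positivity
    · split_ifs <;> positivity
  · intro t
    split_ifs <;> norm_num
  · intro t
    split_ifs <;> positivity
  · intro t x
    simp only [hf]
    have h0 : 0 ≤ |x| ^ p := by positivity
    by_cases h : t = s
    · simp only [h, if_true]
      split_ifs with h1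
      · have h2 : |x| ^ 4 ≤ |x| ^ p := by
          rw [← Real.rpow_natCast]
          exact Real.rpow_le_rpow_of_exponent_le ((hτ s).trans h1.le) (by exact_mod_cast hp)
        rw [zero_add]
        gcongr
      · simp only [ne_eq, OfNat.ofNat_ne_zero, not_false_eq_true, zero_pow, mul_zero, zero_add]
        positivity
    · simp only [h, if_false, mul_one]
      split_ifs with h1
      · have := hbig t x h1
        linarith
      · have : 0 ≤ 2 * θ t ^ 2 * |x| ^ p := by positivity
        linarith
  have hprodle : ∏ t, ((if t = s then (0 : ℝ) else 1)
      + (if t = s then Real.exp 1 else 2 * θ t ^ 2) * C) ≤ Real.exp 1 * C * Real.exp (2 * C) := by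
    calc ∏ t, ((if t = s then (0 : ℝ) else 1) + (if t = s then Real.exp 1 else 2 * θ t ^ 2) * C)
        ≤ ∏ t, ((if t = s then Real.exp 1 * C else 1) * (1 + 2 * θ t ^ 2 * C)) := by
          refine Finset.prod_le_prod (fun t _ => ?_) fun t _ => ?_
          · split_ifs <;> positivity
          · split_ifs
            · rw [zero_add]
              refine le_mul_of_one_le_right (by positivity) ?_
              have : 0 ≤ 2 * θ t ^ 2 * C := by positivity
              linarith
            · rw [one_mul]
      _ = Real.exp 1 * C * ∏ t, (1 + 2 * θ t ^ 2 * C) := by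
          rw [Finset.prod_mul_distrib, Finset.prod_ite_eq' Finset.univ s]
          simp
      _ ≤ Real.exp 1 * C * Real.exp (∑ t, 2 * θ t ^ 2 * C) := by
          gcongr
          exact prod_one_add_mul_le_exp fun t => by positivity
      _ ≤ _ := by
          have e1 : ∑ t, 2 * θ t ^ 2 * C = 2 * C * ∑ t, θ t ^ 2 := by
            rw [Finset.mul_sum]
            exact Finset.sum_congr rfl fun t _ => by ring
          rw [e1]
          have e2 : 2 * C * ∑ t, θ t ^ 2 ≤ 2 * C := mul_le_of_le_one_right (by positivity) hθ
          gcongr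
  have key2 := lintegral_ofReal_const_mul_le (P := P) (c := 2) (by norm_num)
    (Finset.measurable_fun_prod Finset.univ fun t _ => (hfm t).comp (hX t))
    (key.trans (ENNReal.ofReal_le_ofReal hprodle))
  refine (lintegral_mono fun ω => ENNReal.ofReal_le_ofReal ?_).trans key2
  have e2 : ∏ t, f t (X t ω) = Real.exp (∑ t, if τ t < |X t ω| then (1 : ℝ) else 0)
      * (if τ s < |X s ω| then |X s ω| else 0) ^ 4 := by
    simp only [hf]
    rw [Finset.prod_mul_distrib, Finset.prod_ite_eq' Finset.univ s, if_pos (Finset.mem_univ s),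
      Real.exp_sum]
    congr 1
    refine Finset.prod_congr rfl fun t _ => ?_
    split_ifs
    · rfl
    · simp
  have e3 : (∑ t, if τ t < |X t ω| then (1 : ℝ) else 0) ^ 2
      ≤ 2 * Real.exp (∑ t, if τ t < |X t ω| then (1 : ℝ) else 0) := by
    have h0 : 0 ≤ ∑ t, if τ t < |X t ω| then (1 : ℝ) else 0 :=
      Finset.sum_nonneg fun t _ => by split_ifs <;> norm_num
    have := Real.quadratic_le_exp_of_nonneg h0
    nlinarith
  simp only [Function.comp_apply, e2]
  rw [← mul_assoc]
  gcongr

/-- The contribution of the large factors. -/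
theorem lintegral_sq_sum_large_le {P : Measure Ω} {X A : ι → Ω → ℝ} {τ θ : ι → ℝ} {η : ℝ}
    (hX : ∀ t, Measurable (X t)) (hA : ∀ t, Measurable (A t))
    (hp : 4 ≤ p) (hC : 0 ≤ C) (hprod : HasProdMoment P X p C)
    (hτ : ∀ s, 1 ≤ τ s) (hθτ : ∀ s, 1 ≤ θ s ^ 2 * τ s ^ p) (hθ : ∑ s, θ s ^ 2 ≤ 1)
    (hθ0 : ∀ s, 0 < θ s) (hη : 0 < η)
    (hA4 : ∀ s, ∫⁻ ω, ENNReal.ofReal (A s ω ^ 4) ∂P ≤ ENNReal.ofReal (η ^ 4 * θ s ^ 4)) :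
    ∫⁻ ω, ENNReal.ofReal ((∑ s, (if τ s < |X s ω| then |X s ω| else 0) * |A s ω|) ^ 2) ∂P
      ≤ ENNReal.ofReal (η ^ 2 * (Real.exp 1 * C * Real.exp (2 * C) + 1)) := by
  set χ : ι → Ω → ℝ := fun t ω => if τ t < |X t ω| then 1 else 0 with hχ
  set B : ι → Ω → ℝ := fun t ω => if τ t < |X t ω| then |X t ω| else 0 with hB
  have hset : ∀ t, MeasurableSet {ω | τ t < |X t ω|} := fun t =>
    measurableSet_lt measurable_const (hX t).norm
  have hχm : ∀ t, Measurable (χ t) := fun t =>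
    Measurable.ite (hset t) measurable_const measurable_const
  have hBm : ∀ t, Measurable (B t) := fun t =>
    Measurable.ite (hset t) (hX t).norm measurable_const
  have hKm : Measurable fun ω => ∑ t, χ t ω := Finset.measurable_fun_sum _ fun t _ => hχm t
  -- Cauchy–Schwarz leaves `K B_s² A_s²`. AM–GM with parameter `η² θ_s²` balances the moment of `K²
  -- B_s⁴`, which is bounded, against that of `A_s⁴`, which is at most `η⁴ θ_s⁴`; both parts become
  -- multiples of `η² θ_s²`.
  set g : ι → Ω → ℝ := fun s ω => η ^ 2 * θ s ^ 2 / 2 * ((∑ t, χ t ω) ^ 2 * B s ω ^ 4)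
    + 1 / (2 * (η ^ 2 * θ s ^ 2)) * A s ω ^ 4 with hg
  have hpt : ∀ ω, (∑ s, B s ω * |A s ω|) ^ 2 ≤ ∑ s, g s ω := by
    intro ω
    have h1 : (∑ s, B s ω * |A s ω|) ^ 2 ≤ (∑ s, χ s ω) * ∑ s, B s ω ^ 2 * A s ω ^ 2 := by
      refine Finset.sum_sq_le_sum_mul_sum_of_sq_le_mul _ (fun s _ => ?_) (fun s _ => by positivity)
        fun s _ => le_of_eq ?_
      · simp only [hχ]; split_ifs <;> norm_num
      · simp only [hχ, hB]
        split_ifs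
        · rw [mul_pow, sq_abs (A s ω), one_mul]
        · simp
    refine h1.trans ?_
    rw [Finset.mul_sum]
    refine Finset.sum_le_sum fun s _ => ?_
    have hc : 0 < η ^ 2 * θ s ^ 2 := by have := hθ0 s; positivity
    simp only [hg]
    have h2 := two_mul_le_add_sq ((η ^ 2 * θ s ^ 2) * ((∑ t, χ t ω) * B s ω ^ 2)) (A s ω ^ 2)
    rw [← sub_nonneg]
    have h3 : η ^ 2 * θ s ^ 2 / 2 * ((∑ t, χ t ω) ^ 2 * B s ω ^ 4)
        + 1 / (2 * (η ^ 2 * θ s ^ 2)) * A s ω ^ 4 - (∑ t, χ t ω) * (B s ω ^ 2 * A s ω ^ 2)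
        = 1 / (2 * (η ^ 2 * θ s ^ 2))
          * (((η ^ 2 * θ s ^ 2) * ((∑ t, χ t ω) * B s ω ^ 2)) ^ 2 + (A s ω ^ 2) ^ 2
            - 2 * ((η ^ 2 * θ s ^ 2) * ((∑ t, χ t ω) * B s ω ^ 2)) * A s ω ^ 2) := by
      have := hθ0 s
      field_simp
    rw [h3]
    exact mul_nonneg (by positivity) (by linarith)
  refine (lintegral_mono fun ω => ENNReal.ofReal_le_ofReal (hpt ω)).trans ?_
  have hb : ∀ s, ∫⁻ ω, ENNReal.ofReal (g s ω) ∂P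
      ≤ ENNReal.ofReal (η ^ 2 * θ s ^ 2 / 2 * (2 * (Real.exp 1 * C * Real.exp (2 * C)))
        + 1 / (2 * (η ^ 2 * θ s ^ 2)) * (η ^ 4 * θ s ^ 4)) := by
    intro s
    have hθs := hθ0 s
    have hm1 : Measurable fun ω => (∑ t, χ t ω) ^ 2 * B s ω ^ 4 :=
      (hKm.pow_const 2).mul ((hBm s).pow_const 4)
    refine lintegral_ofReal_add_le (hm1.const_mul _) (fun ω => by positivity)
      (fun ω => by positivity) (by positivity) (by positivity)
      (lintegral_ofReal_const_mul_le (by positivity) hm1 ?_)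
      (lintegral_ofReal_const_mul_le (by positivity) ((hA s).pow_const 4) (hA4 s))
    exact lintegral_sq_sum_mul_exp_le hX hp hC hprod hτ hθτ hθ s
  refine (lintegral_ofReal_sum_le (fun s => ?_) (fun s ω => ?_) (fun s => ?_) hb).trans
    (ENNReal.ofReal_le_ofReal ?_)
  · exact (((hKm.pow_const 2).mul ((hBm s).pow_const 4)).const_mul _).add
      (((hA s).pow_const 4).const_mul _)
  · have := hθ0 s
    simp only [hg]
    positivity
  · have := hθ0 s
    positivity
  · have e : ∀ s, η ^ 2 * θ s ^ 2 / 2 * (2 * (Real.exp 1 * C * Real.exp (2 * C)))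
        + 1 / (2 * (η ^ 2 * θ s ^ 2)) * (η ^ 4 * θ s ^ 4)
        = η ^ 2 * (Real.exp 1 * C * Real.exp (2 * C) + 1 / 2) * θ s ^ 2 := by
      intro s
      have := hθ0 s
      field_simp
    simp_rw [e]
    rw [← Finset.mul_sum]
    have h0 : 0 ≤ Real.exp 1 * C * Real.exp (2 * C) := by positivity
    have h1 : 0 ≤ η ^ 2 * (Real.exp 1 * C * Real.exp (2 * C) + 1 / 2) := by positivity
    have h2 := mul_le_mul_of_nonneg_left hθ h1
    nlinarith [sq_nonneg η]

/-- Exponential tail bound for a weighted sum of squares of truncated variables. -/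
theorem measure_sum_truncated_sq_le {P : Measure Ω} {X : ι → Ω → ℝ} {τ l : ι → ℝ}
    (hX : ∀ t, Measurable (X t)) (hp : 4 ≤ p) (hC : 0 ≤ C) (hprod : HasProdMoment P X p C)
    (T : Finset ι) (hl : ∀ t, 0 ≤ l t) {b x : ℝ} (hb : 0 < b)
    (hT : ∀ t ∈ T, b * (l t * τ t ^ 2) ≤ 1) :
    P {ω | 2 * (1 + C) * ∑ t ∈ T, l t + x / b
        < ∑ t ∈ T, l t * (if |X t ω| ≤ τ t then |X t ω| else 0) ^ 2}
      ≤ ENNReal.ofReal (Real.exp (-x)) := by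
  classical
  set y : ι → ℝ → ℝ := fun t z => if |z| ≤ τ t then |z| else 0 with hy
  have hym : ∀ t, Measurable (y t) := fun t =>
    Measurable.ite (measurableSet_le measurable_norm measurable_const) measurable_norm
      measurable_const
  have hy1 : ∀ t z, y t z ^ 2 ≤ 1 + |z| ^ p := by
    intro t z
    have h1 := pow_four_le_one_add_rpow hp z
    have h0 : 0 ≤ |z| ^ p := by positivity
    simp only [hy]
    split_ifs
    · rw [sq_abs]
      rcases le_or_gt 1 |z| with hz | hz
      · have : z ^ 2 ≤ |z| ^ p := by
          rw [← sq_abs, ← Real.rpow_natCast]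
          exact Real.rpow_le_rpow_of_exponent_le hz (by push_cast; linarith)
        linarith
      · have : z ^ 2 ≤ 1 := by rw [← sq_abs]; nlinarith [abs_nonneg z]
        linarith
    · simp only [ne_eq, OfNat.ofNat_ne_zero, not_false_eq_true, zero_pow]
      linarith
  have hyτ : ∀ t ∈ T, ∀ z, b * (l t * y t z ^ 2) ≤ 1 := by
    intro t ht z
    simp only [hy]
    split_ifs with h
    · refine le_trans ?_ (hT t ht)
      have := hl t
      gcongr
    · simp
  -- Chernoff's method. The exponential of the weighted sum is a product, and the truncation keeps
  -- each exponent below one, where `exp u ≤ 1 + 2u`; moments of order `p` therefore suffice.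
  set f : ι → ℝ → ℝ := fun t z => if t ∈ T then Real.exp (b * (l t * y t z ^ 2)) else 1 with hf
  have hfm : ∀ t, Measurable (f t) := fun t => by
    by_cases h : t ∈ T
    · simp only [hf, h, if_true]
      exact Real.measurable_exp.comp ((((hym t).pow_const 2).const_mul _).const_mul _)
    · simp only [hf, h, if_false]
      exact measurable_const
  set g : ι → ℝ := fun t => if t ∈ T then 2 * (b * l t) else 0 with hg
  have hg0 : ∀ t, 0 ≤ g t := fun t => by
    have := hl t
    simp only [hg]
    split_ifs <;> positivity
  have key := hprod f (fun t => 1 + g t) g hfm (fun t z => ?_) (fun t => by linarith [hg0 t]) hg0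
    (fun t z => ?_)
  rotate_left
  · simp only [hf]
    split_ifs <;> positivity
  · have h0 : 0 ≤ |z| ^ p := by positivity
    simp only [hf, hg]
    split_ifs with h
    · have hl0 := hl t
      have h1 := exp_le_one_add_two_mul (by positivity : 0 ≤ b * (l t * y t z ^ 2)) (hyτ t h z)
      have h2 : b * (l t * y t z ^ 2) ≤ b * (l t * (1 + |z| ^ p)) := by
        have := hy1 t z
        gcongr
      nlinarith
    · simp
  have hprodle : ∏ t, (1 + g t + g t * C) ≤ Real.exp (b * (2 * (1 + C) * ∑ t ∈ T, l t)) := by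
    have h1 := prod_one_add_mul_le_exp (x := fun t => g t * (1 + C)) fun t =>
      mul_nonneg (hg0 t) (by linarith)
    have e1 : ∑ t, g t * (1 + C) = b * (2 * (1 + C) * ∑ t ∈ T, l t) := by
      simp only [hg, ite_mul, zero_mul]
      rw [Finset.sum_ite_mem, Finset.univ_inter, Finset.mul_sum, Finset.mul_sum]
      exact Finset.sum_congr rfl fun t _ => by ring
    rw [e1] at h1
    refine le_trans (le_of_eq ?_) h1
    exact Finset.prod_congr rfl fun t _ => by ring
  set c := 2 * (1 + C) * ∑ t ∈ T, l t + x / b with hc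
  have key2 := lintegral_ofReal_const_mul_le (P := P) (c := Real.exp (-(b * c)))
    (Real.exp_pos _).le (Finset.measurable_fun_prod Finset.univ fun t _ => (hfm t).comp (hX t))
    (key.trans (ENNReal.ofReal_le_ofReal hprodle))
  have e2 : Real.exp (-(b * c)) * Real.exp (b * (2 * (1 + C) * ∑ t ∈ T, l t))
      = Real.exp (-x) := by
    rw [← Real.exp_add]
    congr 1
    rw [hc]
    field_simp
    ring
  rw [e2] at key2
  have hsetm : MeasurableSet {ω | c < ∑ t ∈ T, l t * y t (X t ω) ^ 2} := by
    refine measurableSet_lt measurable_const (Finset.measurable_fun_sum _ fun t _ => ?_)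
    exact (((hym t).comp (hX t)).pow_const 2).const_mul _
  refine le_trans ?_ key2
  rw [← lintegral_indicator_one hsetm]
  refine lintegral_mono fun ω => ?_
  by_cases hω : ω ∈ {ω | c < ∑ t ∈ T, l t * y t (X t ω) ^ 2}
  · rw [Set.indicator_of_mem hω, Pi.one_apply, ← ENNReal.ofReal_one]
    refine ENNReal.ofReal_le_ofReal ?_
    have e3 : ∏ t, (f t ∘ X t) ω = Real.exp (b * ∑ t ∈ T, l t * y t (X t ω) ^ 2) := by
      simp only [hf, Function.comp_apply]
      rw [Finset.prod_ite_mem, Finset.univ_inter, ← Real.exp_sum, Finset.mul_sum]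
    rw [e3, ← Real.exp_add]
    refine Real.one_le_exp ?_
    have := mul_lt_mul_of_pos_left hω.out hb
    linarith
  · rw [Set.indicator_of_notMem hω]
    exact zero_le

/-- Cauchy–Schwarz with weights `l_s`, followed by summation block by block. A block whose sum of
squares is too large contributes nothing. -/
theorem sq_sum_good_le {y a l : ι → ℝ} {j : ι → ℕ} {c : ℕ → ℝ} (hc : ∀ k, 0 ≤ c k)
    (hl : ∀ s, 0 ≤ l s) (ha : ∀ s, l s = 0 → a s = 0) :
    (∑ s, (if ∑ t with j t = j s, l t * y t ^ 2 ≤ c (j s) then y s else 0) * a s) ^ 2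
      ≤ (∑ k ∈ Finset.univ.image j, c k) * ∑ s, a s ^ 2 / l s := by
  set v : ι → ℝ := fun s => if ∑ t with j t = j s, l t * y t ^ 2 ≤ c (j s) then y s else 0 with hv
  have h1 : (∑ s, v s * a s) ^ 2 ≤ (∑ s, l s * v s ^ 2) * ∑ s, a s ^ 2 / l s := by
    refine Finset.sum_sq_le_sum_mul_sum_of_sq_le_mul _ (fun s _ => mul_nonneg (hl s) (sq_nonneg _))
      (fun s _ => div_nonneg (sq_nonneg _) (hl s)) fun s _ => le_of_eq ?_
    rcases eq_or_ne (l s) 0 with h | h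
    · simp [ha s h]
    · field_simp
  refine h1.trans (mul_le_mul_of_nonneg_right ?_
    (Finset.sum_nonneg fun s _ => div_nonneg (sq_nonneg _) (hl s)))
  rw [← Finset.sum_fiberwise_of_maps_to (s := Finset.univ) (t := Finset.univ.image j) (g := j)
    (fun s hs => Finset.mem_image_of_mem j hs)]
  refine Finset.sum_le_sum fun k _ => ?_
  by_cases hk : ∑ t with j t = k, l t * y t ^ 2 ≤ c k
  · refine le_trans (le_of_eq (Finset.sum_congr rfl fun s hs => ?_)) hk
    have hs' : j s = k := (Finset.mem_filter.1 hs).2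
    simp only [hv, hs', hk, if_true]
  · refine le_trans (le_of_eq (Finset.sum_eq_zero fun s hs => ?_)) (hc k)
    have hs' : j s = k := (Finset.mem_filter.1 hs).2
    simp only [hv, hs', hk, if_false]
    ring

/-- The exponential beats every power: its series gives `exp u ≥ u^m / m!`, and `m` is chosen with
`q^m < 1/8`. -/
theorem exists_exp_neg_inv_pow_le {q : ℝ} (hq0 : 0 < q) (hq1 : q < 1) :
    ∃ M : ℝ, 0 ≤ M ∧ ∀ j : ℕ, Real.exp (-((q ^ j)⁻¹ / 2)) ≤ M * (1 / 8) ^ j := by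
  obtain ⟨m, hm⟩ := exists_pow_lt_of_lt_one (by norm_num : (0 : ℝ) < 1 / 8) hq1
  refine ⟨m.factorial * 2 ^ m, by positivity, fun j => ?_⟩
  have hqj : 0 < q ^ j := by positivity
  have hx : 0 < (q ^ j)⁻¹ / 2 := by positivity
  have h1 := Real.pow_div_factorial_le_exp _ hx.le m
  rw [Real.exp_neg]
  have h2 : 0 < ((q ^ j)⁻¹ / 2) ^ m / (m.factorial : ℝ) := by positivity
  refine (inv_anti₀ h2 h1).trans ?_
  have e : (((q ^ j)⁻¹ / 2) ^ m / (m.factorial : ℝ))⁻¹ = m.factorial * 2 ^ m * (q ^ m) ^ j := by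
    rw [← pow_mul, mul_comm m j, pow_mul]
    rw [inv_div, div_pow, inv_pow, div_div_eq_mul_div, div_inv_eq_mul]
  rw [e]
  gcongr

/-- The contribution of truncated factors on rare events. -/
theorem lintegral_sq_sum_rare_le {P : Measure Ω} {A y : ι → Ω → ℝ} {H : ι → Set Ω}
    {τ θ e : ι → ℝ} {η M : ℝ} (hH : ∀ s, MeasurableSet (H s)) (hA : ∀ t, Measurable (A t))
    (hy : ∀ s ω, |y s ω| ≤ τ s) (hθ : ∑ s, θ s ^ 2 ≤ 1) (hθ0 : ∀ s, 0 < θ s) (hη : 0 < η)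
    (he : ∀ s, 0 < e s) (hPH : ∀ s, P (H s) ≤ ENNReal.ofReal (e s ^ 2)) (hM : 0 ≤ M)
    (hτe : ∀ s, τ s ^ 2 * e s ≤ M * θ s ^ 2)
    (hA4 : ∀ s, ∫⁻ ω, ENNReal.ofReal (A s ω ^ 4) ∂P ≤ ENNReal.ofReal (η ^ 4 * θ s ^ 4)) :
    ∫⁻ ω, ENNReal.ofReal ((∑ s, (H s).indicator (y s) ω * |A s ω|) ^ 2) ∂P
      ≤ ENNReal.ofReal (η ^ 2 * M) := by
  set χ : ι → Ω → ℝ := fun s => (H s).indicator fun _ => (1 : ℝ) with hχ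
  have hχm : ∀ s, Measurable (χ s) := fun s => measurable_const.indicator (hH s)
  have hχ0 : ∀ s ω, 0 ≤ χ s ω := fun s ω => Set.indicator_nonneg (fun _ _ => zero_le_one) ω
  have hχi : ∀ s, ∫⁻ ω, ENNReal.ofReal (χ s ω) ∂P ≤ ENNReal.ofReal (e s ^ 2) := by
    intro s
    refine le_trans (le_of_eq ?_) (hPH s)
    rw [← lintegral_indicator_one (hH s)]
    refine lintegral_congr fun ω => ?_
    by_cases h : ω ∈ H s <;> simp [hχ, h]
  -- After Cauchy–Schwarz against `θ_s`, AM–GM splits the event from `A_s²`. The weights are tuned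
  -- with `e_s`, so that `P(H_s) ≤ e_s²` and the fourth moment of `A_s` both yield `η² τ_s² e_s /
  -- 2`.
  set g : ι → Ω → ℝ := fun s ω => τ s ^ 2 * e s / (2 * η ^ 2 * θ s ^ 4) * A s ω ^ 4
    + τ s ^ 2 * η ^ 2 / (2 * e s) * χ s ω with hg
  have hpt : ∀ ω, (∑ s, (H s).indicator (y s) ω * |A s ω|) ^ 2 ≤ ∑ s, g s ω := by
    intro ω
    have h1 : (∑ s, (H s).indicator (y s) ω * |A s ω|) ^ 2
        ≤ (∑ s, θ s ^ 2) * ∑ s, χ s ω * (τ s ^ 2 * A s ω ^ 2) / θ s ^ 2 := by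
      refine Finset.sum_sq_le_sum_mul_sum_of_sq_le_mul _ (fun s _ => sq_nonneg _)
        (fun s _ => div_nonneg (mul_nonneg (hχ0 s ω) (by positivity)) (sq_nonneg _)) fun s _ => ?_
      have hθs := hθ0 s
      rw [mul_div_cancel₀ _ (by positivity), mul_pow, sq_abs]
      by_cases h : ω ∈ H s
      · have h2 : y s ω ^ 2 ≤ τ s ^ 2 := sq_le_sq' (by linarith [abs_le.1 (hy s ω)])
          (abs_le.1 (hy s ω)).2
        simp only [hχ, Set.indicator_of_mem h, one_mul]
        gcongr
      · simp [hχ, h]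
    have h0 : 0 ≤ ∑ s, χ s ω * (τ s ^ 2 * A s ω ^ 2) / θ s ^ 2 := Finset.sum_nonneg fun s _ =>
      div_nonneg (mul_nonneg (hχ0 s ω) (by positivity)) (sq_nonneg _)
    refine h1.trans ((mul_le_of_le_one_left h0 hθ).trans (Finset.sum_le_sum fun s _ => ?_))
    have hθs := hθ0 s
    have hes := he s
    by_cases h : ω ∈ H s
    · simp only [hg, hχ, Set.indicator_of_mem h, one_mul, mul_one]
      rw [← sub_nonneg]
      have h3 : τ s ^ 2 * e s / (2 * η ^ 2 * θ s ^ 4) * A s ω ^ 4 + τ s ^ 2 * η ^ 2 / (2 * e s)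
          - τ s ^ 2 * A s ω ^ 2 / θ s ^ 2
          = τ s ^ 2 / (2 * e s) * (e s * A s ω ^ 2 / (η * θ s ^ 2) - η) ^ 2 := by
        field_simp
        ring
      rw [h3]
      positivity
    · simp only [hg, hχ, Set.indicator_of_notMem h, zero_mul, zero_div, mul_zero, add_zero]
      positivity
  refine (lintegral_mono fun ω => ENNReal.ofReal_le_ofReal (hpt ω)).trans ?_
  have hb : ∀ s, ∫⁻ ω, ENNReal.ofReal (g s ω) ∂P
      ≤ ENNReal.ofReal (τ s ^ 2 * e s / (2 * η ^ 2 * θ s ^ 4) * (η ^ 4 * θ s ^ 4)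
        + τ s ^ 2 * η ^ 2 / (2 * e s) * e s ^ 2) := by
    intro s
    have hθs := hθ0 s
    have hes := he s
    exact lintegral_ofReal_add_le (((hA s).pow_const 4).const_mul _) (fun ω => by positivity)
      (fun ω => mul_nonneg (by positivity) (hχ0 s ω)) (by positivity) (by positivity)
      (lintegral_ofReal_const_mul_le (by positivity) ((hA s).pow_const 4) (hA4 s))
      (lintegral_ofReal_const_mul_le (by positivity) (hχm s) (hχi s))
  refine (lintegral_ofReal_sum_le (fun s => ?_) (fun s ω => ?_) (fun s => ?_) hb).trans
    (ENNReal.ofReal_le_ofReal ?_)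
  · exact (((hA s).pow_const 4).const_mul _).add ((hχm s).const_mul _)
  · have hθs := hθ0 s
    have hes := he s
    exact add_nonneg (by positivity) (mul_nonneg (by positivity) (hχ0 s ω))
  · have hθs := hθ0 s
    have hes := he s
    positivity
  · have e1 : ∀ s, τ s ^ 2 * e s / (2 * η ^ 2 * θ s ^ 4) * (η ^ 4 * θ s ^ 4)
        + τ s ^ 2 * η ^ 2 / (2 * e s) * e s ^ 2 = η ^ 2 * (τ s ^ 2 * e s) := by
      intro s
      have hθs := hθ0 s
      have hes := he s
      field_simp
      ring
    simp_rw [e1]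
    calc ∑ s, η ^ 2 * (τ s ^ 2 * e s) ≤ ∑ s, η ^ 2 * (M * θ s ^ 2) :=
          Finset.sum_le_sum fun s _ => mul_le_mul_of_nonneg_left (hτe s) (sq_nonneg _)
      _ = η ^ 2 * M * ∑ s, θ s ^ 2 := by
          rw [Finset.mul_sum]
          exact Finset.sum_congr rfl fun s _ => by ring
      _ ≤ _ := mul_le_of_le_one_right (by positivity) hθ

end ProdMoment

/-! ### Truncation levels and the combined inequality -/

section ProdMoment

universe u v

/-- Properties of the truncation level `t^(-2/p)`: an exceedance has probability of order `t²`, yet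
`t` times the squared level is still a positive power of `t`, because `p > 4`. -/
theorem rpow_neg_two_div_bounds {p t : ℝ} (hp : 4 < p) (ht0 : 0 < t) (ht1 : t ≤ 1) :
    1 ≤ t ^ (-(2 / p)) ∧ 1 ≤ t ^ 2 * (t ^ (-(2 / p))) ^ p ∧ (t ^ (-(2 / p))) ^ 2 * t ≤ 1 ∧
      t * (t ^ (-(2 / p))) ^ 2 = (t ^ (1 / 2 - 2 / p)) ^ 2 := by
  have hp0 : 0 < p := by linarith
  have h2p : 2 / p ≤ 1 / 2 := by rw [div_le_div_iff₀ hp0 (by norm_num)]; linarith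
  have e1 : (t ^ (-(2 / p))) ^ 2 = t ^ (-(4 / p)) := by
    rw [← Real.rpow_natCast, ← Real.rpow_mul ht0.le]
    congr 1
    push_cast
    ring
  have e2 : t * (t ^ (-(2 / p))) ^ 2 = (t ^ (1 / 2 - 2 / p)) ^ 2 := by
    rw [e1, ← Real.rpow_natCast (t ^ (1 / 2 - 2 / p)), ← Real.rpow_mul ht0.le]
    nth_rewrite 1 [← Real.rpow_one t]
    rw [← Real.rpow_add ht0]
    congr 1
    push_cast
    ring
  refine ⟨Real.one_le_rpow_of_pos_of_le_one_of_nonpos ht0 ht1 (by simp; positivity), ?_, ?_, e2⟩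
  · rw [← Real.rpow_mul ht0.le]
    have : -(2 / p) * p = -(2 : ℕ) := by field_simp; norm_num
    rw [this, Real.rpow_neg ht0.le, Real.rpow_natCast, mul_inv_cancel₀ (by positivity)]
  · rw [mul_comm, e2]
    exact pow_le_one₀ (by positivity) (Real.rpow_le_one ht0.le ht1 (by linarith))

/-- The `A_s` may depend on all the `X_t`, so no cancellation is available. The sum is cut into
large values of `X_s`, truncated values on good blocks, and truncated values on rare bad blocks.
They contribute at most multiples of `η²`, `ε + ε²` and `η²`; summing the weights `l_s` inside
blocks avoids any loss depending on the number of sectors. -/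
theorem exists_lintegral_sq_sum_mul_le {p C : ℝ} (hp : 4 < p) (hC : 0 ≤ C) :
    ∃ M : ℝ, 0 ≤ M ∧ ∀ {Ω : Type u} {ι : Type v} [MeasurableSpace Ω] [Fintype ι] {P : Measure Ω}
      {X A : ι → Ω → ℝ} {θ l : ι → ℝ} {η ε : ℝ}, (∀ t, Measurable (X t)) →
      (∀ t, Measurable (A t)) → HasProdMoment P X p C → (∀ s, 0 < θ s) → ∑ s, θ s ^ 2 ≤ 1 →
      0 < η → (∀ s, 0 ≤ l s) → (∀ s, l s ≤ θ s) → ∑ s, l s ≤ ε →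
      (∀ s, ∫⁻ ω, ENNReal.ofReal (A s ω ^ 2) ∂P ≤ ENNReal.ofReal (l s ^ 2)) →
      (∀ s, ∫⁻ ω, ENNReal.ofReal (A s ω ^ 4) ∂P ≤ ENNReal.ofReal (η ^ 4 * θ s ^ 4)) →
      ∫⁻ ω, ENNReal.ofReal ((∑ s, X s ω * A s ω) ^ 2) ∂P
        ≤ ENNReal.ofReal (M * (η ^ 2 + ε + ε ^ 2)) := by
  have hp0 : 0 < p := by linarith
  set κ := 1 / 2 - 2 / p with hκ
  have hκ0 : 0 < κ := by
    have : 2 / p < 1 / 2 := by rw [div_lt_div_iff₀ hp0 (by norm_num)]; linarith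
    linarith
  set q : ℝ := (1 / 2) ^ κ with hq
  have hq0 : 0 < q := by positivity
  have hq1 : q < 1 := Real.rpow_lt_one (by norm_num) (by norm_num) hκ0
  obtain ⟨M₀, hM₀, hexp⟩ := exists_exp_neg_inv_pow_le hq0 hq1
  set E := Real.exp 1 * C * Real.exp (2 * C) + 1 with hE
  have hE0 : 0 ≤ E := by positivity
  have hc0 : 0 ≤ (1 - q)⁻¹ := inv_nonneg.2 (by linarith)
  refine ⟨3 * (E + 8 * M₀ + 2 * (1 + C) + (1 - q)⁻¹), by positivity, ?_⟩
  intro Ω ι _ _ P X A θ l η ε hX hA hprod hθ0 hθ hη hl hlθ hlε hA2 hA4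
  have hθ1 : ∀ s, θ s ≤ 1 := fun s => by
    have h1 : θ s ^ 2 ≤ 1 := (Finset.single_le_sum (f := fun s => θ s ^ 2)
      (fun s _ => sq_nonneg _) (Finset.mem_univ s)).trans hθ
    have := hθ0 s
    nlinarith
  have hε0 : 0 ≤ ε := (Finset.sum_nonneg fun s _ => hl s).trans hlε
  set τ : ι → ℝ := fun s => θ s ^ (-(2 / p)) with hτ
  have hτb := fun s => rpow_neg_two_div_bounds hp (hθ0 s) (hθ1 s)
  -- The dyadic block of `s`. The failure probability of a block can then be expressed in terms of
  -- the common size of its `θ_s`.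
  have hj : ∀ s, ∃ n : ℕ, (1 / 2 : ℝ) ^ (n + 1) < θ s ∧ θ s ≤ (1 / 2) ^ n := fun s =>
    exists_nat_pow_near_of_lt_one (hθ0 s) (hθ1 s) (by norm_num) (by norm_num)
  choose j hj1 hj2 using hj
  set y : ι → Ω → ℝ := fun s ω => if |X s ω| ≤ τ s then |X s ω| else 0 with hy
  have hym : ∀ s, Measurable (y s) := fun s =>
    Measurable.ite (measurableSet_le (hX s).norm measurable_const) (hX s).norm measurable_const
  -- Twice the bound on the mean of the block sum, plus a geometric slack. The slacks are summable
  -- over blocks, and the first terms add up to at most a multiple of `ε`.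
  set c : ℕ → ℝ := fun k => 2 * (1 + C) * ∑ t with j t = k, l t + q ^ k with hc
  have hck : ∀ k, 0 ≤ c k := fun k => by
    have : 0 ≤ ∑ t with j t = k, l t := Finset.sum_nonneg fun t _ => hl t
    positivity
  have hcsum : ∑ k ∈ Finset.univ.image j, c k ≤ 2 * (1 + C) * ε + (1 - q)⁻¹ := by
    simp only [hc]
    rw [Finset.sum_add_distrib, ← Finset.mul_sum,
      Finset.sum_fiberwise_of_maps_to (s := Finset.univ) (t := Finset.univ.image j) (g := j)
      (fun s hs => Finset.mem_image_of_mem j hs)]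
    have h1 : ∑ k ∈ Finset.univ.image j, q ^ k ≤ (1 - q)⁻¹ := by
      rw [← tsum_geometric_of_lt_one hq0.le hq1]
      exact (summable_geometric_of_lt_one hq0.le hq1).sum_le_tsum _ fun k _ => by positivity
    gcongr
  set H : ι → Set Ω := fun s => {ω | c (j s) < ∑ t with j t = j s, l t * y t ω ^ 2} with hH
  have hHm : ∀ s, MeasurableSet (H s) := fun s =>
    measurableSet_lt measurable_const
      (Finset.measurable_fun_sum _ fun t _ => ((hym t).pow_const 2).const_mul _)
  set e : ι → ℝ := fun s => Real.exp (-((q ^ j s)⁻¹ / 2)) with he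
  have hPH : ∀ s, P (H s) ≤ ENNReal.ofReal (e s ^ 2) := by
    intro s
    have hqj : 0 < q ^ j s := by positivity
    -- With `b = q^(-2j)` and `x = q^(-j)` the slack `x / b` is `q^j`. The exponents are admissible
    -- because `l_t τ_t² ≤ θ_t τ_t² = (θ_t^κ)² ≤ q^(2j)` in block `j`.
    have h1 := measure_sum_truncated_sq_le (τ := τ) (l := l) hX hp.le hC hprod
      (Finset.univ.filter fun t => j t = j s) hl (b := ((q ^ j s)⁻¹) ^ 2) (x := (q ^ j s)⁻¹)
      (by positivity) ?_
    · have e1 : (q ^ j s)⁻¹ / ((q ^ j s)⁻¹) ^ 2 = q ^ j s := by field_simp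
      have e2 : e s ^ 2 = Real.exp (-(q ^ j s)⁻¹) := by
        simp only [he]
        rw [← Real.exp_nat_mul]
        congr 1
        push_cast
        ring
      rw [e1] at h1
      rw [e2]
      exact h1
    · intro t ht
      have htj : j t = j s := (Finset.mem_filter.1 ht).2
      have h2 : l t * τ t ^ 2 ≤ (q ^ j s) ^ 2 := by
        calc l t * τ t ^ 2 ≤ θ t * τ t ^ 2 := by have := hlθ t; gcongr
          _ = (θ t ^ κ) ^ 2 := (hτb t).2.2.2
          _ ≤ (q ^ j s) ^ 2 := by
              have h3 : θ t ^ κ ≤ q ^ j s := by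
                rw [hq, ← Real.rpow_natCast, ← Real.rpow_mul (by norm_num), mul_comm κ,
                  Real.rpow_mul (by norm_num), Real.rpow_natCast, ← htj]
                exact Real.rpow_le_rpow (hθ0 t).le (hj2 t) hκ0.le
              have := hθ0 t
              gcongr
      calc ((q ^ j s)⁻¹) ^ 2 * (l t * τ t ^ 2) ≤ ((q ^ j s)⁻¹) ^ 2 * (q ^ j s) ^ 2 := by gcongr
        _ = 1 := by field_simp
  -- The rarity `e_s` is of order `8^(-j)`, hence of order `θ_s³`; one factor `θ_s` absorbs `τ_s²`.
  have hτe : ∀ s, τ s ^ 2 * e s ≤ 8 * M₀ * θ s ^ 2 := by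
    intro s
    have h1 := hexp (j s)
    have h2 : ((1 : ℝ) / 8) ^ j s ≤ 8 * θ s ^ 3 := by
      have h3 : (1 / 2 : ℝ) ^ j s ≤ 2 * θ s := by
        have := hj1 s
        rw [pow_succ] at this
        linarith
      calc ((1 : ℝ) / 8) ^ j s = ((1 / 2) ^ j s) ^ 3 := by
            rw [← pow_mul, mul_comm, pow_mul]; norm_num
        _ ≤ (2 * θ s) ^ 3 := by gcongr
        _ = 8 * θ s ^ 3 := by ring
    calc τ s ^ 2 * e s ≤ τ s ^ 2 * (M₀ * (8 * θ s ^ 3)) := by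
          have := h1.trans (mul_le_mul_of_nonneg_left h2 hM₀)
          gcongr
      _ = 8 * M₀ * θ s ^ 2 * (τ s ^ 2 * θ s) := by ring
      _ ≤ 8 * M₀ * θ s ^ 2 := mul_le_of_le_one_right (by positivity) (hτb s).2.2.1
  have hyτ : ∀ s ω, |y s ω| ≤ τ s := by
    intro s ω
    have h1 := (hτb s).1
    simp only [hy]
    split_ifs with h
    · rwa [abs_abs]
    · rw [abs_zero]
      exact zero_le_one.trans h1
  have hlarge := lintegral_sq_sum_large_le hX hA hp.le hC hprod (fun s => (hτb s).1)
    (fun s => (hτb s).2.1) hθ hθ0 hη hA4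
  have hrare := lintegral_sq_sum_rare_le hHm hA hyτ hθ hθ0 hη (fun s => Real.exp_pos _) hPH
    (by positivity) hτe hA4
  have hgood : ∫⁻ ω, ENNReal.ofReal ((2 * (1 + C) * ε + (1 - q)⁻¹) * ∑ s, A s ω ^ 2 / l s) ∂P
      ≤ ENNReal.ofReal ((2 * (1 + C) * ε + (1 - q)⁻¹) * ε) := by
    refine lintegral_ofReal_const_mul_le (by positivity)
      (Finset.measurable_fun_sum _ fun s _ => ((hA s).pow_const 2).div_const _) ?_
    refine (lintegral_ofReal_sum_le (fun s => ((hA s).pow_const 2).div_const _)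
      (fun s ω => div_nonneg (sq_nonneg _) (hl s)) hl fun s => ?_).trans
      (ENNReal.ofReal_le_ofReal hlε)
    simp_rw [div_eq_inv_mul]
    refine (lintegral_ofReal_const_mul_le (inv_nonneg.2 (hl s)) ((hA s).pow_const 2)
      (hA2 s)).trans (ENNReal.ofReal_le_ofReal ?_)
    rcases eq_or_ne (l s) 0 with h | h
    · simp [h]
    · rw [pow_two, inv_mul_cancel_left₀ h]
  -- Where `l_s = 0` the quotient `A_s² / l_s` is read as zero, which is legitimate since `A_s` then
  -- vanishes.
  have hA0 : ∀ᵐ ω ∂P, ∀ s, l s = 0 → A s ω = 0 := by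
    refine ae_all_iff.2 fun s => ?_
    rcases eq_or_ne (l s) 0 with h | h
    · have h1 : ∫⁻ ω, ENNReal.ofReal (A s ω ^ 2) ∂P = 0 := by simpa [h] using hA2 s
      rw [lintegral_eq_zero_iff ((hA s).pow_const 2).ennreal_ofReal] at h1
      filter_upwards [h1] with ω hω _
      have h2 : A s ω ^ 2 ≤ 0 := by simpa using hω
      exact pow_eq_zero_iff (two_ne_zero) |>.1 (le_antisymm h2 (sq_nonneg _))
    · exact Eventually.of_forall fun ω h' => absurd h' h
  set G1 : Ω → ℝ := fun ω => (∑ s, (if τ s < |X s ω| then |X s ω| else 0) * |A s ω|) ^ 2 with hG1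
  set G2 : Ω → ℝ := fun ω => (∑ s, (H s).indicator (y s) ω * |A s ω|) ^ 2 with hG2
  set G3 : Ω → ℝ := fun ω => (2 * (1 + C) * ε + (1 - q)⁻¹) * ∑ s, A s ω ^ 2 / l s with hG3
  have hG3nn : ∀ ω, 0 ≤ G3 ω := fun ω =>
    mul_nonneg (by positivity) (Finset.sum_nonneg fun s _ => div_nonneg (sq_nonneg _) (hl s))
  have hG1m : Measurable G1 := by
    refine (Finset.measurable_fun_sum _ fun s _ => Measurable.mul ?_ (hA s).norm).pow_const 2
    exact Measurable.ite (measurableSet_lt measurable_const (hX s).norm) (hX s).norm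
      measurable_const
  have hG2m : Measurable G2 :=
    (Finset.measurable_fun_sum _ fun s _ =>
      ((hym s).indicator (hHm s)).mul (hA s).norm).pow_const 2
  have hG3m : Measurable G3 :=
    (Finset.measurable_fun_sum _ fun s _ => ((hA s).pow_const 2).div_const _).const_mul _
  have hpt : ∀ᵐ ω ∂P, (∑ s, X s ω * A s ω) ^ 2 ≤ 3 * (G1 ω + (G2 ω + G3 ω)) := by
    filter_upwards [hA0] with ω hω
    set g : ι → ℝ := fun s =>
      (if ∑ t with j t = j s, l t * y t ω ^ 2 ≤ c (j s) then y s ω else 0) * |A s ω| with hg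
    have h3 : (∑ s, g s) ^ 2 ≤ G3 ω := by
      have h4 := sq_sum_good_le (y := fun t => y t ω) (a := fun s => |A s ω|) (j := j) hck hl
        fun s hs => by simp [hω s hs]
      refine h4.trans ?_
      simp only [sq_abs, hG3]
      exact mul_le_mul_of_nonneg_right hcsum
        (Finset.sum_nonneg fun s _ => div_nonneg (sq_nonneg _) (hl s))
    set a := ∑ s, (if τ s < |X s ω| then |X s ω| else 0) * |A s ω| with ha
    set b := ∑ s, (H s).indicator (y s) ω * |A s ω| with hb
    set d := ∑ s, g s with hd
    have h5 : |∑ s, X s ω * A s ω| ≤ a + b + d := by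
      refine (Finset.abs_sum_le_sum_abs _ _).trans ?_
      rw [ha, hb, hd, ← Finset.sum_add_distrib, ← Finset.sum_add_distrib]
      refine Finset.sum_le_sum fun s _ => ?_
      rw [abs_mul, ← add_mul, ← add_mul]
      refine mul_le_mul_of_nonneg_right ?_ (abs_nonneg _)
      have h6 : (H s).indicator (y s) ω
          + (if ∑ t with j t = j s, l t * y t ω ^ 2 ≤ c (j s) then y s ω else 0) = y s ω := by
        by_cases hs : ∑ t with j t = j s, l t * y t ω ^ 2 ≤ c (j s)
        · rw [if_pos hs, Set.indicator_of_notMem (by simpa [hH] using hs), zero_add]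
        · rw [if_neg hs, Set.indicator_of_mem (by simpa [hH] using hs), add_zero]
      rw [add_assoc, h6]
      simp only [hy]
      by_cases hs : |X s ω| ≤ τ s
      · simp [hs, not_lt.2 hs]
      · simp [hs, not_le.1 hs]
    have h7 : (∑ s, X s ω * A s ω) ^ 2 ≤ (a + b + d) ^ 2 := by
      rw [← sq_abs]
      gcongr
    have h8 : (a + b + d) ^ 2 ≤ 3 * (a ^ 2 + (b ^ 2 + d ^ 2)) := by
      nlinarith [sq_nonneg (a - b), sq_nonneg (b - d), sq_nonneg (a - d)]
    calc _ ≤ 3 * (a ^ 2 + (b ^ 2 + d ^ 2)) := h7.trans h8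
      _ ≤ _ := by
        have e1 : G1 ω = a ^ 2 := rfl
        have e2 : G2 ω = b ^ 2 := rfl
        rw [e1, e2]
        gcongr
  refine (lintegral_mono_ae (hpt.mono fun ω hω => ENNReal.ofReal_le_ofReal hω)).trans ?_
  refine (lintegral_ofReal_const_mul_le (by norm_num) (hG1m.add (hG2m.add hG3m))
    (lintegral_ofReal_add_le hG1m (fun ω => sq_nonneg _)
      (fun ω => add_nonneg (sq_nonneg _) (hG3nn ω)) (by positivity) (by positivity) hlarge
      (lintegral_ofReal_add_le hG2m (fun ω => sq_nonneg _) hG3nn (by positivity) (by positivity)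
        hrare hgood))).trans (ENNReal.ofReal_le_ofReal ?_)
  have h1 : 0 ≤ η ^ 2 * (2 * (1 + C) + (1 - q)⁻¹) := by positivity
  have h2 : 0 ≤ ε * (E + 8 * M₀ + 2 * (1 + C)) := by positivity
  have h3 : 0 ≤ ε ^ 2 * (E + 8 * M₀ + (1 - q)⁻¹) := by positivity
  nlinarith

end ProdMoment

/-! ### The linearization error in the score -/

section LinearizationError

variable {Ω : ℕ → Type*} {m : ∀ S, MeasurableSpace (Ω S)} [mΩ : ∀ S, MeasurableSpace (Ω S)]
  [∀ S, StandardBorelSpace (Ω S)] {μ : ∀ S, Measure (Ω S)} [∀ S, IsProbabilityMeasure (μ S)]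
  {N : ℕ → ℕ} {K : ℕ} {D : ∀ S, ShiftShareData (Ω S) (N S) S K} {γ : Fin K → ℝ}

/-- The root mean square of the linearization error of region `i`. -/
noncomputable def ShiftShareData.linNorm {Ω : Type*} [MeasurableSpace Ω] {N S K : ℕ}
    (D : ShiftShareData Ω N S K) (μ : Measure Ω) (i : Fin N) : ℝ := √(∫ ω, D.L ω i ^ 2 ∂μ)

theorem ShiftShareData.linNorm_nonneg {Ω : Type*} [MeasurableSpace Ω] {N S K : ℕ}
    (D : ShiftShareData Ω N S K) (μ : Measure Ω) (i : Fin N) : 0 ≤ D.linNorm μ i :=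
  Real.sqrt_nonneg _

theorem ShiftShareData.linNorm_sq {Ω : Type*} [MeasurableSpace Ω] {N S K : ℕ}
    (D : ShiftShareData Ω N S K) (μ : Measure Ω) (i : Fin N) :
    D.linNorm μ i ^ 2 = ∫ ω, D.L ω i ^ 2 ∂μ :=
  Real.sq_sqrt (integral_nonneg fun _ => sq_nonneg _)

theorem sq_sum_mul_le_of_eq_zero {ι : Type*} [Fintype ι] {l a b : ι → ℝ} (hl : ∀ i, 0 ≤ l i)
    (h : ∀ i, l i = 0 → b i = 0) :
    (∑ i, a i * b i) ^ 2 ≤ (∑ i, l i * a i ^ 2) * ∑ i, b i ^ 2 / l i := by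
  refine Finset.sum_sq_le_sum_mul_sum_of_sq_le_mul _ (fun i _ => mul_nonneg (hl i) (sq_nonneg _))
    (fun i _ => div_nonneg (sq_nonneg _) (hl i)) fun i _ => le_of_eq ?_
  rcases eq_or_ne (l i) 0 with h0 | h0
  · simp [h i h0]
  · field_simp

theorem integrable_L_sq (hr : ShiftShareRegular μ D γ) (S : ℕ) (i : Fin (N S)) :
    Integrable (fun ω => (D S).L ω i ^ 2) (μ S) :=
  ((memLp_L hr S i).mono_exponent (by norm_num : (2 : ENNReal) ≤ 4)).integrable_sq

theorem ae_L_eq_zero_of_linNorm (hr : ShiftShareRegular μ D γ) (S : ℕ) :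
    ∀ᵐ ω ∂μ S, ∀ i, (D S).linNorm (μ S) i = 0 → (D S).L ω i = 0 := by
  refine ae_all_iff.2 fun i => ?_
  by_cases h : (D S).linNorm (μ S) i = 0
  · have h1 : ∫ ω, (D S).L ω i ^ 2 ∂μ S = 0 := by rw [← (D S).linNorm_sq, h]; norm_num
    rw [integral_eq_zero_iff_of_nonneg (fun _ => sq_nonneg _) (integrable_L_sq hr S i)] at h1
    filter_upwards [h1] with ω hω _
    simpa using hω
  · exact Eventually.of_forall fun ω h2 => absurd h2 h

/-- Conditional second moments of the linearization errors, relative to unconditional ones. -/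
theorem isBoundedOp_linNorm_ratio (hm : ∀ S, m S ≤ mΩ S) (hr : ShiftShareRegular μ D γ) :
    IsBoundedOp μ fun x => (∑ i, (∫ ω', (D x.1).L ω' i ^ 2 ∂condExpKernel (μ x.1) (m x.1) x.2)
      / (D x.1).linNorm (μ x.1) i) / ∑ i, (D x.1).linNorm (μ x.1) i := by
  have hae := fun S i => condExp_ae_eq_integral_condExpKernel (μ := μ S) (hm S)
    (integrable_L_sq hr S i)
  have hintegrable : ∀ S i, Integrable (fun ω => ∫ ω', (D S).L ω' i ^ 2 ∂condExpKernel (μ S) (m S) ω)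
      (μ S) := fun S i => integrable_condExp.congr (hae S i)
  have hnn : ∀ S ω, 0 ≤ (∑ i, (∫ ω', (D S).L ω' i ^ 2 ∂condExpKernel (μ S) (m S) ω)
      / (D S).linNorm (μ S) i) / ∑ i, (D S).linNorm (μ S) i := fun S ω =>
    div_nonneg (Finset.sum_nonneg fun i _ => div_nonneg (integral_nonneg fun _ => sq_nonneg _)
      ((D S).linNorm_nonneg _ i)) (Finset.sum_nonneg fun i _ => (D S).linNorm_nonneg _ i)
  refine isBoundedOp_of_lintegral_le (C := 1) (fun S => ?_) fun S => ?_
  · have hmeas : ∀ i, Measurable fun ω => ∫ ω', (D S).L ω' i ^ 2 ∂condExpKernel (μ S) (m S) ω := by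
      intro i
      have h0 : StronglyMeasurable fun ω => (D S).L ω i ^ 2 :=
        Measurable.stronglyMeasurable (by fun_prop)
      have h1 : StronglyMeasurable[m S] fun ω =>
          ∫ ω', (D S).L ω' i ^ 2 ∂condExpKernel (μ S) (m S) ω :=
        StronglyMeasurable.integral_condExpKernel h0
      exact h1.measurable.mono (hm S) le_rfl
    have h2 := Finset.measurable_fun_sum Finset.univ fun i _ =>
      (hmeas i).div_const ((D S).linNorm (μ S) i)
    exact h2.div_const (∑ i, (D S).linNorm (μ S) i)
  · have hI : Integrable (fun ω => (∑ i, (∫ ω', (D S).L ω' i ^ 2 ∂condExpKernel (μ S) (m S) ω)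
        / (D S).linNorm (μ S) i) / ∑ i, (D S).linNorm (μ S) i) (μ S) :=
      (integrable_finsetSum _ fun i _ => (hintegrable S i).div_const _).div_const _
    simp only [abs_of_nonneg (hnn S _)]
    rw [← ofReal_integral_eq_lintegral_ofReal hI (Eventually.of_forall (hnn S))]
    refine ENNReal.ofReal_le_ofReal ?_
    rw [integral_div, integral_finsetSum _ fun i _ => (hintegrable S i).div_const _]
    simp only [integral_div]
    -- The mean conditional second moment is the square of `linNorm`, and dividing by `linNorm`
    -- returns it, also when it is zero. The normalised sum has mean at most one, and Markov's
    -- inequality applies.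
    have e : ∀ i, (∫ ω, ∫ ω', (D S).L ω' i ^ 2 ∂condExpKernel (μ S) (m S) ω ∂μ S)
        / (D S).linNorm (μ S) i = (D S).linNorm (μ S) i := by
      intro i
      rw [← integral_congr_ae (hae S i), integral_condExp (hm S), ← (D S).linNorm_sq, pow_two,
        mul_self_div_self]
    simp only [e]
    exact div_self_le_one _

/-- The noise in the controls does not interact with the linearization error. -/
theorem tendsto_noise_mul_L (hr : ShiftShareRegular μ D γ) :
    Tendsto (fun x : Σ S, Ω S => (D x.1).r x.2 * ∫ ω', (∑ i, (D x.1).Ugamma γ ω' i *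
      (D x.1).L ω' i) ^ 2 ∂condExpKernel (μ x.1) (D x.1).F0 x.2) (whp μ) (𝓝 0) := by
  -- The deterministic norms of `L_i`, normalised, serve as weights: Cauchy–Schwarz against them
  -- separates the noise from the linearization errors.
  have hg : ShareWeight μ D fun S _ i => (D S).linNorm (μ S) i / ∑ i, (D S).linNorm (μ S) i :=
    { measurable := fun S i => measurable_const
      nonneg := fun S => Eventually.of_forall fun ω i => div_nonneg ((D S).linNorm_nonneg _ i)
        (Finset.sum_nonneg fun i _ => (D S).linNorm_nonneg _ i)
      sum_le := fun S => Eventually.of_forall fun ω => by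
        rw [← Finset.sum_div]
        exact div_self_le_one _
      const := fun S ω ω' h => rfl }
  have hU : FourthBdd μ D fun S => (D S).Ugamma γ :=
    FourthBdd.dotProduct (v := fun S => (D S).U) (a := fun S _ => γ) (fun k => fourthBdd_U hr k)
      (fun k => IsBoundedOp.const _)
  have h1 := (IsBoundedOp.const (μ := μ) 1).add (hU _ hg)
  have h2 := isBoundedOp_linNorm_ratio (m := fun S => (D S).F0) (fun S => (D S).F0_le) hr
  have h3 := isLittleOp_iff_tendsto.1 hr.lin_error_rate
  have h4 := (h1.mul h2).mul_tendsto_zero (by simpa using h3.pow 2)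
  have hLi : ∀ S, ∀ᵐ ω ∂μ S, ∀ i, Integrable (fun ω' => (D S).L ω' i ^ 2)
      (condExpKernel (μ S) (D S).F0 ω) := fun S =>
    ae_all_iff.2 fun i => (integrable_L_sq hr S i).condExpKernel_ae
  refine squeeze_zero' (Eventually.of_forall fun x => mul_nonneg ((D x.1).r_nonneg _)
    (integral_nonneg fun _ => sq_nonneg _)) ?_ h4
  filter_upwards [eventually_whp_of_ae_curried hLi,
    eventually_whp_of_ae_curried fun S => (D S).ae_kernel_F0_const (μ S),
    eventually_whp_of_ae_curried fun S =>
      ae_ae_condExpKernel (D S).F0_le (ae_L_eq_zero_of_linNorm hr S)] with x hLx hcx hzx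
  obtain ⟨S, ω⟩ := x
  simp only at hLx hcx hzx ⊢
  set P := condExpKernel (μ S) (D S).F0 ω with hP
  set l := (D S).linNorm (μ S) with hl
  set u := (D S).Ugamma γ ω with hu
  have hl0 : ∀ i, 0 ≤ l i := (D S).linNorm_nonneg (μ S)
  have hle : ∫ ω', (∑ i, (D S).Ugamma γ ω' i * (D S).L ω' i) ^ 2 ∂P
      ≤ (∑ i, l i * u i ^ 2) * ∑ i, (∫ ω', (D S).L ω' i ^ 2 ∂P) / l i := by
    have hI : Integrable (fun ω' => (∑ i, l i * u i ^ 2) * ∑ i, (D S).L ω' i ^ 2 / l i) P :=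
      (integrable_finsetSum _ fun i _ => (hLx i).div_const _).const_mul _
    have e : (∑ i, l i * u i ^ 2) * ∑ i, (∫ ω', (D S).L ω' i ^ 2 ∂P) / l i
        = ∫ ω', (∑ i, l i * u i ^ 2) * ∑ i, (D S).L ω' i ^ 2 / l i ∂P := by
      rw [integral_const_mul, integral_finsetSum _ fun i _ => (hLx i).div_const _]
      simp only [integral_div]
    rw [e]
    refine integral_mono_of_nonneg (Eventually.of_forall fun _ => sq_nonneg _) hI ?_
    filter_upwards [hcx, hzx] with ω' h1 h2
    have e2 : (D S).Ugamma γ ω' = u := by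
      funext i
      simp only [hu, ShiftShareData.Ugamma, h1.2.1]
    simp only [e2]
    exact sq_sum_mul_le_of_eq_zero hl0 h2
  refine (mul_le_mul_of_nonneg_left hle ((D S).r_nonneg ω)).trans ?_
  set a := ∑ i, l i with ha
  have ha0 : 0 ≤ a := Finset.sum_nonneg fun i _ => hl0 i
  set v := ∑ i, (∫ ω', (D S).L ω' i ^ 2 ∂P) / l i with hv
  have hv0 : 0 ≤ v := Finset.sum_nonneg fun i _ =>
    div_nonneg (integral_nonneg fun _ => sq_nonneg _) (hl0 i)
  have e3 : (√((D S).r ω) * ∑ i, √(∫ ω', (D S).L ω' i ^ 2 ∂μ S)) ^ 2 = (D S).r ω * a ^ 2 := by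
    rw [mul_pow, Real.sq_sqrt ((D S).r_nonneg ω)]
    rfl
  rw [e3]
  rcases eq_or_lt_of_le ha0 with h0 | h0
  · have hz : ∀ i, l i = 0 := fun i =>
      (Finset.sum_eq_zero_iff_of_nonneg fun i _ => hl0 i).1 h0.symm i (Finset.mem_univ i)
    simp [hz, ← h0]
  · have h5 : ∑ i, l i * u i ^ 2 ≤ a * (1 + ∑ i, l i / a * u i ^ 4) := by
      have e4 : a * (1 + ∑ i, l i / a * u i ^ 4) = ∑ i, l i * (1 + u i ^ 4) := by
        simp only [mul_add, Finset.mul_sum, Finset.sum_add_distrib, mul_one, ha.symm]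
        congr 1
        exact Finset.sum_congr rfl fun i _ => by field_simp
      rw [e4]
      refine Finset.sum_le_sum fun i _ => mul_le_mul_of_nonneg_left ?_ (hl0 i)
      nlinarith [sq_nonneg (u i ^ 2 - 1), sq_nonneg (u i ^ 2)]
    have hr0 := (D S).r_nonneg ω
    calc (D S).r ω * ((∑ i, l i * u i ^ 2) * v)
        ≤ (D S).r ω * (a * (1 + ∑ i, l i / a * u i ^ 4) * v) := by gcongr
      _ = _ := by field_simp

/-- Minkowski's inequality in `L²`, derived from Cauchy–Schwarz with the norms as weights. -/
theorem integral_sq_sum_mul_le_sq {Ω ι : Type*} [MeasurableSpace Ω] [Fintype ι] {P : Measure Ω}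
    {f : ι → Ω → ℝ} (hf : ∀ i, MemLp (f i) 2 P) {c : ι → ℝ} (hc : ∀ i, 0 ≤ c i) :
    ∫ ω, (∑ i, c i * f i ω) ^ 2 ∂P ≤ (∑ i, c i * √(∫ ω, f i ω ^ 2 ∂P)) ^ 2 := by
  set v : ι → ℝ := fun i => √(∫ ω, f i ω ^ 2 ∂P) with hv
  have hvsq : ∀ i, ∫ ω, f i ω ^ 2 ∂P = v i ^ 2 := fun i =>
    (Real.sq_sqrt (integral_nonneg fun _ => sq_nonneg _)).symm
  have hl : ∀ i, 0 ≤ c i * v i := fun i => mul_nonneg (hc i) (Real.sqrt_nonneg _)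
  have hz : ∀ᵐ ω ∂P, ∀ i, c i * v i = 0 → c i * f i ω = 0 := by
    refine ae_all_iff.2 fun i => ?_
    by_cases h : v i = 0
    · have h1 : ∫ ω, f i ω ^ 2 ∂P = 0 := by rw [hvsq, h]; norm_num
      rw [integral_eq_zero_iff_of_nonneg (fun _ => sq_nonneg _) (hf i).integrable_sq] at h1
      filter_upwards [h1] with ω hω _
      have : f i ω = 0 := by simpa using hω
      rw [this, mul_zero]
    · refine Eventually.of_forall fun ω h' => ?_
      rw [(mul_eq_zero.1 h').resolve_right h, zero_mul]
  have hi : ∀ i, Integrable (fun ω => (c i * f i ω) ^ 2 / (c i * v i)) P := fun i =>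
    ((hf i).const_mul (c i)).integrable_sq.div_const _
  calc ∫ ω, (∑ i, c i * f i ω) ^ 2 ∂P
      ≤ ∫ ω, (∑ i, c i * v i) * ∑ i, (c i * f i ω) ^ 2 / (c i * v i) ∂P := by
        refine integral_mono_of_nonneg (Eventually.of_forall fun _ => sq_nonneg _)
          ((integrable_finsetSum _ fun i _ => hi i).const_mul _) ?_
        filter_upwards [hz] with ω hω
        have := sq_sum_mul_le_of_eq_zero (a := fun _ => (1 : ℝ)) hl hω
        simpa using this
    _ = (∑ i, c i * v i) * ∑ i, c i * v i := by
        rw [integral_const_mul, integral_finsetSum _ fun i _ => hi i]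
        congr 1
        refine Finset.sum_congr rfl fun i _ => ?_
        simp only [integral_div, mul_pow, integral_const_mul, hvsq]
        rw [← mul_pow, pow_two, mul_self_div_self]
    _ = _ := by rw [pow_two]

theorem sqrt_integral_sq_le {Ω : Type*} [MeasurableSpace Ω] {P : Measure Ω}
    [IsProbabilityMeasure P] {f : Ω → ℝ} (hf : MemLp f 4 P) {a : ℝ}
    (h : ∫ ω, f ω ^ 4 ∂P ≤ a) : √(∫ ω, f ω ^ 2 ∂P) ≤ √√a := by
  have hm : MemLp (fun ω => f ω ^ 2) 2 P := by
    refine (memLp_two_iff_integrable_sq (hf.aestronglyMeasurable.pow 2)).2 ?_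
    refine (integrable_pow_four hf).congr (Eventually.of_forall fun ω => ?_)
    simp only [Pi.pow_apply]
    ring
  have h1 := variance_nonneg (fun ω => f ω ^ 2) P
  rw [variance_eq_sub hm] at h1
  have e : ∫ ω, ((fun ω => f ω ^ 2) ^ 2) ω ∂P = ∫ ω, f ω ^ 4 ∂P := by
    refine integral_congr_ae (Eventually.of_forall fun ω => ?_)
    simp only [Pi.pow_apply]
    ring
  rw [e] at h1
  refine Real.sqrt_le_sqrt (Real.le_sqrt_of_sq_le ?_)
  linarith

/-- The aggregated linearization error does not contribute to the score. -/
theorem tendsto_Xtilde_mul_Lagg (hd : ShiftShareDesign μ D γ) (hr : ShiftShareRegular μ D γ)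
    (hc : ShifterRecovery μ D γ) :
    Tendsto (fun x : Σ S, Ω S => (D x.1).r x.2 * ∫ ω', (∑ s, (D x.1).Xtilde γ ω' s *
      (D x.1).Lagg ω' s) ^ 2 ∂condExpKernel (μ x.1) (D x.1).F0 x.2) (whp μ) (𝓝 0) := by
  obtain ⟨p, C, hp, hC, hlaw⟩ := exists_shifterLaw hd hr
  obtain ⟨M, hM, hmain⟩ := exists_lintegral_sq_sum_mul_le hp hC
  set η₀ : (Σ S, Ω S) → ℝ := fun x =>
    ⨆ i, ((μ x.1)[fun ω' => (D x.1).L ω' i ^ 4 | (D x.1).FW]) x.2 with hη₀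
  -- The fourth root of the largest conditional fourth moment; the added `1/(S+1)` makes it strictly
  -- positive, as the inequality requires.
  set η : (Σ S, Ω S) → ℝ := fun x => √√|η₀ x| + 1 / ((x.1 : ℝ) + 1) with hη
  set v : ∀ x : Σ S, Ω S, Fin (N x.1) → ℝ := fun x i =>
    √(∫ ω', (D x.1).L ω' i ^ 2 ∂condExpKernel (μ x.1) (D x.1).FW x.2) with hv
  set ε : (Σ S, Ω S) → ℝ := fun x => √((D x.1).r x.2) * ∑ i, v x i with hε
  have hηt : Tendsto η (whp μ) (𝓝 0) := by
    have h1 := isLittleOp_iff_tendsto.1 hr.lin_error_fourth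
    have h2 := h1.abs.sqrt.sqrt
    have h3 := (tendsto_one_div_add_atTop_nhds_zero_nat (𝕜 := ℝ)).comp (tendsto_fst_whp (μ := μ))
    have h4 := h2.add h3
    simp only [abs_zero, Real.sqrt_zero, add_zero] at h4
    exact h4
  -- The rate assumption concerns unconditional norms, while conditional ones are needed.
  -- Cauchy–Schwarz bounds their sum by the unconditional sum times the root of a ratio that is
  -- bounded in probability.
  have hεt : Tendsto ε (whp μ) (𝓝 0) := by
    have h2 := (isBoundedOp_linNorm_ratio (m := fun S => (D S).FW) (fun S => (D S).FW_le) hr).sqrt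
    have h3 := isLittleOp_iff_tendsto.1 hr.lin_error_rate
    have h4 := h2.mul_tendsto_zero h3
    refine squeeze_zero' (Eventually.of_forall fun x => mul_nonneg (Real.sqrt_nonneg _)
      (Finset.sum_nonneg fun i _ => Real.sqrt_nonneg _)) ?_ h4
    filter_upwards [eventually_whp_of_ae_curried fun S =>
      ae_ae_condExpKernel (D S).FW_le (ae_L_eq_zero_of_linNorm hr S)] with x hzx
    set l := (D x.1).linNorm (μ x.1) with hl
    have hl0 : ∀ i, 0 ≤ l i := (D x.1).linNorm_nonneg (μ x.1)
    have hz : ∀ i, l i = 0 → v x i = 0 := by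
      intro i hi
      have : ∫ ω', (D x.1).L ω' i ^ 2 ∂condExpKernel (μ x.1) (D x.1).FW x.2 = 0 := by
        refine integral_eq_zero_of_ae ?_
        filter_upwards [hzx] with ω' h
        simp [h i hi]
      simp only [hv, this, Real.sqrt_zero]
    have h5 := sq_sum_mul_le_of_eq_zero (a := fun _ => (1 : ℝ)) hl0 hz
    simp only [one_mul, one_pow, mul_one] at h5
    have hvsq : ∀ i, v x i ^ 2 = ∫ ω', (D x.1).L ω' i ^ 2 ∂condExpKernel (μ x.1) (D x.1).FW x.2 :=
      fun i => Real.sq_sqrt (integral_nonneg fun _ => sq_nonneg _)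
    simp only [hvsq] at h5
    set G := ∑ i, (∫ ω', (D x.1).L ω' i ^ 2 ∂condExpKernel (μ x.1) (D x.1).FW x.2) / l i with hG
    have e1 : ∑ i, √(∫ ω', (D x.1).L ω' i ^ 2 ∂μ x.1) = ∑ i, l i := rfl
    rw [e1]
    set a := ∑ i, l i with ha
    have ha0 : 0 ≤ a := Finset.sum_nonneg fun i _ => hl0 i
    have h6 : ∑ i, v x i ≤ √(G / a) * a := by
      have h7 : ∑ i, v x i ≤ √(a * G) := Real.le_sqrt_of_sq_le h5
      rcases eq_or_lt_of_le ha0 with h0 | h0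
      · simpa [← h0] using h7
      · refine h7.trans (le_of_eq ?_)
        have e2 : a * G = G / a * a ^ 2 := by field_simp
        rw [e2, Real.sqrt_mul' _ (sq_nonneg a), Real.sqrt_sq ha0]
    calc ε x ≤ √((D x.1).r x.2) * (√(G / a) * a) :=
          mul_le_mul_of_nonneg_left h6 (Real.sqrt_nonneg _)
      _ = _ := by ring
  have hH : Tendsto (fun x => M * (η x ^ 2 + ε x + ε x ^ 2)) (whp μ) (𝓝 0) := by
    simpa using (((hηt.pow 2).add hεt).add (hεt.pow 2)).const_mul M
  have hη1 : ∀ᶠ x in whp μ, η x ≤ 1 := hηt.eventually_le_const one_pos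
  have hbind : ∀ S, ∀ᵐ ω ∂μ S, (condExpKernel (μ S) (D S).FW ω).bind
      (fun ω' => condExpKernel (μ S) (D S).F0 ω') = condExpKernel (μ S) (D S).FW ω := fun S =>
    ae_bind_condExpKernel (D S).FW_le_F0 (D S).F0_le
  -- Fourth moments of `L` are controlled only given `W`, so the inequality is applied under that
  -- law, where the shifters are a mixture of independent families.
  have hprod : ∀ S, ∀ᵐ ω ∂μ S, HasProdMoment (condExpKernel (μ S) (D S).FW ω)
      (fun s ω' => (D S).Xtilde γ ω' s) p C := by
    intro S
    have h1 : ∀ᵐ ω ∂μ S, HasProdMoment (condExpKernel (μ S) (D S).F0 ω)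
        (fun s ω' => (D S).Xtilde γ ω' s) p C := by
      filter_upwards [hlaw S] with ω h
      exact hasProdMoment_of_iIndepFun (fun s => by fun_prop) h.indep h.integrable h.moment
    filter_upwards [hbind S, ae_ae_condExpKernel (D S).FW_le h1] with ω h2 h3
    exact HasProdMoment.of_bind (fun s => by fun_prop)
      (measurable_condExpKernel_measure (D S).F0_le) h2 h3
  have hL4 : ∀ S, ∀ᵐ ω ∂μ S, ∀ i, Integrable (fun ω' => (D S).L ω' i ^ 4)
      (condExpKernel (μ S) (D S).FW ω) ∧ ∫ ω', (D S).L ω' i ^ 4 ∂condExpKernel (μ S) (D S).FW ω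
        ≤ |η₀ ⟨S, ω⟩| := by
    intro S
    refine (ae_all_iff.2 fun i => ?_)
    filter_upwards [(hr.lin_error_moment S i).condExpKernel_ae (m := (D S).FW),
      condExp_ae_eq_integral_condExpKernel (D S).FW_le (hr.lin_error_moment S i)] with ω h1 h2
    refine ⟨h1, ?_⟩
    rw [← h2]
    exact (le_ciSup (f := fun i => ((μ S)[fun ω' => (D S).L ω' i ^ 4 | (D S).FW]) ω)
      (Set.finite_range _).bddAbove i).trans (le_abs_self _)
  -- Transfers the bound given `W` to the finer conditioning on `ℱ₀`.
  have hkey := tendsto_integral_condExpKernel_of_le (μ := μ) (m' := fun S => (D S).FW)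
    (m := fun S => (D S).F0) (fun S => (D S).FW_le_F0) (fun S => (D S).F0_le)
    (f := fun S ω' => (D S).r ω' * (∑ s, (D S).Xtilde γ ω' s * (D S).Lagg ω' s) ^ 2)
    (fun S => by fun_prop) (fun S ω => mul_nonneg ((D S).r_nonneg ω) (sq_nonneg _)) ?_ hH
  · refine hkey.congr' ?_
    filter_upwards [eventually_whp_of_ae_curried fun S => (D S).ae_kernel_F0_const (μ S)] with x hx
    rw [← integral_const_mul]
    refine integral_congr_ae ?_
    filter_upwards [hx] with ω' h
    simp only [ShiftShareData.r, ShiftShareData.n, h.2.2.2.2.1]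
  filter_upwards [hη1, eventually_whp_of_ae_curried hd.share_nonneg,
    eventually_whp_of_ae_curried hd.share_sum_le, eventually_whp_of_ae_curried hc.full_rank,
    eventually_whp_of_ae_curried hprod, eventually_whp_of_ae_curried hL4,
    eventually_whp_of_ae_curried fun S => (D S).ae_kernel_FW_const (μ S)]
    with x h1 h0 hs1 hrk hpx hLx hcx
  obtain ⟨S, ω⟩ := x
  simp only at h1 h0 hs1 hrk hpx hLx hcx ⊢
  set P := condExpKernel (μ S) (D S).FW ω with hP
  -- Shares are frozen at `ω`. The scales are `θ_s = √r_N n_s`, and `l_s` aggregates the conditional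
  -- norms of the `L_i`; these norms are at most one when `η ≤ 1`, which gives `l_s ≤ θ_s`.
  set A : Fin S → Ω S → ℝ := fun s ω' => ∑ i, (√((D S).r ω) * (D S).w ω i s) * (D S).L ω' i with hA
  set θ : Fin S → ℝ := fun s => √((D S).r ω) * (D S).n ω s with hθ
  set l : Fin S → ℝ := fun s => ∑ i, (√((D S).r ω) * (D S).w ω i s) * v ⟨S, ω⟩ i with hl
  have hn := (D S).n_pos hrk h0
  have hc0 : ∀ s i, 0 ≤ √((D S).r ω) * (D S).w ω i s := fun s i =>
    mul_nonneg (Real.sqrt_nonneg _) (h0 i s)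
  have hθeq : ∀ s, θ s = ∑ i, √((D S).r ω) * (D S).w ω i s := fun s => by
    simp only [hθ, ShiftShareData.n, Finset.mul_sum]
  have hLm : ∀ i, MemLp (fun ω' => (D S).L ω' i) 4 P := fun i =>
    (memLp_four_iff (Measurable.aestronglyMeasurable (by fun_prop))).2 (hLx i).1
  have hLm2 : ∀ i, MemLp (fun ω' => (D S).L ω' i) 2 P := fun i =>
    (hLm i).mono_exponent (by norm_num)
  have hv1 : ∀ i, v ⟨S, ω⟩ i ≤ 1 := fun i => by
    have h2 := sqrt_integral_sq_le (hLm i) (hLx i).2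
    have h3 : (0 : ℝ) ≤ 1 / ((S : ℝ) + 1) := by positivity
    simp only [hη] at h1
    linarith
  have hη0 : 0 < η ⟨S, ω⟩ := by
    simp only [hη]
    positivity
  have hη4 : |η₀ ⟨S, ω⟩| ≤ η ⟨S, ω⟩ ^ 4 := by
    have h2 : √√|η₀ ⟨S, ω⟩| ≤ η ⟨S, ω⟩ := by
      simp only [hη]
      have h3 : (0 : ℝ) ≤ 1 / ((S : ℝ) + 1) := by positivity
      linarith
    calc |η₀ ⟨S, ω⟩| = √√|η₀ ⟨S, ω⟩| ^ 4 := by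
          rw [show (4 : ℕ) = 2 * 2 by norm_num, pow_mul, Real.sq_sqrt (Real.sqrt_nonneg _),
            Real.sq_sqrt (abs_nonneg _)]
      _ ≤ _ := by gcongr
  have hAm4 : ∀ s, MemLp (A s) 4 P := fun s => memLp_finsetSum _ fun i _ => (hLm i).const_mul _
  have hAm2 : ∀ s, MemLp (A s) 2 P := fun s => (hAm4 s).mono_exponent (by norm_num)
  have key := hmain (P := P) (X := fun s ω' => (D S).Xtilde γ ω' s) (A := A) (θ := θ) (l := l)
    (η := η ⟨S, ω⟩) (ε := ε ⟨S, ω⟩) (fun s => by fun_prop) (fun s => by fun_prop) hpx ?_ ?_ hη0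
    ?_ ?_ ?_ ?_ ?_
  · refine le_trans (le_of_eq (lintegral_congr_ae ?_)) key
    filter_upwards [hcx] with ω' h
    congr 1
    have e1 : ∀ s, A s ω' = √((D S).r ω) * (D S).Lagg ω' s := fun s => by
      simp only [hA, ShiftShareData.Lagg, h, Finset.mul_sum, mul_assoc]
    have e2 : (D S).r ω' = (D S).r ω := by simp only [ShiftShareData.r, ShiftShareData.n, h]
    have e3 : ∑ s, (D S).Xtilde γ ω' s * A s ω'
        = √((D S).r ω) * ∑ s, (D S).Xtilde γ ω' s * (D S).Lagg ω' s := by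
      rw [Finset.mul_sum]
      exact Finset.sum_congr rfl fun s _ => by rw [e1]; ring
    rw [e3, mul_pow, Real.sq_sqrt ((D S).r_nonneg ω), e2]
  · intro s
    have hrp : 0 < (D S).r ω := inv_pos.2 (Finset.sum_pos (fun t _ => by have := hn t; positivity)
      ⟨s, Finset.mem_univ s⟩)
    exact mul_pos (Real.sqrt_pos.2 hrp) (hn s)
  · refine le_trans (le_of_eq (Finset.sum_congr rfl fun s _ => ?_)) ((D S).sum_r_mul_sq_le_one ω)
    simp only [hθ, mul_pow, Real.sq_sqrt ((D S).r_nonneg ω)]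
  · exact fun s => Finset.sum_nonneg fun i _ => mul_nonneg (hc0 s i) (Real.sqrt_nonneg _)
  · intro s
    rw [hθeq]
    exact Finset.sum_le_sum fun i _ => mul_le_of_le_one_right (hc0 s i) (hv1 i)
  · simp only [hl, hε, Finset.mul_sum]
    rw [Finset.sum_comm]
    refine Finset.sum_le_sum fun i _ => ?_
    have e1 : ∑ s, √((D S).r ω) * (D S).w ω i s * v ⟨S, ω⟩ i
        = √((D S).r ω) * v ⟨S, ω⟩ i * ∑ s, (D S).w ω i s := by
      rw [Finset.mul_sum]
      exact Finset.sum_congr rfl fun s _ => by ring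
    rw [e1]
    exact mul_le_of_le_one_right (mul_nonneg (Real.sqrt_nonneg _) (Real.sqrt_nonneg _)) (hs1 i)
  · intro s
    rw [← ofReal_integral_eq_lintegral_ofReal (hAm2 s).integrable_sq
      (Eventually.of_forall fun _ => sq_nonneg _)]
    exact ENNReal.ofReal_le_ofReal (integral_sq_sum_mul_le_sq hLm2 (hc0 s))
  · intro s
    rw [← ofReal_integral_eq_lintegral_ofReal (integrable_pow_four (hAm4 s))
      (Eventually.of_forall fun _ => by positivity)]
    refine ENNReal.ofReal_le_ofReal ?_
    have hθ0 : 0 ≤ θ s := mul_nonneg (Real.sqrt_nonneg _) (hn s).le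
    refine (integral_sum_mul_pow_four_le (c := θ s) ?_ hLm).trans ?_
    · rw [hθeq]
      exact le_of_eq (Finset.sum_congr rfl fun i _ => abs_of_nonneg (hc0 s i))
    · calc θ s ^ 3 * ∑ i, |√((D S).r ω) * (D S).w ω i s| * ∫ ω', (D S).L ω' i ^ 4 ∂P
          ≤ θ s ^ 3 * ∑ i, (√((D S).r ω) * (D S).w ω i s) * η ⟨S, ω⟩ ^ 4 := by
            refine mul_le_mul_of_nonneg_left (Finset.sum_le_sum fun i _ => ?_) (by positivity)
            rw [abs_of_nonneg (hc0 s i)]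
            exact mul_le_mul_of_nonneg_left ((hLx i).2.trans hη4) (hc0 s i)
        _ = η ⟨S, ω⟩ ^ 4 * θ s ^ 4 := by
            rw [← Finset.sum_mul, ← hθeq]
            ring

end LinearizationError

/-! ### The conditional variance of the score under constant effects -/

section Variance

variable {Ω : Type*} {m : MeasurableSpace Ω} [mΩ : MeasurableSpace Ω]

theorem memLp_two_mul {P : Measure Ω} {f g : Ω → ℝ} (hf : MemLp f 4 P) (hg : MemLp g 4 P) :
    MemLp (fun ω => f ω * g ω) 2 P := by
  refine (memLp_two_iff_integrable_sq
    (hf.aestronglyMeasurable.mul hg.aestronglyMeasurable)).2 ?_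
  simpa only [Pi.mul_apply, mul_pow] using integrable_sq_mul_sq hf hg

/-- Cauchy–Schwarz for the covariance, read off from the nonpositive discriminant of the variance of
`t * f + g`. -/
theorem abs_variance_add_sub_le {P : Measure Ω} [IsProbabilityMeasure P] {f g : Ω → ℝ}
    (hf : MemLp f 2 P) (hg : MemLp g 2 P) :
    |Var[fun ω => f ω + g ω; P] - Var[f; P]| ≤ 2 * √(Var[f; P] * Var[g; P]) + Var[g; P] := by
  have hquad : ∀ t : ℝ, 0 ≤ Var[f; P] * (t * t) + 2 * cov[f, g; P] * t + Var[g; P] := by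
    intro t
    have h1 := variance_nonneg (fun ω => t * f ω + g ω) P
    rw [variance_fun_add (hf.const_mul t) hg, variance_const_mul, covariance_const_mul_left] at h1
    linarith
  have h2 := discrim_le_zero hquad
  rw [discrim] at h2
  have h3 : |cov[f, g; P]| ≤ √(Var[f; P] * Var[g; P]) := by
    refine Real.abs_le_sqrt ?_
    linarith
  have hg0 := variance_nonneg g P
  rw [variance_fun_add hf hg]
  rw [abs_le] at h3 ⊢
  constructor <;> linarith

theorem condVar_ae_eq_variance_condExpKernel [StandardBorelSpace Ω] {μ : Measure Ω}
    [IsProbabilityMeasure μ] (hm : m ≤ mΩ) {f : Ω → ℝ} (hfm : Measurable f) (hf : MemLp f 2 μ) :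
    condVar m f μ =ᵐ[μ] fun ω => Var[f; condExpKernel μ m ω] := by
  have hsq : Integrable (fun ω => (f ω - (μ[f | m]) ω) ^ 2) μ :=
    (hf.sub (MemLp.condExp (m := m) (by norm_num) hf)).integrable_sq
  filter_upwards [condExp_ae_eq_integral_condExpKernel hm hsq,
    condExp_ae_eq_integral_condExpKernel hm (hf.integrable (by norm_num)),
    ae_condExpKernel_eq hm (stronglyMeasurable_condExp (f := f) (m := m) (μ := μ)).measurable]
    with ω h1 h2 h3
  have e : condVar m f μ ω = ∫ ω', (f ω' - (μ[f | m]) ω') ^ 2 ∂condExpKernel μ m ω := h1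
  rw [e, variance_eq_integral hfm.aemeasurable]
  refine integral_congr_ae ?_
  filter_upwards [h3] with ω' h
  rw [h, h2]

end Variance

section ConstantEffects

variable {Ω : ℕ → Type*} [mΩ : ∀ S, MeasurableSpace (Ω S)] [∀ S, StandardBorelSpace (Ω S)]
  {μ : ∀ S, Measure (Ω S)} [∀ S, IsProbabilityMeasure (μ S)]
  {N : ℕ → ℕ} {K : ℕ} {D : ∀ S, ShiftShareData (Ω S) (N S) S K} {γ : Fin K → ℝ}

namespace ShiftShareData

variable {Ω : Type*} [MeasurableSpace Ω] {N S K : ℕ} (D : ShiftShareData Ω N S K)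

/-- The aggregate over a sector of the `ℱ₀`-measurable part of the error. -/
noncomputable def errorAgg (μ : Measure Ω) (γ : Fin K → ℝ) (ω : Ω) (s : Fin S) : ℝ :=
  ∑ i, D.w ω i s * D.errorMean μ γ ω i

/-- The contribution of the linearization error to the score. -/
noncomputable def linScore (γ : Fin K → ℝ) (ω : Ω) : ℝ :=
  ∑ s, D.Xtilde γ ω s * D.Lagg ω s - ∑ i, D.Ugamma γ ω i * D.L ω i

@[fun_prop]
theorem measurable_linScore (γ : Fin K → ℝ) : Measurable (D.linScore γ) := by
  unfold linScore; fun_prop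

theorem errorAgg_eq_mul {ω : Ω} {s : Fin S} (hn : D.n ω s ≠ 0) (μ : Measure Ω) (γ : Fin K → ℝ) :
    D.errorAgg μ γ ω s = D.n ω s * D.sectorError μ γ ω s := by
  rw [sectorError, D.sum_share_div_mul, mul_div_cancel₀ _ hn, errorAgg]

theorem R_eq_of_effectDev {μ : Measure Ω} {γ : Fin K → ℝ} {ω : Ω}
    (h : ∀ i t, D.effectDev μ ω i t * D.Xtilde γ ω t = 0) (s : Fin S) :
    D.R μ ω s = D.errorAgg μ γ ω s + D.Lagg ω s := by
  rw [D.R_eq μ γ, errorAgg]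
  have h1 : ∑ t, (∑ i, D.w ω i s * (D.w ω i t * D.effectDev μ ω i t)) * D.Xtilde γ ω t = 0 := by
    refine Finset.sum_eq_zero fun t _ => ?_
    rw [Finset.sum_mul]
    refine Finset.sum_eq_zero fun i _ => ?_
    have := h i t
    linear_combination D.w ω i s * D.w ω i t * this
  rw [h1, add_zero]

theorem score_eq_of_effectDev {μ : Measure Ω} {γ : Fin K → ℝ} {ω : Ω}
    (h : ∀ i t, D.effectDev μ ω i t * D.Xtilde γ ω t = 0) :
    ∑ i, (D.X ω i - D.Z ω i ⬝ᵥ γ) * D.eps μ ω i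
      = ∑ s, D.errorAgg μ γ ω s * D.Xtilde γ ω s + D.linScore γ ω
        - ∑ i, D.Ugamma γ ω i * D.errorMean μ γ ω i := by
  have h1 : ∀ i, D.eps μ ω i = D.errorMean μ γ ω i + D.L ω i := by
    intro i
    rw [D.eps_eq μ γ]
    have h2 : ∑ t, D.w ω i t * D.effectDev μ ω i t * D.Xtilde γ ω t = 0 :=
      Finset.sum_eq_zero fun t _ => by rw [mul_assoc, h, mul_zero]
    rw [h2, add_zero]
  rw [D.score_eq]
  simp only [D.R_eq_of_effectDev h, h1, mul_add, Finset.sum_add_distrib, linScore,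
    mul_comm (D.errorAgg μ γ ω _)]
  ring

end ShiftShareData

/-- Under constant effects the shifters do not load on the deviations from the estimand. -/
theorem ae_effectDev_mul_Xtilde (hd : ShiftShareDesign μ D γ) (hr : ShiftShareRegular μ D γ)
    (hc : ShifterRecovery μ D γ) {S : ℕ} (hB : (D S).ConstantEffects (μ S)) :
    ∀ᵐ ω ∂μ S, ∀ᵐ ω' ∂condExpKernel (μ S) (D S).F0 ω,
      ∀ i t, (D S).effectDev (μ S) ω' i t * (D S).Xtilde γ ω' t = 0 := by
  obtain ⟨p, C, hp, hC, hlaw⟩ := exists_shifterLaw hd hr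
  filter_upwards [hB, hlaw S, hd.share_nonneg S, hc.full_rank S,
    ae_kernel_F0_errorMean (D := D) (μ := μ) (γ := γ) S] with ω hB hl h0 hrk hcx
  have hπ : ∀ i s, 0 ≤ (D S).w ω i s ^ 2 * (D S).sigmaSq (μ S) ω s := fun i s =>
    mul_nonneg (sq_nonneg _) (hl.sigma_nonneg s)
  -- If the denominator of `β` vanishes, then `β` is `0` by convention and the deviations need not
  -- vanish. But no sector is empty, so every conditional variance is zero and the recentred
  -- shifters vanish instead.
  by_cases hz : ∑ i, ∑ s, (D S).w ω i s ^ 2 * (D S).sigmaSq (μ S) ω s = 0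
  · have hσ : ∀ s, (D S).sigmaSq (μ S) ω s = 0 := by
      intro s
      by_contra hne
      have hw : ∀ i, (D S).w ω i s = 0 := by
        intro i
        have h1 := (Finset.sum_eq_zero_iff_of_nonneg fun i _ =>
          Finset.sum_nonneg fun s _ => hπ i s).1 hz i (Finset.mem_univ i)
        have h2 := (Finset.sum_eq_zero_iff_of_nonneg fun s _ => hπ i s).1 h1 s (Finset.mem_univ s)
        exact pow_eq_zero_iff (two_ne_zero) |>.1 ((mul_eq_zero.1 h2).resolve_right hne)
      have := (D S).n_pos hrk h0 s
      simp [ShiftShareData.n, hw] at this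
    have hX : ∀ᵐ ω' ∂condExpKernel (μ S) (D S).F0 ω, ∀ t, (D S).Xtilde γ ω' t = 0 := by
      refine ae_all_iff.2 fun t => ?_
      have h1 := hl.variance t
      rw [hσ t, integral_eq_zero_iff_of_nonneg (fun _ => sq_nonneg _)
        (hl.memLp_two t).integrable_sq] at h1
      filter_upwards [h1] with ω' h
      simpa using h
    filter_upwards [hX] with ω' h i t
    rw [h t, mul_zero]
  · filter_upwards [hcx] with ω' h i t
    have hb : (D S).beta (μ S) ω = (D S).B ω i t := by
      rw [ShiftShareData.beta, div_eq_iff hz, Finset.mul_sum]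
      refine Finset.sum_congr rfl fun i' _ => ?_
      rw [Finset.mul_sum]
      refine Finset.sum_congr rfl fun s' _ => ?_
      rw [hB i' s' i t, mul_comm]
    rw [h.2.1, ShiftShareData.effectDev, hb, sub_self, zero_mul]

theorem memLp_sum_Xtilde_mul_Lagg (hd : ShiftShareDesign μ D γ) (hr : ShiftShareRegular μ D γ)
    (S : ℕ) : MemLp (fun ω => ∑ s, (D S).Xtilde γ ω s * (D S).Lagg ω s) 2 (μ S) := by
  refine memLp_finsetSum _ fun s _ => ?_
  have h1 : MemLp (fun ω => (D S).Lagg ω s) 4 (μ S) :=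
    memLp_finsetSum _ fun i _ => (memLp_L hr S i).share_mul hd i s
  exact memLp_two_mul (memLp_Xtilde hr S s) h1

theorem memLp_sum_Ugamma_mul_L (hr : ShiftShareRegular μ D γ)
    (S : ℕ) : MemLp (fun ω => ∑ i, (D S).Ugamma γ ω i * (D S).L ω i) 2 (μ S) :=
  memLp_finsetSum _ fun i _ => memLp_two_mul (memLp_U_dotProduct hr S i γ) (memLp_L hr S i)

theorem memLp_score (hd : ShiftShareDesign μ D γ) (hr : ShiftShareRegular μ D γ) (S : ℕ) :
    MemLp (fun ω => ∑ i, ((D S).X ω i - (D S).Z ω i ⬝ᵥ γ) * (D S).eps (μ S) ω i) 2 (μ S) := by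
  refine memLp_finsetSum _ fun i _ => ?_
  have h1 : MemLp (fun ω => (D S).X ω i - (D S).Z ω i ⬝ᵥ γ) 4 (μ S) := by
    have e : ∀ ω, (D S).X ω i - (D S).Z ω i ⬝ᵥ γ
        = ∑ s, (D S).w ω i s * (D S).Xtilde γ ω s - (D S).U ω i ⬝ᵥ γ := fun ω => by
      rw [(D S).X_eq γ, add_sub_cancel_right]
      rfl
    simp only [e]
    have h2 : MemLp (fun ω => ∑ s, (D S).w ω i s * (D S).Xtilde γ ω s) 4 (μ S) :=
      memLp_finsetSum _ fun s _ => (memLp_Xtilde hr S s).share_mul hd i s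
    exact h2.sub (memLp_U_dotProduct hr S i γ)
  exact memLp_two_mul h1 (memLp_eps hd hr S i)

/-- Under constant effects the score is linear in the shifters apart from the linearization term;
its part fixed by `ℱ₀` does not affect the conditional variance. -/
theorem ae_VN_eq (hd : ShiftShareDesign μ D γ) (hr : ShiftShareRegular μ D γ)
    (hc : ShifterRecovery μ D γ) {S : ℕ} (hB : (D S).ConstantEffects (μ S)) :
    ∀ᵐ ω ∂μ S, (D S).VN (μ S) γ ω = (D S).r ω *
      Var[fun ω' => ∑ s, (D S).errorAgg (μ S) γ ω s * (D S).Xtilde γ ω' s + (D S).linScore γ ω';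
        condExpKernel (μ S) (D S).F0 ω] := by
  have hm : Measurable fun ω =>
      ∑ i, ((D S).X ω i - (D S).Z ω i ⬝ᵥ γ) * (D S).eps (μ S) ω i := by
    unfold dotProduct
    fun_prop
  filter_upwards [condVar_ae_eq_variance_condExpKernel (D S).F0_le hm (memLp_score hd hr S),
    ae_effectDev_mul_Xtilde hd hr hc hB, ae_kernel_F0_errorMean (D := D) (μ := μ) (γ := γ) S,
    (D S).ae_kernel_F0_const (μ S)] with ω h1 h2 h3 h4
  rw [ShiftShareData.VN, h1]
  congr 1
  rw [← variance_sub_const (X := fun ω' => ∑ s, (D S).errorAgg (μ S) γ ω s * (D S).Xtilde γ ω' s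
    + (D S).linScore γ ω') (Measurable.aestronglyMeasurable (by fun_prop))
    (∑ i, (D S).Ugamma γ ω i * (D S).errorMean (μ S) γ ω i)]
  refine variance_congr ?_
  filter_upwards [h2, h3, h4] with ω' h2 h3 h4
  rw [(D S).score_eq_of_effectDev h2]
  simp only [ShiftShareData.errorAgg, ShiftShareData.Ugamma, h3.1, h3.2.2, h4.2.1]

theorem ShiftShareData.ShifterLaw.variance_sum {Ω : Type*} [MeasurableSpace Ω] {N S K : ℕ}
    {D : ShiftShareData Ω N S K} {γ : Fin K → ℝ} {p C : ℝ} {ω : Ω} {P : Measure Ω}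
    [IsProbabilityMeasure P] {σ : Fin S → ℝ} (h : D.ShifterLaw γ p C ω P σ) (a : Fin S → ℝ) :
    Var[fun ω' => ∑ s, a s * D.Xtilde γ ω' s; P] = ∑ s, a s ^ 2 * σ s := by
  have hmem : MemLp (fun ω' => ∑ s, a s * D.Xtilde γ ω' s) 2 P :=
    memLp_finsetSum _ fun s _ => (h.memLp_two s).const_mul _
  have h1 := (integral_sum_mul_affine h.memLp_two h.indep h.mean a a 0).2
  have h2 : ∫ ω', ∑ s, a s * D.Xtilde γ ω' s ∂P = 0 := by
    rw [integral_finsetSum _ fun s _ => ((h.memLp_two s).integrable (by norm_num)).const_mul _]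
    simp [integral_const_mul, h.mean]
  rw [variance_of_integral_eq_zero hmem.aemeasurable h2]
  simp only [zero_add, ← pow_two, h.variance] at h1
  exact h1

/-- Without linearization error the diagonal approximation is exact under constant effects. -/
theorem VN_ae_eq_Vdiag (hd : ShiftShareDesign μ D γ) (hr : ShiftShareRegular μ D γ)
    (hc : ShifterRecovery μ D γ) {S : ℕ} (hB : (D S).ConstantEffects (μ S))
    (hL : ∀ᵐ ω ∂μ S, ∀ i, (D S).L ω i = 0) :
    (D S).VN (μ S) γ =ᵐ[μ S] (D S).Vdiag (μ S) γ := by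
  obtain ⟨p, C, hp, hC, hlaw⟩ := exists_shifterLaw hd hr
  filter_upwards [ae_VN_eq hd hr hc hB, ae_Vdiag_eq hd hr S, hlaw S,
    ae_effectDev_mul_Xtilde hd hr hc hB, ae_kernel_F0_errorMean (D := D) (μ := μ) (γ := γ) S,
    ae_ae_condExpKernel (D S).F0_le hL] with ω h1 h2 h3 h4 h5 h6
  rw [h1, h2]
  congr 1
  have e : Var[fun ω' => ∑ s, (D S).errorAgg (μ S) γ ω s * (D S).Xtilde γ ω' s
      + (D S).linScore γ ω'; condExpKernel (μ S) (D S).F0 ω]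
      = Var[fun ω' => ∑ s, (D S).errorAgg (μ S) γ ω s * (D S).Xtilde γ ω' s;
        condExpKernel (μ S) (D S).F0 ω] := by
    refine variance_congr ?_
    filter_upwards [h6] with ω' h
    simp [ShiftShareData.linScore, ShiftShareData.Lagg, h]
  rw [e, h3.variance_sum]
  refine Finset.sum_congr rfl fun s _ => ?_
  rw [← h3.variance s, ← integral_const_mul]
  refine integral_congr_ae ?_
  filter_upwards [h4, h5, h6] with ω' h4 h5 h6
  rw [(D S).R_eq_of_effectDev h4]
  simp only [ShiftShareData.errorAgg, ShiftShareData.Lagg, h6, h5.1, h5.2.2, mul_zero,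
    Finset.sum_const_zero, add_zero]
  ring

theorem tendsto_linScore (hd : ShiftShareDesign μ D γ) (hr : ShiftShareRegular μ D γ)
    (hc : ShifterRecovery μ D γ) :
    Tendsto (fun x : Σ S, Ω S => (D x.1).r x.2 * ∫ ω', (D x.1).linScore γ ω' ^ 2
      ∂condExpKernel (μ x.1) (D x.1).F0 x.2) (whp μ) (𝓝 0) := by
  have h := ((tendsto_Xtilde_mul_Lagg hd hr hc).add (tendsto_noise_mul_L hr)).const_mul 2
  simp only [add_zero, mul_zero] at h
  refine squeeze_zero' (Eventually.of_forall fun x => mul_nonneg ((D x.1).r_nonneg _)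
    (integral_nonneg fun _ => sq_nonneg _)) ?_ h
  filter_upwards [eventually_whp_of_ae_curried fun S =>
      (memLp_sum_Xtilde_mul_Lagg hd hr S).integrable_sq.condExpKernel_ae (m := (D S).F0),
    eventually_whp_of_ae_curried fun S =>
      (memLp_sum_Ugamma_mul_L hr S).integrable_sq.condExpKernel_ae (m := (D S).F0)] with x h1 h2
  rw [← mul_add, mul_left_comm]
  refine mul_le_mul_of_nonneg_left ?_ ((D x.1).r_nonneg _)
  rw [← integral_add h1 h2, ← integral_const_mul]
  refine integral_mono_of_nonneg (Eventually.of_forall fun _ => sq_nonneg _)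
    ((h1.add h2).const_mul 2) (Eventually.of_forall fun ω' => ?_)
  simp only [ShiftShareData.linScore]
  have h3 := sq_nonneg (∑ s, (D x.1).Xtilde γ ω' s * (D x.1).Lagg ω' s
    + ∑ i, (D x.1).Ugamma γ ω' i * (D x.1).L ω' i)
  linarith

/-- The diagonal part of the conditional variance under constant effects. -/
theorem tendsto_sum_errorAgg_sub_Vdiag (hd : ShiftShareDesign μ D γ)
    (hr : ShiftShareRegular μ D γ) (hc : ShifterRecovery μ D γ)
    (hB : ∀ S, (D S).ConstantEffects (μ S)) :
    Tendsto (fun x : Σ S, Ω S => (D x.1).r x.2 * ∑ s, (D x.1).errorAgg (μ x.1) γ x.2 s ^ 2 *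
      (D x.1).sigmaSq (μ x.1) x.2 s - (D x.1).Vdiag (μ x.1) γ x.2) (whp μ) (𝓝 0) := by
  obtain ⟨p, C, hp, hC, hlaw⟩ := exists_shifterLaw hd hr
  refine (tendsto_integral_sector_sub_Vdiag hd hr hc).congr' ?_
  filter_upwards [eventually_whp_of_ae_curried hlaw,
    eventually_whp_of_ae_curried fun S => ae_effectDev_mul_Xtilde hd hr hc (hB S),
    eventually_whp_of_ae_curried (ae_kernel_F0_sector (D := D) (γ := γ) (μ := μ)),
    eventually_whp_of_ae_curried hc.full_rank,
    eventually_whp_of_ae_curried hd.share_nonneg] with x h1 h2 h3 h4 h5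
  have hn := (D x.1).n_pos h4 h5
  congr 1
  have e : ∫ ω', ∑ s, (D x.1).r ω' * (D x.1).n ω' s ^ 2 * ((D x.1).Xtilde γ ω' s ^ 2
        * ((D x.1).sectorError (μ x.1) γ ω' s + ∑ t, (D x.1).sectorLoading (μ x.1) ω' s t
          * (D x.1).Xtilde γ ω' t) ^ 2) ∂condExpKernel (μ x.1) (D x.1).F0 x.2
      = ∫ ω', ∑ s, (D x.1).r x.2 * (D x.1).errorAgg (μ x.1) γ x.2 s ^ 2 *
        (D x.1).Xtilde γ ω' s ^ 2 ∂condExpKernel (μ x.1) (D x.1).F0 x.2 := by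
    refine integral_congr_ae ?_
    filter_upwards [h2, h3] with ω' h2 h3
    refine Finset.sum_congr rfl fun s _ => ?_
    have hz : ∑ t, (D x.1).sectorLoading (μ x.1) ω' s t * (D x.1).Xtilde γ ω' t = 0 := by
      refine Finset.sum_eq_zero fun t _ => ?_
      rw [ShiftShareData.sectorLoading, Finset.sum_mul]
      refine Finset.sum_eq_zero fun i _ => ?_
      have := h2 i t
      linear_combination (D x.1).w ω' i s / (D x.1).n ω' s * (D x.1).w ω' i t * this
    rw [hz, add_zero, (D x.1).errorAgg_eq_mul (hn s).ne']
    simp only [h3.1, ShiftShareData.r, ShiftShareData.n, h3.2.2]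
    ring
  rw [e, integral_finsetSum _ fun s _ => (h1.memLp_two s).integrable_sq.const_mul _,
    Finset.mul_sum]
  simp only [integral_const_mul, h1.variance, mul_assoc]

/-- Needed because the cross term in the variance is the root of this sum times a negligible one.
The conditional variances are bounded, and `r_N n_s²` are weights. -/
theorem isBoundedOp_sum_errorAgg (hd : ShiftShareDesign μ D γ) (hr : ShiftShareRegular μ D γ)
    (hc : ShifterRecovery μ D γ) :
    IsBoundedOp μ fun x => (D x.1).r x.2 * ∑ s, (D x.1).errorAgg (μ x.1) γ x.2 s ^ 2 *
      (D x.1).sigmaSq (μ x.1) x.2 s := by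
  obtain ⟨p, C, hp, hC, hlaw⟩ := exists_shifterLaw hd hr
  have h := ((IsBoundedOp.const (μ := μ) 1).add (fourthBdd_sectorError hd hr _
    (ShareWeight.sector μ D))).const_mul (1 + C)
  refine h.mono ?_
  filter_upwards [eventually_whp_of_ae_curried hlaw, eventually_whp_of_ae_curried hc.full_rank,
    eventually_whp_of_ae_curried hd.share_nonneg] with x h1 h4 h5
  have hn := (D x.1).n_pos h4 h5
  have hr0 := (D x.1).r_nonneg x.2
  have hσ : ∀ s, (D x.1).sigmaSq (μ x.1) x.2 s ≤ 1 + C := by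
    intro s
    rw [← h1.variance s]
    have h6 := integral_Xtilde_pow_four_le h1 hC s
    have h7 : ∫ ω', (D x.1).Xtilde γ ω' s ^ 2 ∂condExpKernel (μ x.1) (D x.1).F0 x.2
        ≤ ∫ ω', (1 + (D x.1).Xtilde γ ω' s ^ 4) ∂condExpKernel (μ x.1) (D x.1).F0 x.2 := by
      refine integral_mono (h1.memLp_two s).integrable_sq
        ((integrable_const _).add (integrable_pow_four (h1.memLp_four s))) fun ω' => ?_
      dsimp only
      nlinarith [sq_nonneg ((D x.1).Xtilde γ ω' s ^ 2 - 1), sq_nonneg ((D x.1).Xtilde γ ω' s ^ 2)]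
    rw [integral_add (integrable_const _) (integrable_pow_four (h1.memLp_four s))] at h7
    simp only [integral_const, probReal_univ, one_smul] at h7
    linarith
  have hle : (D x.1).r x.2 * ∑ s, (D x.1).errorAgg (μ x.1) γ x.2 s ^ 2 *
      (D x.1).sigmaSq (μ x.1) x.2 s ≤ (1 + C) * (1 + ∑ s, (D x.1).r x.2 * (D x.1).n x.2 s ^ 2 *
        (D x.1).sectorError (μ x.1) γ x.2 s ^ 4) := by
    calc (D x.1).r x.2 * ∑ s, (D x.1).errorAgg (μ x.1) γ x.2 s ^ 2 * (D x.1).sigmaSq (μ x.1) x.2 s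
        ≤ ∑ s, (1 + C) * ((D x.1).r x.2 * (D x.1).n x.2 s ^ 2
          + (D x.1).r x.2 * (D x.1).n x.2 s ^ 2 * (D x.1).sectorError (μ x.1) γ x.2 s ^ 4) := by
          rw [Finset.mul_sum]
          refine Finset.sum_le_sum fun s _ => ?_
          rw [(D x.1).errorAgg_eq_mul (hn s).ne']
          set z := (D x.1).sectorError (μ x.1) γ x.2 s
          have h8 : z ^ 2 * (D x.1).sigmaSq (μ x.1) x.2 s ≤ (1 + z ^ 4) * (1 + C) := by
            refine mul_le_mul ?_ (hσ s) (h1.sigma_nonneg s) (by positivity)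
            nlinarith [sq_nonneg (z ^ 2 - 1), sq_nonneg (z ^ 2)]
          have h9 : 0 ≤ (D x.1).r x.2 * (D x.1).n x.2 s ^ 2 := by positivity
          have h10 := mul_le_mul_of_nonneg_left h8 h9
          linarith
      _ = (1 + C) * (∑ s, (D x.1).r x.2 * (D x.1).n x.2 s ^ 2 + ∑ s, (D x.1).r x.2 *
          (D x.1).n x.2 s ^ 2 * (D x.1).sectorError (μ x.1) γ x.2 s ^ 4) := by
          rw [← Finset.mul_sum, Finset.sum_add_distrib]
      _ ≤ _ := by
          have := (D x.1).sum_r_mul_sq_le_one x.2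
          gcongr
  have h0 : 0 ≤ (D x.1).r x.2 * ∑ s, (D x.1).errorAgg (μ x.1) γ x.2 s ^ 2 *
      (D x.1).sigmaSq (μ x.1) x.2 s :=
    mul_nonneg hr0 (Finset.sum_nonneg fun s _ => mul_nonneg (sq_nonneg _) (h1.sigma_nonneg s))
  rw [abs_of_nonneg h0]
  exact hle.trans (le_abs_self _)

/-- The diagonal sum `W` is exactly the variance of the linear part. The linearization term perturbs
it by at most `2 √(W q) + q`, with `q` its negligible second moment. -/
theorem tendsto_VN_sub_Vdiag (hd : ShiftShareDesign μ D γ) (hr : ShiftShareRegular μ D γ)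
    (hc : ShifterRecovery μ D γ) (hB : ∀ S, (D S).ConstantEffects (μ S)) :
    Tendsto (fun x : Σ S, Ω S => (D x.1).VN (μ x.1) γ x.2 - (D x.1).Vdiag (μ x.1) γ x.2)
      (whp μ) (𝓝 0) := by
  obtain ⟨p, C, hp, hC, hlaw⟩ := exists_shifterLaw hd hr
  set W : (Σ S, Ω S) → ℝ := fun x => (D x.1).r x.2 * ∑ s, (D x.1).errorAgg (μ x.1) γ x.2 s ^ 2 *
    (D x.1).sigmaSq (μ x.1) x.2 s with hW
  set q : (Σ S, Ω S) → ℝ := fun x => (D x.1).r x.2 * ∫ ω', (D x.1).linScore γ ω' ^ 2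
    ∂condExpKernel (μ x.1) (D x.1).F0 x.2 with hq
  have hqt : Tendsto q (whp μ) (𝓝 0) := tendsto_linScore hd hr hc
  have h1 : Tendsto (fun x => 2 * √(W x * q x) + q x) (whp μ) (𝓝 0) := by
    have h2 := (isBoundedOp_sum_errorAgg hd hr hc).mul_tendsto_zero hqt
    have h3 := (h2.sqrt.const_mul 2).add hqt
    simpa using h3
  have h4 : Tendsto (fun x : Σ S, Ω S => (D x.1).VN (μ x.1) γ x.2 - W x) (whp μ) (𝓝 0) := by
    refine squeeze_zero_norm' ?_ h1
    filter_upwards [eventually_whp_of_ae_curried hlaw,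
      eventually_whp_of_ae_curried fun S => ae_VN_eq hd hr hc (hB S),
      eventually_whp_of_ae_curried fun S =>
        (memLp_sum_Xtilde_mul_Lagg hd hr S).integrable_sq.condExpKernel_ae (m := (D S).F0),
      eventually_whp_of_ae_curried fun S =>
        (memLp_sum_Ugamma_mul_L hr S).integrable_sq.condExpKernel_ae (m := (D S).F0)]
      with x hl hV hi1 hi2
    set P := condExpKernel (μ x.1) (D x.1).F0 x.2 with hP
    have hQ : MemLp ((D x.1).linScore γ) 2 P := by
      have a1 := (memLp_two_iff_integrable_sq (μ := P) (f := fun ω' =>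
        ∑ s, (D x.1).Xtilde γ ω' s * (D x.1).Lagg ω' s)
        (Measurable.aestronglyMeasurable (by fun_prop))).2 hi1
      have a2 := (memLp_two_iff_integrable_sq (μ := P) (f := fun ω' =>
        ∑ i, (D x.1).Ugamma γ ω' i * (D x.1).L ω' i)
        (Measurable.aestronglyMeasurable (by fun_prop))).2 hi2
      exact a1.sub a2
    have hA : MemLp (fun ω' => ∑ s, (D x.1).errorAgg (μ x.1) γ x.2 s * (D x.1).Xtilde γ ω' s) 2 P :=
      memLp_finsetSum _ fun s _ => (hl.memLp_two s).const_mul _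
    have h5 := abs_variance_add_sub_le hA hQ
    rw [hl.variance_sum] at h5
    set V := ∑ s, (D x.1).errorAgg (μ x.1) γ x.2 s ^ 2 * (D x.1).sigmaSq (μ x.1) x.2 s with hVd
    have hV0 : 0 ≤ V := Finset.sum_nonneg fun s _ => mul_nonneg (sq_nonneg _) (hl.sigma_nonneg s)
    have hr0 := (D x.1).r_nonneg x.2
    have h6 : Var[(D x.1).linScore γ; P] ≤ ∫ ω', (D x.1).linScore γ ω' ^ 2 ∂P :=
      variance_le_expectation_sq hQ.aestronglyMeasurable
    rw [Real.norm_eq_abs, hV]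
    have e1 : W x = (D x.1).r x.2 * V := rfl
    have e2 : q x = (D x.1).r x.2 * ∫ ω', (D x.1).linScore γ ω' ^ 2 ∂P := rfl
    rw [e1, e2, ← mul_sub, abs_mul, abs_of_nonneg hr0]
    set J := ∫ ω', (D x.1).linScore γ ω' ^ 2 ∂P with hJ
    have e3 : √((D x.1).r x.2 * V * ((D x.1).r x.2 * J)) = (D x.1).r x.2 * √(V * J) := by
      rw [show (D x.1).r x.2 * V * ((D x.1).r x.2 * J) = (D x.1).r x.2 ^ 2 * (V * J) by ring,
        Real.sqrt_mul (sq_nonneg _), Real.sqrt_sq hr0]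
    rw [e3]
    have h7 : √(V * Var[(D x.1).linScore γ; P]) ≤ √(V * J) := by gcongr
    have h8 := mul_le_mul_of_nonneg_left (h5.trans (add_le_add (mul_le_mul_of_nonneg_left h7
      (by norm_num)) h6)) hr0
    linarith
  have h9 := h4.add (tendsto_sum_errorAgg_sub_Vdiag hd hr hc hB)
  simp only [add_zero] at h9
  refine h9.congr fun x => ?_
  simp only [hW]
  ring

end ConstantEffects

theorem proposition5 {Ω : ℕ → Type*} [∀ S, MeasurableSpace (Ω S)]
    [∀ S, StandardBorelSpace (Ω S)] (μ : ∀ S, Measure (Ω S)) [∀ S, IsProbabilityMeasure (μ S)]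
    {N : ℕ → ℕ} {K : ℕ} (D : ∀ S, ShiftShareData (Ω S) (N S) S K) (γ : Fin K → ℝ)
    (hdesign : ShiftShareDesign μ D γ) (hreg : ShiftShareRegular μ D γ)
    (hrec : ShifterRecovery μ D γ) :
    -- residuals at arbitrary consistent estimators of `(β, δ)`
    (∀ (b : ∀ S, Ω S → ℝ) (d : ∀ S, Ω S → Fin K → ℝ), ConsistentFor μ D b d →
      IsLittleOp μ (fun S ω =>
        (D S).Vhat (b S ω) (d S ω) ω - (D S).Vdiag (μ S) γ ω) ∧
      ((∀ S, (D S).ConstantEffects (μ S)) → IsLittleOp μ (fun S ω =>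
        (D S).Vhat (b S ω) (d S ω) ω - (D S).VN (μ S) γ ω))) ∧
    -- OLS residuals
    (IsLittleOp μ (fun S ω =>
        (D S).Vhat ((D S).betaHat ω) ((D S).deltaHat ω) ω - (D S).Vdiag (μ S) γ ω) ∧
      ((∀ S, (D S).ConstantEffects (μ S)) → IsLittleOp μ (fun S ω =>
        (D S).Vhat ((D S).betaHat ω) ((D S).deltaHat ω) ω - (D S).VN (μ S) γ ω))) ∧
    -- under constant effects and without linearization error the limit is exactly `𝒱_N`
    (∀ S, (D S).ConstantEffects (μ S) → (∀ᵐ ω ∂μ S, ∀ i, (D S).L ω i = 0) →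
      (D S).VN (μ S) γ =ᵐ[μ S] (D S).Vdiag (μ S) γ) := by
  have hgen : ∀ (b : ∀ S, Ω S → ℝ) (d : ∀ S, Ω S → Fin K → ℝ), ConsistentFor μ D b d →
      IsLittleOp μ (fun S ω =>
        (D S).Vhat (b S ω) (d S ω) ω - (D S).Vdiag (μ S) γ ω) ∧
      ((∀ S, (D S).ConstantEffects (μ S)) → IsLittleOp μ (fun S ω =>
        (D S).Vhat (b S ω) (d S ω) ω - (D S).VN (μ S) γ ω)) := by
    intro b d hbd
    have h1 := (tendsto_Vhat_sub hdesign hreg hrec hbd).add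
      (tendsto_oracle_sub_Vdiag hdesign hreg hrec)
    rw [add_zero] at h1
    refine ⟨?_, fun hB => ?_⟩
    · rw [isLittleOp_iff_tendsto]
      refine h1.congr fun x => ?_
      ring
    · have h2 := h1.sub (tendsto_VN_sub_Vdiag hdesign hreg hrec hB)
      rw [sub_zero] at h2
      rw [isLittleOp_iff_tendsto]
      refine h2.congr fun x => ?_
      ring
  exact ⟨hgen, hgen _ _ (consistentFor_ols hdesign hreg hrec),
    fun S hB hL => VN_ae_eq_Vdiag hdesign hreg hrec hB hL⟩
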